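/- Let $k\ge 2$ be an integer (the forbidden degree) and $t\ge 0$. \textbf{Setting.} For a finite loopless multigraph whose edges carry distinct real labels, the forbidden degree version $\Phi(G)$ is obtained by adding the edges in increasing order of their labels and, each time an endpoint of the added edge reaches degree $k$, removing all the edges incident to that endpoint (including the added one; on both sides if both endpoints reach degree $k$). Let $\Omega$ be the class of loopless, locally finite multigraphs with distinctly labelled edges. For $G\in\Omega$ and an edge $e$ of $G$, let $l(e)$ be the smallest $l$ such that, for every time $s$ at which $e$ is present, the $l$-ball of $G$ around $e$, restricted to the edges of label at most $s$, determines whether $e$ is kept: $e$ is kept in all, or in none, of the forbidden degree versions of the finite graphs of $\Omega$ that contain this restricted ball as a subgraph induced on its vertices and attach further edges leading outside it only at vertices of the $l$-sphere. Let $\Omega^+$ be the class of the $G\in\Omega$ with $l(e)<\infty$ for all edges $e$; for $G\in\Omega^+$, $\Phi(G)$ is the graph of those edges $e$ that are kept in the forbidden degree version of the finite ball $B_{l(e)}(G,e)$. Let $T^\infty_t$ be the Galton–Watson tree with Poisson offspring of mean $t$ and independent edge labels uniform on $[0,t]$, and let $T^k_t$ be the component of the root in $\Phi(T^\infty_t)$.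 For $y\in[0,t]$ let $\Theta^y(T)$ be the rooted tree $T$ with an extra vertex joined to the root by an edge of label $y$; let $T^{k,y}_t$ be the component of the root in $\Phi(\Theta^y(T^\infty_t))\cap T^\infty_t$ if the extra edge is kept in $\Phi(\Theta^y(T^\infty_t))$, and a cemetery value $\mathscr X$ otherwise. Put $m(t,y)=\mathbb P(T^{k,y}_t\ne\mathscr X)$ and let $T^{k+,y}_t$ be $T^{k,y}_t$ conditioned on being different from $\mathscr X$. Trees are considered up to isomorphism of rooted trees preserving the labels. Let $B(y)$ be the law of the set of the labels of the edges adjacent to the root of $T^{k+,y}_t$. For a finite set $X=\{x_1,\dots,x_i\}$ let $T^{\infty,X}_t$ be the tree whose root is attached to independent copies of $T^\infty_t$ by edges with labels in $P\cup X$, one copy for each label, $P$ being a Poisson process of intensity $1$ on $[0,t]$. Let $f_i(t,y,x)$ be the probability that the extra edge is kept in $\Phi(\Theta^y(T^{\infty,X}_t))$ and that the other edges kept at the root are exactly those labelled by $X$; let $h_i(t,x)$ be the probability that the edges adjacent to the root in $\Phi(T^{\infty,X}_t)$ are exactly those labelled by $X$; and let $g_i=f_i/m(t,y)$. \textbf{Theorem.}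 \begin{enumerate} \item For every $y\in[0,t]$, almost surely $T^\infty_t$ and $\Theta^y(T^\infty_t)$ belong to $\Omega^+$; the event $\{T^{k,y}_t\neq\mathscr X\}$ is measurable up to a null set, and the law of $T^{k+,y}_t$ depends measurably on $y\in[0,t]$. \item For every $y\in[0,t]$, $T^{k+,y}_t$ is a multitype branching process with types in $[0,t]$ (the type of a vertex is the label of the edge to its parent), with offspring law $B(\cdot)$ and a root of type $y$: for every $n$, conditionally on the generations $0,\dots,n$, the sets of labels of the children of the vertices of generation $n$ are independent, that of a vertex of type $z$ having law $B(z)$. \item $T^k_t$ is a two-stage branching process: conditionally on the set of the labels of the edges adjacent to its root, the subtrees starting at the root's children are independent, the one attached by the edge with label $\tau$ being distributed as $T^{k+,\tau}_t$. \item For $y\in[0,t]$, $B(y)$ is carried by the subsets of $[0,t]$ with at most $k-2$ elements, and the law of the set of labels of the edges adjacent to the root of $T^k_t$ by those with at most $k-1$ elements. Moreover $m(t,y)\ge e^{-t}$ for $0\le y\le t$, and $(t,y)\mapsto m(t,y)$ is continuous on $\{0\le y<t\}$. \item For $y\in[0,t]$ and $0\le i\le k-2$, the restriction of $B(y)$ to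 the sets of $i$ elements, enumerated in increasing order, has density $g_i(t,y,\cdot)$ with respect to the Lebesgue measure on $\{0\le x_1<\dots<x_i\le t\}$. The functions $f_i$ and $g_i$ are continuous in $(t,y,x)$ on the set where $y,x_1,\dots,x_i$ are distinct elements of $(0,t)$. They are at least $\exp(-(i+1)t)$ whenever $y,x_1,\dots,x_i$ are distinct elements of $[0,t]$. \item For $0\le i\le k-1$, the restriction to the sets of $i$ elements of the law of the set of labels of the edges adjacent to the root of $T^k_t$, enumerated in increasing order, has density $h_i(t,\cdot)$ on $\{0\le x_1<\dots<x_i\le t\}$; $h_i$ is continuous in $(t,x)$ where $t>0$ and $x_1,\dots,x_i$ are distinct elements of $(0,t)$, and it is at least $\exp(-(i+1)t)$ whenever $x_1,\dots,x_i$ are distinct elements of $[0,t]$. \end{enumerate} -/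

import Mathlib

open MeasureTheory ProbabilityTheory Set
open scoped ENNReal unitInterval

noncomputable section

namespace ForbiddenDegree

/-! ### Labelled multigraphs and the forbidden degree version of a finite graph -/

/-- A multigraph with labelled edges on the vertex set `V`, given by its edges: an edge is a pair
(label, unordered pair of endpoints). Two parallel edges are told apart by their labels. -/
abbrev LGraph (V : Type*) := Set (ℝ × Sym2 V)

/-- The class `Ω`: loopless, locally finite, no two edges with the same label. -/
structure IsOmega {V : Type*} (G : LGraph V) : Prop where
  label_inj : ∀ e ∈ G, ∀ f ∈ G, e.1 = f.1 → e = f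
  loopless : ∀ e ∈ G, ¬ e.2.IsDiag
  locallyFinite : ∀ v : V, {e ∈ G | v ∈ e.2}.Finite

/-- The degree of `v` in `G`, counted with multiplicity. -/
def degree {V : Type*} (G : LGraph V) (v : V) : ℕ∞ := {e ∈ G | v ∈ e.2}.encard

/-- One step of the dynamics with forbidden degree `k`: the edge `e` is added to the present graph
`H`, then every edge incident to an endpoint of `e` that has reached degree `k` is removed
(on both sides if both endpoints have reached degree `k`). -/
def addStep {V : Type*} (k : ℕ) (H : LGraph V) (e : ℝ × Sym2 V) : LGraph V :=
  {f ∈ insert e H | ∀ v ∈ e.2, v ∈ f.2 → degree (insert e H) v < k}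

open Classical in
/-- The forbidden degree version of a finite graph: its edges are added one by one in the
increasing order of their labels (for an infinite set of edges the value is `∅`, by convention). -/
def forbidFinite {V : Type*} (k : ℕ) (G : LGraph V) : LGraph V :=
  if h : G.Finite then
    (h.toFinset.toList.mergeSort (fun e f => decide (e.1 ≤ f.1))).foldl (addStep k) ∅
  else ∅

/-! ### Extension to infinite graphs -/

/-- `G_t`: the subgraph of the edges with label at most `t`. -/
def upTo {V : Type*} (G : LGraph V) (t : ℝ) : LGraph V := {e ∈ G | e.1 ≤ t}

/-- The subgraph of `G` induced by the set of vertices `B`. -/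
def induced {V : Type*} (G : LGraph V) (B : Set V) : LGraph V := {e ∈ G | ∀ v ∈ e.2, v ∈ B}

/-- The set of vertices at graph distance at most `l` from the set `R`. -/
def ball {V : Type*} (G : LGraph V) (R : Set V) : ℕ → Set V
  | 0 => R
  | l + 1 => ball G R l ∪ {v | ∃ e ∈ G, v ∈ e.2 ∧ ∃ u ∈ e.2, u ∈ ball G R l}

/-- The set of vertices at graph distance exactly `l` from the set `R`. -/
def sphere {V : Type*} (G : LGraph V) (R : Set V) (l : ℕ) : Set V :=
  {v ∈ ball G R l | ∀ j < l, v ∉ ball G R j}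

/-- The endpoints of an edge, as a set of vertices. -/
def ends {V : Type*} (e : ℝ × Sym2 V) : Set V := {v | v ∈ e.2}

/-- Transport of a labelled edge along a map of vertices; the label is kept. -/
def mapEdge {V W : Type*} (ψ : V → W) (e : ℝ × Sym2 V) : ℝ × Sym2 W := (e.1, e.2.map ψ)

/-- `H` is a finite graph of the class `Ω` and `ψ` identifies `(G_B, B, S)`, with labels, with a
neighborhood with boundary `(H_{ψ(B)}, ψ(B), ψ(S))` in `H`: the graph induced by `H` on `ψ(B)` is
the image of the graph induced by `G` on `B`, and only vertices of `ψ(S)` have neighbors in `H`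
outside `ψ(B)`. -/
structure IsExtension {V : Type*} (G : LGraph V) (B S : Set V)
    (H : LGraph ℕ) (ψ : V → ℕ) : Prop where
  finite : H.Finite
  omega : IsOmega H
  inj : Set.InjOn ψ B
  induced_eq : induced H (ψ '' B) = mapEdge ψ '' induced G B
  boundary : ∀ f ∈ H, ∀ u ∈ f.2, ∀ w ∈ f.2, u ∈ ψ '' B → w ∉ ψ '' B → u ∈ ψ '' S

/-- The knowledge of the neighborhood with boundary `(G_B, B, S)` is sufficient to know whether the
edge `e` is removed in the forbidden degree version of `G`. -/
def Sufficient {V : Type*} (k : ℕ) (G : LGraph V) (B S : Set V) (e : ℝ × Sym2 V) : Prop :=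
  (∀ (H : LGraph ℕ) (ψ : V → ℕ), IsExtension G B S H ψ → mapEdge ψ e ∈ forbidFinite k H) ∨
  (∀ (H : LGraph ℕ) (ψ : V → ℕ), IsExtension G B S H ψ → mapEdge ψ e ∉ forbidFinite k H)

/-- For every time `t` (at which the edge `e` is in `G_t`), the knowledge of the `l`-ball around `e`
with the `l`-sphere as its boundary is sufficient to know whether `e` is removed in the forbidden
degree version of `G_t`. -/
def DecidedBy {V : Type*} (k : ℕ) (G : LGraph V) (e : ℝ × Sym2 V) (l : ℕ) : Prop :=
  ∀ t : ℝ, e.1 ≤ t → Sufficient k (upTo G t) (ball G (ends e) l) (sphere G (ends e) l) e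

/-- The class `Ω⁺` of the graphs of `Ω` for which `l(e) < ∞` for every edge `e`. -/
def IsOmegaPlus {V : Type*} (k : ℕ) (G : LGraph V) : Prop :=
  IsOmega G ∧ ∀ e ∈ G, ∃ l, DecidedBy k G e l

/-- `l(e)`, the smallest radius that decides the status of `e` (meaningful on `Ω⁺`). -/
def radius {V : Type*} (k : ℕ) (G : LGraph V) (e : ℝ × Sym2 V) : ℕ :=
  sInf {l | DecidedBy k G e l}

/-- `Φ(G)`, the forbidden degree version of a possibly infinite graph `G` of the class `Ω⁺`: the
edge `e` is kept if and only if it is present in the forbidden degree version of the finite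
graph `B_{l(e)}(G, e)`. -/
def forbid {V : Type*} (k : ℕ) (G : LGraph V) : LGraph V :=
  {e ∈ G | e ∈ forbidFinite k (induced G (ball G (ends e) (radius k G e)))}

/-- The set of vertices of the connected component of `r` in the graph `G`. -/
def component {V : Type*} (G : LGraph V) (r : V) : Set V :=
  {v | Relation.ReflTransGen (fun u w => ∃ e ∈ G, e.2 = s(u, w)) r v}

/-! ### Configurations and rooted labelled trees

A rooted tree in which the children of any vertex are attached by edges with distinct labels is
coded, up to isomorphism of rooted graphs preserving the labels, by a set of finite sequences of
reals: a vertex is the sequence of the labels met on the path from the root to it, and the root is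
the empty sequence. -/

/-- Words over a measurable space, as the disjoint union of the finite powers. -/
instance listMeasurableSpace (α : Type*) [MeasurableSpace α] : MeasurableSpace (List α) :=
  ⨅ n : ℕ, MeasurableSpace.map (fun x : Fin n → α => List.ofFn x) MeasurableSpace.pi

/-- A subset of `α` seen as a simple point configuration. -/
@[ext]
structure Config (α : Type*) where
  /-- the points of the configuration -/
  pts : Set α

/-- The usual σ-algebra on point configurations, generated by the numbers of points in the
measurable sets. -/
instance configMeasurableSpace (α : Type*) [MeasurableSpace α] : MeasurableSpace (Config α) :=
  ⨆ A : {A : Set α // MeasurableSet A},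
    MeasurableSpace.comap (fun X : Config α => (X.pts ∩ A.1).encard) ⊤

/-- Codes of rooted labelled trees. -/
abbrev LTree := Config (List ℝ)

/-- The labels of the edges from the vertex `p` to its children. -/
def offspring (T : LTree) (p : List ℝ) : Config ℝ := ⟨{a | p ++ [a] ∈ T.pts}⟩

/-- The labels of the edges adjacent to the root. -/
def rootLabels (T : LTree) : Config ℝ := ⟨{a | [a] ∈ T.pts}⟩

/-- The subtree starting at the child of the root attached by the edge with label `a`. -/
def subtree (T : LTree) (a : ℝ) : LTree := ⟨{p | a :: p ∈ T.pts}⟩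

/-- The vertices of the `n`-th generation. -/
def generation (T : LTree) (n : ℕ) : Set (List ℝ) := {p ∈ T.pts | p.length = n}

/-- The tree restricted to its generations `0, …, n`. -/
def truncate (n : ℕ) (T : LTree) : LTree := ⟨{p ∈ T.pts | p.length ≤ n}⟩

/-- `T` is the code of a locally finite rooted tree. -/
def IsLocallyFiniteTree (T : LTree) : Prop :=
  [] ∈ T.pts ∧ (∀ p a, p ++ [a] ∈ T.pts → p ∈ T.pts) ∧ ∀ p, (offspring T p).pts.Finite

/-- The labelled graph with code `T`. -/
def treeGraph (T : LTree) : LGraph (List ℝ) :=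
  {e | ∃ p a, p ++ [a] ∈ T.pts ∧ e = (a, s(p, p ++ [a]))}

/-- `Θ^y(T)`: the tree with an extra vertex `none`, joined to the root by an edge labelled `y`. -/
def theta (y : ℝ) (T : LTree) : LGraph (Option (List ℝ)) :=
  insert (y, s(none, some [])) (mapEdge some '' treeGraph T)

/-- The connected component of the root in `Φ(T)`. -/
def forbidTree (k : ℕ) (T : LTree) : LTree := ⟨component (forbid k (treeGraph T)) []⟩

open Classical in
/-- `Φ^y(T)`: the value `none` (the graph is no longer relevant) if the extra edge is removed in
`Φ(Θ^y(T))`; otherwise the component of the root in the part of `Φ(Θ^y(T))` inside `T`. -/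
def forbidTreeAt (k : ℕ) (y : ℝ) (T : LTree) : Option LTree :=
  if (y, s(none, some [])) ∈ forbid k (theta y T) then
    some ⟨component {e | mapEdge some e ∈ forbid k (theta y T)} []⟩
  else none

/-! ### The random trees -/

/-- Sample space: each node of the Ulam–Harris tree carries its number of children and a mark. -/
abbrev Sample := List ℕ → ℕ × I

/-- Independent nodes; the numbers of children are Poisson with mean `t` and the marks are uniform
on `[0,1]` and independent of them. -/
def sampleMeasure (t : ℝ) : Measure Sample :=
  Measure.infinitePi fun _ : List ℕ => (poissonMeasure t.toNNReal).prod (volume : Measure I)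

/-- `GWPath t ω u p`: the node `u` belongs to the Galton–Watson tree, and `p` is the sequence of
the labels from the root to `u`. The edge from a node to its parent is labelled by `t` times the
mark of the node, which is uniform on `[0,t]`. -/
inductive GWPath (t : ℝ) (ω : Sample) : List ℕ → List ℝ → Prop
  | root : GWPath t ω [] []
  | child (u : List ℕ) (p : List ℝ) (j : ℕ) : GWPath t ω u p → j < (ω u).1 →
      GWPath t ω (u ++ [j]) (p ++ [t * ((ω (u ++ [j])).2 : ℝ)])

/-- `T^∞_t`: Galton–Watson tree with Poisson offspring of mean `t` and independent labels, uniform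
on `[0,t]`. -/
def treeInf (t : ℝ) (ω : Sample) : LTree := ⟨{p | ∃ u, GWPath t ω u p}⟩

/-- `T^k_t`: the component of the root in the forbidden degree version of `T^∞_t`. -/
def treeK (k : ℕ) (t : ℝ) (ω : Sample) : LTree := forbidTree k (treeInf t ω)

/-- The event that `T^{k,y}_t = Φ^y(T^∞_t)` is relevant, that is, not `none`. -/
def survives (k : ℕ) (t y : ℝ) : Set Sample := {ω | forbidTreeAt k y (treeInf t ω) ≠ none}

/-- `T^{k,y}_t` on the event `survives k t y` (elsewhere the one-point tree, by convention). -/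
def treeKAt (k : ℕ) (t y : ℝ) (ω : Sample) : LTree :=
  (forbidTreeAt k y (treeInf t ω)).getD ⟨{[]}⟩

/-- `m(t,y)`, the probability that `T^{k,y}_t` is relevant. -/
def survivalProb (k : ℕ) (t y : ℝ) : ℝ := (sampleMeasure t).real (survives k t y)

/-- The probability conditioned on the event that `T^{k,y}_t` is relevant. Under this probability
the random tree `treeKAt k t y` is `T^{k+,y}_t`. -/
def condMeasure (k : ℕ) (t y : ℝ) : Measure Sample := (sampleMeasure t)[|survives k t y]

/-- The law of `T^{k+,y}_t`. -/
def lawPlus (k : ℕ) (t y : ℝ) : Measure LTree := (condMeasure k t y).map (treeKAt k t y)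

/-- `B(y)`: the law of the set of the labels of the edges adjacent to the root of `T^{k+,y}_t`. -/
def offspringLaw (k : ℕ) (t y : ℝ) : Measure (Config ℝ) := (lawPlus k t y).map rootLabels

/-- The law of the set of the labels of the edges adjacent to the root of `T^k_t`. -/
def rootLaw (k : ℕ) (t : ℝ) : Measure (Config ℝ) :=
  ((sampleMeasure t).map (treeK k t)).map rootLabels

/-! ### Multitype branching processes -/

/-- The type of the vertex `p` in a tree whose root has type `y`: the label of the edge to the
parent. -/
def vertexType (y : ℝ) (p : List ℝ) : ℝ := p.getLast?.getD y

/-- The random tree `T` is a multitype branching process with offspring law `B(·)` and a root of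
type `y`: conditionally on the generations `0, …, n`, the sets of labels of the children of the
vertices of generation `n` are independent, the one of a vertex of type `z` having the law `B(z)`.
By induction on the generations this determines the law of `T`. -/
structure IsBranchingProcess {Ω : Type*} [MeasurableSpace Ω] (μ : Measure Ω) (T : Ω → LTree)
    (B : ℝ → Measure (Config ℝ)) (y : ℝ) : Prop where
  isProbabilityMeasure : IsProbabilityMeasure μ
  aemeasurable : AEMeasurable T μ
  tree : ∀ᵐ ω ∂μ, IsLocallyFiniteTree (T ω)
  branching : ∀ (n : ℕ) (F : LTree → ℝ≥0∞) (φ : List ℝ → Config ℝ → ℝ≥0∞),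
    Measurable F → Measurable (Function.uncurry φ) →
      ∫⁻ ω, F (truncate n (T ω)) *
          ∏ᶠ p ∈ generation (T ω) n, φ p (offspring (T ω) p) ∂μ =
        ∫⁻ ω, F (truncate n (T ω)) *
          ∏ᶠ p ∈ generation (T ω) n, (∫⁻ X, φ p X ∂(B (vertexType y p))) ∂μ

/-- Conditionally on the set of the labels of the edges adjacent to the root of the random tree
`T`, the subtrees starting at the root's children are independent, and the one attached by the
edge with label `z` has the law `Q z`. -/
structure HasIndependentSubtrees {Ω : Type*} [MeasurableSpace Ω] (μ : Measure Ω) (T : Ω → LTree)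
    (Q : ℝ → Measure LTree) : Prop where
  isProbabilityMeasure : IsProbabilityMeasure μ
  aemeasurable : AEMeasurable T μ
  tree : ∀ᵐ ω ∂μ, IsLocallyFiniteTree (T ω)
  indep : ∀ (F : Config ℝ → ℝ≥0∞) (φ : ℝ → LTree → ℝ≥0∞),
    Measurable F → Measurable (Function.uncurry φ) →
      ∫⁻ ω, F (rootLabels (T ω)) *
          ∏ᶠ z ∈ (rootLabels (T ω)).pts, φ z (subtree (T ω) z) ∂μ =
        ∫⁻ ω, F (rootLabels (T ω)) *
          ∏ᶠ z ∈ (rootLabels (T ω)).pts, (∫⁻ T', φ z T' ∂(Q z)) ∂μ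

/-! ### Densities -/

/-- `T^{∞,X}_t` for `X = {x_1, …, x_i}`: besides its Poisson set of edges with labels in `[0,t]`
(those of `T^∞_t`), the root has an edge of label `x_j` for each `j`; the subtrees attached to all
these edges are independent copies of `T^∞_t`. -/
def treeInfWith {i : ℕ} (t : ℝ) (x : Fin i → ℝ) (ω : Sample × (Fin i → Sample)) : LTree :=
  ⟨(treeInf t ω.1).pts ∪ {q | ∃ j, ∃ p ∈ (treeInf t (ω.2 j)).pts, q = x j :: p}⟩

/-- The probability measure under which `T^{∞,X}_t` is built. -/
def sampleMeasureWith (i : ℕ) (t : ℝ) : Measure (Sample × (Fin i → Sample)) :=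
  (sampleMeasure t).prod (Measure.pi fun _ => sampleMeasure t)

/-- `f_i(t,y,x) = P(E^{y,X}_t)`: the probability that `Φ^y(T^{∞,X}_t)` is relevant and that the
edges adjacent to its root are exactly the edges labelled by `X = {x_1, …, x_i}`. -/
def densityF (k i : ℕ) (t y : ℝ) (x : Fin i → ℝ) : ℝ :=
  (sampleMeasureWith i t).real
    {ω | ∃ T, forbidTreeAt k y (treeInfWith t x ω) = some T ∧ (rootLabels T).pts = range x}

/-- `g_i(t,y,x) = f_i(t,y,x) / m(t,y)`. -/
def densityG (k i : ℕ) (t y : ℝ) (x : Fin i → ℝ) : ℝ := densityF k i t y x / survivalProb k t y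

/-- `h_i(t,x) = P(E^X_t)`: the probability that the edges adjacent to the root in `Φ(T^{∞,X}_t)`
are exactly the edges labelled by `X = {x_1, …, x_i}`. -/
def densityH (k i : ℕ) (t : ℝ) (x : Fin i → ℝ) : ℝ :=
  (sampleMeasureWith i t).real
    {ω | (rootLabels (forbidTree k (treeInfWith t x ω))).pts = range x}

/-- The restriction of the law `ν` of a random finite subset of `[0,t]` to the sets of cardinality
`i` has density `h`: the increasing enumeration of the set has density `h`, with respect to the
Lebesgue measure, on the simplex `0 ≤ x_1 < ⋯ < x_i ≤ t`. -/
def HasDensity (i : ℕ) (t : ℝ) (ν : Measure (Config ℝ)) (h : (Fin i → ℝ) → ℝ) : Prop :=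
  ∀ A : Set (Fin i → ℝ), MeasurableSet A →
    ν {X | ∃ x ∈ A, StrictMono x ∧ X.pts = range x} =
      ∫⁻ x in A ∩ {x | StrictMono x ∧ ∀ j, x j ∈ Icc 0 t}, ENNReal.ofReal (h x)

/-- The points `(t,y,x)` with `y, x_1, …, x_i` distinct in `(0,t)`: the union, up to permutations
of the `x_j`, of the sets `0 < x_1 < ⋯ < x_j < y < x_{j+1} < ⋯ < x_i < t`. -/
def domainY (i : ℕ) : Set (ℝ × ℝ × (Fin i → ℝ)) :=
  {q | q.2.1 ∈ Ioo 0 q.1 ∧ Function.Injective q.2.2 ∧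
    ∀ j, q.2.2 j ∈ Ioo 0 q.1 ∧ q.2.2 j ≠ q.2.1}

/-- The points `(t,x)` with `t > 0` and `x_1, …, x_i` distinct in `(0,t)`. -/
def domain (i : ℕ) : Set (ℝ × (Fin i → ℝ)) :=
  {q | 0 < q.1 ∧ Function.Injective q.2 ∧ ∀ j, q.2 j ∈ Ioo 0 q.1}

end ForbiddenDegree

end

noncomputable section

namespace ForbiddenDegree

/-! ### Blow-ups -/

/-! The dynamics is encoded by its blow-ups: the pairs `(f, v)` such that the vertex `v` reaches
degree `k` when the edge `f` is added. An edge is kept exactly when no endpoint of it blows up at or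
after its label. Whether `(f, v)` is a blow-up depends only on pairs `(f', v')` with a smaller label
and with `v'` on an edge containing `v`. If this dependency relation `Dep` is well founded, the
blow-ups are determined by recursion. With local finiteness each status then depends on finitely
many vertices, so the graph is in the class `Ω⁺` and `forbid` is read from the blow-ups
(`isOmegaPlus_of_wellFounded`, `forbid_eq_kept`).

On the Galton–Watson tree an infinite dependency chain produces, along a descending path, decreasing
times that are labels of edges incident to every second vertex. The probability that `m` such steps
exist below time `t * v` is at most `C ^ m * v ^ m / m!`, because the times are ordered
(`measure_chain_le`). This tends to zero, so almost surely `Dep` is well founded.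

On a tree the dynamics is recursive. While the root does not blow up, the side of a child attached
by an edge of label `a` evolves as `Θ^a` of its own subtree (`thetaBlow_graft`). The statuses of the
edges at the root are thus a function of their labels and of the survival of each of them on the
child's side. This gives measurable models `Alive`, `RootEdge`, `KNode`, `treeHat`, almost surely
equal to the graph objects. Two conventions run through the file: `t + 1` is a horizon beyond all
labels, and an extra edge of label `t + 2` arrives too late to matter, so the tree without extra
edge is the case `y = t + 2`.

The branching property holds because all that the rest of the tree sees of what lies above a kept
node is that the edge to the parent is not removed from above. Replacing the sample above this node
by any other one with the same property changes nothing else (`put_spec`). As resampling preserves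
the law, the samples above the nodes of one generation are independent and conditioned on that
survival only (`swap_above`, `lintegral_generation`).

The densities come from the Palm formula for Poisson processes: summing over the injective choices
of `i` children among a Poisson number, the other children are again Poisson and the chosen labels
have Lebesgue intensity (`measure_enumeration`). The lower bounds come from the event that `i + 1`
independent trees are reduced to their roots. For continuity, all values of `t` are coupled through
uniform variables. Almost surely a status is decided by finitely many strict comparisons of labels,
so it is locally constant in the parameters, and bounded convergence applies. -/

/-- Unique solvability of recursive equations along a well-founded relation. -/
theorem exists_fixedPoint {X : Type*} {r : X → X → Prop} (wf : WellFounded r)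
    (Op : X → Set X → Prop)
    (loc : ∀ x B B', (∀ x', r x' x → (x' ∈ B ↔ x' ∈ B')) → (Op x B ↔ Op x B')) :
    ∃ B : Set X, ∀ x, x ∈ B ↔ Op x B := by
  classical
  -- `Op` expects a set, while the recursion only knows the points below `x`. The other points are
  -- left out of the set, which is harmless by `loc`.
  let F : (x : X) → ((y : X) → r y x → Prop) → Prop :=
    fun x f => Op x {y | ∃ h : r y x, f y h}
  refine ⟨{x | wf.fix F x}, fun x => ?_⟩
  rw [mem_ofPred_eq, wf.fix_eq]
  refine loc x _ _ fun x' hx' => ?_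
  simp [hx']

/-- `B` is the set of the blow-ups of the dynamics on `G`: the pair `(f, v)` is in `B` when the
vertex `v` reaches the degree `k` as the edge `f` is added. -/
def IsBlow {V : Type*} (k : ℕ) (G : LGraph V) (B : Set ((ℝ × Sym2 V) × V)) : Prop :=
  ∀ f ∈ G, ∀ v ∈ f.2, (f, v) ∈ B ↔
    (k : ℕ∞) ≤ 1 + {g ∈ G | v ∈ g.2 ∧ g.1 < f.1 ∧
      ∀ f' ∈ G, g.1 ≤ f'.1 → f'.1 < f.1 → ∀ v' ∈ f'.2, v' ∈ g.2 → (f', v') ∉ B}.encard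

/-- The blow-up `x` may depend on the blow-up `x'`. -/
def Dep {V : Type*} (G : LGraph V) (x' x : (ℝ × Sym2 V) × V) : Prop :=
  x'.1 ∈ G ∧ x.1 ∈ G ∧ x'.2 ∈ x'.1.2 ∧ x.2 ∈ x.1.2 ∧ x'.1.1 < x.1.1 ∧
    ∃ g ∈ G, x.2 ∈ g.2 ∧ x'.2 ∈ g.2

/-- The edges that are never removed, in terms of the blow-ups. -/
def kept {V : Type*} (G : LGraph V) (B : Set ((ℝ × Sym2 V) × V)) : LGraph V :=
  {e ∈ G | ∀ f ∈ G, e.1 ≤ f.1 → ∀ v ∈ f.2, v ∈ e.2 → (f, v) ∉ B}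

/-- The right-hand side of the equation at `(f, v)` consults `(f', v')` only when `f'` is earlier
than `f` and `v'` is an endpoint of an edge `g` containing `v`, which is the relation `Dep`. In that
equation the summand `1` counts `f` itself, and `g.1 ≤ f'.1` is not strict because an edge can be
removed by its own addition. -/
theorem exists_isBlow {V : Type*} (k : ℕ) {G : LGraph V} (wf : WellFounded (Dep G)) :
    ∃ B, IsBlow k G B := by
  obtain ⟨B, hB⟩ := exists_fixedPoint wf
    (fun x B => x.1 ∈ G ∧ x.2 ∈ x.1.2 ∧ (k : ℕ∞) ≤ 1 + {g ∈ G | x.2 ∈ g.2 ∧ g.1 < x.1.1 ∧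
      ∀ f' ∈ G, g.1 ≤ f'.1 → f'.1 < x.1.1 → ∀ v' ∈ f'.2, v' ∈ g.2 → (f', v') ∉ B}.encard) (by
    intro x B B' h
    by_cases hx : x.1 ∈ G ∧ x.2 ∈ x.1.2
    · have : {g ∈ G | x.2 ∈ g.2 ∧ g.1 < x.1.1 ∧
          ∀ f' ∈ G, g.1 ≤ f'.1 → f'.1 < x.1.1 → ∀ v' ∈ f'.2, v' ∈ g.2 → (f', v') ∉ B} =
          {g ∈ G | x.2 ∈ g.2 ∧ g.1 < x.1.1 ∧
          ∀ f' ∈ G, g.1 ≤ f'.1 → f'.1 < x.1.1 → ∀ v' ∈ f'.2, v' ∈ g.2 → (f', v') ∉ B'} := by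
        ext g
        refine and_congr_right fun hg => and_congr_right fun hxg => and_congr_right fun _ =>
          forall_congr' fun f' => forall_congr' fun hf' => forall_congr' fun _ =>
          forall_congr' fun hlt => forall_congr' fun v' => forall_congr' fun hv' =>
          forall_congr' fun hv'g => not_congr ?_
        exact h (f', v') ⟨hf', hx.1, hv', hx.2, hlt, g, hg, hxg, hv'g⟩
      rw [this]
    · tauto)
  refine ⟨B, fun f hf v hv => ?_⟩
  rw [hB]
  simp [hf, hv]

/-- A relation whose pairs have strictly increasing values in a finite set is well founded. -/
theorem wellFounded_dep_of_finite {V : Type*} {G : LGraph V} (hG : G.Finite) :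
    WellFounded (Dep G) := by
  have hfin : (Prod.fst '' G).Finite := hG.image _
  have hwf : (Prod.fst '' G).IsWF := hfin.isWF
  rw [Set.isWF_iff_no_descending_seq] at hwf
  rw [wellFounded_iff_isEmpty_descending_chain]
  refine ⟨fun ⟨F, hF⟩ => ?_⟩
  refine hwf (fun n => (F n).1.1) (strictAnti_nat_of_succ_lt fun n => ?_) fun n => ?_
  · exact (hF n).2.2.2.2.1
  · exact ⟨_, (hF n).2.1, rfl⟩

theorem encard_insert_aux {V : Type*} {H : LGraph V} {e : ℝ × Sym2 V} (he : e ∉ H) {v : V}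
    (hv : v ∈ e.2) : degree (insert e H) v = 1 + {g ∈ H | v ∈ g.2}.encard := by
  have : {g ∈ insert e H | v ∈ g.2} = insert e {g ∈ H | v ∈ g.2} := by
    ext g
    simp only [mem_ofPred_eq, mem_insert_iff]
    constructor
    · rintro ⟨h | h, h'⟩ <;> tauto
    · rintro (rfl | h) <;> tauto
  rw [degree, this, encard_insert_of_notMem (fun h => he h.1), add_comm]

/-- Induction on the part `l` of the list already processed. The remaining part `l'` has to be
carried along, since the blow-ups refer to the whole graph. As the list is strictly sorted, the
edges before the last one are exactly those of smaller label. -/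
theorem foldl_addStep {V : Type*} (k : ℕ) (B : Set ((ℝ × Sym2 V) × V)) (G : LGraph V)
    (hB : IsBlow k G B) (l : List (ℝ × Sym2 V)) :
    ∀ l', G = {e | e ∈ l ++ l'} → (l ++ l').Pairwise (fun e f => e.1 < f.1) →
    l.foldl (addStep k) ∅ = {e | e ∈ l ∧
      ∀ f ∈ l, e.1 ≤ f.1 → ∀ v ∈ f.2, v ∈ e.2 → (f, v) ∉ B} := by
  induction l using List.reverseRecOn with
  | nil => intro l' _ _; ext e; simp
  | append_singleton l a ih =>
    intro l' hG hs
    rw [List.foldl_append, ih (a :: l') (by simpa using hG) (by simpa using hs)]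
    have hs' := hs
    rw [List.append_assoc, List.pairwise_append] at hs'
    obtain ⟨-, h2, h3⟩ := hs'
    have hla : ∀ e ∈ l, e.1 < a.1 := fun e he => h3 e he a (by simp)
    have hal : ∀ e ∈ l', a.1 < e.1 := by
      intro e he
      rw [List.singleton_append, List.pairwise_cons] at h2
      exact h2.1 e he
    have haG : a ∈ G := by rw [hG]; simp
    have hlt : ∀ e ∈ G, e.1 < a.1 ↔ e ∈ l := by
      intro e he
      rw [hG] at he
      simp only [List.append_assoc, List.mem_append, List.mem_cons, mem_ofPred_eq,
        List.not_mem_nil, or_false] at he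
      constructor
      · rcases he with he | rfl | he
        · exact fun _ => he
        · exact fun h => absurd h (lt_irrefl _)
        · exact fun h => absurd h (not_lt.2 (hal e he).le)
      · exact hla e
    have hlG : ∀ e ∈ l, e ∈ G := fun e he => by rw [hG]; simp [he]
    have hanl : a ∉ l := fun h => lt_irrefl _ (hla a h)
    set H : LGraph V := {e | e ∈ l ∧ ∀ f ∈ l, e.1 ≤ f.1 → ∀ v ∈ f.2, v ∈ e.2 → (f, v) ∉ B}
      with hH
    have haH : a ∉ H := fun h => hanl h.1
    -- The degree test of `addStep` is the equation of `IsBlow` at `(a, v)`, because the present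
    -- graph consists of the earlier edges not removed so far.
    have hdeg : ∀ v ∈ a.2, (degree (insert a H) v < k ↔ (a, v) ∉ B) := by
      intro v hv
      rw [encard_insert_aux haH hv, hB a haG v hv, not_le]
      have : {g ∈ H | v ∈ g.2} = {g ∈ G | v ∈ g.2 ∧ g.1 < a.1 ∧
          ∀ f' ∈ G, g.1 ≤ f'.1 → f'.1 < a.1 → ∀ v' ∈ f'.2, v' ∈ g.2 → (f', v') ∉ B} := by
        ext g
        constructor
        · rintro ⟨⟨hg, h⟩, hvg⟩
          exact ⟨hlG g hg, hvg, hla g hg, fun f' hf' h1 h2 => h f' ((hlt f' hf').1 h2) h1⟩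
        · rintro ⟨hg, hvg, hga, h⟩
          exact ⟨⟨(hlt g hg).1 hga, fun f' hf' h1 => h f' (hlG f' hf') h1 (hla f' hf')⟩, hvg⟩
      rw [this]
    ext e
    simp only [List.foldl_cons, List.foldl_nil, addStep, mem_ofPred_eq, mem_insert_iff,
      List.mem_append, List.mem_singleton]
    constructor
    · rintro ⟨rfl | he, h⟩
      · refine ⟨Or.inr rfl, ?_⟩
        rintro f (hf | rfl) hle v hv hve
        · exact absurd hle (not_le.2 (hla f hf))
        · exact (hdeg v hv).1 (h v hv hve)
      · refine ⟨Or.inl he.1, ?_⟩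
        rintro f (hf | rfl) hle v hv hve
        · exact he.2 f hf hle v hv hve
        · exact (hdeg v hv).1 (h v hv hve)
    · rintro ⟨he, h⟩
      refine ⟨?_, fun v hv hve => (hdeg v hv).2 (h a (Or.inr rfl) ?_ v hv hve)⟩
      · rcases he with he | rfl
        · exact Or.inr ⟨he, fun f hf => h f (Or.inl hf)⟩
        · exact Or.inl rfl
      · rcases he with he | rfl
        · exact (hla e he).le
        · exact le_rfl

/-- Distinct labels make the sorted list strictly sorted. This is the passage from the algorithm to
the blow-ups; finite graphs are afterwards handled through `kept` only. -/
theorem forbidFinite_eq_kept {V : Type*} {k : ℕ} {G : LGraph V} (hfin : G.Finite)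
    (hinj : ∀ e ∈ G, ∀ f ∈ G, e.1 = f.1 → e = f) {B : Set ((ℝ × Sym2 V) × V)}
    (hB : IsBlow k G B) : forbidFinite k G = kept G B := by
  classical
  rw [forbidFinite, dif_pos hfin]
  set l := hfin.toFinset.toList.mergeSort (fun e f => decide (e.1 ≤ f.1)) with hl
  have hmem : ∀ e, e ∈ l ↔ e ∈ G := by
    intro e; rw [hl, List.mem_mergeSort]; simp
  have hsort : l.Pairwise (fun e f => e.1 ≤ f.1) := by
    have := List.pairwise_mergeSort (le := fun e f : ℝ × Sym2 V => decide (e.1 ≤ f.1))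
      (fun a b c h1 h2 => by simp only [decide_eq_true_eq] at *; exact h1.trans h2)
      (fun a b => by simpa using le_total a.1 b.1) hfin.toFinset.toList
    simpa using this
  have hnd : l.Nodup := (List.mergeSort_perm _ _).nodup_iff.2 (Finset.nodup_toList _)
  have hlt : l.Pairwise (fun e f => e.1 < f.1) := by
    refine (hsort.and hnd).imp_of_mem fun {a b} ha hb h => ?_
    exact lt_of_le_of_ne h.1 fun heq => h.2 (hinj a ((hmem a).1 ha) b ((hmem b).1 hb) heq)
  rw [foldl_addStep k B G hB l [] (by ext e; simp [hmem]) (by simpa using hlt)]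
  ext e
  simp [kept, hmem]

/-! ### Comparison of two graphs -/

/-- Two graphs with the same edges around the vertices of `C`, as far as the labels below `s` are
concerned, have the same blow-ups at these vertices as long as the dependencies stay in `C`, or in a
set `X` of vertices that do not blow up. -/
theorem blow_congr {V W : Type*} {k : ℕ} {G : LGraph V} {G' : LGraph W}
    {B : Set ((ℝ × Sym2 V) × V)} {B' : Set ((ℝ × Sym2 W) × W)} {ψ : V → W}
    (hB : IsBlow k G B) (hB' : IsBlow k G' B') {C U X : Set V} {s : ℝ}
    (hU : InjOn ψ U) (hCU : ∀ e ∈ G, ∀ u ∈ C, u ∈ e.2 → ∀ w ∈ e.2, w ∈ U)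
    (h1 : ∀ e ∈ G, ∀ u ∈ C, u ∈ e.2 → mapEdge ψ e ∈ G')
    (h2 : ∀ f ∈ G', f.1 < s → ∀ u ∈ C, ψ u ∈ f.2 → ∃ e ∈ G, u ∈ e.2 ∧ mapEdge ψ e = f)
    (hX : ∀ g ∈ G, ∀ v ∈ g.2, v ∈ X → ∀ f ∈ G, g.1 ≤ f.1 → f.1 < s → v ∈ f.2 → (f, v) ∉ B)
    (hX' : ∀ g ∈ G, ∀ v ∈ g.2, v ∈ X → ∀ f ∈ G', g.1 ≤ f.1 → f.1 < s → ψ v ∈ f.2 →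
      (f, ψ v) ∉ B')
    {x : (ℝ × Sym2 V) × V} (acc : Acc (Dep G) x)
    (hC : ∀ z, Relation.ReflTransGen (Dep G) z x → z.2 ∈ C ∪ X) (hxC : x.2 ∈ C)
    (hx : x.1 ∈ G) (hx' : x.2 ∈ x.1.2) (hxs : x.1.1 ≤ s) :
    x ∈ B ↔ (mapEdge ψ x.1, ψ x.2) ∈ B' := by
  induction acc with
  | intro x _ ih =>
  obtain ⟨f, v⟩ := x
  simp only at *
  rw [hB f hx v hx', hB' (mapEdge ψ f) (h1 f hx v hxC hx') (ψ v)
    (by simpa [mapEdge] using ⟨v, hx', rfl⟩)]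
  -- The blow-up condition counts edges, so `ψ` must not identify two edges at `v`. Parallel edges
  -- are told apart by their labels.
  have hinj : InjOn (mapEdge ψ) {g ∈ G | v ∈ g.2} := by
    rintro ⟨a, p⟩ ⟨hp, hvp⟩ ⟨b, q⟩ ⟨hq, hvq⟩ heq
    simp only [mapEdge, Prod.mk.injEq] at heq
    obtain ⟨p2, rfl⟩ := Sym2.mem_iff_exists.1 hvp
    obtain ⟨q2, rfl⟩ := Sym2.mem_iff_exists.1 hvq
    have hp2 := hCU _ hp v hxC hvp p2 (by simp)
    have hq2 := hCU _ hq v hxC hvq q2 (by simp)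
    obtain ⟨rfl, heq⟩ := heq
    rw [Sym2.map_mk, Sym2.map_mk] at heq
    have : ψ p2 = ψ q2 := by
      rcases (by simpa using heq : ψ p2 = ψ q2 ∨ ψ v = ψ q2 ∧ ψ p2 = ψ v) with h | h
      exacts [h, h.2.trans h.1]
    rw [hU hp2 hq2 this]
  have key : {g ∈ G' | ψ v ∈ g.2 ∧ g.1 < (mapEdge ψ f).1 ∧
      ∀ f' ∈ G', g.1 ≤ f'.1 → f'.1 < (mapEdge ψ f).1 → ∀ v' ∈ f'.2, v' ∈ g.2 → (f', v') ∉ B'} =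
      mapEdge ψ '' {g ∈ G | v ∈ g.2 ∧ g.1 < f.1 ∧
      ∀ f' ∈ G, g.1 ≤ f'.1 → f'.1 < f.1 → ∀ v' ∈ f'.2, v' ∈ g.2 → (f', v') ∉ B} := by
    have hstar : ∀ g ∈ G, v ∈ g.2 → g.1 < f.1 → ((∀ f' ∈ G', (mapEdge ψ g).1 ≤ f'.1 →
        f'.1 < f.1 → ∀ v' ∈ f'.2, v' ∈ (mapEdge ψ g).2 → (f', v') ∉ B') ↔
        ∀ f' ∈ G, g.1 ≤ f'.1 → f'.1 < f.1 → ∀ v' ∈ f'.2, v' ∈ g.2 → (f', v') ∉ B) := by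
      intro g hg hvg hgf
      -- The pair `(g, w)` is itself a dependency of `(f, v)`, which places every endpoint of `g` in
      -- `C ∪ X`. Endpoints in `C` are treated by induction, and those in `X` blow up on neither
      -- side.
      have hcase : ∀ w ∈ g.2, w ∈ C ∪ X := fun w hw =>
        hC (g, w) (Relation.ReflTransGen.single ⟨hg, hx, hw, hx', hgf, g, hg, hvg, hw⟩)
      have hih : ∀ w ∈ g.2, w ∈ C → ∀ f' ∈ G, w ∈ f'.2 → f'.1 < f.1 →
          ((f', w) ∈ B ↔ (mapEdge ψ f', ψ w) ∈ B') := by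
        intro w hw hwC f' hf' hwf' hlt
        have hd : Dep G (f', w) (f, v) := ⟨hf', hx, hwf', hx', hlt, g, hg, hvg, hw⟩
        exact ih (f', w) hd (fun z hz => hC z (hz.tail hd)) hwC hf' hwf' (hlt.le.trans hxs)
      constructor
      · intro h f' hf' hle hlt w hwf hwg
        rcases hcase w hwg with hwC | hwX
        · rw [hih w hwg hwC f' hf' hwf hlt]
          exact h _ (h1 f' hf' w hwC hwf) hle hlt _ (by simpa [mapEdge] using ⟨w, hwf, rfl⟩)
            (by simpa [mapEdge] using ⟨w, hwg, rfl⟩)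
        · exact hX g hg w hwg hwX f' hf' hle (hlt.trans_le hxs) hwf
      · intro h f' hf' hle hlt w' hwf hwg
        obtain ⟨w, hw, rfl⟩ : ∃ w ∈ g.2, ψ w = w' := by simpa [mapEdge] using hwg
        rcases hcase w hw with hwC | hwX
        · obtain ⟨e, he, hwe, rfl⟩ := h2 f' hf' (hlt.trans_le hxs) w hwC hwf
          rw [← hih w hw hwC e he hwe hlt]
          exact h e he hle hlt w hwe hw
        · exact hX' g hg w hw hwX f' hf' hle (hlt.trans_le hxs) hwf
    ext g'
    simp only [mem_ofPred_eq, mem_image]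
    constructor
    · rintro ⟨hg', hvg', hlt, h⟩
      obtain ⟨g, hg, hvg, rfl⟩ := h2 g' hg' (lt_of_lt_of_le hlt hxs) v hxC hvg'
      exact ⟨g, ⟨hg, hvg, hlt, (hstar g hg hvg hlt).1 h⟩, rfl⟩
    · rintro ⟨g, ⟨hg, hvg, hlt, h⟩, rfl⟩
      exact ⟨h1 g hg v hxC hvg, by simpa [mapEdge] using ⟨v, hvg, rfl⟩, hlt,
        (hstar g hg hvg hlt).2 h⟩
  rw [key, InjOn.encard_image (hinj.mono ?_)]
  exact fun g hg => ⟨hg.1, hg.2.1⟩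

end ForbiddenDegree
end

noncomputable section

namespace ForbiddenDegree

/-! ### Graphs without infinite decreasing dependency chains are in `Ω⁺` -/

/-- The equation at `f` consults only labels below that of `f`, so the later edges are invisible to
it. -/
theorem isBlow_upTo {V : Type*} {k : ℕ} {G : LGraph V} {B : Set ((ℝ × Sym2 V) × V)}
    (hB : IsBlow k G B) (s : ℝ) : IsBlow k (upTo G s) B := by
  intro f hf v hv
  rw [hB f hf.1 v hv]
  have : {g ∈ G | v ∈ g.2 ∧ g.1 < f.1 ∧
      ∀ f' ∈ G, g.1 ≤ f'.1 → f'.1 < f.1 → ∀ v' ∈ f'.2, v' ∈ g.2 → (f', v') ∉ B} =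
      {g ∈ upTo G s | v ∈ g.2 ∧ g.1 < f.1 ∧
      ∀ f' ∈ upTo G s, g.1 ≤ f'.1 → f'.1 < f.1 → ∀ v' ∈ f'.2, v' ∈ g.2 → (f', v') ∉ B} := by
    ext g
    constructor
    · rintro ⟨hg, hvg, hlt, h⟩
      exact ⟨⟨hg, hlt.le.trans hf.2⟩, hvg, hlt, fun f' hf' => h f' hf'.1⟩
    · rintro ⟨hg, hvg, hlt, h⟩
      exact ⟨hg.1, hvg, hlt, fun f' hf' h1 h2 => h f' ⟨hf', h2.le.trans hf.2⟩ h1 h2⟩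
  rw [this]

theorem dep_mono {V : Type*} {G G' : LGraph V} (h : G ⊆ G') {x y : (ℝ × Sym2 V) × V}
    (hd : Dep G x y) : Dep G' x y := by
  obtain ⟨h1, h2, h3, h4, h5, g, hg, h6⟩ := hd
  exact ⟨h h1, h h2, h3, h4, h5, g, h hg, h6⟩

theorem wellFounded_dep_mono {V : Type*} {G G' : LGraph V} (h : G ⊆ G')
    (wf : WellFounded (Dep G')) : WellFounded (Dep G) :=
  Subrelation.wf (fun hd => dep_mono h hd) wf

theorem finite_ends {V : Type*} (z : Sym2 V) : {v | v ∈ z}.Finite := by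
  induction z with
  | _ a b => exact (Set.toFinite {a, b}).subset fun v hv => by simpa using hv

theorem finite_dep {V : Type*} {G : LGraph V} (hG : ∀ v, {e ∈ G | v ∈ e.2}.Finite)
    (x : (ℝ × Sym2 V) × V) : {x' | Dep G x' x}.Finite := by
  refine ((hG x.2).biUnion fun g _ => (finite_ends g.2).biUnion fun w _ =>
    (hG w).image fun f => (f, w)).subset ?_
  rintro ⟨f, w⟩ ⟨h1, h2, h3, h4, h5, g, hg, h6, h7⟩
  simp only [mem_iUnion]
  exact ⟨g, ⟨hg, h6⟩, w, h7, f, ⟨h1, h3⟩, rfl⟩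

/-- The argument is that of König's lemma: each pair has finitely many direct dependencies, and
accessibility excludes infinite descent. -/
theorem finite_descendants {V : Type*} {G : LGraph V} (hG : ∀ v, {e ∈ G | v ∈ e.2}.Finite)
    {x : (ℝ × Sym2 V) × V} (acc : Acc (Dep G) x) :
    {z | Relation.ReflTransGen (Dep G) z x}.Finite := by
  induction acc with
  | intro x _ ih =>
  refine ((finite_singleton x).union ((finite_dep hG x).biUnion fun y hy => ih y hy)).subset ?_
  intro z hz
  rcases Relation.ReflTransGen.cases_tail hz with rfl | ⟨y, hzy, hyx⟩
  · exact Or.inl rfl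
  · refine Or.inr ?_
    simp only [mem_iUnion]
    exact ⟨y, hyx, hzy⟩

theorem ball_mono {V : Type*} (G : LGraph V) (R : Set V) : Monotone (ball G R) :=
  monotone_nat_of_le_succ fun _ => subset_union_left

theorem mem_ball_succ {V : Type*} {G : LGraph V} {R : Set V} {l : ℕ} {e : ℝ × Sym2 V}
    (he : e ∈ G) {u v : V} (hu : u ∈ e.2) (hv : v ∈ e.2) (hul : u ∈ ball G R l) :
    v ∈ ball G R (l + 1) := Or.inr ⟨e, he, hv, u, hu, hul⟩

theorem finite_ball {V : Type*} {G : LGraph V} (hG : ∀ v, {e ∈ G | v ∈ e.2}.Finite)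
    {R : Set V} (hR : R.Finite) (l : ℕ) : (ball G R l).Finite := by
  induction l with
  | zero => exact hR
  | succ l ih =>
    refine ih.union ((ih.biUnion fun u _ => (hG u).biUnion fun e _ => finite_ends e.2).subset ?_)
    rintro v ⟨e, he, hv, u, hu, hul⟩
    simp only [mem_iUnion]
    exact ⟨u, hul, e, ⟨he, hu⟩, hv⟩

theorem finite_induced {V : Type*} {G : LGraph V} (hG : ∀ v, {e ∈ G | v ∈ e.2}.Finite)
    {S : Set V} (hS : S.Finite) : (induced G S).Finite := by
  refine (hS.biUnion fun u _ => hG u).subset ?_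
  rintro ⟨a, z⟩ ⟨he, h⟩
  induction z with
  | _ p q =>
    simp only [mem_iUnion]
    exact ⟨p, h p (by simp), he, by simp⟩

theorem mem_mapEdge {V W : Type*} (ψ : V → W) (e : ℝ × Sym2 V) (w : W) :
    w ∈ (mapEdge ψ e).2 ↔ ∃ v ∈ e.2, ψ v = w := Sym2.mem_map

/-- The forbidden degree version of a finite graph is invariant by injective relabelling of the
vertices. -/
theorem mapEdge_mem_forbidFinite {V W : Type*} {k : ℕ} {G : LGraph V} (hfin : G.Finite)
    (hinj : ∀ e ∈ G, ∀ f ∈ G, e.1 = f.1 → e = f) {U : Set V} (hU : ∀ e ∈ G, ∀ v ∈ e.2, v ∈ U)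
    {ψ : V → W} (hψ : InjOn ψ U) {e : ℝ × Sym2 V} (he : e ∈ G) :
    mapEdge ψ e ∈ forbidFinite k (mapEdge ψ '' G) ↔ e ∈ forbidFinite k G := by
  have wf := wellFounded_dep_of_finite hfin
  obtain ⟨B, hB⟩ := exists_isBlow k wf
  obtain ⟨B', hB'⟩ := exists_isBlow k (wellFounded_dep_of_finite (hfin.image (mapEdge ψ)))
  have hinj' : ∀ e ∈ mapEdge ψ '' G, ∀ f ∈ mapEdge ψ '' G, e.1 = f.1 → e = f := by
    rintro _ ⟨e, he, rfl⟩ _ ⟨f, hf, rfl⟩ h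
    rw [hinj e he f hf h]
  rw [forbidFinite_eq_kept hfin hinj hB, forbidFinite_eq_kept (hfin.image _) hinj' hB']
  have hcong : ∀ f ∈ G, ∀ v ∈ f.2, ((f, v) ∈ B ↔ (mapEdge ψ f, ψ v) ∈ B') := by
    intro f hf v hv
    refine blow_congr (C := U) (U := U) (X := ∅) (s := f.1) hB hB' hψ
      (fun e he _ _ _ w hw => hU e he w hw) (fun e he _ _ _ => ⟨e, he, rfl⟩) ?_ (by simp) (by simp)
      (wf.apply _) ?_ (hU f hf v hv) hf hv le_rfl
    · rintro _ ⟨e, he, rfl⟩ - u hu hue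
      obtain ⟨w, hw, hwu⟩ := (mem_mapEdge _ _ _).1 hue
      exact ⟨e, he, by rwa [← hψ (hU e he w hw) hu hwu], rfl⟩
    · intro z hz
      rcases Relation.ReflTransGen.cases_head hz with rfl | ⟨y, hzy, -⟩
      · exact Or.inl (hU f hf v hv)
      · exact Or.inl (hU _ hzy.1 _ hzy.2.2.1)
  constructor
  · rintro ⟨-, h⟩
    refine ⟨he, fun f hf hle v hv hve => ?_⟩
    rw [hcong f hf v hv]
    exact h _ ⟨f, hf, rfl⟩ hle _ ((mem_mapEdge _ _ _).2 ⟨v, hv, rfl⟩)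
      ((mem_mapEdge _ _ _).2 ⟨v, hve, rfl⟩)
  · rintro ⟨-, h⟩
    refine ⟨⟨e, he, rfl⟩, ?_⟩
    rintro _ ⟨f, hf, rfl⟩ hle w hw hwe
    obtain ⟨v, hv, rfl⟩ := (mem_mapEdge _ _ _).1 hw
    obtain ⟨u, hu, huv⟩ := (mem_mapEdge _ _ _).1 hwe
    rw [← hcong f hf v hv]
    exact h f hf hle v hv (by rwa [← hψ (hU e he u hu) (hU f hf v hv) huv])

/-- This provides the finite extensions to which `DecidedBy` is applied. An edge leaving the
`l`-ball has its inner endpoint at distance exactly `l`: from a smaller distance the other endpoint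
would still be in the ball. The bound `s` on the labels makes the cut `upTo` ineffective in the
larger ball. -/
theorem isExtension_ball {V : Type*} {G : LGraph V} (hG : IsOmega G) {R : Set V} (hR : R.Finite)
    {l l' : ℕ} (hl : l ≤ l') {s : ℝ} (hs : ∀ e ∈ induced G (ball G R l'), e.1 ≤ s) {ψ : V → ℕ}
    (hψ : InjOn ψ (ball G R l')) :
    IsExtension (upTo G s) (ball G R l) (sphere G R l) (mapEdge ψ '' induced G (ball G R l'))
      ψ := by
  have hfin := finite_induced hG.locallyFinite (finite_ball hG.locallyFinite hR l')
  have hsub := ball_mono G R hl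
  refine ⟨hfin.image _, ⟨?_, ?_, fun v => (hfin.image _).subset fun e he => he.1⟩,
    hψ.mono hsub, ?_, ?_⟩
  · rintro _ ⟨e, he, rfl⟩ _ ⟨f, hf, rfl⟩ h
    rw [hG.label_inj e he.1 f hf.1 h]
  · rintro _ ⟨⟨a, z⟩, he, rfl⟩ hdiag
    refine hG.loopless _ he.1 ?_
    induction z with
    | _ p q =>
      simp only [mapEdge, Sym2.map_mk, Sym2.mk_isDiag_iff] at hdiag ⊢
      exact hψ (he.2 p (by simp)) (he.2 q (by simp)) hdiag
  · ext f
    constructor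
    · rintro ⟨⟨e, he, rfl⟩, h⟩
      refine ⟨e, ⟨⟨he.1, hs e he⟩, fun v hv => ?_⟩, rfl⟩
      obtain ⟨w, hw, hwv⟩ := h (ψ v) ((mem_mapEdge _ _ _).2 ⟨v, hv, rfl⟩)
      rwa [← hψ (hsub hw) (he.2 v hv) hwv]
    · rintro ⟨e, he, rfl⟩
      refine ⟨⟨e, ⟨he.1.1, fun v hv => hsub (he.2 v hv)⟩, rfl⟩, fun w hw => ?_⟩
      obtain ⟨v, hv, rfl⟩ := (mem_mapEdge _ _ _).1 hw
      exact ⟨v, he.2 v hv, rfl⟩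
  · rintro _ ⟨e, he, rfl⟩ _ hu _ hw hub hwb
    obtain ⟨u, hue, rfl⟩ := (mem_mapEdge _ _ _).1 hu
    obtain ⟨w, hwe, rfl⟩ := (mem_mapEdge _ _ _).1 hw
    obtain ⟨u', hu', huu'⟩ := hub
    obtain rfl : u' = u := hψ (hsub hu') (he.2 u hue) huu'
    refine ⟨u', ⟨hu', fun j hj huj => hwb ⟨w, ?_, rfl⟩⟩, rfl⟩
    exact ball_mono G R hj (mem_ball_succ he.1 hue hwe huj)

/-- For a radius large enough, the status of an edge in any extension of its ball is its status in
terms of the blow-ups of the infinite graph. -/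
theorem exists_radius {V : Type*} {k : ℕ} {G : LGraph V} (hG : IsOmega G)
    (wf : WellFounded (Dep G)) {B : Set ((ℝ × Sym2 V) × V)} (hB : IsBlow k G B)
    {e : ℝ × Sym2 V} (he : e ∈ G) :
    ∃ L, ∀ L' ≥ L, ∀ s, e.1 ≤ s → ∀ (H : LGraph ℕ) (ψ : V → ℕ),
      IsExtension (upTo G s) (ball G (ends e) (L' + 1)) (sphere G (ends e) (L' + 1)) H ψ →
      (mapEdge ψ e ∈ forbidFinite k H ↔ e ∈ kept (upTo G s) B) := by
  set R := ends e
  have hR : R.Finite := finite_ends e.2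
  -- `D` collects the vertices of all pairs on which the blow-ups at the endpoints of `e` depend. It
  -- is finite, and following the dependencies back edge by edge shows that it lies in some ball.
  set D : Set V := ⋃ v ∈ R, ⋃ f ∈ {f ∈ G | v ∈ f.2},
    Prod.snd '' {z | Relation.ReflTransGen (Dep G) z (f, v)} with hD
  have hDfin : D.Finite := hR.biUnion fun v _ => (hG.locallyFinite v).biUnion fun f _ =>
    (finite_descendants hG.locallyFinite (wf.apply _)).image _
  have hDball : ∀ v ∈ D, ∃ l, v ∈ ball G R l := by
    intro w hw
    simp only [hD, mem_iUnion] at hw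
    obtain ⟨v, hv, f, hf, z, hz, rfl⟩ := hw
    induction hz using Relation.ReflTransGen.head_induction_on with
    | refl => exact ⟨0, hv⟩
    | head hzy _ ih =>
      obtain ⟨l, hl⟩ := ih
      obtain ⟨-, -, -, -, -, g, hg, h6, h7⟩ := hzy
      exact ⟨l + 1, mem_ball_succ hg h6 h7 hl⟩
  choose! r hr using hDball
  obtain ⟨L, hL⟩ := (hDfin.image r).bddAbove
  refine ⟨L, fun L' hL' s hs H ψ hH => ?_⟩
  have hDC : D ⊆ ball G R L' := fun v hv =>
    ball_mono G R ((hL ⟨v, hv, rfl⟩).trans hL') (hr v hv)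
  obtain ⟨B', hB'⟩ := exists_isBlow k (wellFounded_dep_of_finite hH.finite)
  rw [forbidFinite_eq_kept hH.finite hH.omega.label_inj hB']
  have hsub : ball G R L' ⊆ ball G R (L' + 1) := ball_mono G R (Nat.le_succ _)
  have h1 : ∀ g ∈ upTo G s, ∀ u ∈ ball G R L', u ∈ g.2 → mapEdge ψ g ∈ H := by
    intro g hg u hu hug
    have : mapEdge ψ g ∈ induced H (ψ '' ball G R (L' + 1)) := by
      rw [hH.induced_eq]
      exact ⟨g, ⟨hg, fun w hw => mem_ball_succ hg.1 hug hw hu⟩, rfl⟩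
    exact this.1
  -- The radius `L' + 1` is taken so that the vertices of the `L'`-ball are off the boundary sphere:
  -- all their edges in the extension `H` are then visible in the ball.
  have h2 : ∀ f ∈ H, ∀ u ∈ ball G R L', ψ u ∈ f.2 →
      ∃ g ∈ upTo G s, u ∈ g.2 ∧ mapEdge ψ g = f := by
    intro f hf u hu huf
    have hfi : f ∈ induced H (ψ '' ball G R (L' + 1)) := by
      refine ⟨hf, fun w hw => ?_⟩
      by_contra hwb
      obtain ⟨u', hu', huu'⟩ := hH.boundary f hf _ huf w hw ⟨u, hsub hu, rfl⟩ hwb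
      rw [hH.inj hu'.1 (hsub hu) huu'] at hu'
      exact hu'.2 L' (Nat.lt_succ_self _) hu
    rw [hH.induced_eq] at hfi
    obtain ⟨g, hg, rfl⟩ := hfi
    obtain ⟨w, hw, hwu⟩ := (mem_mapEdge _ _ _).1 huf
    exact ⟨g, hg.1, by rwa [← hH.inj (hg.2 w hw) (hsub hu) hwu], rfl⟩
  have hcong : ∀ f ∈ upTo G s, ∀ v ∈ f.2, v ∈ R →
      ((f, v) ∈ B ↔ (mapEdge ψ f, ψ v) ∈ B') := by
    intro f hf v hv hvR
    have hdesc : ∀ z, Relation.ReflTransGen (Dep (upTo G s)) z (f, v) → z.2 ∈ D := by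
      intro z hz
      simp only [hD, mem_iUnion]
      exact ⟨v, hvR, f, ⟨hf.1, hv⟩, z,
        hz.lift id fun _ _ h => dep_mono (fun _ h => h.1) h, rfl⟩
    exact blow_congr (C := ball G R L') (U := ball G R (L' + 1)) (X := ∅) (s := f.1)
      (isBlow_upTo hB s) hB' hH.inj (fun g hg u hu hug w hw => mem_ball_succ hg.1 hug hw hu) h1
      (fun f hf _ => h2 f hf) (by simp) (by simp)
      ((wellFounded_dep_mono (fun _ h => h.1) wf).apply _)
      (fun z hz => Or.inl (hDC (hdesc z hz))) (hDC (hdesc _ Relation.ReflTransGen.refl)) hf hv le_rfl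
  have hRC : R ⊆ ball G R L' := ball_mono G R (Nat.zero_le _)
  constructor
  · rintro ⟨-, h⟩
    refine ⟨⟨he, hs⟩, fun f hf hle v hv hve => ?_⟩
    rw [hcong f hf v hv hve]
    exact h _ (h1 f hf v (hRC hve) hv) hle _ ((mem_mapEdge _ _ _).2 ⟨v, hv, rfl⟩)
      ((mem_mapEdge _ _ _).2 ⟨v, hve, rfl⟩)
  · rintro ⟨-, h⟩
    have hte : ∃ v, v ∈ e.2 := ⟨_, Sym2.out_fst_mem e.2⟩
    obtain ⟨v0, hv0⟩ := hte
    refine ⟨h1 e ⟨he, hs⟩ v0 (hRC hv0) hv0, ?_⟩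
    intro f hf hle w hw hwe
    obtain ⟨v, hv, rfl⟩ := (mem_mapEdge _ _ _).1 hwe
    obtain ⟨g, hg, hvg, rfl⟩ := h2 f hf v (hRC hv) hw
    rw [← hcong g hg v hvg hv]
    exact h g hg hle v hvg hv

theorem decidedBy_of_forall {V : Type*} {k : ℕ} {G : LGraph V} {e : ℝ × Sym2 V} {L : ℕ}
    {P : ℝ → Prop} (h : ∀ s, e.1 ≤ s → ∀ (H : LGraph ℕ) (ψ : V → ℕ),
      IsExtension (upTo G s) (ball G (ends e) L) (sphere G (ends e) L) H ψ →
      (mapEdge ψ e ∈ forbidFinite k H ↔ P s)) : DecidedBy k G e L := by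
  intro s hs
  by_cases hP : P s
  · exact Or.inl fun H ψ hH => (h s hs H ψ hH).2 hP
  · exact Or.inr fun H ψ hH => fun hm => hP ((h s hs H ψ hH).1 hm)

theorem isOmegaPlus_of_wellFounded {V : Type*} (k : ℕ) {G : LGraph V} (hG : IsOmega G)
    (wf : WellFounded (Dep G)) : IsOmegaPlus k G := by
  obtain ⟨B, hB⟩ := exists_isBlow k wf
  refine ⟨hG, fun e he => ?_⟩
  obtain ⟨L, hL⟩ := exists_radius hG wf hB he
  exact ⟨L + 1, decidedBy_of_forall (hL L le_rfl)⟩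

/-- The radius in the definition of `forbid` is the least deciding one, not the one given by
`exists_radius`. The two are compared in one larger ball, relabelled by integers, which extends the
neighbourhoods of both radii. -/
theorem forbid_eq_kept {V : Type*} {k : ℕ} {G : LGraph V} (hG : IsOmega G)
    (wf : WellFounded (Dep G)) {B : Set ((ℝ × Sym2 V) × V)} (hB : IsBlow k G B) :
    forbid k G = kept G B := by
  ext e
  refine (and_congr_right fun he => ?_ : _ ↔ e ∈ G ∧ _)
  have hdec : DecidedBy k G e (radius k G e) := by
    have := (isOmegaPlus_of_wellFounded k hG wf).2 e he
    exact Nat.sInf_mem (s := {l | DecidedBy k G e l}) this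
  obtain ⟨L, hL⟩ := exists_radius hG wf hB he
  set r := radius k G e
  set R := ends e with hRdef
  have hR : R.Finite := finite_ends e.2
  set l := max r L + 1
  have hrl : r ≤ l := (le_max_left _ _).trans (Nat.le_succ _)
  have hbfin := finite_ball hG.locallyFinite hR l
  have hifin : (induced G (ball G R l)).Finite := finite_induced hG.locallyFinite hbfin
  obtain ⟨s, hs⟩ := (hifin.image Prod.fst).bddAbove
  have hs' : ∀ e ∈ induced G (ball G R l), e.1 ≤ s := fun e he => hs ⟨e, he, rfl⟩
  obtain ⟨ψ, hψ⟩ := Set.countable_iff_exists_injOn.1 hbfin.countable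
  have hsub := ball_mono G R hrl
  have hind : induced G (ball G R r) ⊆ induced G (ball G R l) :=
    fun e he => ⟨he.1, fun v hv => hsub (he.2 v hv)⟩
  have heind : ∀ j, e ∈ induced G (ball G R j) :=
    fun j => ⟨he, fun v hv => ball_mono G R (Nat.zero_le j) hv⟩
  have hes := hs' e (heind l)
  have hext0 := isExtension_ball hG hR (le_refl r) (fun e he => hs' e (hind he)) (hψ.mono hsub)
  have hext1 := isExtension_ball hG hR hrl hs' hψ
  have hext2 := isExtension_ball hG hR (le_refl l) hs' hψ
  have e1 : e ∈ forbidFinite k (induced G (ball G R r)) ↔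
      mapEdge ψ e ∈ forbidFinite k (mapEdge ψ '' induced G (ball G R r)) :=
    (mapEdge_mem_forbidFinite (hifin.subset hind)
      (fun e he f hf => hG.label_inj e he.1 f hf.1) (fun e he => he.2) (hψ.mono hsub)
      (heind r)).symm
  -- The radius `r` decides the status of `e`, so two finite graphs extending the `r`-ball give the
  -- same answer.
  have e2 : mapEdge ψ e ∈ forbidFinite k (mapEdge ψ '' induced G (ball G R r)) ↔
      mapEdge ψ e ∈ forbidFinite k (mapEdge ψ '' induced G (ball G R l)) := by
    rcases hdec s hes with h | h
    · exact iff_of_true (h _ _ hext0) (h _ _ hext1)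
    · exact iff_of_false (h _ _ hext0) (h _ _ hext1)
  rw [e1, e2, hL (max r L) (le_max_right _ _) s hes _ _ hext2]
  constructor
  · rintro ⟨-, h⟩ f hf hle v hv hve
    refine h f ⟨hf, hs' f ⟨hf, fun w hw => ?_⟩⟩ hle v hv hve
    exact ball_mono G R (Nat.succ_le_succ (Nat.zero_le _))
      (mem_ball_succ (R := R) (l := 0) hf hv hw hve)
  · exact fun h => ⟨⟨he, hes⟩, fun f hf => h f hf.1⟩

/-- Finitely many edges do not create infinite dependency chains. -/
theorem wellFounded_dep_of_diff {V : Type*} {G : LGraph V}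
    (hG : ∀ v, {e ∈ G | v ∈ e.2}.Finite) {E : LGraph V} (hE : E.Finite)
    (wf : WellFounded (Dep (G \ E))) : WellFounded (Dep G) := by
  rw [wellFounded_iff_isEmpty_descending_chain] at wf ⊢
  by_contra hne
  rw [not_isEmpty_iff] at hne
  obtain ⟨x, hx⟩ := hne
  have hanti : StrictAnti fun n => (x n).1.1 := strictAnti_nat_of_succ_lt fun n =>
    (hx n).2.2.2.2.1
  have hfin : ∀ F : LGraph V, F.Finite → {n | (x n).1 ∈ F}.Finite := fun F hF =>
    hF.preimage fun a _ b _ hab => hanti.injective (congrArg Prod.fst hab)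
  have hS : (⋃ e ∈ E, {v | v ∈ e.2}).Finite := hE.biUnion fun e _ => finite_ends e.2
  -- Labels strictly decrease along the chain, so an edge occurs at most once in it. Hence the chain
  -- meets the endpoints of `E` finitely often, and the edges through which its tail passes avoid
  -- `E`.
  have hbad : {n | (x n).1 ∈ E ∨ (x n).2 ∈ ⋃ e ∈ E, {v | v ∈ e.2}}.Finite := by
    refine (hfin E hE).union ((hfin _ (hS.biUnion fun v _ => hG v)).subset ?_)
    intro n hn
    exact mem_iUnion₂.2 ⟨(x n).2, hn, (hx n).2.1, (hx n).2.2.2.1⟩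
  obtain ⟨N, hN⟩ := hbad.bddAbove
  have hgood : ∀ n, ¬ ((x (N + 1 + n)).1 ∈ E ∨ (x (N + 1 + n)).2 ∈ ⋃ e ∈ E, {v | v ∈ e.2}) := by
    intro n hn
    have := hN hn
    omega
  refine wf.false ⟨fun n => x (N + 1 + n), fun n => ?_⟩
  obtain ⟨h1, h2, h3, h4, h5, g, hg, h6, h7⟩ := hx (N + 1 + n)
  refine ⟨⟨h1, fun h => hgood (n + 1) (Or.inl h)⟩, ⟨h2, fun h => hgood n (Or.inl h)⟩, h3, h4, h5,
    g, ⟨hg, fun h => hgood n (Or.inr ?_)⟩, h6, h7⟩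
  exact mem_iUnion₂.2 ⟨g, h, h6⟩

end ForbiddenDegree
end

noncomputable section

namespace ForbiddenDegree

/-! ### The dynamics at one vertex -/

/-- `β` is the set of the blow-ups of a vertex with incident edges `i ∈ E` of label `a i`, when
`p j b` tells whether the edge `j` is not removed by its other endpoint before time `b`. -/
def Sol {κ : Type*} (k : ℕ) (E : Finset κ) (a : κ → ℝ) (p : κ → ℝ → Prop) (β : Finset κ) : Prop :=
  ∀ i ∈ E, i ∈ β ↔ (k : ℕ∞) ≤ 1 + {j | j ∈ E ∧ a j < a i ∧ p j (a i) ∧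
    ∀ i' ∈ E, a j ≤ a i' → a i' < a i → i' ∉ β}.encard

/-- The edge `j` is not removed before time `s`, with the notations of `Sol`. -/
def Kept {κ : Type*} (k : ℕ) (E : Finset κ) (a : κ → ℝ) (p : κ → ℝ → Prop) (s : ℝ) (j : κ) :
    Prop :=
  j ∈ E ∧ p j s ∧ ∃ β, Sol k E a p β ∧ ∀ i ∈ E, a j ≤ a i → a i < s → i ∉ β

/-- The recursion of `exists_isBlow` restricted to one vertex. All influence of the other endpoints
is hidden in `p`, so it goes along the finitely many labels at this vertex. -/
theorem exists_sol {κ : Type*} (k : ℕ) (E : Finset κ) (a : κ → ℝ) (p : κ → ℝ → Prop) :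
    ∃ β, Sol k E a p β := by
  classical
  have wf : WellFounded fun i' i : κ => i' ∈ E ∧ i ∈ E ∧ a i' < a i := by
    have hwf : (a '' (E : Set κ)).IsWF := (E.finite_toSet.image a).isWF
    rw [Set.isWF_iff_no_descending_seq] at hwf
    rw [wellFounded_iff_isEmpty_descending_chain]
    refine ⟨fun ⟨F, hF⟩ => hwf (fun n => a (F n)) (strictAnti_nat_of_succ_lt fun n => ?_)
      fun n => ⟨_, (hF n).2.1, rfl⟩⟩
    exact (hF n).2.2
  obtain ⟨B, hB⟩ := exists_fixedPoint wf (fun i B => i ∈ E ∧ (k : ℕ∞) ≤ 1 +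
    {j | j ∈ E ∧ a j < a i ∧ p j (a i) ∧
      ∀ i' ∈ E, a j ≤ a i' → a i' < a i → i' ∉ B}.encard) (by
    intro i B B' h
    refine and_congr_right fun hi => ?_
    have : {j | j ∈ E ∧ a j < a i ∧ p j (a i) ∧ ∀ i' ∈ E, a j ≤ a i' → a i' < a i → i' ∉ B} =
        {j | j ∈ E ∧ a j < a i ∧ p j (a i) ∧ ∀ i' ∈ E, a j ≤ a i' → a i' < a i → i' ∉ B'} := by
      ext j
      refine and_congr_right fun _ => and_congr_right fun _ => and_congr_right fun _ =>
        forall_congr' fun i' => forall_congr' fun hi' => forall_congr' fun _ =>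
        forall_congr' fun hlt => not_congr (h i' ⟨hi', hi, hlt⟩)
    rw [this])
  refine ⟨E.filter (· ∈ B), fun i hi => ?_⟩
  have : {j | j ∈ E ∧ a j < a i ∧ p j (a i) ∧
      ∀ i' ∈ E, a j ≤ a i' → a i' < a i → i' ∉ E.filter (· ∈ B)} =
      {j | j ∈ E ∧ a j < a i ∧ p j (a i) ∧
      ∀ i' ∈ E, a j ≤ a i' → a i' < a i → i' ∉ B} := by
    ext j
    refine and_congr_right fun _ => and_congr_right fun _ => and_congr_right fun _ =>
        forall_congr' fun i' => forall_congr' fun hi' => forall_congr' fun _ =>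
        forall_congr' fun hlt => not_congr (by simp [hi'])
  rw [this, Finset.mem_filter, hB]
  simp [hi]

/-- Two families with the same comparisons and the same data below time `s` have the same
blow-ups before `s`. -/
theorem sol_congr {κ : Type*} {k : ℕ} {E : Finset κ} {a a' : κ → ℝ} {p p' : κ → ℝ → Prop}
    {β β' : Finset κ} (h : Sol k E a p β) (h' : Sol k E a' p' β') {P : κ → Prop}
    (hP : ∀ i ∈ E, P i → ∀ j ∈ E, a j < a i → P j)
    (hlt : ∀ i ∈ E, P i → ∀ j ∈ E, (a j < a i ↔ a' j < a' i))
    (hp : ∀ i ∈ E, P i → ∀ j ∈ E, a j < a i → (p j (a i) ↔ p' j (a' i))) {i : κ} (hi : i ∈ E)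
    (hPi : P i) : i ∈ β ↔ i ∈ β' := by
  have hfin : (a '' (E : Set κ)).Finite := E.finite_toSet.image a
  -- Induction on the number of edges with a smaller label; `hP` keeps the recursion inside `P`.
  have key : ∀ n : ℕ, ∀ i ∈ E, P i → {j ∈ (E : Set κ) | a j < a i}.ncard ≤ n →
      (i ∈ β ↔ i ∈ β') := by
    intro n
    induction n using Nat.strong_induction_on with
    | _ n ih =>
    intro i hi hPi hn
    have hrec : ∀ i' ∈ E, a i' < a i → (i' ∈ β ↔ i' ∈ β') := by
      intro i' hi' hlt'
      have hlt2 : {j ∈ (E : Set κ) | a j < a i'}.ncard < {j ∈ (E : Set κ) | a j < a i}.ncard := by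
        refine Set.ncard_lt_ncard ⟨fun j hj => ⟨hj.1, hj.2.trans hlt'⟩, fun hsub => ?_⟩
          (E.finite_toSet.subset fun j hj => hj.1)
        exact lt_irrefl _ (hsub (show i' ∈ {j ∈ (E : Set κ) | a j < a i} from ⟨hi', hlt'⟩)).2
      exact ih _ (hlt2.trans_le hn) i' hi' (hP i hi hPi i' hi' hlt') le_rfl
    rw [h i hi, h' i hi]
    have : {j | j ∈ E ∧ a j < a i ∧ p j (a i) ∧ ∀ i' ∈ E, a j ≤ a i' → a i' < a i → i' ∉ β} =
        {j | j ∈ E ∧ a' j < a' i ∧ p' j (a' i) ∧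
          ∀ i' ∈ E, a' j ≤ a' i' → a' i' < a' i → i' ∉ β'} := by
      ext j
      refine and_congr_right fun hj => ?_
      rw [← hlt i hi hPi j hj]
      refine and_congr_right fun hji => and_congr (hp i hi hPi j hj hji) ?_
      refine forall_congr' fun i' => forall_congr' fun hi' => ?_
      rw [← hlt i hi hPi i' hi']
      constructor
      · intro hh h1 h2
        rw [← hrec i' hi' h2]
        exact hh (not_lt.1 fun h3 =>
          absurd ((hlt j hj (hP i hi hPi j hj hji) i' hi').1 h3) (not_lt.2 h1)) h2
      · intro hh h1 h2
        rw [hrec i' hi' h2]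
        exact hh (not_lt.1 fun h3 =>
          absurd ((hlt j hj (hP i hi hPi j hj hji) i' hi').2 h3) (not_lt.2 h1)) h2
    rw [this]
  exact key _ i hi hPi le_rfl

/-- Any two solutions agree on `E` by `sol_congr`, so the existential quantifier in `Kept` can be
tested on any one of them. -/
theorem kept_iff_of_sol {κ : Type*} {k : ℕ} {E : Finset κ} {a : κ → ℝ} {p : κ → ℝ → Prop}
    {β : Finset κ} (h : Sol k E a p β) {s : ℝ} {j : κ} :
    Kept k E a p s j ↔ j ∈ E ∧ p j s ∧ ∀ i ∈ E, a j ≤ a i → a i < s → i ∉ β := by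
  refine and_congr_right fun _ => and_congr_right fun _ => ⟨?_, fun hh => ⟨β, h, hh⟩⟩
  rintro ⟨β', h', hh⟩ i hi h1 h2
  rw [sol_congr h h' (P := fun _ => True) (by simp) (by simp) (by simp) hi trivial]
  exact hh i hi h1 h2

/-- The status of an edge before time `s` depends on the comparisons of the labels, and on the data
below time `s` only. -/
theorem kept_congr {κ : Type*} {k : ℕ} {E : Finset κ} {a a' : κ → ℝ} {p p' : κ → ℝ → Prop}
    {s s' : ℝ} (hs : ∀ i ∈ E, (a i < s ↔ a' i < s'))
    (hlt : ∀ i ∈ E, a i < s → ∀ j ∈ E, (a j < a i ↔ a' j < a' i))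
    (hp : ∀ i ∈ E, a i < s → ∀ j ∈ E, a j < a i → (p j (a i) ↔ p' j (a' i)))
    {j : κ} (hj : a j < s ∨ ∀ i ∈ E, a i < s → a i < a j ∧ a' i < a' j)
    (hpj : p j s ↔ p' j s') : Kept k E a p s j ↔ Kept k E a' p' s' j := by
  obtain ⟨β, h⟩ := exists_sol k E a p
  obtain ⟨β', h'⟩ := exists_sol k E a' p'
  rw [kept_iff_of_sol h, kept_iff_of_sol h', hpj]
  refine and_congr_right fun hjI => and_congr_right fun _ => forall_congr' fun i =>
    forall_congr' fun hi => ?_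
  rw [← hs i hi]
  have hle : a i < s → (a j ≤ a i ↔ a' j ≤ a' i) := by
    intro his
    rcases hj with hj | hj
    · rw [← not_lt, ← not_lt, hlt j hjI hj i hi]
    · exact iff_of_false (not_le.2 (hj i hi his).1) (not_le.2 (hj i hi his).2)
  have hβ : a i < s → (i ∈ β ↔ i ∈ β') := fun his =>
    sol_congr h h' (P := fun i => a i < s) (fun i _ h1 j _ h2 => h2.trans h1) hlt hp hi his
  constructor
  · intro hh h1 h2
    rw [← hβ h2]
    exact hh ((hle h2).2 h1) h2
  · intro hh h1 h2
    rw [hβ h2]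
    exact hh ((hle h2).1 h1) h2

/-- Reindexing the edges at a vertex. -/
theorem kept_reindex {κ κ' : Type*} {k : ℕ} {E : Finset κ} {E' : Finset κ'} {a : κ → ℝ}
    {a' : κ' → ℝ} {p : κ → ℝ → Prop} {p' : κ' → ℝ → Prop} (g : κ → κ') (hg : InjOn g E)
    (hI : g '' E = E') (ha : ∀ i ∈ E, a' (g i) = a i) (hp : ∀ i ∈ E, ∀ b, p' (g i) b ↔ p i b)
    {s : ℝ} {j : κ} (hj : j ∈ E) : Kept k E' a' p' s (g j) ↔ Kept k E a p s j := by
  classical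
  obtain ⟨β', h'⟩ := exists_sol k E' a' p'
  have hmem : ∀ i ∈ E, g i ∈ E' := fun i hi => by
    rw [← Finset.mem_coe, ← hI]; exact ⟨i, hi, rfl⟩
  have hsurj : ∀ i' ∈ E', ∃ i ∈ E, g i = i' := fun i' hi' => by
    rw [← Finset.mem_coe, ← hI] at hi'; exact hi'
  have h : Sol k E a p (E.filter (g · ∈ β')) := by
    intro i hi
    rw [Finset.mem_filter, and_iff_right hi, h' (g i) (hmem i hi)]
    have : {j' | j' ∈ E' ∧ a' j' < a' (g i) ∧ p' j' (a' (g i)) ∧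
        ∀ i' ∈ E', a' j' ≤ a' i' → a' i' < a' (g i) → i' ∉ β'} =
        g '' {j | j ∈ E ∧ a j < a i ∧ p j (a i) ∧
        ∀ i' ∈ E, a j ≤ a i' → a i' < a i → i' ∉ E.filter (g · ∈ β')} := by
      ext j'
      constructor
      · rintro ⟨h1, h2, h3, h4⟩
        obtain ⟨j, hj, rfl⟩ := hsurj j' h1
        rw [ha i hi, ha j hj] at h2
        rw [ha i hi, hp j hj] at h3
        refine ⟨j, ⟨hj, h2, h3, fun i' hi' h5 h6 h7 => ?_⟩, rfl⟩
        exact h4 (g i') (hmem i' hi') (by rwa [ha j hj, ha i' hi']) (by rwa [ha i hi, ha i' hi'])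
          (Finset.mem_filter.1 h7).2
      · rintro ⟨j, ⟨hj, h2, h3, h4⟩, rfl⟩
        refine ⟨hmem j hj, by rwa [ha i hi, ha j hj], by rwa [ha i hi, hp j hj], ?_⟩
        intro i' hi' h5 h6 h7
        obtain ⟨l, hl, rfl⟩ := hsurj i' hi'
        rw [ha j hj, ha l hl] at h5
        rw [ha i hi, ha l hl] at h6
        exact h4 l hl h5 h6 (Finset.mem_filter.2 ⟨hl, h7⟩)
    rw [this, InjOn.encard_image (hg.mono fun j hj => hj.1)]
  rw [kept_iff_of_sol h', kept_iff_of_sol h, hp j hj, ha j hj]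
  refine and_congr (iff_of_true (hmem j hj) hj) (and_congr_right fun _ => ?_)
  constructor
  · intro hh i hi h1 h2 h3
    exact hh (g i) (hmem i hi) (by rwa [ha i hi]) (by rwa [ha i hi]) (Finset.mem_filter.1 h3).2
  · intro hh i' hi' h1 h2 h3
    obtain ⟨i, hi, rfl⟩ := hsurj i' hi'
    rw [ha i hi] at h1 h2
    exact hh i hi h1 h2 (Finset.mem_filter.2 ⟨hi, h3⟩)

/-- At any time, less than `k` edges are present. -/
theorem encard_kept_lt {κ : Type*} {k : ℕ} (hk : 1 ≤ k) {E : Finset κ} {a : κ → ℝ}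
    (ha : InjOn a E) {p : κ → ℝ → Prop} (hp : ∀ i b c, b ≤ c → p i c → p i b) {s : ℝ} :
    {j | Kept k E a p s j ∧ a j < s}.encard < k := by
  obtain ⟨β, h⟩ := exists_sol k E a p
  set S := {j | Kept k E a p s j ∧ a j < s} with hS
  have hSI : S ⊆ E := fun j hj => hj.1.1
  have hSfin : S.Finite := E.finite_toSet.subset hSI
  rcases S.eq_empty_or_nonempty with h0 | hne
  · rw [h0, encard_empty]; exact_mod_cast hk
  -- The latest edge `i` present at time `s` did not cause a blow-up when it was added. By the
  -- equation at `i` there were fewer than `k` edges at that time, and these include all those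
  -- present at time `s`.
  · obtain ⟨i, hiS, hmax⟩ := hSfin.exists_maximalFor a _ hne
    have hii := (kept_iff_of_sol h).1 hiS.1
    have his : a i < s := hiS.2
    have hiβ := hii.2.2 i hii.1 le_rfl his
    rw [h i hii.1, not_le] at hiβ
    refine lt_of_le_of_lt ?_ hiβ
    have : S ⊆ insert i {j | j ∈ E ∧ a j < a i ∧ p j (a i) ∧
        ∀ i' ∈ E, a j ≤ a i' → a i' < a i → i' ∉ β} := by
      intro j hj
      by_cases hji : j = i
      · exact Or.inl hji
      · have hjj := (kept_iff_of_sol h).1 hj.1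
        have hle : a j ≤ a i := by
          by_contra hlt
          exact hlt (hmax hj (not_le.1 hlt).le)
        have hlt : a j < a i := lt_of_le_of_ne hle fun he => hji (ha hjj.1 hii.1 he)
        exact Or.inr ⟨hjj.1, hlt, hp _ _ _ his.le hjj.2.1,
          fun i' hi' h1 h2 => hjj.2.2 i' hi' h1 (h2.trans his)⟩
    refine (encard_le_encard this).trans ((encard_insert_le _ _).trans ?_)
    rw [add_comm]

/-- When there are less than `k` edges, none is removed. -/
theorem kept_of_card_lt {κ : Type*} {k : ℕ} {E : Finset κ} (hI : E.card < k) {a : κ → ℝ}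
    {p : κ → ℝ → Prop} {s : ℝ} {j : κ} (hj : j ∈ E) (hp : p j s) : Kept k E a p s j := by
  classical
  -- The empty set is a solution: no degree can reach `k`.
  refine ⟨hj, hp, ∅, fun i hi => ?_, by simp⟩
  rw [iff_false_left (Finset.notMem_empty i), not_le]
  have hsub : {j | j ∈ E ∧ a j < a i ∧ p j (a i) ∧
      ∀ i' ∈ E, a j ≤ a i' → a i' < a i → i' ∉ (∅ : Finset κ)} ⊆ (E.erase i : Finset κ) := by
    intro j hj
    simp only [Finset.coe_erase, mem_sdiff, Finset.mem_coe, mem_singleton_iff]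
    exact ⟨hj.1, fun h => by rw [h] at hj; exact lt_irrefl _ hj.2.1⟩
  refine lt_of_le_of_lt (add_le_add_right (encard_le_encard hsub) 1) ?_
  rw [encard_coe_eq_coe_finsetCard, Finset.card_erase_of_mem hi]
  have : 0 < E.card := Finset.card_pos.2 ⟨i, hi⟩
  have h2 : 1 + (E.card - 1) < k := by omega
  exact_mod_cast h2

end ForbiddenDegree
end

noncomputable section

namespace ForbiddenDegree

/-! ### Trees -/

/-- The edge of a tree between `p` and its child of label `a`. -/
def tEdge (p : List ℝ) (a : ℝ) : ℝ × Sym2 (List ℝ) := (a, s(p, p ++ [a]))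

/-- Locally finite trees with distinct labels and without infinite dependency chains. -/
structure Good (T : LTree) : Prop where
  tree : IsLocallyFiniteTree T
  inj : ∀ p q a, p ++ [a] ∈ T.pts → q ++ [a] ∈ T.pts → p = q
  wf : WellFounded (Dep (treeGraph T))

theorem mem_tEdge {p v : List ℝ} {a : ℝ} : v ∈ (tEdge p a).2 ↔ v = p ∨ v = p ++ [a] := by
  simp [tEdge]

theorem tEdge_mem {T : LTree} {p : List ℝ} {a : ℝ} (h : p ++ [a] ∈ T.pts) :
    tEdge p a ∈ treeGraph T := ⟨p, a, h, rfl⟩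

theorem tEdge_inj {p q : List ℝ} {a b : ℝ} (h : tEdge p a = tEdge q b) : p = q ∧ a = b := by
  simp only [tEdge, Prod.mk.injEq, Sym2.eq_iff] at h
  obtain ⟨rfl, ⟨h, -⟩ | ⟨h1, h2⟩⟩ := h
  · exact ⟨h, rfl⟩
  · have := congrArg List.length h1
    have := congrArg List.length h2
    simp at *
    omega

theorem mapEdge_injective {V W : Type*} {ψ : V → W} (hψ : Function.Injective ψ) :
    Function.Injective (mapEdge ψ) := by
  rintro ⟨a, p⟩ ⟨b, q⟩ h
  simp only [mapEdge, Prod.mk.injEq] at h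
  rw [h.1, Sym2.map.injective hψ h.2]

theorem mem_mapEdge_of_injective {V W : Type*} {ψ : V → W} (hψ : Function.Injective ψ)
    {e : ℝ × Sym2 V} {v : V} : ψ v ∈ (mapEdge ψ e).2 ↔ v ∈ e.2 := by
  rw [mem_mapEdge]
  exact ⟨fun ⟨w, hw, h⟩ => hψ h ▸ hw, fun h => ⟨v, h, rfl⟩⟩

theorem wellFounded_dep_image {V W : Type*} {ψ : V → W} (hψ : Function.Injective ψ)
    {G : LGraph V} (wf : WellFounded (Dep G)) : WellFounded (Dep (mapEdge ψ '' G)) := by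
  rw [wellFounded_iff_isEmpty_descending_chain] at wf ⊢
  by_contra hne
  rw [not_isEmpty_iff] at hne
  obtain ⟨x, hx⟩ := hne
  have h1 : ∀ n, ∃ y : (ℝ × Sym2 V) × V, x n = (mapEdge ψ y.1, ψ y.2) ∧ y.1 ∈ G := by
    intro n
    obtain ⟨-, ⟨e, he, hex⟩, -, h4, -⟩ := hx n
    rw [← hex] at h4
    obtain ⟨v, -, hvx⟩ := (mem_mapEdge _ _ _).1 h4
    exact ⟨(e, v), Prod.ext hex.symm hvx.symm, he⟩
  choose y hy hyG using h1
  refine wf.false ⟨y, fun n => ?_⟩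
  obtain ⟨-, -, h3, h4, h5, g, ⟨g, hg, rfl⟩, h6, h7⟩ := hx n
  rw [hy n] at h4 h5 h6
  rw [hy (n + 1)] at h3 h5 h7
  rw [mem_mapEdge_of_injective hψ] at h3 h4 h6 h7
  exact ⟨hyG _, hyG _, h3, h4, h5, g, hg, h6, h7⟩

theorem wellFounded_dep_comap {V W : Type*} (ψ : V → W) {G : LGraph V} {G' : LGraph W}
    (h : ∀ e ∈ G, mapEdge ψ e ∈ G') (wf : WellFounded (Dep G')) : WellFounded (Dep G) := by
  refine Subrelation.wf (r := InvImage (Dep G') fun x => (mapEdge ψ x.1, ψ x.2))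
    (fun {x y} hd => ?_) (InvImage.wf _ wf)
  obtain ⟨h1, h2, h3, h4, h5, g, hg, h6, h7⟩ := hd
  exact ⟨h _ h1, h _ h2, (mem_mapEdge _ _ _).2 ⟨_, h3, rfl⟩, (mem_mapEdge _ _ _).2 ⟨_, h4, rfl⟩,
    h5, _, h _ hg, (mem_mapEdge _ _ _).2 ⟨_, h6, rfl⟩, (mem_mapEdge _ _ _).2 ⟨_, h7, rfl⟩⟩

theorem finite_star_treeGraph {T : LTree} (hT : ∀ p, (offspring T p).pts.Finite) (v : List ℝ) :
    {e ∈ treeGraph T | v ∈ e.2}.Finite := by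
  have hs : {e | ∃ p a, v = p ++ [a] ∧ e = tEdge p a}.Subsingleton := by
    rintro _ ⟨p, a, rfl, rfl⟩ _ ⟨q, b, h, rfl⟩
    rw [(List.append_inj' h rfl).1, (List.cons.inj (List.append_inj' h rfl).2).1]
  refine (((hT v).image (tEdge v)).union hs.finite).subset ?_
  rintro _ ⟨⟨p, a, hp, rfl⟩, hv⟩
  rcases mem_tEdge.1 hv with rfl | rfl
  · exact Or.inl ⟨a, hp, rfl⟩
  · exact Or.inr ⟨p, a, rfl, rfl⟩

theorem isOmega_treeGraph {T : LTree} (hT : ∀ p, (offspring T p).pts.Finite)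
    (hinj : ∀ p q a, p ++ [a] ∈ T.pts → q ++ [a] ∈ T.pts → p = q) : IsOmega (treeGraph T) := by
  refine ⟨?_, ?_, finite_star_treeGraph hT⟩
  · rintro _ ⟨p, a, hp, rfl⟩ _ ⟨q, b, hq, rfl⟩ h
    obtain rfl : a = b := h
    rw [hinj p q a hp hq]
  · rintro _ ⟨p, a, hp, rfl⟩ h
    simp at h

theorem mem_theta {y : ℝ} {T : LTree} {e : ℝ × Sym2 (Option (List ℝ))} :
    e ∈ theta y T ↔ e = (y, s(none, some [])) ∨
      ∃ p a, p ++ [a] ∈ T.pts ∧ e = mapEdge some (tEdge p a) := by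
  simp only [theta, mem_insert_iff, mem_image]
  refine or_congr Iff.rfl ⟨?_, ?_⟩
  · rintro ⟨_, ⟨p, a, hp, rfl⟩, rfl⟩
    exact ⟨p, a, hp, rfl⟩
  · rintro ⟨p, a, hp, rfl⟩
    exact ⟨_, ⟨p, a, hp, rfl⟩, rfl⟩

theorem some_injective' : Function.Injective (some : List ℝ → Option (List ℝ)) :=
  Option.some_injective _

theorem none_notMem_mapEdge (e : ℝ × Sym2 (List ℝ)) : none ∉ (mapEdge some e).2 := by
  rw [mem_mapEdge]; simp

theorem finite_star_theta {T : LTree} (hT : ∀ p, (offspring T p).pts.Finite) (y : ℝ)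
    (v : Option (List ℝ)) : {e ∈ theta y T | v ∈ e.2}.Finite := by
  have hsub : {e ∈ theta y T | v ∈ e.2} ⊆
      insert (y, s(none, some [])) {e ∈ mapEdge some '' treeGraph T | v ∈ e.2} := by
    rintro e ⟨he | he, hv⟩
    · exact Or.inl he
    · exact Or.inr ⟨he, hv⟩
  refine Finite.subset (Finite.insert _ ?_) hsub
  cases v with
  | none =>
    refine Set.finite_empty.subset ?_
    rintro _ ⟨⟨e, -, rfl⟩, h⟩
    exact none_notMem_mapEdge e h
  | some v =>
    refine ((finite_star_treeGraph hT v).image (mapEdge some)).subset ?_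
    rintro _ ⟨⟨e, he, rfl⟩, h⟩
    exact ⟨e, ⟨he, (mem_mapEdge_of_injective some_injective').1 h⟩, rfl⟩

theorem isOmega_theta {T : LTree} (hT : Good T) {y : ℝ} (hy : ∀ p, p ++ [y] ∉ T.pts) :
    IsOmega (theta y T) := by
  have h0 := isOmega_treeGraph hT.tree.2.2 hT.inj
  refine ⟨?_, ?_, finite_star_theta hT.tree.2.2 y⟩
  · intro e he f hf h
    rw [mem_theta] at he hf
    rcases he with rfl | ⟨p, a, hp, rfl⟩ <;> rcases hf with rfl | ⟨q, b, hq, rfl⟩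
    · rfl
    · obtain rfl : y = b := h
      exact absurd hq (hy q)
    · obtain rfl : a = y := h
      exact absurd hp (hy p)
    · rw [h0.label_inj _ (tEdge_mem hp) _ (tEdge_mem hq) h]
  · intro e he h
    rcases mem_theta.1 he with rfl | ⟨p, a, hp, rfl⟩
    · simp at h
    · simp [mapEdge, tEdge] at h

/-- Only one edge is added to the tree, and finitely many edges cannot create an infinite dependency
chain. -/
theorem wellFounded_theta {T : LTree} (hT : Good T) (y : ℝ) : WellFounded (Dep (theta y T)) := by
  refine wellFounded_dep_of_diff (finite_star_theta hT.tree.2.2 y)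
    (E := {(y, s(none, some []))}) (finite_singleton _) ?_
  refine wellFounded_dep_mono ?_ (wellFounded_dep_image some_injective' hT.wf)
  rintro e ⟨he | he, h⟩
  · exact absurd he h
  · exact he

theorem mapEdge_cons_tEdge (a : ℝ) (p : List ℝ) (b : ℝ) :
    mapEdge (List.cons a) (tEdge p b) = tEdge (a :: p) b := by
  simp [mapEdge, tEdge]

theorem Good.subtree {T : LTree} (hT : Good T) {a : ℝ} (ha : [a] ∈ T.pts) :
    Good (subtree T a) := by
  refine ⟨⟨ha, fun p b h => ?_, fun p => ?_⟩, fun p q b hp hq => ?_, ?_⟩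
  · exact hT.tree.2.1 (a :: p) b h
  · exact hT.tree.2.2 (a :: p)
  · exact (List.cons.inj (hT.inj (a :: p) (a :: q) b hp hq)).2
  · refine wellFounded_dep_comap (List.cons a) ?_ hT.wf
    rintro _ ⟨p, b, hp, rfl⟩
    exact ⟨a :: p, b, hp, mapEdge_cons_tEdge a p b⟩

open Classical in
/-- The blow-ups of the dynamics on `Θ^y(T)`. -/
def thetaBlow (k : ℕ) (y : ℝ) (T : LTree) : Set ((ℝ × Sym2 (Option (List ℝ))) × Option (List ℝ)) :=
  Classical.epsilon (IsBlow k (theta y T))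

theorem isBlow_thetaBlow (k : ℕ) {T : LTree} (hT : Good T) (y : ℝ) :
    IsBlow k (theta y T) (thetaBlow k y T) :=
  Classical.epsilon_spec (exists_isBlow k (wellFounded_theta hT y))

/-- The root of `T` does not blow up between the times `b` and `s` in the dynamics on
`Θ^y(T)`. -/
def Quiet (k : ℕ) (y : ℝ) (T : LTree) (b s : ℝ) : Prop :=
  ∀ f ∈ theta y T, b ≤ f.1 → f.1 < s → some [] ∈ f.2 → (f, some []) ∉ thetaBlow k y T

/-- The edges of `T` that are not removed before time `s` in the dynamics on `Θ^y(T)`. -/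
def keptAt (k : ℕ) (y : ℝ) (T : LTree) (s : ℝ) : LGraph (List ℝ) :=
  {e ∈ treeGraph T | ∀ f ∈ theta y T, e.1 ≤ f.1 → f.1 < s → ∀ v ∈ e.2, some v ∈ f.2 →
    (f, some v) ∉ thetaBlow k y T}

/-- The component of the root in the graph of the edges of `T` not removed before time `s`. -/
def keptTree (k : ℕ) (y : ℝ) (T : LTree) (s : ℝ) : LTree := ⟨component (keptAt k y T s) []⟩

/-- The extra vertex has degree one, and `k` is at least two. The extra edge can therefore be
removed only from the side of the root. -/
theorem none_notMem_thetaBlow {k : ℕ} (hk : 2 ≤ k) {T : LTree} (hT : Good T) (y : ℝ)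
    {f : ℝ × Sym2 (Option (List ℝ))} (hf : f ∈ theta y T) (hn : none ∈ f.2) :
    (f, none) ∉ thetaBlow k y T := by
  have hfe : ∀ f ∈ theta y T, none ∈ f.2 → f = (y, s(none, some [])) := by
    intro f hf hn
    rcases hf with hf | ⟨e, -, rfl⟩
    · exact hf
    · exact absurd hn (none_notMem_mapEdge e)
  rw [isBlow_thetaBlow k hT y f hf none hn, not_le]
  have : {g ∈ theta y T | none ∈ g.2 ∧ g.1 < f.1 ∧ ∀ f' ∈ theta y T, g.1 ≤ f'.1 → f'.1 < f.1 →
      ∀ v' ∈ f'.2, v' ∈ g.2 → (f', v') ∉ thetaBlow k y T} = ∅ := by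
    ext g
    simp only [mem_ofPred_eq, mem_empty_iff_false, iff_false]
    rintro ⟨hg, hgn, hlt, -⟩
    rw [hfe g hg hgn, hfe f hf hn] at hlt
    exact lt_irrefl _ hlt
  rw [this, encard_empty, add_zero]
  exact_mod_cast (show 1 < k by omega)

/-- The embedding of `Θ^a(T_a)` in `Θ^y(T)`. -/
def graftVertex (a : ℝ) : Option (List ℝ) → Option (List ℝ)
  | none => some []
  | some p => some (a :: p)

theorem graftVertex_injective (a : ℝ) : Function.Injective (graftVertex a) := by
  rintro (_ | p) (_ | q) h <;> simp_all [graftVertex]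

theorem mapEdge_graftVertex_root (a : ℝ) :
    mapEdge (graftVertex a) (a, s(none, some [])) = mapEdge some (tEdge [] a) := by
  simp [mapEdge, graftVertex, tEdge]

theorem mapEdge_graftVertex_some (a : ℝ) (e : ℝ × Sym2 (List ℝ)) :
    mapEdge (graftVertex a) (mapEdge some e) = mapEdge some (mapEdge (List.cons a) e) := by
  simp only [mapEdge, Sym2.map_map]
  rfl

theorem graft_mem_theta {T : LTree} {a : ℝ} (ha : [a] ∈ T.pts) (y : ℝ)
    {e : ℝ × Sym2 (Option (List ℝ))} (he : e ∈ theta a (subtree T a)) :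
    mapEdge (graftVertex a) e ∈ theta y T := by
  rw [mem_theta] at he
  rcases he with rfl | ⟨p, b, hp, rfl⟩
  · rw [mapEdge_graftVertex_root]
    exact Or.inr ⟨_, tEdge_mem (p := []) ha, rfl⟩
  · rw [mapEdge_graftVertex_some, mapEdge_cons_tEdge]
    exact Or.inr ⟨_, tEdge_mem (p := a :: p) hp, rfl⟩

/-- Every edge at a vertex above the child `a` comes from `Θ^a(T_a)`. The edge between the root and
this child plays the part of the extra edge. -/
theorem exists_graft_of_mem {T : LTree} {a y : ℝ} {p : List ℝ}
    {f : ℝ × Sym2 (Option (List ℝ))} (hf : f ∈ theta y T) (hp : some (a :: p) ∈ f.2) :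
    ∃ e ∈ theta a (subtree T a), some p ∈ e.2 ∧ mapEdge (graftVertex a) e = f := by
  rcases mem_theta.1 hf with rfl | ⟨q, b, hq, rfl⟩
  · simp at hp
  · rw [mem_mapEdge_of_injective some_injective', mem_tEdge] at hp
    rcases hp with rfl | hp
    · refine ⟨mapEdge some (tEdge p b), Or.inr ⟨_, tEdge_mem hq, rfl⟩, ?_, ?_⟩
      · rw [mem_mapEdge_of_injective some_injective', mem_tEdge]; simp
      · rw [mapEdge_graftVertex_some, mapEdge_cons_tEdge]
    · cases q with
      | nil =>
        simp only [List.nil_append, List.cons.injEq] at hp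
        obtain ⟨rfl, rfl⟩ := hp
        exact ⟨_, Or.inl rfl, by simp, mapEdge_graftVertex_root a⟩
      | cons c q =>
        simp only [List.cons_append, List.cons.injEq] at hp
        obtain ⟨rfl, rfl⟩ := hp
        refine ⟨mapEdge some (tEdge q b), Or.inr ⟨_, tEdge_mem hq, rfl⟩, ?_, ?_⟩
        · rw [mem_mapEdge_of_injective some_injective', mem_tEdge]; simp
        · rw [mapEdge_graftVertex_some, mapEdge_cons_tEdge]

/-- As long as the root does not blow up, the dynamics on the side of the child `a` of the root is
the dynamics on `Θ^a(T_a)`. -/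
theorem thetaBlow_graft {k : ℕ} (hk : 2 ≤ k) {T : LTree} (hT : Good T) {a y s : ℝ}
    (ha : [a] ∈ T.pts) (hq : Quiet k y T a s) {f : ℝ × Sym2 (Option (List ℝ))}
    (hf : f ∈ theta a (subtree T a)) {p : List ℝ} (hp : some p ∈ f.2) (hfs : f.1 ≤ s) :
    (f, some p) ∈ thetaBlow k a (subtree T a) ↔
      (mapEdge (graftVertex a) f, some (a :: p)) ∈ thetaBlow k y T := by
  have hS := hT.subtree ha
  have hXn : ∀ g ∈ theta a (subtree T a), none ∈ g.2 → g.1 = a := by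
    rintro g (rfl | ⟨e, -, rfl⟩) hn
    · rfl
    · exact absurd hn (none_notMem_mapEdge e)
  -- The extra vertex of `Θ^a(T_a)` corresponds to the root of `T`. It is put in `X`: in the smaller
  -- graph it has degree one, and in the larger one the hypothesis `hq` says that it does not blow
  -- up before `s`.
  refine blow_congr (C := range some) (U := univ) (X := {none}) (s := s)
    (isBlow_thetaBlow k hS a) (isBlow_thetaBlow k hT y) ((graftVertex_injective a).injOn)
    (by simp) (fun e he _ _ _ => graft_mem_theta ha y he) ?_ ?_ ?_
    ((wellFounded_theta hS a).apply _) ?_ ⟨p, rfl⟩ hf hp hfs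
  · rintro f hf - _ ⟨q, rfl⟩ hq
    exact exists_graft_of_mem hf hq
  · rintro g hg _ hv rfl f hf - - hvf
    exact none_notMem_thetaBlow hk hS a hf hvf
  · rintro g hg _ hv rfl f hf h1 h2 h3
    rw [hXn g hg hv] at h1
    exact hq f hf h1 h2 h3
  · rintro ⟨z, _ | v⟩ -
    · exact Or.inr rfl
    · exact Or.inl ⟨v, rfl⟩

/-- An edge at the root is removed either by the root or by the child. Until the root blows up, the
child's side is the autonomous dynamics on `Θ^a(T_a)`, so the two causes can be tested separately.
-/
theorem mem_keptAt_root {k : ℕ} (hk : 2 ≤ k) {T : LTree} (hT : Good T) {a y s : ℝ}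
    (ha : [a] ∈ T.pts) : tEdge [] a ∈ keptAt k y T s ↔
      Quiet k y T a s ∧ Quiet k a (subtree T a) a s := by
  constructor
  · rintro ⟨-, h⟩
    have hq : Quiet k y T a s := fun f hf h1 h2 h3 => h f hf h1 h2 [] (by simp [tEdge]) h3
    refine ⟨hq, fun f hf h1 h2 h3 => ?_⟩
    rw [thetaBlow_graft hk hT ha hq hf h3 h2.le]
    exact h _ (graft_mem_theta ha y hf) h1 h2 [a] (by simp [tEdge])
      ((mem_mapEdge _ _ _).2 ⟨_, h3, rfl⟩)
  · rintro ⟨hq, hq'⟩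
    refine ⟨tEdge_mem (p := []) ha, fun f hf h1 h2 v hv hvf => ?_⟩
    rcases mem_tEdge.1 hv with rfl | rfl
    · exact hq f hf h1 h2 hvf
    · obtain ⟨e, he, hpe, rfl⟩ := exists_graft_of_mem hf (a := a) (p := []) hvf
      exact fun h => hq' e he h1 h2 hpe ((thetaBlow_graft hk hT ha hq he hpe h2.le).2 h)

theorem mem_keptAt_cons {k : ℕ} (hk : 2 ≤ k) {T : LTree} (hT : Good T) {a y s : ℝ}
    (ha : [a] ∈ T.pts) (hq : Quiet k y T a s) (p : List ℝ) (b : ℝ) (hab : p ++ [b] ∈ (subtree T a).pts) :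
    tEdge (a :: p) b ∈ keptAt k y T s ↔ tEdge p b ∈ keptAt k a (subtree T a) s := by
  constructor
  · rintro ⟨-, h⟩
    refine ⟨tEdge_mem hab, fun f hf h1 h2 v hv hvf => ?_⟩
    rw [thetaBlow_graft hk hT ha hq hf hvf h2.le]
    refine h _ (graft_mem_theta ha y hf) h1 h2 (a :: v) ?_ ((mem_mapEdge _ _ _).2 ⟨_, hvf, rfl⟩)
    rw [mem_tEdge] at hv ⊢
    rcases hv with rfl | rfl <;> simp
  · rintro ⟨-, h⟩
    refine ⟨tEdge_mem (p := a :: p) hab, fun f hf h1 h2 v hv hvf => ?_⟩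
    obtain ⟨w, rfl, hw⟩ : ∃ w, v = a :: w ∧ w ∈ (tEdge p b).2 := by
      rw [mem_tEdge] at hv
      rcases hv with rfl | rfl
      · exact ⟨p, rfl, mem_tEdge.2 (Or.inl rfl)⟩
      · exact ⟨p ++ [b], rfl, mem_tEdge.2 (Or.inr rfl)⟩
    obtain ⟨e, he, hpe, rfl⟩ := exists_graft_of_mem hf hvf
    exact fun hh => h e he h1 h2 w hw hpe ((thetaBlow_graft hk hT ha hq he hpe h2.le).2 hh)

/-- The component of the root in a subgraph of a tree. -/
theorem mem_component {T : LTree} {K : LGraph (List ℝ)} (hK : K ⊆ treeGraph T) (p : List ℝ) :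
    p ∈ component K [] ↔ ∀ q a, q ++ [a] <+: p → tEdge q a ∈ K := by
  constructor
  · intro h
    induction h with
    | refl => intro q a h; simp at h
    | tail _ hstep ih =>
      obtain ⟨e, he, hvw⟩ := hstep
      obtain ⟨q, a, hq, rfl⟩ := hK he
      simp only [Sym2.eq_iff] at hvw
      rcases hvw with ⟨rfl, rfl⟩ | ⟨rfl, rfl⟩
      · intro r b hr
        rw [List.prefix_concat_iff] at hr
        rcases hr with hr | hr
        · obtain ⟨rfl, h⟩ := List.append_inj' hr rfl
          simp only [List.cons.injEq, and_true] at h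
          exact h ▸ he
        · exact ih r b hr
      · exact fun r b hr => ih r b (hr.trans (List.prefix_append _ _))
  · induction p using List.reverseRecOn with
    | nil => exact fun _ => Relation.ReflTransGen.refl
    | append_singleton p a ih =>
      intro h
      refine Relation.ReflTransGen.tail (ih fun q b hq => h q b (hq.trans (List.prefix_append _ _)))
        ⟨_, h p a List.prefix_rfl, rfl⟩

theorem keptAt_subset (k : ℕ) (y : ℝ) (T : LTree) (s : ℝ) : keptAt k y T s ⊆ treeGraph T :=
  fun _ h => h.1

theorem mem_of_tEdge_mem {T : LTree} {p : List ℝ} {a : ℝ} (h : tEdge p a ∈ treeGraph T) :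
    p ++ [a] ∈ T.pts := by
  obtain ⟨q, b, hq, heq⟩ := h
  obtain ⟨rfl, rfl⟩ := tEdge_inj heq
  exact hq

theorem singleton_mem_keptTree {k : ℕ} {T : LTree} {y s a : ℝ} :
    [a] ∈ (keptTree k y T s).pts ↔ tEdge [] a ∈ keptAt k y T s := by
  rw [keptTree, mem_component (keptAt_subset k y T s)]
  constructor
  · exact fun h => h [] a (by simp)
  · intro h q b hq
    have hl := hq.length_le
    simp only [List.length_append, List.length_cons, List.length_nil] at hl
    obtain rfl : q = [] := List.length_eq_zero_iff.1 (by omega)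
    simp only [List.nil_append, List.cons_prefix_cons] at hq
    rw [hq.1]; exact h

theorem nil_mem_keptTree {k : ℕ} {T : LTree} {y s : ℝ} : [] ∈ (keptTree k y T s).pts :=
  Relation.ReflTransGen.refl

theorem keptTree_subset {k : ℕ} {T : LTree} (hT : IsLocallyFiniteTree T) {y s : ℝ} :
    (keptTree k y T s).pts ⊆ T.pts := by
  intro p hp
  rw [keptTree, mem_component (keptAt_subset k y T s)] at hp
  rcases List.eq_nil_or_concat p with rfl | ⟨q, a, rfl⟩
  · exact hT.1
  · rw [List.concat_eq_append] at hp ⊢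
    exact mem_of_tEdge_mem (hp q a List.prefix_rfl).1

theorem isLocallyFiniteTree_keptTree {k : ℕ} {T : LTree} (hT : IsLocallyFiniteTree T) {y s : ℝ} :
    IsLocallyFiniteTree (keptTree k y T s) := by
  refine ⟨nil_mem_keptTree, fun p a h => ?_, fun p => ?_⟩
  · rw [keptTree, mem_component (keptAt_subset k y T s)] at h ⊢
    exact fun q b hq => h q b (hq.trans (List.prefix_append _ _))
  · exact (hT.2.2 p).subset fun a ha => keptTree_subset hT ha

/-- This is the recursive structure behind the branching property. If the edge to the child `a` is
present, the root has been quiet since time `a`, and the component above the child is computed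
inside its own subtree. -/
theorem cons_mem_keptTree {k : ℕ} (hk : 2 ≤ k) {T : LTree} (hT : Good T) {y s a : ℝ}
    (h : [a] ∈ (keptTree k y T s).pts) (p : List ℝ) :
    a :: p ∈ (keptTree k y T s).pts ↔ p ∈ (keptTree k a (subtree T a) s).pts := by
  have ha : [a] ∈ T.pts := keptTree_subset hT.tree h
  have hq : Quiet k y T a s := ((mem_keptAt_root hk hT ha).1 (singleton_mem_keptTree.1 h)).1
  rw [keptTree, keptTree, mem_component (keptAt_subset k y T s),
    mem_component (keptAt_subset k a (subtree T a) s)]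
  constructor
  · intro h q b hqb
    have := h (a :: q) b (by simpa using hqb)
    exact (mem_keptAt_cons hk hT ha hq q b (mem_of_tEdge_mem (p := a :: q) this.1)).1 this
  · intro h' q b hqb
    cases q with
    | nil =>
      simp only [List.nil_append, List.cons_prefix_cons] at hqb
      rw [hqb.1]; exact singleton_mem_keptTree.1 h
    | cons c q =>
      simp only [List.cons_append, List.cons_prefix_cons] at hqb
      obtain ⟨rfl, hqb⟩ := hqb
      have := h' q b hqb
      exact (mem_keptAt_cons hk hT ha hq q b (mem_of_tEdge_mem this.1)).2 this

/-! ### The forbidden degree versions of trees -/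

/-- As `s` exceeds all labels, not being removed before `s` means never being removed; and only the
root can remove the extra edge. -/
theorem mem_forbid_theta {k : ℕ} (hk : 2 ≤ k) {T : LTree} (hT : Good T) {y s : ℝ}
    (hy : ∀ p, p ++ [y] ∉ T.pts) (hys : y < s) (hs : ∀ p a, p ++ [a] ∈ T.pts → a < s) :
    (y, s(none, some [])) ∈ forbid k (theta y T) ↔ Quiet k y T y s := by
  rw [forbid_eq_kept (isOmega_theta hT hy) (wellFounded_theta hT y) (isBlow_thetaBlow k hT y)]
  have hlt : ∀ f ∈ theta y T, f.1 < s := by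
    intro f hf
    rcases mem_theta.1 hf with rfl | ⟨p, a, hp, rfl⟩
    exacts [hys, hs p a hp]
  constructor
  · rintro ⟨-, h⟩ f hf h1 - h3
    exact h f hf h1 _ h3 (by simp)
  · intro h
    refine ⟨Or.inl rfl, fun f hf h1 v hv hve => ?_⟩
    simp only [Sym2.mem_iff] at hve
    rcases hve with rfl | rfl
    · exact none_notMem_thetaBlow hk hT y hf hv
    · exact h f hf h1 (hlt f hf) hv

theorem forbid_theta_some {k : ℕ} {T : LTree} (hT : Good T) {y s : ℝ}
    (hy : ∀ p, p ++ [y] ∉ T.pts) (hys : y < s) (hs : ∀ p a, p ++ [a] ∈ T.pts → a < s) :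
    {e | mapEdge some e ∈ forbid k (theta y T)} = keptAt k y T s := by
  rw [forbid_eq_kept (isOmega_theta hT hy) (wellFounded_theta hT y) (isBlow_thetaBlow k hT y)]
  have hlt : ∀ f ∈ theta y T, f.1 < s := by
    intro f hf
    rcases mem_theta.1 hf with rfl | ⟨p, a, hp, rfl⟩
    exacts [hys, hs p a hp]
  ext e
  refine and_congr ⟨?_, fun h => Or.inr ⟨e, h, rfl⟩⟩ ?_
  · rintro (h | ⟨e', he', h⟩)
    · exact absurd (by rw [h]; simp) (none_notMem_mapEdge e)
    · rwa [← mapEdge_injective some_injective' h]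
  · constructor
    · exact fun h f hf h1 _ v hv hvf =>
        h f hf h1 _ hvf ((mem_mapEdge_of_injective some_injective').2 hv)
    · rintro h f hf h1 _ hv hve
      obtain ⟨v, hv', rfl⟩ := (mem_mapEdge _ _ _).1 hve
      exact h f hf h1 (hlt f hf) v hv' hv

theorem forbidTreeAt_eq {k : ℕ} (hk : 2 ≤ k) {T : LTree} (hT : Good T) {y s : ℝ}
    (hy : ∀ p, p ++ [y] ∉ T.pts) (hys : y < s) (hs : ∀ p a, p ++ [a] ∈ T.pts → a < s) :
    (Quiet k y T y s → forbidTreeAt k y T = some (keptTree k y T s)) ∧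
    (¬ Quiet k y T y s → forbidTreeAt k y T = none) := by
  rw [forbidTreeAt, forbid_theta_some hT hy hys hs, ← mem_forbid_theta hk hT hy hys hs]
  exact ⟨fun h => if_pos h, fun h => if_neg h⟩

/-- An extra edge arriving after all the others has no effect on the past. The tree alone is thus
covered by the analysis of `Θ^y(T)` with a late `y`. -/
theorem forbid_treeGraph {k : ℕ} {T : LTree} (hT : Good T) {y s : ℝ} (hsy : s ≤ y)
    (hs : ∀ p a, p ++ [a] ∈ T.pts → a < s) : forbid k (treeGraph T) = keptAt k y T s := by
  obtain ⟨B, hB⟩ := exists_isBlow k hT.wf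
  rw [forbid_eq_kept (isOmega_treeGraph hT.tree.2.2 hT.inj) hT.wf hB]
  have hlt : ∀ f ∈ treeGraph T, f.1 < s := by
    rintro _ ⟨p, a, hp, rfl⟩
    exact hs p a hp
  have hlift : ∀ f ∈ theta y T, f.1 < s → ∃ e ∈ treeGraph T, mapEdge some e = f := by
    rintro f (rfl | ⟨e, he, rfl⟩) h
    · exact absurd h (not_lt.2 hsy)
    · exact ⟨e, he, rfl⟩
  have hcong : ∀ f ∈ treeGraph T, ∀ v ∈ f.2,
      ((f, v) ∈ B ↔ (mapEdge some f, some v) ∈ thetaBlow k y T) := by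
    intro f hf v hv
    refine blow_congr (C := univ) (U := univ) (X := ∅) (s := s) hB (isBlow_thetaBlow k hT y)
      some_injective'.injOn (by simp) (fun e he _ _ _ => Or.inr ⟨e, he, rfl⟩) ?_ (by simp)
      (by simp) (hT.wf.apply _) (by simp) trivial hf hv (hlt f hf).le
    intro f hf hfs u _ hu
    obtain ⟨e, he, rfl⟩ := hlift f hf hfs
    exact ⟨e, he, (mem_mapEdge_of_injective some_injective').1 hu, rfl⟩
  ext e
  refine and_congr_right fun he => ?_
  constructor
  · intro h f hf h1 h2 v hv hvf
    obtain ⟨g, hg, rfl⟩ := hlift f hf h2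
    have hvg := (mem_mapEdge_of_injective some_injective').1 hvf
    rw [← hcong g hg v hvg]
    exact h g hg h1 v hvg hv
  · intro h f hf h1 v hv hve
    rw [hcong f hf v hv]
    exact h _ (Or.inr ⟨f, hf, rfl⟩) h1 (hlt f hf) v hve
      ((mem_mapEdge_of_injective some_injective').2 hv)

theorem forbidTree_eq {k : ℕ} {T : LTree} (hT : Good T) {y s : ℝ} (hsy : s ≤ y)
    (hs : ∀ p a, p ++ [a] ∈ T.pts → a < s) : forbidTree k T = keptTree k y T s := by
  rw [forbidTree, forbid_treeGraph hT hsy hs, keptTree]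

/-! ### The dynamics at the root -/

open Classical in
/-- The edge of label `c` at the root of `Θ^y(T)`. -/
def rootEdge (y c : ℝ) : ℝ × Sym2 (Option (List ℝ)) :=
  if c = y then (y, s(none, some [])) else mapEdge some (tEdge [] c)

theorem rootEdge_fst (y c : ℝ) : (rootEdge y c).1 = c := by
  unfold rootEdge
  split_ifs with h
  exacts [h.symm, rfl]

theorem mem_rootEdge (y c : ℝ) : some [] ∈ (rootEdge y c).2 := by
  unfold rootEdge
  split_ifs with h
  · simp
  · simp [mapEdge, tEdge]

theorem rootEdge_mem {T : LTree} {y c : ℝ} (h : c = y ∨ [c] ∈ T.pts) :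
    rootEdge y c ∈ theta y T := by
  unfold rootEdge
  split_ifs with hc
  · exact Or.inl rfl
  · exact Or.inr ⟨_, tEdge_mem (p := []) (h.resolve_left hc), rfl⟩

theorem exists_rootEdge {T : LTree} {y : ℝ} (hy : [y] ∉ T.pts)
    {f : ℝ × Sym2 (Option (List ℝ))} (hf : f ∈ theta y T) (h : some [] ∈ f.2) :
    ∃ c, (c = y ∨ [c] ∈ T.pts) ∧ f = rootEdge y c := by
  rcases mem_theta.1 hf with rfl | ⟨p, a, hp, rfl⟩
  · exact ⟨y, Or.inl rfl, by simp [rootEdge]⟩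
  · rw [mem_mapEdge_of_injective some_injective', mem_tEdge] at h
    rcases h with rfl | h
    · refine ⟨a, Or.inr hp, ?_⟩
      rw [rootEdge, if_neg]
      rintro rfl
      exact hy hp
    · simp at h

/-- The solution of the dynamics at the root of `Θ^y(T)`. -/
theorem sol_root {κ : Type*} {k : ℕ} (hk : 2 ≤ k) {T : LTree} (hT : Good T) {y : ℝ}
    (hy : [y] ∉ T.pts) {E : Finset κ} {a : κ → ℝ} (ha : InjOn a E)
    (hE : a '' E = insert y (rootLabels T).pts) {p : κ → ℝ → Prop}
    (hp : ∀ j ∈ E, ∀ b, p j b ↔ a j = y ∨ Quiet k (a j) (subtree T (a j)) (a j) b)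
    {β : Finset κ} (hβ : ∀ i ∈ E, i ∈ β ↔ (rootEdge y (a i), some []) ∈ thetaBlow k y T) :
    Sol k E a p β := by
  have hroot : ∀ i ∈ E, a i = y ∨ [a i] ∈ T.pts := fun i hi => by
    have : a i ∈ insert y (rootLabels T).pts := by rw [← hE]; exact ⟨i, hi, rfl⟩
    exact this
  have hsurj : ∀ c, (c = y ∨ [c] ∈ T.pts) → ∃ i ∈ E, a i = c := fun c hc => by
    have : c ∈ a '' E := by rw [hE]; exact hc
    exact this
  have hquiet : ∀ b c, (Quiet k y T b c ↔ ∀ i ∈ E, b ≤ a i → a i < c → i ∉ β) := by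
    intro b c
    constructor
    · intro h i hi h1 h2
      rw [hβ i hi]
      exact h _ (rootEdge_mem (hroot i hi)) (by rwa [rootEdge_fst]) (by rwa [rootEdge_fst])
        (mem_rootEdge _ _)
    · intro h f hf h1 h2 h3
      obtain ⟨d, hd, rfl⟩ := exists_rootEdge hy hf h3
      obtain ⟨i, hi, rfl⟩ := hsurj d hd
      rw [rootEdge_fst] at h1 h2
      rw [← hβ i hi]
      exact h i hi h1 h2
  intro i hi
  rw [hβ i hi, isBlow_thetaBlow k hT y _ (rootEdge_mem (hroot i hi)) _ (mem_rootEdge _ _)]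
  have hinj : InjOn (fun j => rootEdge y (a j)) E := by
    intro j hj j' hj' h
    have := congrArg Prod.fst h
    simp only [rootEdge_fst] at this
    exact ha hj hj' this
  have : {g | g ∈ theta y T ∧ some [] ∈ g.2 ∧ g.1 < (rootEdge y (a i)).1 ∧
      ∀ f' ∈ theta y T, g.1 ≤ f'.1 → f'.1 < (rootEdge y (a i)).1 → ∀ v' ∈ f'.2, v' ∈ g.2 →
        (f', v') ∉ thetaBlow k y T} = (fun j => rootEdge y (a j)) '' {j | j ∈ E ∧ a j < a i ∧
      p j (a i) ∧ ∀ i' ∈ E, a j ≤ a i' → a i' < a i → i' ∉ β} := by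
    -- The edge `j` is still present at time `a i` when the root has been quiet since `a j` and, for
    -- a true child, the child has been quiet too. For the extra edge the second condition is void.
    have hstat : ∀ j ∈ E, ((∀ f' ∈ theta y T, a j ≤ f'.1 → f'.1 < a i → ∀ v' ∈ f'.2,
        v' ∈ (rootEdge y (a j)).2 → (f', v') ∉ thetaBlow k y T) ↔
        p j (a i) ∧ ∀ i' ∈ E, a j ≤ a i' → a i' < a i → i' ∉ β) := by
      intro j hj
      rw [← hquiet, hp j hj]
      by_cases hjy : a j = y
      · simp only [hjy, true_or, true_and]
        constructor
        · exact fun h f hf h1 h2 h3 => h f hf h1 h2 _ h3 (by simp [rootEdge])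
        · intro h f hf h1 h2 v hv hv'
          simp only [rootEdge, if_true, Sym2.mem_iff] at hv'
          rcases hv' with rfl | rfl
          · exact none_notMem_thetaBlow hk hT y hf hv
          · exact h f hf h1 h2 hv
      · have haj := (hroot j hj).resolve_left hjy
        rw [or_iff_right hjy, and_comm, ← mem_keptAt_root hk hT haj]
        simp only [rootEdge, if_neg hjy]
        constructor
        · exact fun h => ⟨tEdge_mem (p := []) haj, fun f hf h1 h2 v hv hvf => h f hf h1 h2 _ hvf
            ((mem_mapEdge_of_injective some_injective').2 hv)⟩
        · rintro ⟨-, h⟩ f hf h1 h2 v hv hve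
          obtain ⟨w, hw, rfl⟩ := (mem_mapEdge _ _ _).1 hve
          exact h f hf h1 h2 w hw hv
    ext g
    constructor
    · rintro ⟨hg, hrg, hlt, h⟩
      obtain ⟨c, hc, rfl⟩ := exists_rootEdge hy hg hrg
      obtain ⟨j, hj, rfl⟩ := hsurj c hc
      rw [rootEdge_fst, rootEdge_fst] at hlt
      simp only [rootEdge_fst] at h
      exact ⟨j, ⟨hj, hlt, (hstat j hj).1 h⟩, rfl⟩
    · rintro ⟨j, ⟨hj, hlt, h⟩, rfl⟩
      refine ⟨rootEdge_mem (hroot j hj), mem_rootEdge _ _, ?_, ?_⟩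
      · simpa only [rootEdge_fst] using hlt
      · simpa only [rootEdge_fst] using (hstat j hj).2 h
  rw [this, InjOn.encard_image (hinj.mono fun j hj => hj.1)]

/-- By `sol_root` the actual blow-ups of the root solve the one-vertex equations, so the abstract
`Kept` gives the actual statuses of the edges at the root. -/
theorem kept_root {κ : Type*} {k : ℕ} (hk : 2 ≤ k) {T : LTree} (hT : Good T) {y : ℝ}
    (hy : [y] ∉ T.pts) {E : Finset κ} {a : κ → ℝ} (ha : InjOn a E)
    (hE : a '' E = insert y (rootLabels T).pts) {p : κ → ℝ → Prop}
    (hp : ∀ j ∈ E, ∀ b, p j b ↔ a j = y ∨ Quiet k (a j) (subtree T (a j)) (a j) b)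
    {j : κ} (hj : j ∈ E) (s : ℝ) :
    (a j = y → (Kept k E a p s j ↔ Quiet k y T y s)) ∧
    (a j ≠ y → (Kept k E a p s j ↔ [a j] ∈ (keptTree k y T s).pts)) := by
  classical
  set β := E.filter fun i => (rootEdge y (a i), some []) ∈ thetaBlow k y T with hβdef
  have hβ : ∀ i ∈ E, i ∈ β ↔ (rootEdge y (a i), some []) ∈ thetaBlow k y T :=
    fun i hi => by simp [hβdef, hi]
  have hroot : ∀ i ∈ E, a i = y ∨ [a i] ∈ T.pts := fun i hi => by
    have : a i ∈ insert y (rootLabels T).pts := by rw [← hE]; exact ⟨i, hi, rfl⟩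
    exact this
  have hq : (∀ i ∈ E, a j ≤ a i → a i < s → i ∉ β) ↔ Quiet k y T (a j) s := by
    constructor
    · intro h f hf h1 h2 h3
      obtain ⟨d, hd, rfl⟩ := exists_rootEdge hy hf h3
      have : d ∈ a '' E := by rw [hE]; exact hd
      obtain ⟨i, hi, rfl⟩ := this
      rw [rootEdge_fst] at h1 h2
      rw [← hβ i hi]
      exact h i hi h1 h2
    · intro h i hi h1 h2
      rw [hβ i hi]
      exact h _ (rootEdge_mem (hroot i hi)) (by rwa [rootEdge_fst]) (by rwa [rootEdge_fst])
        (mem_rootEdge _ _)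
  rw [kept_iff_of_sol (sol_root hk hT hy ha hE hp hβ), hp j hj, hq]
  refine ⟨fun h => ?_, fun h => ?_⟩
  · simp [h, hj]
  · rw [singleton_mem_keptTree, mem_keptAt_root hk hT ((hroot j hj).resolve_left h)]
    simp only [h, false_or, hj, true_and]
    tauto

end ForbiddenDegree
end

noncomputable section

namespace ForbiddenDegree

/-! ### Grafting -/

/-- No edge of `T` has label `y`. -/
def LabelFree (y : ℝ) (T : LTree) : Prop := ∀ p, p ++ [y] ∉ T.pts

/-- The tree with root edges of labels `a j`, to which the trees `T j` are attached. -/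
def graft {κ : Type*} (E : Finset κ) (a : κ → ℝ) (T : κ → LTree) : LTree :=
  ⟨{p | p = [] ∨ ∃ j ∈ E, ∃ q ∈ (T j).pts, p = a j :: q}⟩

theorem cons_mem_graft {κ : Type*} {E : Finset κ} {a : κ → ℝ} {T : κ → LTree} {b : ℝ}
    {q : List ℝ} : b :: q ∈ (graft E a T).pts ↔ ∃ j ∈ E, a j = b ∧ q ∈ (T j).pts := by
  simp only [graft, mem_ofPred_eq, reduceCtorEq, false_or, List.cons.injEq]
  constructor
  · rintro ⟨j, hj, q, hq, rfl, rfl⟩; exact ⟨j, hj, rfl, hq⟩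
  · rintro ⟨j, hj, rfl, hq⟩; exact ⟨j, hj, _, hq, rfl, rfl⟩

theorem subtree_graft {κ : Type*} {E : Finset κ} {a : κ → ℝ} {T : κ → LTree} (ha : InjOn a E)
    {j : κ} (hj : j ∈ E) : subtree (graft E a T) (a j) = T j := by
  ext p
  change a j :: p ∈ (graft E a T).pts ↔ _
  rw [cons_mem_graft]
  constructor
  · rintro ⟨i, hi, h, hp⟩
    rwa [← ha hi hj h]
  · exact fun h => ⟨j, hj, rfl, h⟩

theorem rootLabels_graft {κ : Type*} {E : Finset κ} {a : κ → ℝ} {T : κ → LTree}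
    (hT : ∀ j ∈ E, [] ∈ (T j).pts) : (rootLabels (graft E a T)).pts = a '' E := by
  ext b
  change [b] ∈ (graft E a T).pts ↔ _
  rw [cons_mem_graft]
  constructor
  · rintro ⟨j, hj, rfl, -⟩; exact ⟨j, hj, rfl⟩
  · rintro ⟨j, hj, rfl⟩; exact ⟨j, hj, rfl, hT j hj⟩

theorem append_mem_graft {κ : Type*} {E : Finset κ} {a : κ → ℝ} {T : κ → LTree} {p : List ℝ}
    {b : ℝ} : p ++ [b] ∈ (graft E a T).pts ↔ (p = [] ∧ ∃ j ∈ E, a j = b ∧ [] ∈ (T j).pts) ∨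
      ∃ j ∈ E, ∃ q, p = a j :: q ∧ q ++ [b] ∈ (T j).pts := by
  cases p with
  | nil =>
    rw [List.nil_append, cons_mem_graft]
    simp
  | cons c p =>
    rw [List.cons_append, cons_mem_graft]
    simp only [reduceCtorEq, false_and, false_or, List.cons.injEq]
    constructor
    · rintro ⟨j, hj, rfl, h⟩; exact ⟨j, hj, p, ⟨rfl, rfl⟩, h⟩
    · rintro ⟨j, hj, q, ⟨rfl, rfl⟩, h⟩; exact ⟨j, hj, rfl, h⟩

/-- The edges at the root are finitely many. Without them the graph is a disjoint union of copies of
the trees `T j`, and a dependency chain cannot pass from one copy to another. -/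
theorem good_graft {κ : Type*} {E : Finset κ} {a : κ → ℝ} {T : κ → LTree} (ha : InjOn a E)
    (hT : ∀ j ∈ E, Good (T j)) (hfree : ∀ i ∈ E, ∀ j ∈ E, LabelFree (a i) (T j))
    (hcross : ∀ i ∈ E, ∀ j ∈ E, ∀ p q b, p ++ [b] ∈ (T i).pts → q ++ [b] ∈ (T j).pts → i = j) :
    Good (graft E a T) := by
  have htree : IsLocallyFiniteTree (graft E a T) := by
    refine ⟨Or.inl rfl, fun p b h => ?_, fun p => ?_⟩
    · rcases append_mem_graft.1 h with ⟨rfl, -⟩ | ⟨j, hj, q, rfl, hq⟩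
      · exact Or.inl rfl
      · exact cons_mem_graft.2 ⟨j, hj, rfl, (hT j hj).tree.2.1 q b hq⟩
    · cases p with
      | nil =>
        refine (E.finite_toSet.image a).subset fun b hb => ?_
        obtain ⟨j, hj, rfl, -⟩ := cons_mem_graft.1 hb
        exact ⟨j, hj, rfl⟩
      | cons c p =>
        refine (E.finite_toSet.biUnion fun j hj => (hT j hj).tree.2.2 p).subset fun b hb => ?_
        obtain ⟨j, hj, rfl, h⟩ := cons_mem_graft.1 hb
        exact mem_iUnion₂.2 ⟨j, hj, h⟩
  refine ⟨htree, fun p q b hp hq => ?_, ?_⟩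
  · rcases append_mem_graft.1 hp with ⟨rfl, i, hi, rfl, -⟩ | ⟨i, hi, p', rfl, hp'⟩ <;>
      rcases append_mem_graft.1 hq with ⟨rfl, j, hj, hij, -⟩ | ⟨j, hj, q', rfl, hq'⟩
    · rfl
    · exact absurd hq' (hfree i hi j hj q')
    · subst hij
      exact absurd hp' (hfree j hj i hi p')
    · obtain rfl := hcross i hi j hj p' q' b hp' hq'
      rw [(hT i hi).inj p' q' b hp' hq']
  · refine wellFounded_dep_of_diff (finite_star_treeGraph htree.2.2)
      (E := (fun j => tEdge [] (a j)) '' E) (E.finite_toSet.image _) ?_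
    have hedge : ∀ e ∈ treeGraph (graft E a T) \ (fun j => tEdge [] (a j)) '' E,
        ∃ j ∈ E, ∃ f ∈ treeGraph (T j), e = mapEdge (List.cons (a j)) f := by
      rintro _ ⟨⟨p, b, hp, rfl⟩, h⟩
      rcases append_mem_graft.1 hp with ⟨rfl, i, hi, rfl, -⟩ | ⟨i, hi, p', rfl, hp'⟩
      · exact absurd ⟨i, hi, rfl⟩ h
      · exact ⟨i, hi, _, tEdge_mem hp', (mapEdge_cons_tEdge _ _ _).symm⟩
    rw [wellFounded_iff_isEmpty_descending_chain]
    by_contra hne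
    rw [not_isEmpty_iff] at hne
    obtain ⟨x, hx⟩ := hne
    obtain ⟨j, hj, -⟩ := hedge _ (hx 0).2.1
    have hmem : ∀ n, ∃ i ∈ E, ∃ y : (ℝ × Sym2 (List ℝ)) × List ℝ, y.1 ∈ treeGraph (T i) ∧
        x n = (mapEdge (List.cons (a i)) y.1, a i :: y.2) := by
      intro n
      obtain ⟨i, hi, f, hf, he⟩ := hedge _ (hx n).2.1
      have h4 := (hx n).2.2.2.1
      rw [he] at h4
      obtain ⟨v, -, hv⟩ := (mem_mapEdge _ _ _).1 h4
      exact ⟨i, hi, (f, v), hf, Prod.ext he hv.symm⟩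
    choose i hi y hy hxy using hmem
    -- The vertices of consecutive pairs lie on a common edge, which belongs to a single copy.
    have hconst : ∀ n, i n = i 0 := by
      intro n
      induction n with
      | zero => rfl
      | succ n ih =>
        rw [← ih]
        obtain ⟨-, -, -, -, -, g, hg, h6, h7⟩ := hx n
        obtain ⟨l, hl, f, hf, rfl⟩ := hedge g hg
        rw [hxy n] at h6
        rw [hxy (n + 1)] at h7
        obtain ⟨_, -, h6⟩ := (mem_mapEdge _ _ _).1 h6
        obtain ⟨_, -, h7⟩ := (mem_mapEdge _ _ _).1 h7
        exact ha (hi _) (hi _) ((List.cons.inj h7).1.symm.trans (List.cons.inj h6).1)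
    have wf := (hT _ (hi 0)).wf
    rw [wellFounded_iff_isEmpty_descending_chain] at wf
    refine wf.false ⟨y, fun n => ?_⟩
    obtain ⟨-, -, h3, h4, h5, g, hg, h6, h7⟩ := hx n
    obtain ⟨l, hl, f, hf, rfl⟩ := hedge g hg
    have hl0 : l = i 0 := by
      rw [hxy n] at h6
      obtain ⟨_, -, h6⟩ := (mem_mapEdge _ _ _).1 h6
      rw [← hconst n]
      exact ha hl (hi _) (List.cons.inj h6).1
    subst hl0
    have e1 := hxy n
    have e2 := hxy (n + 1)
    rw [hconst] at e1 e2
    have hy1 := hy n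
    have hy2 := hy (n + 1)
    rw [hconst] at hy1 hy2
    rw [e1] at h4 h5 h6
    rw [e2] at h3 h5 h7
    have hinj : Function.Injective (List.cons (a (i 0))) := List.cons_injective
    rw [mem_mapEdge_of_injective hinj] at h3 h4 h6 h7
    exact ⟨hy2, hy1, h3, h4, h5, f, hf, h6, h7⟩

/-! ### The Galton–Watson tree -/

/-- The number of children of the root. -/
def numKids (ω : Sample) : ℕ := (ω []).1

/-- The sample seen from the `j`-th child of the root. -/
def shift (ω : Sample) (j : ℕ) : Sample := fun u => ω (j :: u)

/-- The sample seen from the node `u`. -/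
def shiftBy (u : List ℕ) (ω : Sample) : Sample := fun w => ω (u ++ w)

/-- The label of the edge between the root and its `j`-th child. -/
def lab (t : ℝ) (ω : Sample) (j : ℕ) : ℝ := t * ((ω [j]).2 : ℝ)

theorem lab_mem {t : ℝ} (ht : 0 ≤ t) (ω : Sample) (j : ℕ) : lab t ω j ∈ Icc 0 t :=
  ⟨mul_nonneg ht (ω [j]).2.2.1, mul_le_of_le_one_right ht (ω [j]).2.2.2⟩

/-- `GWPath` grows at its last vertex. Here the first step is split off, as the recursion on the
subtrees of the root requires. -/
theorem gwPath_iff {t : ℝ} {ω : Sample} {u : List ℕ} {p : List ℝ} : GWPath t ω u p ↔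
    (u = [] ∧ p = []) ∨ ∃ j u' p', j < numKids ω ∧ u = j :: u' ∧ p = lab t ω j :: p' ∧
      GWPath t (shift ω j) u' p' := by
  constructor
  · intro h
    induction h with
    | root => exact Or.inl ⟨rfl, rfl⟩
    | child u p i h hi ih =>
      right
      rcases ih with ⟨rfl, rfl⟩ | ⟨j, u', p', hj, rfl, rfl, h'⟩
      · exact ⟨i, [], [], hi, rfl, rfl, GWPath.root⟩
      · exact ⟨j, u' ++ [i], _, hj, rfl, rfl, GWPath.child u' p' i h' hi⟩
  · rintro (⟨rfl, rfl⟩ | ⟨j, u', p', hj, rfl, rfl, h⟩)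
    · exact GWPath.root
    · induction h with
      | root => exact GWPath.child [] [] j GWPath.root hj
      | child u p i h hi ih => exact GWPath.child (j :: u) _ i ih hi

theorem treeInf_eq_graft (t : ℝ) (ω : Sample) : treeInf t ω =
    graft (Finset.range (numKids ω)) (lab t ω) fun j => treeInf t (shift ω j) := by
  ext p
  simp only [treeInf, graft, mem_ofPred_eq]
  constructor
  · rintro ⟨u, hu⟩
    rcases gwPath_iff.1 hu with ⟨-, rfl⟩ | ⟨j, u', p', hj, -, rfl, h⟩
    · exact Or.inl rfl
    · exact Or.inr ⟨j, by simpa using hj, p', ⟨u', h⟩, rfl⟩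
  · rintro (rfl | ⟨j, hj, q, ⟨u', h⟩, rfl⟩)
    · exact ⟨[], GWPath.root⟩
    · exact ⟨j :: u', gwPath_iff.2 (Or.inr ⟨j, u', q, by simpa using hj, rfl, rfl, h⟩)⟩

theorem nil_mem_treeInf (t : ℝ) (ω : Sample) : [] ∈ (treeInf t ω).pts := ⟨[], GWPath.root⟩

theorem treeInfWith_eq_graft {i : ℕ} (t : ℝ) (x : Fin i → ℝ) (ω : Sample × (Fin i → Sample)) :
    treeInfWith t x ω = graft (Finset.univ.disjSum (Finset.range (numKids ω.1)))
      (Sum.elim x (lab t ω.1)) fun j => treeInf t (Sum.elim ω.2 (shift ω.1) j) := by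
  ext p
  rw [treeInfWith, treeInf_eq_graft t ω.1]
  simp only [graft, mem_union, mem_ofPred_eq]
  constructor
  · rintro ((rfl | ⟨j, hj, q, hq, rfl⟩) | ⟨j, q, hq, rfl⟩)
    · exact Or.inl rfl
    · exact Or.inr ⟨Sum.inr j, by simpa using hj, q, hq, rfl⟩
    · exact Or.inr ⟨Sum.inl j, by simp, q, hq, rfl⟩
  · rintro (rfl | ⟨j | j, hj, q, hq, rfl⟩)
    · exact Or.inl (Or.inl rfl)
    · exact Or.inr ⟨j, q, hq, rfl⟩
    · exact Or.inl (Or.inr ⟨j, by simpa using hj, q, hq, rfl⟩)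

theorem isLocallyFiniteTree_treeInf (t : ℝ) (ω : Sample) : IsLocallyFiniteTree (treeInf t ω) := by
  refine ⟨nil_mem_treeInf t ω, fun p => ?_, fun p => ?_⟩
  · induction p generalizing ω with
    | nil => exact fun a _ => nil_mem_treeInf t ω
    | cons c p ih =>
      intro a h
      rw [treeInf_eq_graft] at h ⊢
      rw [List.cons_append, cons_mem_graft] at h
      obtain ⟨j, hj, rfl, h⟩ := h
      exact cons_mem_graft.2 ⟨j, hj, rfl, ih _ _ h⟩
  · induction p generalizing ω with
    | nil =>
      refine ((Finset.range (numKids ω)).finite_toSet.image (lab t ω)).subset fun b hb => ?_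
      change [b] ∈ (treeInf t ω).pts at hb
      rw [treeInf_eq_graft] at hb
      obtain ⟨j, hj, rfl, -⟩ := cons_mem_graft.1 hb
      exact ⟨j, hj, rfl⟩
    | cons c p ih =>
      refine ((Finset.finite_toSet (Finset.range (numKids ω))).biUnion
        fun j hj => ih (shift ω j)).subset fun b hb => ?_
      change c :: p ++ [b] ∈ (treeInf t ω).pts at hb
      rw [treeInf_eq_graft, List.cons_append] at hb
      obtain ⟨j, hj, rfl, h⟩ := cons_mem_graft.1 hb
      exact mem_iUnion₂.2 ⟨j, hj, h⟩

theorem label_mem_treeInf {t : ℝ} (ht : 0 ≤ t) {ω : Sample} {p : List ℝ} {a : ℝ}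
    (h : p ++ [a] ∈ (treeInf t ω).pts) : a ∈ Icc 0 t := by
  induction p generalizing ω with
  | nil =>
    rw [List.nil_append, treeInf_eq_graft] at h
    obtain ⟨j, hj, rfl, -⟩ := cons_mem_graft.1 h
    exact lab_mem ht ω j
  | cons c p ih =>
    rw [treeInf_eq_graft, List.cons_append] at h
    obtain ⟨j, hj, -, h'⟩ := cons_mem_graft.1 h
    exact ih h'

/-! ### Decreasing chains along the rays of the tree -/

/-- There is a descending path in the tree, of `2 m` steps from the root, with decreasing times
below `s` that are labels of edges incident to every second vertex. -/
def Chain (t : ℝ) : ℕ → Sample → ℝ → Prop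
  | 0, _, _ => True
  | m + 1, ω, s => ∃ j < numKids ω, ∃ l < numKids (shift ω j), ∃ τ < s,
      (τ = lab t ω j ∨ ∃ l' < numKids (shift ω j), τ = lab t (shift ω j) l') ∧
      Chain t m (shift (shift ω j) l) τ

theorem Chain.mono {t : ℝ} {m : ℕ} {ω : Sample} {s s' : ℝ} (h : Chain t m ω s) (hs : s ≤ s') :
    Chain t m ω s' := by
  cases m with
  | zero => trivial
  | succ m =>
    obtain ⟨j, hj, l, hl, τ, hτ, h⟩ := h
    exact ⟨j, hj, l, hl, τ, hτ.trans_le hs, h⟩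

/-- The siblings have distinct labels. -/
def SibDistinct (t : ℝ) (ω : Sample) : Prop :=
  ∀ u, InjOn (lab t (shiftBy u ω)) (Finset.range (numKids (shiftBy u ω)))

theorem SibDistinct.shift {t : ℝ} {ω : Sample} (h : SibDistinct t ω) (j : ℕ) :
    SibDistinct t (shift ω j) := fun u => h (j :: u)

theorem SibDistinct.root {t : ℝ} {ω : Sample} (h : SibDistinct t ω) :
    InjOn (lab t ω) (Finset.range (numKids ω)) := h []

theorem subtree_treeInf {t : ℝ} {ω : Sample} (h : SibDistinct t ω) {j : ℕ} (hj : j < numKids ω) :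
    subtree (treeInf t ω) (lab t ω j) = treeInf t (shift ω j) := by
  rw [treeInf_eq_graft]
  exact subtree_graft h.root (by simpa using hj)

theorem exists_lab {t : ℝ} {ω : Sample} {a : ℝ} {q : List ℝ} (h : a :: q ∈ (treeInf t ω).pts) :
    ∃ j < numKids ω, a = lab t ω j ∧ q ∈ (treeInf t (shift ω j)).pts := by
  rw [treeInf_eq_graft] at h
  obtain ⟨j, hj, rfl, h'⟩ := cons_mem_graft.1 h
  exact ⟨j, by simpa using hj, rfl, h'⟩

/-- An infinite walk in the tree `T` from the root, with decreasing times below `s` that are labels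
of edges incident to the current vertex. -/
structure Walk (T : LTree) (s : ℝ) (v : ℕ → List ℝ) (d : ℕ → ℝ) : Prop where
  zero : v 0 = []
  mem : ∀ i, v i ∈ T.pts
  anti : StrictAnti d
  lt : ∀ i, 1 ≤ i → d i < s
  inc : ∀ i, v i ≠ [] → v i ++ [d i] ∈ T.pts ∨ ∃ q, v i = q ++ [d i]
  step : ∀ i, v (i + 1) = v i ∨ (∃ a, v (i + 1) = v i ++ [a]) ∨ ∃ a, v i = v (i + 1) ++ [a]
  fiber : ∀ w, {i | v i = w}.Finite

/-- The walk visits each vertex finitely often. After its last visit to the root it enters the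
subtree of one child and never leaves it, since leaving would mean passing through the root again.
-/
theorem Walk.exists_child {T : LTree} {s : ℝ} {v : ℕ → List ℝ} {d : ℕ → ℝ} (h : Walk T s v d) :
    ∃ a, [a] ∈ T.pts ∧ ∃ τ < s, (τ = a ∨ [a, τ] ∈ T.pts) ∧
      ∃ v' d', Walk (subtree T a) τ v' d' := by
  obtain ⟨i, hi, hmax⟩ := (h.fiber []).exists_maximal ⟨0, h.zero⟩
  have hne : ∀ n, i < n → v n ≠ [] := fun n hn hv => absurd (hmax hv hn.le) (not_le.2 hn)
  have hi' : v i = [] := hi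
  obtain ⟨a, ha⟩ : ∃ a, v (i + 1) = [a] := by
    have h0 := hne (i + 1) (Nat.lt_succ_self i)
    rcases h.step i with h1 | ⟨a, h1⟩ | ⟨a, h1⟩
    · rw [hi'] at h1; exact absurd h1 h0
    · rw [hi'] at h1; exact ⟨a, h1⟩
    · rw [hi'] at h1; simp at h1
  have hw : ∀ n, ∃ w, v (i + 1 + n) = a :: w := by
    intro n
    induction n with
    | zero => exact ⟨[], ha⟩
    | succ n ih =>
      obtain ⟨w, hw⟩ := ih
      rcases h.step (i + 1 + n) with h1 | ⟨b, h1⟩ | ⟨b, h1⟩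
      · exact ⟨w, h1.trans hw⟩
      · exact ⟨w ++ [b], by rw [← add_assoc, h1, hw]; rfl⟩
      · have h0 := hne (i + 1 + n + 1) (by omega)
        obtain ⟨c, q, hq⟩ := List.exists_cons_of_ne_nil h0
        rw [hw, hq] at h1
        exact ⟨q, by rw [← add_assoc, hq, (List.cons.inj h1).1]⟩
  choose w hw using hw
  have hinc : ∀ n, v (i + 1 + n) ++ [d (i + 1 + n)] ∈ T.pts ∨ ∃ q, v (i + 1 + n) = q ++
      [d (i + 1 + n)] := fun n => h.inc _ (hne _ (by omega))
  refine ⟨a, ha ▸ h.mem _, d (i + 1), h.lt _ (by omega), ?_, w, fun n => d (i + 1 + n), ?_⟩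
  · rcases hinc 0 with h1 | ⟨q, h1⟩
    · rw [add_zero, ha] at h1; exact Or.inr h1
    · rw [add_zero, ha] at h1
      have := List.append_inj' (s₁ := []) h1 rfl
      simp only [List.cons.injEq, and_true] at this
      exact Or.inl this.2.symm
  · refine ⟨?_, fun n => ?_, fun m n hmn => h.anti (by omega), fun n hn => h.anti (by omega), ?_, ?_,
      fun u => ?_⟩
    · have := hw 0
      rw [add_zero, ha] at this
      exact (List.cons.inj this).2.symm
    · have := h.mem (i + 1 + n)
      rw [hw n] at this
      exact this
    · intro n hn
      rcases hinc n with h1 | ⟨q, h1⟩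
      · rw [hw n] at h1; exact Or.inl h1
      · rw [hw n] at h1
        cases q with
        | nil => simp only [List.nil_append, List.cons.injEq] at h1; exact absurd h1.2 hn
        | cons c q => exact Or.inr ⟨q, (List.cons.inj h1).2⟩
    · intro n
      have hs := h.step (i + 1 + n)
      rw [add_assoc, hw n, hw (n + 1)] at hs
      simpa using hs
    · refine ((h.fiber (a :: u)).preimage (f := fun n => i + 1 + n)
        fun m _ n _ hmn => by simpa using hmn).subset fun n hn => ?_
      change v (i + 1 + n) = a :: u
      rw [hw n, show w n = u from hn]

/-- Each step of `Chain` uses `Walk.exists_child` twice and forgets the second time. In this way the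
labels used by successive steps belong to disjoint sets of edges, which makes the expectation
estimate multiplicative. -/
theorem Walk.chain {t : ℝ} {m : ℕ} {ω : Sample} (hω : SibDistinct t ω) {s : ℝ}
    {v : ℕ → List ℝ} {d : ℕ → ℝ} (h : Walk (treeInf t ω) s v d) : Chain t m ω s := by
  induction m generalizing ω s v d with
  | zero => trivial
  | succ m ih =>
    obtain ⟨a, ha, τ, hτ, hinc, v', d', h'⟩ := h.exists_child
    obtain ⟨j, hj, rfl, -⟩ := exists_lab ha
    rw [subtree_treeInf hω hj] at h'
    obtain ⟨b, hb, τ', hτ', -, v'', d'', h''⟩ := h'.exists_child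
    obtain ⟨l, hl, rfl, -⟩ := exists_lab hb
    rw [subtree_treeInf (hω.shift j) hl] at h''
    refine ⟨j, hj, l, hl, τ, hτ, ?_, (ih ((hω.shift j).shift l) h'').mono hτ'.le⟩
    refine hinc.imp id fun h => ?_
    change [τ] ∈ (subtree (treeInf t ω) (lab t ω j)).pts at h
    rw [subtree_treeInf hω hj] at h
    obtain ⟨l', hl', rfl, -⟩ := exists_lab h
    exact ⟨l', hl', rfl⟩

theorem treeInf_from {t : ℝ} {ω : Sample} (hω : SibDistinct t ω) {x : List ℝ}
    (hx : x ∈ (treeInf t ω).pts) :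
    ∃ u, ∀ p, x ++ p ∈ (treeInf t ω).pts ↔ p ∈ (treeInf t (shiftBy u ω)).pts := by
  induction x generalizing ω with
  | nil => exact ⟨[], fun p => Iff.rfl⟩
  | cons a x ih =>
    obtain ⟨j, hj, rfl, hx'⟩ := exists_lab hx
    obtain ⟨u, hu⟩ := ih (hω.shift j) hx'
    refine ⟨j :: u, fun p => ?_⟩
    change x ++ p ∈ (subtree (treeInf t ω) (lab t ω j)).pts ↔ _
    rw [subtree_treeInf hω hj]
    exact hu p

theorem shiftBy_shiftBy (u w : List ℕ) (ω : Sample) :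
    shiftBy w (shiftBy u ω) = shiftBy (u ++ w) ω := by
  funext x
  simp [shiftBy, List.append_assoc]

theorem SibDistinct.shiftBy {t : ℝ} {ω : Sample} (h : SibDistinct t ω) (u : List ℕ) :
    SibDistinct t (shiftBy u ω) := fun w => by
  rw [shiftBy_shiftBy]
  exact h (u ++ w)

/-- In a tree where the descending chains are finite, the dependency chains are finite. -/
theorem wellFounded_treeInf {t : ℝ} (ht : 0 ≤ t) {ω : Sample} (hω : SibDistinct t ω)
    (hc : ∀ u, ∃ m, ¬ Chain t m (shiftBy u ω) (t + 1)) :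
    WellFounded (Dep (treeGraph (treeInf t ω))) := by
  have htree := isLocallyFiniteTree_treeInf t ω
  rw [wellFounded_iff_isEmpty_descending_chain]
  by_contra hne
  rw [not_isEmpty_iff] at hne
  obtain ⟨x, hx⟩ := hne
  have hanti : StrictAnti fun n => (x n).1.1 := strictAnti_nat_of_succ_lt fun n =>
    (hx n).2.2.2.2.1
  have hmemv : ∀ e ∈ treeGraph (treeInf t ω), ∀ v ∈ e.2, v ∈ (treeInf t ω).pts := by
    rintro _ ⟨p, a, hp, rfl⟩ v hv
    rcases mem_tEdge.1 hv with rfl | rfl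
    exacts [htree.2.1 _ _ hp, hp]
  have hv : ∀ n, (x n).2 ∈ (treeInf t ω).pts := fun n => hmemv _ (hx n).2.1 _ (hx n).2.2.2.1
  have hinc : ∀ n, (x n).2 ++ [(x n).1.1] ∈ (treeInf t ω).pts ∨
      ∃ q, (x n).2 = q ++ [(x n).1.1] := by
    intro n
    obtain ⟨p, a, hp, he⟩ := (hx n).2.1
    have h4 := (hx n).2.2.2.1
    rw [he] at h4 ⊢
    rcases mem_tEdge.1 h4 with h | h
    · rw [h]; exact Or.inl hp
    · rw [h]; exact Or.inr ⟨p, rfl⟩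
  have hstep : ∀ n, (x (n + 1)).2 = (x n).2 ∨ (∃ a, (x (n + 1)).2 = (x n).2 ++ [a]) ∨
      ∃ a, (x n).2 = (x (n + 1)).2 ++ [a] := by
    intro n
    obtain ⟨-, -, -, -, -, g, ⟨p, a, hp, rfl⟩, h6, h7⟩ := hx n
    rcases mem_tEdge.1 h6 with h | h <;> rcases mem_tEdge.1 h7 with h' | h' <;> rw [h, h']
    · exact Or.inl rfl
    · exact Or.inr (Or.inl ⟨a, rfl⟩)
    · exact Or.inr (Or.inr ⟨a, rfl⟩)
    · exact Or.inl rfl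
  have hlab : ∀ n, (x n).1.1 < t + 1 := by
    intro n
    obtain ⟨p, a, hp, he⟩ := (hx n).2.1
    rw [he]
    have : (tEdge p a).1 ≤ t := (label_mem_treeInf ht hp).2
    change (tEdge p a).1 < t + 1
    linarith
  -- The labels strictly decrease and a vertex has finitely many edges, so a vertex is visited
  -- finitely often.
  have hfib : ∀ w, {n | (x n).2 = w}.Finite := by
    intro w
    refine ((finite_star_treeGraph htree.2.2 w).preimage (f := fun n => (x n).1)
      fun a _ b _ hab => hanti.injective (congrArg Prod.fst hab)).subset fun n hn => ?_
    exact ⟨(hx n).2.1, hn ▸ (hx n).2.2.2.1⟩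
  -- From a vertex of minimal depth on, the chain stays above this vertex: it could leave its
  -- subtree only through its parent, which is less deep.
  obtain ⟨i, hi⟩ : ∃ i, ∀ n, (x i).2.length ≤ (x n).2.length := by
    obtain ⟨l, ⟨i, rfl⟩, hl⟩ := WellFounded.has_min (Nat.lt_wfRel.wf)
      (range fun n => (x n).2.length) ⟨_, 0, rfl⟩
    exact ⟨i, fun n => not_lt.1 (hl _ ⟨n, rfl⟩)⟩
  have hpre : ∀ n, ∃ w, (x (i + n)).2 = (x i).2 ++ w := by
    intro n
    induction n with
    | zero => exact ⟨[], by simp⟩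
    | succ n ih =>
      obtain ⟨w, hw⟩ := ih
      rcases hstep (i + n) with h | ⟨a, h⟩ | ⟨a, h⟩
      · exact ⟨w, h.trans hw⟩
      · exact ⟨w ++ [a], by rw [← add_assoc, h, hw, List.append_assoc]⟩
      · rcases List.eq_nil_or_concat w with rfl | ⟨w, b, rfl⟩
        · have := hi (i + n + 1)
          have h2 := congrArg List.length (h.symm.trans hw)
          simp at h2
          omega
        · rw [List.concat_eq_append, ← List.append_assoc] at hw
          exact ⟨w, (List.append_inj' (h.symm.trans hw) rfl).1⟩
  choose w hw using hpre
  obtain ⟨u, hu⟩ := treeInf_from hω (hv i)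
  obtain ⟨m, hm⟩ := hc u
  refine hm (Walk.chain (hω.shiftBy u) (v := w) (d := fun n => (x (i + n)).1.1) ?_)
  refine ⟨?_, fun n => ?_, fun m n hmn => hanti (by simpa using hmn), fun n _ => hlab _, ?_, ?_,
    fun q => ?_⟩
  · have := hw 0
    rw [add_zero] at this
    simpa using this
  · rw [← hu, ← hw]; exact hv _
  · intro n hn
    rcases hinc (i + n) with h | ⟨q, h⟩
    · rw [hw n, List.append_assoc, hu] at h
      exact Or.inl h
    · rw [hw n] at h
      rcases List.eq_nil_or_concat (w n) with h0 | ⟨w', b, h0⟩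
      · exact absurd h0 hn
      · rw [h0, List.concat_eq_append, ← List.append_assoc] at h
        refine Or.inr ⟨w', ?_⟩
        rw [h0, List.concat_eq_append, (List.append_inj' h rfl).2]
  · intro n
    have hs := hstep (i + n)
    rw [add_assoc, hw n, hw (n + 1)] at hs
    simpa using hs
  · refine ((hfib ((x i).2 ++ q)).preimage (f := fun n => i + n)
      fun m _ n _ hmn => by simpa using hmn).subset fun n hn => ?_
    change (x (i + n)).2 = _
    rw [hw n, show w n = q from hn]

end ForbiddenDegree
end

noncomputable section

namespace ForbiddenDegree

/-! ### A recursive description of the dynamics on the Galton–Watson tree -/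

/-- The labels of the edges at a root: `y` for the extra edge, `a j` for the child `j`. -/
def labs {κ : Type*} (y : ℝ) (a : κ → ℝ) (o : Option κ) : ℝ := o.elim y a

/-- The extra edge is never removed by its other endpoint. -/
def pres {κ : Type*} (q : κ → ℝ → Prop) (o : Option κ) (b : ℝ) : Prop :=
  o.elim True fun j => q j b

/-- The status before time `s` of the edges at a root with children `E` and an extra edge. -/
def RootKept {κ : Type*} (k : ℕ) (y : ℝ) (E : Finset κ) (a : κ → ℝ) (q : κ → ℝ → Prop) (s : ℝ)
    (o : Option κ) : Prop := Kept k (Finset.insertNone E) (labs y a) (pres q) s o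

/-- The predicate `q` may be any approximation of the quietness of the children, provided that it is
exact at the finitely many times that are consulted, namely the labels below `s` of edges at the
root. This is what allows truncations of the tree. -/
theorem rootKept_quiet {κ : Type*} {k : ℕ} (hk : 2 ≤ k) {E : Finset κ} {a : κ → ℝ}
    {T : κ → LTree} (ha : InjOn a E) (hT : ∀ j ∈ E, [] ∈ (T j).pts) (hG : Good (graft E a T))
    {y : ℝ} (hy : ∀ j ∈ E, a j ≠ y) {q : κ → ℝ → Prop} {s : ℝ}
    (hq : ∀ o ∈ Finset.insertNone E, ∀ j ∈ E, labs y a o < s → a j < labs y a o →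
      (q j (labs y a o) ↔ Quiet k (a j) (T j) (a j) (labs y a o))) :
    (RootKept k y E a q s none ↔ Quiet k y (graft E a T) y s) ∧
    ∀ j ∈ E, a j < s → (q j s ↔ Quiet k (a j) (T j) (a j) s) →
      (RootKept k y E a q s (some j) ↔ [a j] ∈ (keptTree k y (graft E a T) s).pts) := by
  have hroot := rootLabels_graft hT (a := a)
  have hinj : InjOn (labs y a) (Finset.insertNone E) := by
    rintro (_ | i) hi (_ | j) hj h
    · rfl
    · exact absurd h.symm (hy j (by simpa using hj))
    · exact absurd h (hy i (by simpa using hi))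
    · rw [ha (by simpa using hi) (by simpa using hj) h]
  have himg : labs y a '' (Finset.insertNone E) = insert y (rootLabels (graft E a T)).pts := by
    rw [hroot]
    ext c
    constructor
    · rintro ⟨_ | i, hi, rfl⟩
      · exact Or.inl rfl
      · exact Or.inr ⟨i, by simpa using hi, rfl⟩
    · rintro (rfl | ⟨i, hi, rfl⟩)
      · exact ⟨none, by simp, rfl⟩
      · exact ⟨some i, by simpa using hi, rfl⟩
  have hyT : [y] ∉ (graft E a T).pts := by
    rw [cons_mem_graft]
    rintro ⟨j, hj, h, -⟩
    exact hy j hj h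
  set q' : κ → ℝ → Prop := fun j b => Quiet k (a j) (T j) (a j) b with hq'
  have hp : ∀ o ∈ Finset.insertNone E, ∀ b, pres q' o b ↔ labs y a o = y ∨
      Quiet k (labs y a o) (subtree (graft E a T) (labs y a o)) (labs y a o) b := by
    rintro (_ | j) ho b
    · simp [pres, labs]
    · have hj : j ∈ E := by simpa using ho
      simp only [pres, Option.elim_some, labs, hy j hj, false_or, hq', subtree_graft ha hj]
  have hmain := fun o ho => kept_root hk hG hyT hinj himg hp (j := o) ho s
  have hcongr : ∀ o, (labs y a o < s ∨ ∀ i ∈ Finset.insertNone E, labs y a i < s →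
      labs y a i < labs y a o ∧ labs y a i < labs y a o) → (pres q o s ↔ pres q' o s) →
      (RootKept k y E a q s o ↔ RootKept k y E a q' s o) := by
    intro o ho hpo
    refine kept_congr (fun _ _ => Iff.rfl) (fun _ _ _ _ _ => Iff.rfl) ?_ ho hpo
    rintro i hi his (_ | j) hj hji
    · rfl
    · exact hq i hi j (by simpa using hj) his hji
  constructor
  · rw [hcongr none _ Iff.rfl]
    · exact (hmain none (by simp)).1 rfl
    · rcases lt_or_ge y s with h | h
      · exact Or.inl h
      · exact Or.inr fun i _ his => ⟨his.trans_le h, his.trans_le h⟩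
  · intro j hj hjs hqj
    rw [hcongr (some j) (Or.inl hjs) hqj]
    exact (hmain (some j) (by simpa using hj)).2 (hy j hj)

/-- The extra edge of `Θ^y(T)` is not removed before time `s`, when `T` is cut at depth `n`. -/
def Ahat (k : ℕ) (t : ℝ) : ℕ → ℝ → Sample → ℝ → Prop
  | 0, _, _, _ => True
  | n + 1, y, ω, s => RootKept k y (Finset.range (numKids ω)) (lab t ω)
      (fun j b => Ahat k t n (lab t ω j) (shift ω j) b) s none

/-- The first `n` generations determine whether the extra edge of `Θ^y(T)` is removed before
time `s`. -/
def Sure (t : ℝ) : ℕ → ℝ → Sample → ℝ → Prop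
  | 0, _, _, _ => False
  | n + 1, y, ω, s => ∀ o ∈ Finset.insertNone (Finset.range (numKids ω)), ∀ j < numKids ω,
      labs y (lab t ω) o < s → lab t ω j < labs y (lab t ω) o →
      Sure t n (lab t ω j) (shift ω j) (labs y (lab t ω) o)

theorem Sure.mono {t : ℝ} {n m : ℕ} (hnm : n ≤ m) {y : ℝ} {ω : Sample} {s : ℝ}
    (h : Sure t n y ω s) : Sure t m y ω s := by
  induction n generalizing m y ω s with
  | zero => exact h.elim
  | succ n ih =>
    obtain ⟨m, rfl⟩ : ∃ m', m = m' + 1 := ⟨m - 1, by omega⟩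
    exact fun o ho j hj h1 h2 => ih (by omega) (h o ho j hj h1 h2)

/-- If no depth suffices at a node, then for one of its finitely many children and one of its
finitely many labels no depth suffices either. Two such descents make one step of `Chain`. -/
theorem chain_of_forall_not_sure {t : ℝ} {m : ℕ} {y : ℝ} {ω : Sample} {s : ℝ}
    (h : ∀ n, ¬ Sure t n y ω s) : Chain t m ω s := by
  have step : ∀ (y : ℝ) (ω : Sample) (s : ℝ), (∀ n, ¬ Sure t n y ω s) →
      ∃ o ∈ Finset.insertNone (Finset.range (numKids ω)), ∃ j < numKids ω,
        labs y (lab t ω) o < s ∧ lab t ω j < labs y (lab t ω) o ∧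
        ∀ n, ¬ Sure t n (lab t ω j) (shift ω j) (labs y (lab t ω) o) := by
    intro y ω s h
    by_contra! hcon
    choose! f hf using hcon
    -- Otherwise every pair `(o, j)` has a sufficient depth, and one more than the largest of them
    -- suffices for the node.
    refine h ((Finset.insertNone (Finset.range (numKids ω))).sup
      (fun o => (Finset.range (numKids ω)).sup (fun j => f o j)) + 1) fun o ho j hj h1 h2 => ?_
    refine (hf o ho j hj h1 h2).mono ?_
    exact (Finset.le_sup (f := fun j => f o j) (Finset.mem_range.2 hj)).trans
      (Finset.le_sup (f := fun o => (Finset.range (numKids ω)).sup (fun j => f o j)) ho)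
  induction m generalizing y ω s with
  | zero => trivial
  | succ m ih =>
    obtain ⟨o, ho, j, hj, h1, h2, h3⟩ := step y ω s h
    obtain ⟨o', ho', l, hl, h4, h5, h6⟩ := step _ _ _ h3
    refine ⟨j, hj, l, hl, _, h4.trans h1, ?_, ih h6⟩
    cases o' with
    | none => exact Or.inl rfl
    | some l' => exact Or.inr ⟨l', by simpa using ho', rfl⟩

/-- The samples for which the tree has distinct labels and finite dependency chains. -/
structure Nice (t : ℝ) (ω : Sample) : Prop where
  good : Good (treeInf t ω)
  sib : SibDistinct t ω
  chain : ∀ u, ∃ m, ¬ Chain t m (shiftBy u ω) (t + 1)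

theorem lab_mem_treeInf {t : ℝ} {ω : Sample} {j : ℕ} (hj : j < numKids ω) :
    [lab t ω j] ∈ (treeInf t ω).pts := by
  rw [treeInf_eq_graft]
  exact cons_mem_graft.2 ⟨j, by simpa using hj, rfl, nil_mem_treeInf _ _⟩

theorem Nice.shift {t : ℝ} {ω : Sample} (h : Nice t ω) {j : ℕ} (hj : j < numKids ω) :
    Nice t (shift ω j) :=
  ⟨subtree_treeInf h.sib hj ▸ h.good.subtree (lab_mem_treeInf hj), h.sib.shift j,
    fun u => h.chain (j :: u)⟩

theorem Nice.labelFree {t : ℝ} {ω : Sample} (h : Nice t ω) {i j : ℕ} (hi : i < numKids ω)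
    (hj : j < numKids ω) : LabelFree (lab t ω i) (treeInf t (ForbiddenDegree.shift ω j)) := by
  intro p hp
  rw [← subtree_treeInf h.sib hj] at hp
  exact List.cons_ne_nil _ _ (h.good.inj (lab t ω j :: p) [] _ hp (lab_mem_treeInf hi))

theorem Nice.exists_sure {t : ℝ} {ω : Sample} (h : Nice t ω) (y : ℝ) {s : ℝ} (hs : s ≤ t + 1) :
    ∃ n, Sure t n y ω s := by
  by_contra! hcon
  obtain ⟨m, hm⟩ := h.chain []
  exact hm ((chain_of_forall_not_sure hcon).mono hs)

theorem labelFree_root {t : ℝ} {ω : Sample} {y : ℝ} (h : LabelFree y (treeInf t ω)) {j : ℕ}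
    (hj : j < numKids ω) : lab t ω j ≠ y := by
  rintro rfl
  exact h [] (lab_mem_treeInf hj)

/-- At each level `Sure` guarantees that the approximations of the children are exact at the
consulted times, so the truncation error never reaches the root. -/
theorem ahat_iff_quiet {k : ℕ} (hk : 2 ≤ k) {t : ℝ} {n m : ℕ} (hnm : n ≤ m) {y : ℝ} {ω : Sample}
    {s : ℝ} (hω : Nice t ω) (hy : LabelFree y (treeInf t ω)) (h : Sure t n y ω s) :
    Ahat k t m y ω s ↔ Quiet k y (treeInf t ω) y s := by
  induction n generalizing m y ω s with
  | zero => exact h.elim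
  | succ n ih =>
    obtain ⟨m, rfl⟩ : ∃ m', m = m' + 1 := ⟨m - 1, by omega⟩
    have hG := hω.good
    rw [treeInf_eq_graft] at hG ⊢
    refine (rootKept_quiet hk hω.sib.root (fun j _ => nil_mem_treeInf _ _) hG
      (fun j hj => labelFree_root hy (by simpa using hj)) ?_).1
    intro o ho j hj h1 h2
    rw [Finset.mem_range] at hj
    exact ih (by omega) (hω.shift hj) (hω.labelFree hj hj) (h o ho j hj h1 h2)

/-- The extra edge of `Θ^y(T)` is not removed before time `s`. -/
def Alive (k : ℕ) (t y : ℝ) (ω : Sample) (s : ℝ) : Prop := ∀ᶠ n in Filter.atTop, Ahat k t n y ω s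

theorem alive_iff_ahat {k : ℕ} (hk : 2 ≤ k) {t : ℝ} {n : ℕ} {y : ℝ} {ω : Sample} {s : ℝ}
    (hω : Nice t ω) (hy : LabelFree y (treeInf t ω)) (h : Sure t n y ω s) :
    Alive k t y ω s ↔ Ahat k t n y ω s := by
  rw [ahat_iff_quiet hk le_rfl hω hy h, Alive, Filter.eventually_atTop]
  constructor
  · rintro ⟨N, hN⟩
    exact (ahat_iff_quiet hk (le_max_right N n) hω hy h).1 (hN _ (le_max_left N n))
  · exact fun hq => ⟨n, fun m hm => (ahat_iff_quiet hk hm hω hy h).2 hq⟩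

/-- `Alive` is a stand-in for `Quiet` that is defined from the sample by countable operations, hence
measurable everywhere. The bound `t + 1` is the horizon for which the chains are known to be finite.
-/
theorem alive_iff_quiet {k : ℕ} (hk : 2 ≤ k) {t : ℝ} {y : ℝ} {ω : Sample} {s : ℝ}
    (hω : Nice t ω) (hy : LabelFree y (treeInf t ω)) (hs : s ≤ t + 1) :
    Alive k t y ω s ↔ Quiet k y (treeInf t ω) y s := by
  obtain ⟨n, hn⟩ := hω.exists_sure y hs
  rw [alive_iff_ahat hk hω hy hn, ahat_iff_quiet hk le_rfl hω hy hn]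

/-- The family of the samples `c j` and of the labels `a j`, for `j ∈ E`, are those of the children
of the root of a tree with distinct labels and finite dependency chains. -/
structure RootNice {κ : Type*} (t : ℝ) (E : Finset κ) (a : κ → ℝ) (c : κ → Sample) : Prop where
  inj : InjOn a E
  mem : ∀ j ∈ E, a j ∈ Icc 0 t
  nice : ∀ j ∈ E, Nice t (c j)
  free : ∀ i ∈ E, ∀ j ∈ E, LabelFree (a i) (treeInf t (c j))
  cross : ∀ i ∈ E, ∀ j ∈ E, ∀ p q b, p ++ [b] ∈ (treeInf t (c i)).pts →
    q ++ [b] ∈ (treeInf t (c j)).pts → i = j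

theorem Nice.rootNice {t : ℝ} (ht : 0 ≤ t) {ω : Sample} (h : Nice t ω) :
    RootNice t (Finset.range (numKids ω)) (lab t ω) (ForbiddenDegree.shift ω) := by
  refine ⟨h.sib.root, fun j _ => lab_mem ht ω j, fun j hj => h.shift (by simpa using hj),
    fun i hi j hj => h.labelFree (by simpa using hi) (by simpa using hj), ?_⟩
  intro i hi j hj p q b hp hq
  rw [← subtree_treeInf h.sib (by simpa using hi)] at hp
  rw [← subtree_treeInf h.sib (by simpa using hj)] at hq
  exact h.sib.root hi hj (List.cons.inj (h.good.inj (lab t ω i :: p) (lab t ω j :: q) b hp hq)).1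

theorem RootNice.good {κ : Type*} {t : ℝ} {E : Finset κ} {a : κ → ℝ} {c : κ → Sample}
    (h : RootNice t E a c) : Good (graft E a fun j => treeInf t (c j)) :=
  good_graft h.inj (fun j hj => (h.nice j hj).good) h.free h.cross

/-- The edges at the root that are never removed. -/
def RootModel {κ : Type*} (k : ℕ) (t y : ℝ) (E : Finset κ) (a : κ → ℝ) (c : κ → Sample)
    (o : Option κ) : Prop :=
  RootKept k y E a (fun j b => Alive k t (a j) (c j) b) (t + 1) o

theorem RootNice.rootModel_iff {κ : Type*} {k : ℕ} (hk : 2 ≤ k) {t : ℝ} {E : Finset κ} {a : κ → ℝ}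
    {c : κ → Sample} (h : RootNice t E a c) {y : ℝ}
    (hy : LabelFree y (graft E a fun j => treeInf t (c j))) :
    (RootModel k t y E a c none ↔ Quiet k y (graft E a fun j => treeInf t (c j)) y (t + 1)) ∧
    ∀ j ∈ E, RootModel k t y E a c (some j) ↔
      [a j] ∈ (keptTree k y (graft E a fun j => treeInf t (c j)) (t + 1)).pts := by
  have := rootKept_quiet hk h.inj (fun j _ => nil_mem_treeInf t (c j)) h.good (y := y) ?_
    (q := fun j b => Alive k t (a j) (c j) b) (s := t + 1) ?_
  · refine ⟨this.1, fun j hj => this.2 j hj ?_ ?_⟩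
    · have := (h.mem j hj).2
      linarith
    · exact alive_iff_quiet hk (h.nice j hj) (h.free j hj j hj) le_rfl
  · rintro j hj rfl
    exact hy [] (cons_mem_graft.2 ⟨j, hj, rfl, nil_mem_treeInf _ _⟩)
  · intro o _ j hj h1 _
    exact alive_iff_quiet hk (h.nice j hj) (h.free j hj j hj) h1.le

theorem RootNice.label_lt {κ : Type*} {t : ℝ} (ht : 0 ≤ t) {E : Finset κ} {a : κ → ℝ}
    {c : κ → Sample} (h : RootNice t E a c) (p : List ℝ) (b : ℝ)
    (hp : p ++ [b] ∈ (graft E a fun j => treeInf t (c j)).pts) : b < t + 1 := by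
  rcases append_mem_graft.1 hp with ⟨-, j, hj, rfl, -⟩ | ⟨j, hj, q, -, hq⟩
  · have := (h.mem j hj).2
    linarith
  · have := (label_mem_treeInf ht hq).2
    linarith

theorem RootNice.rootLabels_keptTree {κ : Type*} {k : ℕ} (hk : 2 ≤ k) {t : ℝ} {E : Finset κ}
    {a : κ → ℝ} {c : κ → Sample} (h : RootNice t E a c) {y : ℝ}
    (hy : LabelFree y (graft E a fun j => treeInf t (c j))) :
    (rootLabels (keptTree k y (graft E a fun j => treeInf t (c j)) (t + 1))).pts =
      a '' {j | RootModel k t y E a c (some j)} := by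
  ext b
  constructor
  · intro hb
    obtain ⟨j, hj, rfl, -⟩ := cons_mem_graft.1 (keptTree_subset h.good.tree hb)
    exact ⟨j, ((h.rootModel_iff hk hy).2 j hj).2 hb, rfl⟩
  · rintro ⟨j, hj, rfl⟩
    have hjE : j ∈ E := by simpa using hj.1
    exact ((h.rootModel_iff hk hy).2 j hjE).1 hj

theorem RootNice.forbidTreeAt_eq {κ : Type*} {k : ℕ} (hk : 2 ≤ k) {t : ℝ} (ht : 0 ≤ t)
    {E : Finset κ} {a : κ → ℝ} {c : κ → Sample} (h : RootNice t E a c) {y : ℝ} (hyt : y ≤ t)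
    (hy : LabelFree y (graft E a fun j => treeInf t (c j))) :
    (RootModel k t y E a c none → forbidTreeAt k y (graft E a fun j => treeInf t (c j)) =
      some (keptTree k y (graft E a fun j => treeInf t (c j)) (t + 1))) ∧
    (¬ RootModel k t y E a c none →
      forbidTreeAt k y (graft E a fun j => treeInf t (c j)) = none) := by
  rw [(h.rootModel_iff hk hy).1]
  exact ForbiddenDegree.forbidTreeAt_eq hk h.good hy (by linarith) (h.label_lt ht)

/-- The paths of the nodes. -/
def path (t : ℝ) : Sample → List ℕ → List ℝ
  | _, [] => []
  | ω, j :: u => lab t ω j :: path t (shift ω j) u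

/-- The nodes of the component of the root, when the edge `j` of a node is kept if
`RootModel` holds. -/
def KNode (k : ℕ) (t : ℝ) : ℝ → Sample → List ℕ → Prop
  | _, _, [] => True
  | y, ω, j :: u => RootModel k t y (Finset.range (numKids ω)) (lab t ω) (shift ω) (some j) ∧
      KNode k t (lab t ω j) (shift ω j) u

/-- The component of the root in the edges of `T^∞_t` that are never removed from
`Θ^y(T^∞_t)`. -/
def treeHat (k : ℕ) (t y : ℝ) (ω : Sample) : LTree := ⟨path t ω '' {u | KNode k t y ω u}⟩

/-- Induction on the word: `cons_mem_keptTree` peels off the first letter on the side of the graph,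
as the definition of `KNode` does on the side of the sample. -/
theorem keptTree_treeInf {k : ℕ} (hk : 2 ≤ k) {t : ℝ} (ht : 0 ≤ t) {y : ℝ} {ω : Sample}
    (hω : Nice t ω) (hy : LabelFree y (treeInf t ω)) :
    keptTree k y (treeInf t ω) (t + 1) = treeHat k t y ω := by
  ext p
  change _ ↔ p ∈ path t ω '' {u | KNode k t y ω u}
  induction p generalizing y ω with
  | nil =>
    refine iff_of_true nil_mem_keptTree ⟨[], trivial, rfl⟩
  | cons b p ih =>
    have hroot : ∀ j < numKids ω, (RootModel k t y (Finset.range (numKids ω)) (lab t ω) (shift ω)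
        (some j) ↔ [lab t ω j] ∈ (keptTree k y (treeInf t ω) (t + 1)).pts) := by
      intro j hj
      have hy' := hy
      rw [treeInf_eq_graft] at hy' ⊢
      exact ((hω.rootNice ht).rootModel_iff hk hy').2 j (by simpa using hj)
    have hcons : ∀ j < numKids ω, [lab t ω j] ∈ (keptTree k y (treeInf t ω) (t + 1)).pts →
        (lab t ω j :: p ∈ (keptTree k y (treeInf t ω) (t + 1)).pts ↔
          p ∈ path t (shift ω j) '' {u | KNode k t (lab t ω j) (shift ω j) u}) := by
      intro j hj hm
      rw [cons_mem_keptTree hk hω.good hm, subtree_treeInf hω.sib hj]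
      exact ih (hω.shift hj) (hω.labelFree hj hj)
    constructor
    · intro hb
      obtain ⟨j, hj, rfl, -⟩ := exists_lab (keptTree_subset hω.good.tree hb)
      have h1 : [lab t ω j] ∈ (keptTree k y (treeInf t ω) (t + 1)).pts := by
        rw [keptTree, mem_component (keptAt_subset _ _ _ _)] at hb ⊢
        exact fun q a hq => hb q a (hq.trans (by simp))
      obtain ⟨u, hu, rfl⟩ := (hcons j hj h1).1 hb
      exact ⟨j :: u, ⟨(hroot j hj).2 h1, hu⟩, rfl⟩
    · rintro ⟨_ | ⟨j, u⟩, hu, hp⟩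
      · simp [path] at hp
      · obtain ⟨rfl, rfl⟩ := List.cons.inj hp
        have hj : j < numKids ω := by
          have := hu.1.1
          simpa using this
        exact (hcons j hj ((hroot j hj).1 hu.1)).2 ⟨u, hu.2, rfl⟩

end ForbiddenDegree
end

noncomputable section

namespace ForbiddenDegree

/-! ### Product measures -/

/-- Replacing one coordinate by an independent copy does not change a product law; this is checked
on finite boxes. -/
theorem measurePreserving_update {κ α : Type*} [DecidableEq κ] [MeasurableSpace α] (ρ : Measure α)
    [IsProbabilityMeasure ρ] (i : κ) :
    MeasurePreserving (fun p : α × (κ → α) => Function.update p.2 i p.1)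
      (ρ.prod (Measure.infinitePi fun _ => ρ)) (Measure.infinitePi fun _ => ρ) := by
  have hm : Measurable fun p : α × (κ → α) => Function.update p.2 i p.1 := by
    refine measurable_pi_iff.2 fun j => ?_
    by_cases h : j = i
    · subst h
      simpa using measurable_fst
    · simp only [Function.update_of_ne h]
      exact (measurable_pi_apply j).comp measurable_snd
  refine ⟨hm, Measure.eq_infinitePi _ fun s T hT => ?_⟩
  have hpi : ∀ s : Finset κ, MeasurableSet (Set.pi (s : Set κ) T) :=
    fun s => MeasurableSet.pi s.countable_toSet fun j _ => hT j
  rw [Measure.map_apply hm (hpi s)]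
  by_cases hi : i ∈ s
  · have : (fun p : α × (κ → α) => Function.update p.2 i p.1) ⁻¹' Set.pi (s : Set κ) T =
        T i ×ˢ Set.pi ((s.erase i : Finset κ) : Set κ) T := by
      ext ⟨x, c⟩
      simp only [mem_preimage, mem_pi, mem_prod, Finset.mem_coe, Finset.mem_erase]
      constructor
      · refine fun h => ⟨by simpa using h i hi, fun j hj => ?_⟩
        simpa [Function.update_of_ne hj.1] using h j hj.2
      · rintro ⟨h1, h2⟩ j hj
        by_cases h : j = i
        · subst h; simpa using h1
        · simpa [Function.update_of_ne h] using h2 j ⟨h, hj⟩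
    rw [this, Measure.prod_prod, Measure.infinitePi_pi _ fun j _ => hT j,
      Finset.mul_prod_erase s (fun j => ρ (T j)) hi]
  · have : (fun p : α × (κ → α) => Function.update p.2 i p.1) ⁻¹' Set.pi (s : Set κ) T =
        univ ×ˢ Set.pi (s : Set κ) T := by
      ext ⟨x, c⟩
      simp only [mem_preimage, mem_pi, mem_prod, Finset.mem_coe, mem_univ, true_and]
      refine forall₂_congr fun j hj => ?_
      rw [Function.update_of_ne]
      rintro rfl; exact hi hj
    rw [this, Measure.prod_prod, Measure.infinitePi_pi _ fun j _ => hT j, measure_univ, one_mul]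

theorem lintegral_update {κ α : Type*} [DecidableEq κ] [MeasurableSpace α] (ρ : Measure α)
    [IsProbabilityMeasure ρ] (i : κ) {f : (κ → α) → ℝ≥0∞} (hf : Measurable f) :
    ∫⁻ c, f c ∂(Measure.infinitePi fun _ => ρ) =
      ∫⁻ c, ∫⁻ x, f (Function.update c i x) ∂ρ ∂(Measure.infinitePi fun _ => ρ) := by
  have h := measurePreserving_update ρ i
  rw [← h.lintegral_comp hf]
  exact lintegral_prod_symm _ (hf.comp h.measurable).aemeasurable

theorem measurable_update₂ {κ α : Type*} [DecidableEq κ] [MeasurableSpace α] (i : κ) :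
    Measurable fun p : (κ → α) × α => Function.update p.1 i p.2 := by
  refine measurable_pi_iff.2 fun j => ?_
  by_cases h : j = i
  · subst h
    simpa using measurable_snd
  · simp only [Function.update_of_ne h]
    exact (measurable_pi_apply j).comp measurable_fst

/-- Resampling of the second part of one coordinate. -/
theorem lintegral_resample {κ α β : Type*} [DecidableEq κ] [MeasurableSpace α] [MeasurableSpace β]
    (ρ : Measure α) [IsProbabilityMeasure ρ] (τ : Measure β) [IsProbabilityMeasure τ] (i : κ)
    {f : (κ → α × β) → ℝ≥0∞} (hf : Measurable f) :
    ∫⁻ d, f d ∂(Measure.infinitePi fun _ => ρ.prod τ) =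
      ∫⁻ d, ∫⁻ w, f (Function.update d i ((d i).1, w)) ∂τ
        ∂(Measure.infinitePi fun _ => ρ.prod τ) := by
  have h1 : Measurable fun p : (κ → α × β) × β => f (Function.update p.1 i ((p.1 i).1, p.2)) :=
    hf.comp ((measurable_update₂ i).comp (measurable_fst.prodMk
      (((measurable_pi_apply i).comp measurable_fst).fst.prodMk measurable_snd)))
  rw [lintegral_update _ i hf, lintegral_update _ i h1.lintegral_prod_right']
  refine lintegral_congr fun d => ?_
  have h2 : Measurable fun x : α × β => f (Function.update d i x) :=
    hf.comp ((measurable_update₂ i).comp (measurable_const.prodMk measurable_id))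
  have h3 : Measurable fun x : α × β => ∫⁻ w, f (Function.update d i (x.1, w)) ∂τ :=
    (Measurable.lintegral_prod_right' (f := fun x => f (Function.update d i x)) h2).comp
      measurable_fst
  rw [lintegral_prod _ h2.aemeasurable]
  simp only [Function.update_self, Function.update_idem]
  rw [lintegral_prod _ h3.aemeasurable]
  simp

/-- The labelling of the words given by the label of the empty word and the labellings seen from
the one-letter words. -/
def glue {α : Type*} (p : α × (ℕ → List ℕ → α)) : List ℕ → α
  | [] => p.1
  | j :: u => p.2 j u

theorem measurable_glue {α : Type*} [MeasurableSpace α] : Measurable (glue (α := α)) := by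
  refine measurable_pi_iff.2 fun w => ?_
  cases w with
  | nil => exact measurable_fst
  | cons j u => exact (measurable_pi_apply u).comp ((measurable_pi_apply j).comp measurable_snd)

/-- The finite set `S` of constrained words is enlarged to the empty word and a rectangle `J ×ˢ U`,
with trivial constraints `T'` on the added words. The product then factorizes over the first letter.
-/
theorem measurePreserving_glue {α : Type*} [MeasurableSpace α] (ρ : Measure α)
    [IsProbabilityMeasure ρ] : MeasurePreserving (glue (α := α))
      (ρ.prod (Measure.infinitePi fun _ : ℕ => Measure.infinitePi fun _ : List ℕ => ρ))
      (Measure.infinitePi fun _ : List ℕ => ρ) := by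
  refine ⟨measurable_glue, Measure.eq_infinitePi _ fun S T hT => ?_⟩
  rw [Measure.map_apply measurable_glue (MeasurableSet.pi S.countable_toSet fun j _ => hT j)]
  classical
  set T' : List ℕ → Set α := fun w => if w ∈ S then T w else univ with hT'
  have hT'm : ∀ w, MeasurableSet (T' w) := fun w => by
    simp only [hT']; split_ifs
    exacts [hT w, MeasurableSet.univ]
  set J : Finset ℕ := S.image fun w => w.headD 0
  set U : Finset (List ℕ) := S.image List.tail
  set S' : Finset (List ℕ) := insert [] ((J ×ˢ U).image fun p => p.1 :: p.2) with hS'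
  have hSS : S ⊆ S' := by
    intro w hw
    cases w with
    | nil => simp [hS']
    | cons j u =>
      refine Finset.mem_insert_of_mem (Finset.mem_image.2 ⟨(j, u), Finset.mem_product.2
        ⟨Finset.mem_image.2 ⟨_, hw, rfl⟩, Finset.mem_image.2 ⟨_, hw, rfl⟩⟩, rfl⟩)
  have h1 : ∏ w ∈ S, ρ (T w) = ∏ w ∈ S', ρ (T' w) := by
    rw [← Finset.prod_subset hSS fun w _ hw => by simp [hT', hw]]
    exact Finset.prod_congr rfl fun w hw => by simp [hT', hw]
  have h2 : glue ⁻¹' Set.pi (S : Set (List ℕ)) T = T' [] ×ˢ Set.pi (J : Set ℕ)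
      fun j => Set.pi (U : Set (List ℕ)) fun u => T' (j :: u) := by
    ext ⟨x, c⟩
    simp only [mem_preimage, mem_pi, mem_prod, Finset.mem_coe]
    constructor
    · intro h
      constructor
      · by_cases h0 : ([] : List ℕ) ∈ S
        · simpa [hT', h0, glue] using h [] h0
        · simp [hT', h0]
      · intro j _ u _
        by_cases h0 : j :: u ∈ S
        · simpa [hT', h0, glue] using h _ h0
        · simp [hT', h0]
    · rintro ⟨ha, hb⟩ w hw
      cases w with
      | nil => simpa [hT', hw, glue] using ha
      | cons j u =>
        have := hb j (Finset.mem_image.2 ⟨_, hw, rfl⟩) u (Finset.mem_image.2 ⟨_, hw, rfl⟩)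
        simpa [hT', hw, glue] using this
  rw [h2, h1, Measure.prod_prod, Measure.infinitePi_pi _ fun j _ =>
      MeasurableSet.pi U.countable_toSet fun u _ => hT'm (j :: u), hS',
    Finset.prod_insert (by simp),
    Finset.prod_image (s := J ×ˢ U) (by rintro ⟨a, b⟩ - ⟨c, d⟩ -; simp), Finset.prod_product]
  congr 1
  exact Finset.prod_congr rfl fun j _ => Measure.infinitePi_pi _ fun u _ => hT'm (j :: u)

/-! ### The root of the sample -/

instance (t : ℝ) : IsProbabilityMeasure (sampleMeasure t) := by
  unfold sampleMeasure; infer_instance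

/-- The law of the number of children and of the mark of a node. -/
abbrev nodeMeasure (t : ℝ) : Measure (ℕ × I) := (poissonMeasure t.toNNReal).prod (volume : Measure I)

/-- The sample with another mark at the root. -/
def setMark (u : I) (ω : Sample) : Sample := Function.update ω [] ((ω []).1, u)

@[simp] theorem numKids_setMark (u : I) (ω : Sample) : numKids (setMark u ω) = numKids ω := by
  simp [numKids, setMark]

@[simp] theorem shift_setMark (u : I) (ω : Sample) (j : ℕ) :
    shift (setMark u ω) j = shift ω j := by
  funext w; simp [shift, setMark]

@[simp] theorem lab_setMark (t : ℝ) (u : I) (ω : Sample) (j : ℕ) :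
    lab t (setMark u ω) j = lab t ω j := by
  simp [lab, setMark]

theorem measurable_setMark : Measurable fun p : I × Sample => setMark p.1 p.2 :=
  (measurable_update₂ _).comp (measurable_snd.prodMk
    (((measurable_pi_apply _).comp measurable_snd).fst.prodMk measurable_fst))

theorem setMark_glue (u : I) (p : (ℕ × I) × (ℕ → Sample)) :
    setMark u (glue p) = glue ((p.1.1, u), p.2) := by
  funext w
  cases w with
  | nil => simp [setMark, glue]
  | cons j w => simp [setMark, glue]

/-- The mark at the root is independent of all the rest. Since it labels the edge to the parent, the
label of the edge to a child is thereby separated from the tree above this child. -/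
theorem measurePreserving_setMark (t : ℝ) : MeasurePreserving (fun p : I × Sample => setMark p.1 p.2)
    ((volume : Measure I).prod (sampleMeasure t)) (sampleMeasure t) := by
  refine ⟨measurable_setMark, Measure.ext_of_lintegral _ fun f hf => ?_⟩
  have hg := measurePreserving_glue (nodeMeasure t)
  rw [lintegral_map hf measurable_setMark,
    lintegral_prod (fun p : I × Sample => f (setMark p.1 p.2))
      (hf.comp measurable_setMark).aemeasurable]
  have h1 : ∀ u : I, ∫⁻ ω, f (setMark u ω) ∂(sampleMeasure t) =
      ∫⁻ n, ∫⁻ c, f (glue ((n, u), c)) ∂(Measure.infinitePi fun _ : ℕ => sampleMeasure t)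
        ∂(poissonMeasure t.toNNReal) := by
    intro u
    have hm : Measurable fun ω => f (setMark u ω) :=
      hf.comp (measurable_setMark.comp (measurable_const.prodMk measurable_id))
    have := hg.lintegral_comp hm
    rw [sampleMeasure, ← this, lintegral_prod (fun p => f (setMark u (glue p)))
      (hm.comp measurable_glue).aemeasurable]
    have h3 : Measurable fun n : ℕ × I => ∫⁻ c, f (glue ((n.1, u), c))
        ∂(Measure.infinitePi fun _ : ℕ => sampleMeasure t) := by
      refine Measurable.lintegral_prod_right' (f := fun q : (ℕ × I) × (ℕ → Sample) =>
        f (glue ((q.1.1, u), q.2))) ?_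
      exact hf.comp (measurable_glue.comp
        ((measurable_fst.fst.prodMk measurable_const).prodMk measurable_snd))
    simp only [setMark_glue]
    refine (lintegral_prod (fun n : ℕ × I => ∫⁻ c, f (glue ((n.1, u), c))
        ∂(Measure.infinitePi fun _ : ℕ => sampleMeasure t)) h3.aemeasurable).trans ?_
    simp [sampleMeasure]
  simp_rw [h1]
  have h2 : Measurable fun q : ℕ × I => ∫⁻ c, f (glue (q, c))
      ∂(Measure.infinitePi fun _ : ℕ => sampleMeasure t) :=
    Measurable.lintegral_prod_right' (f := fun q : (ℕ × I) × (ℕ → Sample) => f (glue q))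
      (hf.comp measurable_glue)
  rw [lintegral_lintegral_swap (f := fun (u : I) (n : ℕ) => ∫⁻ c, f (glue ((n, u), c))
    ∂(Measure.infinitePi fun _ : ℕ => sampleMeasure t)) (h2.comp measurable_swap).aemeasurable]
  rw [sampleMeasure, ← hg.lintegral_comp hf,
    lintegral_prod (fun p => f (glue p)) (hf.comp measurable_glue).aemeasurable]
  exact (lintegral_prod _ h2.aemeasurable).symm

/-- The law of the families of the marks and of the samples attached to the children. -/
abbrev kidsMeasure (t : ℝ) : Measure (ℕ → I × Sample) :=
  Measure.infinitePi fun _ => (volume : Measure I).prod (sampleMeasure t)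

/-- The sample with `x` at the root, and with the marks `(d j).1` and the samples `(d j).2` at the
children. -/
def build (x : ℕ × I) (d : ℕ → I × Sample) : Sample :=
  glue (x, fun j => setMark (d j).1 (d j).2)

@[simp] theorem numKids_build (x : ℕ × I) (d : ℕ → I × Sample) : numKids (build x d) = x.1 := rfl

@[simp] theorem shift_build (x : ℕ × I) (d : ℕ → I × Sample) (j : ℕ) :
    shift (build x d) j = setMark (d j).1 (d j).2 := rfl

@[simp] theorem lab_build (t : ℝ) (x : ℕ × I) (d : ℕ → I × Sample) (j : ℕ) :
    lab t (build x d) j = t * ((d j).1 : ℝ) := by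
  simp [lab, build, glue, setMark]

/-- The mark that the sample of a child already carries at its own root is overwritten by a fresh
one. A child is then described by two independent coordinates, a mark and a sample. -/
theorem measurePreserving_build (t : ℝ) :
    MeasurePreserving (fun p : (ℕ × I) × (ℕ → I × Sample) => build p.1 p.2)
      ((nodeMeasure t).prod (kidsMeasure t)) (sampleMeasure t) := by
  have h1 : MeasurePreserving (fun d : ℕ → I × Sample => fun j => setMark (d j).1 (d j).2)
      (kidsMeasure t) (Measure.infinitePi fun _ : ℕ => sampleMeasure t) := by
    refine ⟨measurable_pi_iff.2 fun j => measurable_setMark.comp (measurable_pi_apply j), ?_⟩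
    rw [Measure.infinitePi_map_pi (f := fun (_ : ℕ) (p : I × Sample) => setMark p.1 p.2) _
      fun _ => measurable_setMark]
    simp_rw [(measurePreserving_setMark t).map_eq]
  exact (measurePreserving_glue (nodeMeasure t)).comp ((MeasurePreserving.id _).prod h1)

theorem lintegral_build (t : ℝ) {f : Sample → ℝ≥0∞} (hf : Measurable f) :
    ∫⁻ ω, f ω ∂(sampleMeasure t) =
      ∫⁻ x, ∫⁻ d, f (build x d) ∂(kidsMeasure t) ∂(nodeMeasure t) := by
  have h := measurePreserving_build t
  rw [← h.lintegral_comp hf]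
  exact lintegral_prod _ (hf.comp h.measurable).aemeasurable

theorem measurePreserving_shiftBy (t : ℝ) (u : List ℕ) :
    MeasurePreserving (shiftBy u) (sampleMeasure t) (sampleMeasure t) := by
  refine ⟨measurable_pi_iff.2 fun w => measurable_pi_apply _, ?_⟩
  exact Measure.map_infinitePi_infinitePi_of_inj (P := fun _ : List ℕ => nodeMeasure t)
    (f := fun w => u ++ w) (List.append_right_injective u)

end ForbiddenDegree
end

/-! ### The expected number of descending chains. -/

noncomputable section

namespace ForbiddenDegree

/-- The base 4 is only a convenience: `4 ^ n` dominates both `n` and `n ^ 2`, the numbers of ways to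
choose one child or two children. -/
theorem lintegral_four_pow_poisson_ne_top (t : ℝ) :
    ∫⁻ n, (4 : ℝ≥0∞) ^ n ∂(poissonMeasure t.toNNReal) ≠ ∞ := by
  rw [poissonMeasure, lintegral_sum_measure]
  simp only [lintegral_smul_measure, lintegral_dirac, smul_eq_mul]
  have h : ∀ n : ℕ, ENNReal.ofReal (Real.exp (-t.toNNReal) * t.toNNReal ^ n / n.factorial) * 4 ^ n =
      ENNReal.ofReal (Real.exp (-t.toNNReal) * ((4 * t.toNNReal : ℝ) ^ n / n.factorial)) := by
    intro n
    have h4 : (4 : ℝ≥0∞) ^ n = ENNReal.ofReal (4 ^ n) := by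
      rw [ENNReal.ofReal_pow (by norm_num)]; norm_num
    rw [h4, ← ENNReal.ofReal_mul (by positivity)]
    congr 1
    rw [mul_pow]; ring
  simp_rw [h]
  exact ((Real.summable_pow_div_factorial _).mul_left _).tsum_ofReal_ne_top

theorem measurable_sum_range {α : Type*} [MeasurableSpace α] {N : α → ℕ} (hN : Measurable N)
    {f : ℕ → α → ℝ≥0∞} (hf : ∀ n, Measurable (f n)) :
    Measurable fun x => ∑ l ∈ Finset.range (N x), f l x := by
  have : Measurable fun p : ℕ × α => ∑ l ∈ Finset.range p.1, f l p.2 :=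
    measurable_from_prod_countable_right fun n =>
      Finset.measurable_fun_sum (Finset.range n) fun l _ => hf l
  exact this.comp (hN.prodMk measurable_id)

theorem measurable_numKids : Measurable numKids := (measurable_pi_apply _).fst

theorem measurable_shift (j : ℕ) : Measurable fun ω => shift ω j :=
  measurable_pi_iff.2 fun _ => measurable_pi_apply _

theorem measurable_lab (t : ℝ) (j : ℕ) : Measurable fun ω => lab t ω j :=
  (measurable_subtype_coe.comp (measurable_pi_apply _).snd).const_mul t

theorem chain_setMark {t : ℝ} {m : ℕ} {u : I} {ω : Sample} {s : ℝ} :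
    Chain t m (setMark u ω) s ↔ Chain t m ω s := by
  cases m with
  | zero => rfl
  | succ m => simp [Chain]

theorem measurable_lt_prop {α β : Type*} [MeasurableSpace α] [TopologicalSpace β] [LinearOrder β]
    [OrderClosedTopology β] [SecondCountableTopology β] [MeasurableSpace β] [OpensMeasurableSpace β]
    {f g : α → β} (hf : Measurable f) (hg : Measurable g) : Measurable fun x => f x < g x :=
  measurableSet_setOfPred.1 (measurableSet_lt hf hg)

theorem measurable_chain (t : ℝ) (m : ℕ) {α : Type*} [MeasurableSpace α] {f : α → Sample}
    {g : α → ℝ} (hf : Measurable f) (hg : Measurable g) :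
    Measurable fun x => Chain t m (f x) (g x) := by
  induction m generalizing f g with
  | zero => exact measurable_const
  | succ m ih =>
    -- The time `τ` is eliminated, since it is one of countably many labels. Only countable
    -- quantifiers remain.
    have : ∀ x, Chain t (m + 1) (f x) (g x) ↔ ∃ j l, j < numKids (f x) ∧
        l < numKids (shift (f x) j) ∧ ((lab t (f x) j < g x ∧
          Chain t m (shift (shift (f x) j) l) (lab t (f x) j)) ∨ ∃ l', l' < numKids (shift (f x) j) ∧
          lab t (shift (f x) j) l' < g x ∧
          Chain t m (shift (shift (f x) j) l) (lab t (shift (f x) j) l')) := by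
      intro p
      simp only [Chain]
      constructor
      · rintro ⟨j, hj, l, hl, τ, hτ, rfl | ⟨l', hl', rfl⟩, h⟩
        · exact ⟨j, l, hj, hl, Or.inl ⟨hτ, h⟩⟩
        · exact ⟨j, l, hj, hl, Or.inr ⟨l', hl', hτ, h⟩⟩
      · rintro ⟨j, l, hj, hl, ⟨hτ, h⟩ | ⟨l', hl', hτ, h⟩⟩
        · exact ⟨j, hj, l, hl, _, hτ, Or.inl rfl, h⟩
        · exact ⟨j, hj, l, hl, _, hτ, Or.inr ⟨l', hl', rfl⟩, h⟩
    simp only [this]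
    refine Measurable.exists fun j => Measurable.exists fun l => ?_
    have hs : Measurable fun x => shift (f x) j := (measurable_shift j).comp hf
    have hss : Measurable fun x => shift (shift (f x) j) l := (measurable_shift l).comp hs
    have hl0 : Measurable fun x => lab t (f x) j := (measurable_lab t j).comp hf
    have hl1 : ∀ l', Measurable fun x => lab t (shift (f x) j) l' :=
      fun l' => (measurable_lab t l').comp hs
    exact (measurable_lt_prop measurable_const (measurable_numKids.comp hf)).and
      ((measurable_lt_prop measurable_const (measurable_numKids.comp hs)).and
      (((measurable_lt_prop hl0 hg).and (ih hss hl0)).or (Measurable.exists fun l' =>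
      (measurable_lt_prop measurable_const (measurable_numKids.comp hs)).and
      ((measurable_lt_prop (hl1 l') hg).and (ih hss (hl1 l'))))))

theorem measurableSet_chain (t : ℝ) (m : ℕ) :
    MeasurableSet {p : Sample × ℝ | Chain t m p.1 p.2} :=
  measurableSet_setOfPred.2 (measurable_chain t m measurable_fst measurable_snd)

/-- The indicator function of the chains of length `2 m` with times below `τ < s`. -/
def chainInd (t : ℝ) (m : ℕ) (s : ℝ) : Sample × ℝ → ℝ≥0∞ :=
  indicator {p | p.2 < s ∧ Chain t m p.1 p.2} 1

theorem measurable_chainInd (t : ℝ) (m : ℕ) (s : ℝ) : Measurable (chainInd t m s) :=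
  measurable_one.indicator
    ((measurableSet_lt measurable_snd measurable_const).inter (measurableSet_chain t m))

theorem chainInd_setMark (t : ℝ) (m : ℕ) (s : ℝ) (u : I) (ω : Sample) (τ : ℝ) :
    chainInd t m s (setMark u ω, τ) = chainInd t m s (ω, τ) := by
  classical
  simp only [chainInd, indicator_apply, mem_ofPred_eq, chain_setMark, Pi.one_apply]

/-- The number of the two-step beginnings of a chain. -/
def chainSum (t : ℝ) (m : ℕ) (s : ℝ) (p : I × Sample) : ℝ≥0∞ :=
  ∑ l ∈ Finset.range (numKids p.2), (chainInd t m s (shift p.2 l, t * p.1) +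
    ∑ l' ∈ Finset.range (numKids p.2), chainInd t m s (shift p.2 l, lab t p.2 l'))

theorem measurable_chainSum (t : ℝ) (m : ℕ) (s : ℝ) : Measurable (chainSum t m s) := by
  refine measurable_sum_range (measurable_numKids.comp measurable_snd) fun l => ?_
  have h1 : Measurable fun p : I × Sample => shift p.2 l := (measurable_shift l).comp measurable_snd
  refine ((measurable_chainInd t m s).comp (h1.prodMk
    ((measurable_subtype_coe.comp measurable_fst).const_mul t))).add ?_
  exact measurable_sum_range (measurable_numKids.comp measurable_snd) fun l' =>
    (measurable_chainInd t m s).comp (h1.prodMk ((measurable_lab t l').comp measurable_snd))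

/-- A union bound over the child `j`, the grandchild `l` and the edge whose label is `τ`. -/
theorem indicator_chain_le (t : ℝ) (m : ℕ) (s : ℝ) (x : ℕ × I) (d : ℕ → I × Sample) :
    indicator {ω | Chain t (m + 1) ω s} (1 : Sample → ℝ≥0∞) (build x d) ≤
      ∑ j ∈ Finset.range x.1, chainSum t m s (d j) := by
  classical
  rw [indicator_apply]
  split_ifs with h
  · obtain ⟨j, hj, l, hl, τ, hτ, h1, h2⟩ := h
    simp only [numKids_build, shift_build, numKids_setMark, shift_setMark, lab_setMark,
      lab_build] at hj hl h1 h2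
    refine le_trans ?_ (Finset.single_le_sum (f := fun j => chainSum t m s (d j))
      (fun _ _ => zero_le) (Finset.mem_range.2 hj))
    refine le_trans ?_ (Finset.single_le_sum (f := fun l => chainInd t m s
      (shift (d j).2 l, t * (d j).1) + ∑ l' ∈ Finset.range (numKids (d j).2),
      chainInd t m s (shift (d j).2 l, lab t (d j).2 l')) (fun _ _ => zero_le)
      (Finset.mem_range.2 hl))
    have hone : chainInd t m s (shift (d j).2 l, τ) = 1 := by
      rw [chainInd, indicator_of_mem]
      · rfl
      · exact ⟨hτ, h2⟩
    rcases h1 with rfl | ⟨l', hl', rfl⟩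
    · exact le_trans hone.ge le_self_add
    · refine le_trans ?_ le_add_self
      refine hone.ge.trans (Finset.single_le_sum (f := fun l' => chainInd t m s (shift (d j).2 l,
        lab t (d j).2 l')) (fun _ _ => zero_le) (Finset.mem_range.2 hl'))
  · exact zero_le

theorem lintegral_eval_kids (t : ℝ) (j : ℕ) {f : I × Sample → ℝ≥0∞} (hf : Measurable f) :
    ∫⁻ d, f (d j) ∂(kidsMeasure t) = ∫⁻ p, f p ∂((volume : Measure I).prod (sampleMeasure t)) :=
  (measurePreserving_eval_infinitePi
    (fun _ : ℕ => (volume : Measure I).prod (sampleMeasure t)) j).lintegral_comp hf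

/-- The integral of the probability of a chain. -/
def chainInt (t : ℝ) (m : ℕ) (s : ℝ) : ℝ≥0∞ :=
  ∫⁻ u : I, ∫⁻ ω, chainInd t m s (ω, t * u) ∂(sampleMeasure t)

/-- The sample of the child `l` is independent of the mark of the child `l'`, even for `l = l'`,
because the mark and the sample of a child are separate coordinates. -/
theorem lintegral_kids_pair (t : ℝ) (m : ℕ) (s : ℝ) (l l' : ℕ) :
    ∫⁻ d, chainInd t m s ((d l).2, t * (d l').1) ∂(kidsMeasure t) = chainInt t m s := by
  have hm : Measurable fun q : I × Sample => chainInd t m s (q.2, t * q.1) :=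
    (measurable_chainInd t m s).comp (measurable_snd.prodMk
      ((measurable_subtype_coe.comp measurable_fst).const_mul t))
  have h1 : Measurable fun d : ℕ → I × Sample => chainInd t m s ((d l).2, t * (d l').1) :=
    hm.comp (g := fun q : I × Sample => chainInd t m s (q.2, t * q.1))
      (f := fun d : ℕ → I × Sample => ((d l').1, (d l).2)) (by fun_prop)
  -- Only the sample of the child `l` is drawn anew; all marks stay.
  rw [lintegral_resample _ _ l h1]
  have h2 : ∀ (d : ℕ → I × Sample) (w : Sample),
      (Function.update d l ((d l).1, w) l').1 = (d l').1 := by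
    intro d w
    by_cases h : l' = l
    · subst h; simp
    · rw [Function.update_of_ne h]
  simp only [Function.update_self, h2]
  have h3 : Measurable fun q : I × Sample => ∫⁻ w, chainInd t m s (w, t * q.1)
      ∂(sampleMeasure t) := hm.lintegral_prod_right'.comp measurable_fst
  rw [lintegral_eval_kids t l' h3, lintegral_prod _ h3.aemeasurable]
  simp [chainInt]

/-- A node with `n` children contributes `n` terms in which `τ` is the label of its own edge and `n
^ 2` terms in which it is the label of an edge to a child. Each of them has mean `chainInt` once the
marks are averaged. -/
theorem lintegral_chainSum_le (t : ℝ) (m : ℕ) (s : ℝ) :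
    ∫⁻ p, chainSum t m s p ∂((volume : Measure I).prod (sampleMeasure t)) ≤
      2 * (∫⁻ n, (4 : ℝ≥0∞) ^ n ∂(poissonMeasure t.toNNReal)) * chainInt t m s := by
  rw [lintegral_prod _ (measurable_chainSum t m s).aemeasurable]
  have hm : ∀ u : I, Measurable fun ω => chainSum t m s (u, ω) := fun u =>
    (measurable_chainSum t m s).comp (measurable_const.prodMk measurable_id)
  have hc : ∀ l, Measurable fun q : I × (ℕ → I × Sample) => chainInd t m s ((q.2 l).2, t * q.1) :=
    fun l => (measurable_chainInd t m s).comp (((measurable_pi_apply l).comp measurable_snd).snd.prodMk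
      ((measurable_subtype_coe.comp measurable_fst).const_mul t))
  have hc' : ∀ l l', Measurable fun q : ℕ → I × Sample =>
      chainInd t m s ((q l).2, t * (q l').1) :=
    fun l l' => (measurable_chainInd t m s).comp ((measurable_pi_apply l).snd.prodMk
      ((measurable_subtype_coe.comp (measurable_pi_apply l').fst).const_mul t))
  have h1 : ∀ u : I, ∫⁻ ω, chainSum t m s (u, ω) ∂(sampleMeasure t) =
      ∫⁻ x, ((x.1 : ℝ≥0∞) * ∫⁻ ω, chainInd t m s (ω, t * u) ∂(sampleMeasure t) +
        (x.1 : ℝ≥0∞) ^ 2 * chainInt t m s) ∂(nodeMeasure t) := by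
    intro u
    rw [lintegral_build t (hm u)]
    refine lintegral_congr fun x => ?_
    simp only [chainSum, numKids_build, shift_build, lab_build, chainInd_setMark]
    have hu : ∀ l, Measurable fun d : ℕ → I × Sample => chainInd t m s ((d l).2, t * u) :=
      fun l => (hc l).comp (measurable_const.prodMk measurable_id)
    have hu' : ∀ l, Measurable fun d : ℕ → I × Sample =>
        ∑ l' ∈ Finset.range x.1, chainInd t m s ((d l).2, t * (d l').1) :=
      fun l => Finset.measurable_fun_sum _ fun l' _ => hc' l l'
    rw [lintegral_finsetSum _ fun l _ => (hu l).fun_add (hu' l)]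
    have h2 : ∀ l, ∫⁻ d, (chainInd t m s ((d l).2, t * u) +
        ∑ l' ∈ Finset.range x.1, chainInd t m s ((d l).2, t * (d l').1)) ∂(kidsMeasure t) =
        ∫⁻ ω, chainInd t m s (ω, t * u) ∂(sampleMeasure t) + x.1 * chainInt t m s := by
      intro l
      rw [lintegral_add_left (hu l), lintegral_finsetSum _ fun l' _ => hc' l l']
      simp only [lintegral_kids_pair, Finset.sum_const, Finset.card_range, nsmul_eq_mul]
      congr 1
      have h3 : Measurable fun q : I × Sample => chainInd t m s (q.2, t * u) :=
        (measurable_chainInd t m s).comp (measurable_snd.prodMk measurable_const)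
      rw [lintegral_eval_kids t l h3, lintegral_prod _ h3.aemeasurable]
      simp
    simp only [h2, Finset.sum_const, Finset.card_range, nsmul_eq_mul]
    ring
  simp_rw [h1]
  have h5 : ∀ n : ℕ, (n : ℝ≥0∞) ≤ 4 ^ n ∧ (n : ℝ≥0∞) ^ 2 ≤ 4 ^ n := by
    intro n
    have h6 : n < 2 ^ n := Nat.lt_two_pow_self
    have h7 : n ^ 2 ≤ 4 ^ n := by
      calc n ^ 2 ≤ (2 ^ n) ^ 2 := Nat.pow_le_pow_left h6.le 2
        _ = 4 ^ n := by rw [← pow_mul, mul_comm, pow_mul]; norm_num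
    have h8 : n ≤ 4 ^ n := (Nat.le_self_pow two_ne_zero n).trans h7
    exact ⟨by exact_mod_cast h8, by exact_mod_cast h7⟩
  have h9 : ∀ c : ℝ≥0∞, ∫⁻ x : ℕ × I, (4 : ℝ≥0∞) ^ x.1 * c ∂(nodeMeasure t) =
      (∫⁻ n, (4 : ℝ≥0∞) ^ n ∂(poissonMeasure t.toNNReal)) * c := by
    intro c
    rw [lintegral_prod _ (by fun_prop)]
    simp only [lintegral_const, measure_univ, mul_one]
    rw [lintegral_mul_const _ (by fun_prop)]
  calc _ ≤ ∫⁻ u : I, ∫⁻ x : ℕ × I, (4 : ℝ≥0∞) ^ x.1 *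
        (∫⁻ ω, chainInd t m s (ω, t * u) ∂(sampleMeasure t) + chainInt t m s) ∂(nodeMeasure t) := by
        refine lintegral_mono fun u => lintegral_mono fun x => ?_
        rw [mul_add]
        exact add_le_add (mul_le_mul_left (h5 _).1 _) (mul_le_mul_left (h5 _).2 _)
    _ = _ := by
        simp_rw [h9]
        rw [lintegral_const_mul', lintegral_add_right]
        · simp only [lintegral_const, measure_univ, mul_one]
          rw [← chainInt]
          ring
        · exact measurable_const
        · exact lintegral_four_pow_poisson_ne_top t

/-- One more step of the chain costs a constant factor and an integration over a uniform time below
`s`. -/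
theorem measure_chain_succ_le (t : ℝ) (m : ℕ) (s : ℝ) :
    sampleMeasure t {ω | Chain t (m + 1) ω s} ≤
      2 * (∫⁻ n, (4 : ℝ≥0∞) ^ n ∂(poissonMeasure t.toNNReal)) ^ 2 * chainInt t m s := by
  have hms : MeasurableSet {ω | Chain t (m + 1) ω s} :=
    (measurableSet_chain t (m + 1)).preimage (measurable_id.prodMk measurable_const)
  rw [← lintegral_indicator_one hms, lintegral_build t (measurable_one.indicator hms)]
  set M := ∫⁻ n, (4 : ℝ≥0∞) ^ n ∂(poissonMeasure t.toNNReal) with hM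
  calc _ ≤ ∫⁻ x : ℕ × I, (4 : ℝ≥0∞) ^ x.1 * (2 * M * chainInt t m s) ∂(nodeMeasure t) := by
        refine lintegral_mono fun x => ?_
        refine (lintegral_mono fun d => indicator_chain_le t m s x d).trans ?_
        have hj : ∀ j, Measurable fun d : ℕ → I × Sample => chainSum t m s (d j) :=
          fun j => (measurable_chainSum t m s).comp (measurable_pi_apply j)
        rw [lintegral_finsetSum _ fun j _ => hj j]
        simp only [lintegral_eval_kids t _ (measurable_chainSum t m s), Finset.sum_const,
          Finset.card_range, nsmul_eq_mul]
        refine mul_le_mul' ?_ (lintegral_chainSum_le t m s)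
        have h6 : x.1 < 4 ^ x.1 := Nat.lt_pow_self (by norm_num)
        exact_mod_cast h6.le
    _ = _ := by
        rw [lintegral_prod _ (by fun_prop)]
        simp only [lintegral_const, measure_univ, mul_one]
        rw [lintegral_mul_const _ (by fun_prop), ← hM]
        ring

end ForbiddenDegree
end

/-! ### Almost sure finiteness of the chains and absence of coincidences between labels. -/

noncomputable section

namespace ForbiddenDegree

theorem lintegral_pow_lt_le (m : ℕ) {v : ℝ} (hv : 0 ≤ v) :
    ∫⁻ u : I, indicator {u : I | (u : ℝ) < v} (fun u => ENNReal.ofReal ((u : ℝ) ^ m / m.factorial)) u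
      ≤ ENNReal.ofReal (v ^ (m + 1) / (m + 1).factorial) := by
  classical
  have hf : Measurable fun x : ℝ =>
      indicator {x : ℝ | x < v} (fun x => ENNReal.ofReal (x ^ m / m.factorial)) x :=
    (ENNReal.measurable_ofReal.comp ((measurable_id.pow_const m).div_const _)).indicator
      (measurableSet_lt measurable_id measurable_const)
  calc _ = ∫⁻ u : I, (fun x : ℝ =>
          indicator {x : ℝ | x < v} (fun x => ENNReal.ofReal (x ^ m / m.factorial)) x) u := by
        refine lintegral_congr fun u => ?_
        simp only [indicator_apply, mem_ofPred_eq]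
    _ = ∫⁻ x in Icc (0 : ℝ) 1,
          indicator {x : ℝ | x < v} (fun x => ENNReal.ofReal (x ^ m / m.factorial)) x :=
        unitInterval.measurePreserving_coe.lintegral_comp hf
    _ ≤ ∫⁻ x in Ioc (0 : ℝ) v, ENNReal.ofReal (x ^ m / m.factorial) := by
        have hms : MeasurableSet {x : ℝ | x < v} := measurableSet_Iio
        rw [← Measure.restrict_congr_set (Ioc_ae_eq_Icc (a := (0 : ℝ)) (b := 1)),
          lintegral_indicator hms, Measure.restrict_restrict hms]
        exact lintegral_mono_set fun x hx => ⟨hx.2.1, le_of_lt hx.1⟩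
    _ = ENNReal.ofReal (v ^ (m + 1) / (m + 1).factorial) := by
        rw [← ofReal_integral_eq_lintegral_ofReal]
        · rw [← intervalIntegral.integral_of_le hv, intervalIntegral.integral_div, integral_pow,
            Nat.factorial_succ]
          congr 1
          push_cast
          simp only [ne_eq, Nat.add_eq_zero_iff, one_ne_zero, and_false, not_false_eq_true, zero_pow,
            sub_zero, div_div]
        · exact (((continuous_id.pow m).div_const _).integrableOn_Icc (a := 0) (b := v)).mono_set
            Ioc_subset_Icc_self
        · filter_upwards [ae_restrict_mem measurableSet_Ioc] with x hx
          have := hx.1.le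
          positivity

/-- The growth constant of the chains. -/
def chainConst (t : ℝ) : ℝ≥0∞ := 2 * (∫⁻ n, (4 : ℝ≥0∞) ^ n ∂(poissonMeasure t.toNNReal)) ^ 2

/-- The times of a chain decrease, so the iterated integrals give the volume `v ^ m / m!` of a
simplex, which beats the exponential number of choices. -/
theorem measure_chain_le {t : ℝ} (ht : 0 < t) (m : ℕ) {v : ℝ} (hv : 0 ≤ v) :
    sampleMeasure t {ω | Chain t m ω (t * v)} ≤
      chainConst t ^ m * ENNReal.ofReal (v ^ m / m.factorial) := by
  classical
  induction m generalizing v with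
  | zero => simp [Chain]
  | succ m ih =>
    have hC : chainConst t ≠ ∞ := ENNReal.mul_ne_top (by simp)
      (ENNReal.pow_ne_top (lintegral_four_pow_poisson_ne_top t))
    refine (measure_chain_succ_le t m _).trans ?_
    have h1 : chainInt t m (t * v) ≤ ∫⁻ u : I, chainConst t ^ m * indicator {u : I | (u : ℝ) < v}
        (fun u => ENNReal.ofReal ((u : ℝ) ^ m / m.factorial)) u := by
      refine lintegral_mono fun u => ?_
      by_cases hu : (u : ℝ) < v
      · rw [indicator_of_mem (show u ∈ {u : I | (u : ℝ) < v} from hu)]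
        refine le_trans ?_ (ih u.2.1)
        have hms : MeasurableSet {ω | Chain t m ω (t * u)} :=
          (measurableSet_chain t m).preimage (measurable_id.prodMk measurable_const)
        rw [← lintegral_indicator_one hms]
        refine lintegral_mono fun ω => ?_
        simp only [chainInd, indicator_apply, mem_ofPred_eq, Pi.one_apply]
        split_ifs with h2 h3
        · exact le_rfl
        · exact absurd h2.2 h3
        · exact zero_le
        · exact le_rfl
      · have : ∀ ω, chainInd t m (t * v) (ω, t * u) = 0 := fun ω =>
          indicator_of_notMem (fun h => hu (lt_of_mul_lt_mul_left h.1 ht.le)) _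
        simp [this]
    rw [lintegral_const_mul' _ _ (ENNReal.pow_ne_top hC)] at h1
    calc _ ≤ chainConst t * (chainConst t ^ m * ENNReal.ofReal (v ^ (m + 1) / (m + 1).factorial)) :=
          mul_le_mul_right (h1.trans (mul_le_mul_right (lintegral_pow_lt_le m hv) _)) _
      _ = _ := by rw [← mul_assoc, ← pow_succ']

theorem ae_exists_not_chain_of_pos {t : ℝ} (ht : 0 < t) :
    ∀ᵐ ω ∂(sampleMeasure t), ∃ m, ¬ Chain t m ω (t + 1) := by
  -- With `v = (t + 1) / t` the bound on the times is `t * v = t + 1`, which no label reaches, so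
  -- the constraint on the first time is void.
  have hv : 0 ≤ (t + 1) / t := by positivity
  have htv : t * ((t + 1) / t) = t + 1 := by field_simp
  have hC : chainConst t ≠ ∞ := ENNReal.mul_ne_top (by simp)
      (ENNReal.pow_ne_top (lintegral_four_pow_poisson_ne_top t))
  set c := (chainConst t).toReal with hc
  have hb : ∀ m : ℕ, sampleMeasure t {ω | ∀ m, Chain t m ω (t + 1)} ≤
      ENNReal.ofReal ((c * ((t + 1) / t)) ^ m / m.factorial) := by
    intro m
    refine (measure_mono fun ω (h : ∀ m, Chain t m ω (t + 1)) => ?_).trans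
      ((measure_chain_le ht m hv).trans_eq ?_)
    · exact htv.symm ▸ h m
    · rw [← ENNReal.ofReal_toReal hC, ← ENNReal.ofReal_pow ENNReal.toReal_nonneg,
        ← ENNReal.ofReal_mul (by positivity), ← hc, mul_pow, mul_div_assoc]
  have hlim := ENNReal.tendsto_ofReal
    (FloorSemiring.tendsto_pow_div_factorial_atTop (c * ((t + 1) / t)))
  rw [ENNReal.ofReal_zero] at hlim
  rw [ae_iff]
  push Not
  exact le_antisymm (ge_of_tendsto' hlim hb) zero_le

theorem nodeMeasure_mark_eq (t : ℝ) (a : I) : nodeMeasure t {x | x.2 = a} = 0 := by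
  have : {x : ℕ × I | x.2 = a} = univ ×ˢ {a} := by ext x; simp
  rw [this, Measure.prod_prod]
  simp

theorem measurableSet_mark_eq (u v : List ℕ) :
    MeasurableSet {ω : Sample × Sample | (ω.1 u).2 = (ω.2 v).2} :=
  measurableSet_eq_fun (by fun_prop) (by fun_prop)

theorem ae_mark_ne (t : ℝ) (u : List ℕ) (a : I) : ∀ᵐ ω ∂(sampleMeasure t), (ω u).2 ≠ a := by
  have h := measurePreserving_eval_infinitePi (fun _ : List ℕ => nodeMeasure t) u
  have h1 : ∀ᵐ x ∂(nodeMeasure t), x.2 ≠ a := by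
    rw [ae_iff]
    simpa using nodeMeasure_mark_eq t a
  exact h.quasiMeasurePreserving.ae h1

theorem ae_marks_distinct (t : ℝ) :
    ∀ᵐ ω ∂(sampleMeasure t), ∀ u v : List ℕ, u ≠ v → (ω u).2 ≠ (ω v).2 := by
  rw [ae_all_iff]; intro u
  rw [ae_all_iff]; intro v
  by_cases huv : u = v
  · exact Filter.Eventually.of_forall fun _ h => absurd huv h
  have h : MeasurePreserving (fun ω : Sample => (ω u, ω v)) (sampleMeasure t)
      ((nodeMeasure t).prod (nodeMeasure t)) :=
    ⟨by fun_prop, Measure.infinitePi_map_eval_prod huv⟩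
  have h1 : ∀ᵐ p ∂((nodeMeasure t).prod (nodeMeasure t)), p.1.2 ≠ p.2.2 := by
    rw [ae_iff]
    have hm : MeasurableSet {p : (ℕ × I) × (ℕ × I) | p.1.2 = p.2.2} :=
      measurableSet_eq_fun (by fun_prop) (by fun_prop)
    have := (Measure.measure_prod_null (μ := nodeMeasure t) (ν := nodeMeasure t) hm).2
      (Filter.Eventually.of_forall fun x => ?_)
    · simpa using this
    · have h2 : Prod.mk x ⁻¹' {p : (ℕ × I) × (ℕ × I) | p.1.2 = p.2.2} = {y | y.2 = x.2} := by
        ext y; exact eq_comm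
      change nodeMeasure t (Prod.mk x ⁻¹' {p : (ℕ × I) × (ℕ × I) | p.1.2 = p.2.2}) = 0
      rw [h2, nodeMeasure_mark_eq]
  filter_upwards [h.quasiMeasurePreserving.ae h1] with ω hω _ using hω

theorem ae_marks_disjoint (t : ℝ) : ∀ᵐ ω ∂((sampleMeasure t).prod (sampleMeasure t)),
    ∀ u v : List ℕ, (ω.1 u).2 ≠ (ω.2 v).2 := by
  rw [ae_all_iff]; intro u
  rw [ae_all_iff]; intro v
  rw [ae_iff]
  have := (Measure.measure_prod_null (μ := sampleMeasure t) (ν := sampleMeasure t)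
    (measurableSet_mark_eq u v)).2 (Filter.Eventually.of_forall fun ω => ?_)
  · simpa using this
  · have h := ae_mark_ne t v (ω u).2
    rw [ae_iff] at h
    simp only [ne_eq, not_not] at h
    have h2 : Prod.mk ω ⁻¹' {ω : Sample × Sample | (ω.1 u).2 = (ω.2 v).2} =
        {ω' | (ω' v).2 = (ω u).2} := by
      ext y; exact eq_comm
    change sampleMeasure t (Prod.mk ω ⁻¹' {ω : Sample × Sample | (ω.1 u).2 = (ω.2 v).2}) = 0
    rw [h2, h]

/-- For `t = 0` all labels would be equal to zero, but the tree is almost surely a single vertex.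
This settles the degenerate case of the statements on distinct labels. -/
theorem ae_numKids_zero (u : List ℕ) : ∀ᵐ ω ∂(sampleMeasure 0), (ω u).1 = 0 := by
  have h := (Measure.quasiMeasurePreserving_fst (μ := poissonMeasure (0 : ℝ).toNNReal)
    (ν := (volume : Measure I))).comp
    (measurePreserving_eval_infinitePi (fun _ : List ℕ => nodeMeasure 0) u).quasiMeasurePreserving
  have h1 : ∀ᵐ n ∂(poissonMeasure (0 : ℝ).toNNReal), n = 0 := by
    rw [ae_iff]
    have := prob_compl_eq_zero_iff (μ := poissonMeasure (0 : ℝ).toNNReal)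
      (measurableSet_singleton (0 : ℕ))
    have h0 : {a : ℕ | ¬ a = 0} = {0}ᶜ := rfl
    rw [h0, this, poissonMeasure_singleton]
    simp
  exact h.ae h1

theorem path_concat (t : ℝ) (ω : Sample) (u : List ℕ) (j : ℕ) :
    path t ω (u ++ [j]) = path t ω u ++ [t * ((ω (u ++ [j])).2 : ℝ)] := by
  induction u generalizing ω with
  | nil => rfl
  | cons i u ih =>
    rw [List.cons_append, path, ih, path, List.cons_append]
    rfl

theorem GWPath.eq_path {t : ℝ} {ω : Sample} {u : List ℕ} {p : List ℝ} (h : GWPath t ω u p) :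
    p = path t ω u := by
  induction h with
  | root => rfl
  | child u p j _ _ ih => rw [path_concat, ← ih]

theorem exists_mark {t : ℝ} {ω : Sample} {p : List ℝ} {a : ℝ} (h : p ++ [a] ∈ (treeInf t ω).pts) :
    ∃ u j, j < (ω u).1 ∧ p = path t ω u ∧ a = t * ((ω (u ++ [j])).2 : ℝ) := by
  obtain ⟨w, hw⟩ := h
  generalize hq : p ++ [a] = q at hw
  cases hw with
  | root => simp at hq
  | child u p' j h hj =>
    obtain ⟨rfl, h2⟩ := List.append_inj' hq rfl
    exact ⟨u, j, hj, h.eq_path, (List.cons.inj h2).1⟩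

theorem ae_exists_not_chain {t : ℝ} (ht : 0 ≤ t) :
    ∀ᵐ ω ∂(sampleMeasure t), ∀ u, ∃ m, ¬ Chain t m (shiftBy u ω) (t + 1) := by
  rw [ae_all_iff]; intro u
  refine (measurePreserving_shiftBy t u).quasiMeasurePreserving.ae
    (p := fun ω => ∃ m, ¬ Chain t m ω (t + 1)) ?_
  rcases ht.eq_or_lt with rfl | ht
  · filter_upwards [ae_numKids_zero []] with ω hω
    refine ⟨1, ?_⟩
    rintro ⟨j, hj, -⟩
    rw [numKids, hω] at hj
    omega
  · exact ae_exists_not_chain_of_pos ht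

theorem ae_label_ne {t : ℝ} (ht : 0 ≤ t) : ∀ᵐ ω ∂(sampleMeasure t), ∀ u v : List ℕ, ∀ i j,
    u ++ [i] ≠ v ++ [j] → i < (ω u).1 →
      t * ((ω (u ++ [i])).2 : ℝ) ≠ t * ((ω (v ++ [j])).2 : ℝ) := by
  rcases ht.eq_or_lt with rfl | ht
  · filter_upwards [ae_all_iff.2 ae_numKids_zero] with ω hω u v i j _ hi
    rw [hω u] at hi
    omega
  · filter_upwards [ae_marks_distinct t] with ω hω u v i j huv _ h
    exact hω _ _ huv (Subtype.ext (mul_left_cancel₀ ht.ne' h))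

theorem ae_nice {t : ℝ} (ht : 0 ≤ t) : ∀ᵐ ω ∂(sampleMeasure t), Nice t ω := by
  filter_upwards [ae_exists_not_chain ht, ae_label_ne ht] with ω hc hd
  have hsib : SibDistinct t ω := by
    intro u i hi j hj hij
    by_contra hne
    refine hd u u i j (by simpa using hne) ?_ hij
    simpa [numKids, shiftBy] using hi
  refine ⟨⟨isLocallyFiniteTree_treeInf t ω, ?_, wellFounded_treeInf ht hsib hc⟩, hsib, hc⟩
  intro p q a hp hq
  obtain ⟨u, i, hi, rfl, ha⟩ := exists_mark hp
  obtain ⟨v, j, hj, rfl, hb⟩ := exists_mark hq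
  by_cases h : u ++ [i] = v ++ [j]
  · rw [(List.append_inj' h rfl).1]
  · exact absurd (ha.symm.trans hb) (hd u v i j h hi)

theorem ae_labelFree {t : ℝ} (ht : 0 ≤ t) (y : ℝ) :
    ∀ᵐ ω ∂(sampleMeasure t), LabelFree y (treeInf t ω) := by
  rcases ht.eq_or_lt with rfl | ht
  · filter_upwards [ae_all_iff.2 ae_numKids_zero] with ω hω p hp
    obtain ⟨u, i, hi, -⟩ := exists_mark hp
    rw [hω u] at hi
    omega
  · by_cases hy : y / t ∈ I
    · filter_upwards [ae_all_iff.2 fun u => ae_mark_ne t u ⟨_, hy⟩] with ω hω p hp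
      obtain ⟨u, i, hi, -, h⟩ := exists_mark hp
      refine hω (u ++ [i]) (Subtype.ext ?_)
      exact (eq_div_iff ht.ne').2 ((mul_comm _ _).trans h.symm)
    · refine Filter.Eventually.of_forall fun ω p hp => hy ?_
      have := label_mem_treeInf ht.le hp
      exact ⟨div_nonneg this.1 ht.le, div_le_one_of_le₀ this.2 ht.le⟩

/-- The two trees have no label in common. -/
def LabelDisjoint (T T' : LTree) : Prop := ∀ p q b, p ++ [b] ∈ T.pts → q ++ [b] ∉ T'.pts

theorem ae_labelDisjoint {t : ℝ} (ht : 0 ≤ t) : ∀ᵐ ω ∂((sampleMeasure t).prod (sampleMeasure t)),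
    LabelDisjoint (treeInf t ω.1) (treeInf t ω.2) := by
  rcases ht.eq_or_lt with rfl | ht
  · filter_upwards [Measure.quasiMeasurePreserving_fst.ae (ae_all_iff.2 ae_numKids_zero)]
      with ω hω p q b hp
    obtain ⟨u, i, hi, -⟩ := exists_mark hp
    rw [hω u] at hi
    omega
  · filter_upwards [ae_marks_disjoint t] with ω hω p q b hp hq
    obtain ⟨u, i, hi, -, h⟩ := exists_mark hp
    obtain ⟨v, j, hj, -, h'⟩ := exists_mark hq
    exact hω _ _ (Subtype.ext (mul_left_cancel₀ ht.ne' (h.symm.trans h')))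

/-- The prescribed labels `x j` are deterministic and distinct, the marks have a diffuse law, and
independent trees almost surely share no label. These facts exclude every possible coincidence. -/
theorem ae_rootNice_with {t : ℝ} (ht : 0 ≤ t) {i : ℕ} {x : Fin i → ℝ} (hx : Function.Injective x)
    (hxt : ∀ j, x j ∈ Icc 0 t) : ∀ᵐ ω ∂(sampleMeasureWith i t),
      RootNice t (Finset.univ.disjSum (Finset.range (numKids ω.1))) (Sum.elim x (lab t ω.1))
        (Sum.elim ω.2 (shift ω.1)) := by
  have hfst : ∀ {p : Sample → Prop}, (∀ᵐ ω ∂(sampleMeasure t), p ω) →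
      ∀ᵐ ω ∂(sampleMeasureWith i t), p ω.1 := fun h => Measure.quasiMeasurePreserving_fst.ae h
  have hsnd : ∀ (j : Fin i) {p : Sample → Prop}, (∀ᵐ ω ∂(sampleMeasure t), p ω) →
      ∀ᵐ ω ∂(sampleMeasureWith i t), p (ω.2 j) := fun j p h =>
    Measure.quasiMeasurePreserving_snd.ae
      ((measurePreserving_eval (fun _ : Fin i => sampleMeasure t) j).quasiMeasurePreserving.ae h)
  have h12 : ∀ j : Fin i, ∀ᵐ ω ∂(sampleMeasureWith i t),
      LabelDisjoint (treeInf t ω.1) (treeInf t (ω.2 j)) := fun j =>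
    ((MeasurePreserving.id (sampleMeasure t)).prod
      (measurePreserving_eval (fun _ : Fin i => sampleMeasure t) j)).quasiMeasurePreserving.ae
      (ae_labelDisjoint ht)
  have h22 : ∀ j l : Fin i, ∀ᵐ ω ∂(sampleMeasureWith i t), j ≠ l →
      LabelDisjoint (treeInf t (ω.2 j)) (treeInf t (ω.2 l)) := by
    intro j l
    by_cases hjl : j = l
    · exact Filter.Eventually.of_forall fun _ h => absurd hjl h
    have hp : MeasurePreserving (fun c : Fin i → Sample => (c j, c l))
        (Measure.pi fun _ => sampleMeasure t) ((sampleMeasure t).prod (sampleMeasure t)) :=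
      ⟨by fun_prop, by rw [← Measure.infinitePi_eq_pi]; exact Measure.infinitePi_map_eval_prod hjl⟩
    have := (Measure.quasiMeasurePreserving_snd (μ := sampleMeasure t)).ae
      (hp.quasiMeasurePreserving.ae (ae_labelDisjoint ht))
    filter_upwards [this] with ω hω _ using hω
  filter_upwards [hfst (ae_nice ht), ae_all_iff.2 fun j => hsnd j (ae_nice ht),
    ae_all_iff.2 fun j => hfst (ae_labelFree ht (x j)),
    ae_all_iff.2 fun l => ae_all_iff.2 fun j => hsnd l (ae_labelFree ht (x j)),
    ae_all_iff.2 h12, ae_all_iff.2 fun j => ae_all_iff.2 fun l => h22 j l]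
    with ω hn1 hn2 hf1 hf2 hd1 hd2
  have hr := hn1.rootNice ht
  have hsub : ∀ {j : ℕ} {p : List ℝ} {b : ℝ}, j < numKids ω.1 →
      p ++ [b] ∈ (treeInf t (shift ω.1 j)).pts → (lab t ω.1 j :: p) ++ [b] ∈ (treeInf t ω.1).pts := by
    intro j p b hj h
    rw [treeInf_eq_graft t ω.1]
    exact cons_mem_graft.2 ⟨j, by simpa using hj, rfl, h⟩
  refine ⟨?_, ?_, ?_, ?_, ?_⟩
  · rintro (j | j) hj (l | l) hl h
    · rw [hx h]
    · have h' : x j = lab t ω.1 l := h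
      exact absurd (h' ▸ lab_mem_treeInf (by simpa using hl)) (hf1 j [])
    · have h' : lab t ω.1 j = x l := h
      exact absurd (h' ▸ lab_mem_treeInf (by simpa using hj)) (hf1 l [])
    · rw [hr.inj (by simpa using hj) (by simpa using hl) h]
  · rintro (j | j) hj
    · exact hxt j
    · exact lab_mem ht _ _
  · rintro (j | j) hj
    · exact hn2 j
    · exact hn1.shift (by simpa using hj)
  · rintro (j | j) hj (l | l) hl
    · exact hf2 l j
    · exact fun p hp => hf1 j _ (hsub (by simpa using hl) hp)
    · exact fun p hp => hd1 l [] p _ (lab_mem_treeInf (by simpa using hj)) hp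
    · exact hn1.labelFree (by simpa using hj) (by simpa using hl)
  · rintro (j | j) hj (l | l) hl p q b hp hq
    · by_contra hne
      exact hd2 j l (fun h => hne (by rw [h])) p q b hp hq
    · exact absurd hp (hd1 j _ p b (hsub (by simpa using hl) hq))
    · exact absurd hq (hd1 l _ q b (hsub (by simpa using hj) hp))
    · rw [hr.cross j (by simpa using hj) l (by simpa using hl) p q b hp hq]

theorem ae_labelFree_with {t : ℝ} (ht : 0 ≤ t) {i : ℕ} {x : Fin i → ℝ} {y : ℝ}
    (hxy : ∀ j, x j ≠ y) : ∀ᵐ ω ∂(sampleMeasureWith i t), LabelFree y (treeInfWith t x ω) := by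
  have hsnd : ∀ (j : Fin i), ∀ᵐ ω ∂(sampleMeasureWith i t), LabelFree y (treeInf t (ω.2 j)) :=
    fun j => Measure.quasiMeasurePreserving_snd.ae
      ((measurePreserving_eval (fun _ : Fin i => sampleMeasure t) j).quasiMeasurePreserving.ae
      (ae_labelFree ht y))
  have hfst : ∀ᵐ ω ∂(sampleMeasureWith i t), LabelFree y (treeInf t ω.1) :=
    Measure.quasiMeasurePreserving_fst.ae (ae_labelFree ht y)
  filter_upwards [hfst, ae_all_iff.2 hsnd] with ω h1 h2 p hp
  rcases hp with hp | ⟨j, q, hq, h⟩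
  · exact h1 p hp
  · cases p with
    | nil => exact hxy j (List.cons.inj h).1.symm
    | cons c p =>
      obtain ⟨-, rfl⟩ := List.cons.inj h
      exact h2 j p hq

end ForbiddenDegree
end

noncomputable section

namespace ForbiddenDegree

/-! ### Measurability of the statuses of the edges -/

theorem measurable_le_prop {α : Type*} [MeasurableSpace α] {f g : α → ℝ} (hf : Measurable f)
    (hg : Measurable g) : Measurable fun x => f x ≤ g x :=
  measurableSet_setOfPred.1 (measurableSet_le hf hg)

theorem measurable_prop_comp {α β : Type*} [MeasurableSpace α] [MeasurableSpace β] [Countable β]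
    [MeasurableSingletonClass β] {N : α → β} (hN : Measurable N) {Q : β → α → Prop}
    (hQ : ∀ n, Measurable (Q n)) : Measurable fun x => Q (N x) x := by
  have : Measurable fun p : β × α => Q p.1 p.2 := measurable_from_prod_countable_right hQ
  exact this.comp (hN.prodMk measurable_id)

/-- A lower bound on a cardinality becomes a quantifier over finite sets, which is countable and
hence harmless for measurability. -/
theorem le_one_add_encard_iff {κ : Type*} {k : ℕ} {E : Finset κ} {P : κ → Prop} :
    (k : ℕ∞) ≤ 1 + {j | j ∈ E ∧ P j}.encard ↔
      ∃ F : Finset κ, k ≤ 1 + F.card ∧ ∀ j ∈ F, j ∈ E ∧ P j := by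
  have hfin : {j | j ∈ E ∧ P j}.Finite := E.finite_toSet.subset fun j hj => hj.1
  constructor
  · intro h
    refine ⟨hfin.toFinset, ?_, fun j hj => by simpa using hj⟩
    rw [hfin.encard_eq_coe_toFinset_card] at h
    exact_mod_cast h
  · rintro ⟨F, h, hF⟩
    have : (F : Set κ).encard ≤ {j | j ∈ E ∧ P j}.encard := encard_le_encard fun j hj => hF j hj
    rw [encard_coe_eq_coe_finsetCard] at this
    refine le_trans ?_ (add_le_add_right this 1)
    exact_mod_cast h

section

variable {α κ : Type*} [MeasurableSpace α] [Countable κ]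

/-- `Kept` involves only countable quantifiers and comparisons of labels. The hypothesis on `p` is
stated along measurable random times because `p` is evaluated at the labels. -/
theorem measurable_kept (k : ℕ) (E : Finset κ) {a : α → κ → ℝ} {p : α → κ → ℝ → Prop} {s : α → ℝ}
    (ha : ∀ j, Measurable fun x => a x j)
    (hp : ∀ j (g : α → ℝ), Measurable g → Measurable fun x => p x j (g x)) (hs : Measurable s)
    (j : κ) : Measurable fun x => Kept k E (a x) (p x) (s x) j := by
  have hbar : ∀ (j : κ) (β : Finset κ) (s : α → ℝ), Measurable s →
      Measurable fun x => ∀ i ∈ E, a x j ≤ a x i → a x i < s x → i ∉ β := fun j β s hs =>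
    Measurable.forall fun i => measurable_const.imp ((measurable_le_prop (ha j) (ha i)).imp
      ((measurable_lt_prop (ha i) hs).imp measurable_const))
  refine measurable_const.and ((hp j s hs).and (Measurable.exists fun β => Measurable.and ?_
    (hbar j β s hs)))
  refine Measurable.forall fun i => measurable_const.imp (measurable_const.iff ?_)
  simp only [le_one_add_encard_iff]
  exact Measurable.exists fun F => measurable_const.and (Measurable.forall fun j =>
    measurable_const.imp (measurable_const.and ((measurable_lt_prop (ha j) (ha i)).and
    ((hp j _ (ha i)).and (hbar j β _ (ha i))))))

theorem measurable_rootKept (k : ℕ) (E : Finset κ) {y : α → ℝ} {a : α → κ → ℝ}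
    {q : α → κ → ℝ → Prop} {s : α → ℝ} (hy : Measurable y) (ha : ∀ j, Measurable fun x => a x j)
    (hq : ∀ j (g : α → ℝ), Measurable g → Measurable fun x => q x j (g x)) (hs : Measurable s)
    (o : Option κ) : Measurable fun x => RootKept k (y x) E (a x) (q x) (s x) o := by
  refine measurable_kept k _ (a := fun x => labs (y x) (a x)) (p := fun x => pres (q x)) ?_ ?_ hs o
  · rintro (_ | j)
    exacts [hy, ha j]
  · rintro (_ | j) g hg
    exacts [measurable_const, hq j g hg]

variable {k : ℕ} {t : ℝ} {f : α → Sample} {y s : α → ℝ}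

theorem measurable_ahat {n : ℕ} (hf : Measurable f) (hy : Measurable y) (hs : Measurable s) :
    Measurable fun x => Ahat k t n (y x) (f x) (s x) := by
  induction n generalizing f y s with
  | zero => exact measurable_const
  | succ n ih =>
    refine measurable_prop_comp (Q := fun m x => RootKept k (y x) (Finset.range m) (lab t (f x))
      (fun j b => Ahat k t n (lab t (f x) j) (shift (f x) j) b) (s x) none)
      (measurable_numKids.comp hf) fun m => ?_
    exact measurable_rootKept k _ hy (fun j => (measurable_lab t j).comp hf) (fun j g hg =>
      ih ((measurable_shift j).comp hf) ((measurable_lab t j).comp hf) hg) hs none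

theorem measurable_alive (hf : Measurable f) (hy : Measurable y) (hs : Measurable s) :
    Measurable fun x => Alive k t (y x) (f x) (s x) := by
  simp only [Alive, Filter.eventually_atTop]
  exact Measurable.exists fun N => Measurable.forall fun n => measurable_const.imp
    (measurable_ahat hf hy hs)

theorem measurable_rootModel (E : Finset κ) {a : α → κ → ℝ} {c : α → κ → Sample}
    (hy : Measurable y) (ha : ∀ j, Measurable fun x => a x j) (hc : ∀ j, Measurable fun x => c x j)
    (o : Option κ) : Measurable fun x => RootModel k t (y x) E (a x) (c x) o :=
  measurable_rootKept k E hy ha (fun j _ hg => measurable_alive (hc j) (ha j) hg)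
    measurable_const o

/-- The status of an edge at the root of the Galton–Watson tree. -/
def RootEdge (k : ℕ) (t y : ℝ) (ω : Sample) (o : Option ℕ) : Prop :=
  RootModel k t y (Finset.range (numKids ω)) (lab t ω) (shift ω) o

theorem measurable_rootEdge (hf : Measurable f) (hy : Measurable y) (o : Option ℕ) :
    Measurable fun x => RootEdge k t (y x) (f x) o :=
  measurable_prop_comp (Q := fun m x => RootModel k t (y x) (Finset.range m) (lab t (f x))
    (shift (f x)) o) (measurable_numKids.comp hf) fun _ =>
    measurable_rootModel _ hy (fun j => (measurable_lab t j).comp hf)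
      (fun j => (measurable_shift j).comp hf) o

theorem kNode_cons {y : ℝ} {ω : Sample} {j : ℕ} {u : List ℕ} : KNode k t y ω (j :: u) ↔
    RootEdge k t y ω (some j) ∧ KNode k t (lab t ω j) (shift ω j) u := Iff.rfl

theorem measurable_kNode (hf : Measurable f) (hy : Measurable y) (u : List ℕ) :
    Measurable fun x => KNode k t (y x) (f x) u := by
  induction u generalizing f y with
  | nil => exact measurable_const
  | cons j u ih =>
    exact (measurable_rootEdge hf hy (some j)).and
      (ih ((measurable_shift j).comp hf) ((measurable_lab t j).comp hf))

/-! ### Measurability of words and of configurations -/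

theorem measurable_ofFn {β : Type*} [MeasurableSpace β] (n : ℕ) :
    Measurable fun x : Fin n → β => List.ofFn x :=
  fun _ hA => (MeasurableSpace.measurableSet_iInf.1 hA) n

theorem measurable_of_list {β γ : Type*} [MeasurableSpace β] [MeasurableSpace γ] {g : List β → γ}
    (hg : ∀ n, Measurable fun x : Fin n → β => g (List.ofFn x)) : Measurable g :=
  fun _ hA => MeasurableSpace.measurableSet_iInf.2 fun n => hg n hA

theorem path_eq_ofFn (t : ℝ) (ω : Sample) (u : List ℕ) : path t ω u =
    List.ofFn fun i : Fin u.length => t * ((ω (u.take (i + 1))).2 : ℝ) := by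
  induction u generalizing ω with
  | nil => rfl
  | cons j u ih =>
    rw [path, ih]
    simp only [List.length_cons, List.ofFn_succ]
    rfl

theorem measurable_path (hf : Measurable f) (u : List ℕ) : Measurable fun x => path t (f x) u := by
  simp only [path_eq_ofFn]
  refine (measurable_ofFn u.length).comp (measurable_pi_iff.2 fun i => ?_)
  exact (measurable_subtype_coe.comp ((measurable_pi_apply _).comp hf).snd).const_mul t

theorem measurable_path_eq {f' : α → Sample} (hf : Measurable f) (hf' : Measurable f')
    (u v : List ℕ) : Measurable fun x => path t (f x) u = path t (f' x) v := by
  induction u generalizing f f' v with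
  | nil =>
    cases v with
    | nil => simp only [path]; exact measurable_const
    | cons j v => simp only [path, reduceCtorEq]; exact measurable_const
  | cons i u ih =>
    cases v with
    | nil => simp only [path, reduceCtorEq]; exact measurable_const
    | cons j v =>
      simp only [path, List.cons.injEq]
      exact (measurableSet_setOfPred.1 (measurableSet_eq_fun ((measurable_lab t i).comp hf)
        ((measurable_lab t j).comp hf'))).and
        (ih ((measurable_shift i).comp hf) ((measurable_shift j).comp hf') v)

theorem natCast_le_encard_iff {β : Type*} {S : Set β} {m : ℕ} :
    (m : ℕ∞) ≤ S.encard ↔ ∃ F : Finset β, F.card = m ∧ ↑F ⊆ S := by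
  constructor
  · intro h
    obtain ⟨T, hT, hm⟩ := exists_subset_encard_eq h
    have hfin : T.Finite := finite_of_encard_eq_coe hm
    refine ⟨hfin.toFinset, ?_, by simpa using hT⟩
    rw [hfin.encard_eq_coe_toFinset_card] at hm
    exact_mod_cast hm
  · rintro ⟨F, rfl, h⟩
    rw [← encard_coe_eq_coe_finsetCard]
    exact encard_le_encard h

theorem measurable_enat {g : α → ℕ∞} (h : ∀ m : ℕ, Measurable fun x => (m : ℕ∞) ≤ g x) :
    Measurable g := by
  refine ENat.measurable_iff.2 fun m => ?_
  have : g ⁻¹' {(m : ℕ∞)} = {x | (m : ℕ∞) ≤ g x ∧ ¬ ((m + 1 : ℕ) : ℕ∞) ≤ g x} := by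
    ext x
    simp only [mem_preimage, mem_singleton_iff, mem_ofPred_eq, not_le]
    constructor
    · intro h
      rw [h]
      exact ⟨le_rfl, by exact_mod_cast Nat.lt_succ_self m⟩
    · rintro ⟨h1, h2⟩
      rw [Nat.cast_add, Nat.cast_one] at h2
      exact le_antisymm (Order.le_of_lt_add_one h2) h1
  rw [this]
  exact measurableSet_setOfPred.2 ((h m).and (h (m + 1)).not)

theorem measurable_config_iff {γ β : Type*} [MeasurableSpace γ] [MeasurableSpace β]
    {F : γ → Config β} : Measurable F ↔
      ∀ A, MeasurableSet A → Measurable fun x => ((F x).pts ∩ A).encard := by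
  rw [measurable_iff_comap_le, configMeasurableSpace, MeasurableSpace.comap_iSup, iSup_le_iff]
  simp only [MeasurableSpace.comap_comp, Subtype.forall]
  exact forall₂_congr fun A _ => measurable_iff_comap_le.symm

theorem measurable_encard {β : Type*} [MeasurableSpace β] {A : Set β} (hA : MeasurableSet A) :
    Measurable fun X : Config β => (X.pts ∩ A).encard := measurable_config_iff.1 measurable_id A hA

/-- There are at least `m` points in `A` when `m` indices have pairwise distinct images in `A`. The
hypothesis `hgg` is needed since points are counted without multiplicity. -/
theorem measurable_config {ι β : Type*} [Countable ι] [MeasurableSpace β] {P : α → ι → Prop}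
    {g : ι → α → β} (hP : ∀ i, Measurable fun x => P x i) (hg : ∀ i, Measurable (g i))
    (hgg : ∀ i j, Measurable fun x => g i x = g j x) :
    Measurable fun x => (⟨(fun i => g i x) '' {i | P x i}⟩ : Config β) := by
  classical
  refine measurable_config_iff.2 fun A hA => measurable_enat fun m => ?_
  have : ∀ x, ((m : ℕ∞) ≤ ((fun i => g i x) '' {i | P x i} ∩ A).encard ↔
      ∃ U : Finset ι, U.card = m ∧ ∀ i, i ∈ U → P x i ∧ g i x ∈ A ∧
        ∀ j, j ∈ U → ¬ i = j → ¬ g i x = g j x) := by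
    intro x
    rw [natCast_le_encard_iff]
    constructor
    · rintro ⟨F, rfl, hF⟩
      have : ∀ b : F, ∃ i, P x i ∧ g i x = b := fun b => (hF b.2).1
      choose c hc hcb using this
      have hinj : Function.Injective c := fun a b h => by
        rw [← Subtype.coe_inj, ← hcb, ← hcb, h]
      refine ⟨Finset.univ.image c, ?_, ?_⟩
      · rw [Finset.card_image_of_injective _ hinj, Finset.card_univ, Fintype.card_coe]
      · intro i hi
        obtain ⟨b, -, rfl⟩ := Finset.mem_image.1 hi
        refine ⟨hc b, by rw [hcb]; exact (hF b.2).2, fun j hj hne h => ?_⟩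
        obtain ⟨b', -, rfl⟩ := Finset.mem_image.1 hj
        rw [hcb, hcb, Subtype.coe_inj] at h
        exact hne (by rw [h])
    · rintro ⟨U, rfl, hU⟩
      refine ⟨U.image fun i => g i x, Finset.card_image_of_injOn fun i hi j hj h => ?_, ?_⟩
      · by_contra hne
        exact (hU i hi).2.2 j hj hne h
      · intro b hb
        obtain ⟨i, hi, rfl⟩ := Finset.mem_image.1 hb
        exact ⟨⟨i, (hU i hi).1, rfl⟩, (hU i hi).2.1⟩
  simp only [this]
  exact Measurable.exists fun U => measurable_const.and (Measurable.forall fun i =>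
    measurable_const.imp ((hP i).and ((measurableSet_setOfPred.1 ((hg i) hA)).and
    (Measurable.forall fun j => measurable_const.imp (measurable_const.imp (hgg i j).not)))))

theorem measurable_treeHat (hf : Measurable f) (hy : Measurable y) :
    Measurable fun x => treeHat k t (y x) (f x) :=
  measurable_config (fun u => measurable_kNode hf hy u) (fun u => measurable_path hf u)
    fun u v => measurable_path_eq hf hf u v

end

theorem measurableSet_list {β : Type*} [MeasurableSpace β] {A : Set (List β)}
    (h : ∀ n, MeasurableSet ((fun x : Fin n → β => List.ofFn x) ⁻¹' A)) : MeasurableSet A :=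
  MeasurableSpace.measurableSet_iInf.2 h

theorem measurable_rootLabels : Measurable rootLabels := by
  refine measurable_config_iff.2 fun A hA => ?_
  have hm : MeasurableSet ((fun a : ℝ => [a]) '' A) := by
    refine measurableSet_list fun n => ?_
    rcases n with _ | _ | n
    · convert MeasurableSet.empty
      ext x
      simp
    · convert (show Measurable fun x : Fin 1 → ℝ => x 0 from measurable_pi_apply 0) hA
      ext x
      simp [List.ofFn_succ]
    · convert MeasurableSet.empty
      ext x
      simp [List.ofFn_succ]
  convert! measurable_encard hm using 2 with T
  have : T.pts ∩ (fun a : ℝ => [a]) '' A = (fun a : ℝ => [a]) '' ((rootLabels T).pts ∩ A) := by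
    ext p
    constructor
    · rintro ⟨h, a, ha, rfl⟩; exact ⟨a, ⟨h, ha⟩, rfl⟩
    · rintro ⟨a, ⟨h, ha⟩, rfl⟩; exact ⟨h, a, ha, rfl⟩
  rw [this, Function.Injective.encard_image]
  exact fun a b h => (List.cons.inj h).1

theorem measurable_truncate (n : ℕ) : Measurable (truncate n) := by
  refine measurable_config_iff.2 fun A hA => ?_
  have hm : MeasurableSet ({p : List ℝ | p.length ≤ n}) := by
    refine measurableSet_list fun m => ?_
    simp
  convert! measurable_encard (hm.inter hA) using 2 with T
  rw [truncate, ← inter_assoc]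
  rfl

theorem measurable_vertexType (y : ℝ) : Measurable (vertexType y) := by
  refine measurable_of_list fun n => ?_
  rcases n with _ | n
  · simp only [vertexType, List.ofFn_zero]
    exact measurable_const
  · convert measurable_pi_apply (Fin.last n) with x
    rw [vertexType, List.ofFn_succ', List.concat_eq_append]
    simp

/-! ### The increasing enumeration of a finite configuration -/

/-- The `j`-th smallest point of a configuration of `i` points. -/
def orderStat (i : ℕ) (X : {X : Config ℝ // X.pts.encard = i}) : Fin i → ℝ :=
  (finite_of_encard_eq_coe X.2).toFinset.orderEmbOfFin (by
    have h := X.2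
    rw [(finite_of_encard_eq_coe X.2).encard_eq_coe_toFinset_card] at h
    exact_mod_cast h)

theorem strictMono_orderStat {i : ℕ} (X : {X : Config ℝ // X.pts.encard = i}) :
    StrictMono (orderStat i X) := OrderEmbedding.strictMono _

theorem range_orderStat {i : ℕ} (X : {X : Config ℝ // X.pts.encard = i}) :
    range (orderStat i X) = X.1.pts := by
  rw [orderStat, Finset.range_orderEmbOfFin, Finite.coe_toFinset]

/-- Indices start at zero, so the point of rank `j` is at most `r` when at least `j + 1` points are.
This expresses the order statistics by counting variables. -/
theorem encard_range_inter_Iic {i : ℕ} {x : Fin i → ℝ} (hx : StrictMono x) (j : Fin i) (r : ℝ) :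
    x j ≤ r ↔ ((j + 1 : ℕ) : ℕ∞) ≤ (range x ∩ Iic r).encard := by
  constructor
  · intro h
    rw [natCast_le_encard_iff]
    refine ⟨(Finset.Iic j).map ⟨x, hx.injective⟩, by simp, ?_⟩
    intro b hb
    simp only [Finset.coe_map, Function.Embedding.coeFn_mk, Finset.coe_Iic] at hb
    obtain ⟨l, hl, rfl⟩ := hb
    exact ⟨⟨l, rfl⟩, (hx.monotone hl).trans h⟩
  · intro h
    by_contra! hr
    have : range x ∩ Iic r ⊆ ((Finset.Iio j).map ⟨x, hx.injective⟩ : Finset ℝ) := by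
      rintro _ ⟨⟨l, rfl⟩, hl⟩
      simp only [Finset.coe_map, Function.Embedding.coeFn_mk, Finset.coe_Iio]
      exact ⟨l, hx.lt_iff_lt.1 (lt_of_le_of_lt hl hr), rfl⟩
    have h2 := h.trans (encard_le_encard this)
    rw [encard_coe_eq_coe_finsetCard, Finset.card_map, Fin.card_Iio] at h2
    have : (j : ℕ) + 1 ≤ j := by exact_mod_cast h2
    omega

theorem measurable_orderStat (i : ℕ) : Measurable (orderStat i) := by
  refine measurable_pi_iff.2 fun j => measurable_of_Iic fun r => ?_
  have : (fun X => orderStat i X j) ⁻¹' Iic r = {X | ((j + 1 : ℕ) : ℕ∞) ≤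
      (X.1.pts ∩ Iic r).encard} := by
    ext X
    rw [mem_ofPred_eq, ← range_orderStat X]
    exact encard_range_inter_Iic (strictMono_orderStat X) j r
  rw [this]
  exact ((measurable_encard measurableSet_Iic).comp measurable_subtype_coe)
    (MeasurableSet.of_discrete (s := Ici ((j + 1 : ℕ) : ℕ∞)))

theorem measurableSet_enumeration {i : ℕ} {A : Set (Fin i → ℝ)} (hA : MeasurableSet A) :
    MeasurableSet {X : Config ℝ | ∃ x ∈ A, StrictMono x ∧ X.pts = range x} := by
  have hZ : MeasurableSet {X : Config ℝ | X.pts.encard = i} := by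
    have := measurable_encard (β := ℝ) MeasurableSet.univ (measurableSet_singleton (i : ℕ∞))
    simpa [preimage] using this
  have : {X : Config ℝ | ∃ x ∈ A, StrictMono x ∧ X.pts = range x} =
      Subtype.val '' (orderStat i ⁻¹' A) := by
    ext X
    constructor
    · rintro ⟨x, hx, hmono, hX⟩
      have hcard : X.pts.encard = i := by
        rw [hX, ← image_univ, hmono.injective.encard_image]
        simp
      refine ⟨⟨X, hcard⟩, ?_, rfl⟩
      have h := range_orderStat ⟨X, hcard⟩
      rw [hX] at h
      rwa [mem_preimage, (strictMono_orderStat ⟨X, hcard⟩).range_inj hmono |>.1 h]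
    · rintro ⟨⟨X, hcard⟩, hx, rfl⟩
      exact ⟨_, hx, strictMono_orderStat _, (range_orderStat _).symm⟩
  rw [this]
  exact hZ.subtype_image (measurable_orderStat i hA)

end ForbiddenDegree
end

noncomputable section

namespace ForbiddenDegree

/-! ### Regular samples -/

/-- The status of the extra edge of the root is determined by finitely many generations. -/
def AllSure (t : ℝ) (ω : Sample) : Prop := ∀ y s, s ≤ t + 1 → ∃ n, Sure t n y ω s

/-- Every node satisfies `AllSure`. -/
def Reg (t : ℝ) (ω : Sample) : Prop := ∀ u, AllSure t (shiftBy u ω)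

/-- Replacing a subtree may create equal labels and so destroy `Nice`. `Reg` retains only the
finiteness of the dependencies, which survives all replacements. -/
theorem Nice.reg {t : ℝ} {ω : Sample} (h : Nice t ω) : Reg t ω := by
  intro u y s hs
  by_contra! hcon
  obtain ⟨m, hm⟩ := h.chain u
  exact hm ((chain_of_forall_not_sure hcon).mono hs)

theorem ae_reg {t : ℝ} (ht : 0 ≤ t) : ∀ᵐ ω ∂(sampleMeasure t), Reg t ω :=
  (ae_nice ht).mono fun _ h => h.reg

theorem reg_iff {t : ℝ} {ω : Sample} : Reg t ω ↔ AllSure t ω ∧ ∀ j, Reg t (shift ω j) := by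
  constructor
  · exact fun h => ⟨h [], fun j u => h (j :: u)⟩
  · rintro ⟨h1, h2⟩ (_ | ⟨j, u⟩)
    exacts [h1, h2 j u]

theorem Reg.allSure {t : ℝ} {ω : Sample} (h : Reg t ω) : AllSure t ω := h []

/-- A node consults finitely many children at finitely many times, so the largest of the required
depths, plus one, suffices. -/
theorem allSure_of_kids {t : ℝ} {ω : Sample} (h : ∀ j < numKids ω, AllSure t (shift ω j)) :
    AllSure t ω := by
  intro y s hs
  have : ∀ o, ∀ j, ∃ n, j < numKids ω → labs y (lab t ω) o < s →
      Sure t n (lab t ω j) (shift ω j) (labs y (lab t ω) o) := by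
    intro o j
    by_cases hj : j < numKids ω
    · by_cases ho : labs y (lab t ω) o < s
      · obtain ⟨n, hn⟩ := h j hj (lab t ω j) (labs y (lab t ω) o) (ho.le.trans hs)
        exact ⟨n, fun _ _ => hn⟩
      · exact ⟨0, fun _ h => absurd h ho⟩
    · exact ⟨0, fun h => absurd h hj⟩
  choose f hf using this
  refine ⟨(Finset.insertNone (Finset.range (numKids ω))).sup
      (fun o => (Finset.range (numKids ω)).sup (fun j => f o j)) + 1, fun o ho j hj h1 _ => ?_⟩
  refine (hf o j hj h1).mono ?_
  exact (Finset.le_sup (f := fun j => f o j) (Finset.mem_range.2 hj)).trans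
    (Finset.le_sup (f := fun o => (Finset.range (numKids ω)).sup (fun j => f o j)) ho)

section

variable {k : ℕ} {t : ℝ}

theorem rootKept_none_congr {κ : Type*} {E : Finset κ} {a : κ → ℝ} {y s : ℝ}
    {q q' : κ → ℝ → Prop} (h : ∀ o ∈ Finset.insertNone E, labs y a o < s → ∀ j ∈ E,
      a j < labs y a o → (q j (labs y a o) ↔ q' j (labs y a o))) :
    RootKept k y E a q s none ↔ RootKept k y E a q' s none := by
  refine kept_congr (fun _ _ => Iff.rfl) (fun _ _ _ _ _ => Iff.rfl) ?_ ?_ Iff.rfl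
  · rintro o ho hos (_ | j) hj hlt
    · rfl
    · exact h o ho hos j (by simpa using hj) hlt
  · rcases lt_or_ge y s with h | h
    · exact Or.inl h
    · exact Or.inr fun i _ his => ⟨his.trans_le h, his.trans_le h⟩

theorem ahat_iff_of_sure {n m : ℕ} (hnm : n ≤ m) {y : ℝ} {ω : Sample} {s : ℝ}
    (h : Sure t n y ω s) : Ahat k t m y ω s ↔ Ahat k t n y ω s := by
  induction n generalizing m y ω s with
  | zero => exact h.elim
  | succ n ih =>
    obtain ⟨m, rfl⟩ : ∃ m', m = m' + 1 := ⟨m - 1, by omega⟩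
    refine rootKept_none_congr fun o ho hos j hj hlt => ?_
    exact ih (by omega) (h o ho j (by simpa using hj) hos hlt)

theorem alive_iff_of_sure {n : ℕ} {y : ℝ} {ω : Sample} {s : ℝ} (h : Sure t n y ω s) :
    Alive k t y ω s ↔ Ahat k t n y ω s := by
  rw [Alive, Filter.eventually_atTop]
  constructor
  · rintro ⟨N, hN⟩
    exact (ahat_iff_of_sure (le_max_right N n) h).1 (hN _ (le_max_left N n))
  · exact fun hq => ⟨n, fun m hm => (ahat_iff_of_sure hm h).2 hq⟩

/-- `Alive` satisfies the recursion that defines `Ahat`: at depth `n + 1` the truncated statuses of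
the node, and those of its children at depth `n`, have already reached their limits. -/
theorem AllSure.alive_iff {ω : Sample} (h : AllSure t ω) (y : ℝ) :
    Alive k t y ω (t + 1) ↔ RootEdge k t y ω none := by
  obtain ⟨n, hn⟩ := h y (t + 1) le_rfl
  have hn' := hn.mono (Nat.le_succ n)
  rw [alive_iff_of_sure hn']
  refine rootKept_none_congr fun o ho hos j hj hlt => ?_
  exact (alive_iff_of_sure (hn' o ho j (by simpa using hj) hos hlt)).symm

theorem Ahat.anti {n : ℕ} {y : ℝ} {ω : Sample} {b c : ℝ} (hbc : b ≤ c) (h : Ahat k t n y ω c) :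
    Ahat k t n y ω b := by
  cases n with
  | zero => trivial
  | succ n =>
    obtain ⟨h1, -, β, h3, h4⟩ := h
    exact ⟨h1, trivial, β, h3, fun i hi h5 h6 => h4 i hi h5 (h6.trans_le hbc)⟩

theorem Alive.anti {y : ℝ} {ω : Sample} {b c : ℝ} (hbc : b ≤ c) (h : Alive k t y ω c) :
    Alive k t y ω b := h.mono fun _ hn => hn.anti hbc

theorem alive_of_numKids_eq_zero (hk : 2 ≤ k) {y : ℝ} {ω : Sample} (h : numKids ω = 0) (s : ℝ) :
    Alive k t y ω s := by
  refine Filter.Eventually.of_forall fun n => ?_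
  cases n with
  | zero => trivial
  | succ n =>
    refine kept_of_card_lt ?_ (by simp) trivial
    rw [h]
    simp only [Finset.range_zero, Finset.card_insertNone, Finset.card_empty]
    omega

theorem alive_of_lt {y s : ℝ} (hys : s ≤ y) (ω : Sample) : Alive k t y ω s := by
  refine Filter.Eventually.of_forall fun n => ?_
  cases n with
  | zero => trivial
  | succ n =>
    obtain ⟨β, hβ⟩ := exists_sol k (Finset.insertNone (Finset.range (numKids ω)))
      (labs y (lab t ω)) (pres fun j b => Ahat k t n (lab t ω j) (shift ω j) b)
    exact ⟨by simp, trivial, β, hβ, fun i _ h1 h2 => absurd (h2.trans_le (hys.trans h1))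
      (lt_irrefl _)⟩

/-! ### Irrelevance of the mark of the root -/

theorem ahat_setMark (n : ℕ) (y : ℝ) (m : I) (ω : Sample) (s : ℝ) :
    Ahat k t n y (setMark m ω) s ↔ Ahat k t n y ω s := by
  cases n with
  | zero => rfl
  | succ n => simp only [Ahat, numKids_setMark, shift_setMark, funext (lab_setMark t m ω)]

theorem sure_setMark (n : ℕ) (y : ℝ) (m : I) (ω : Sample) (s : ℝ) :
    Sure t n y (setMark m ω) s ↔ Sure t n y ω s := by
  cases n with
  | zero => rfl
  | succ n => simp only [Sure, numKids_setMark, shift_setMark, funext (lab_setMark t m ω)]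

theorem alive_setMark (y : ℝ) (m : I) (ω : Sample) (s : ℝ) :
    Alive k t y (setMark m ω) s ↔ Alive k t y ω s := by simp only [Alive, ahat_setMark]

theorem rootEdge_setMark (y : ℝ) (m : I) (ω : Sample) (o : Option ℕ) :
    RootEdge k t y (setMark m ω) o ↔ RootEdge k t y ω o := by
  simp only [RootEdge, numKids_setMark, funext (lab_setMark t m ω), funext (shift_setMark m ω)]

theorem kNode_setMark (y : ℝ) (m : I) (ω : Sample) (u : List ℕ) :
    KNode k t y (setMark m ω) u ↔ KNode k t y ω u := by
  cases u with
  | nil => rfl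
  | cons j u => simp only [kNode_cons, rootEdge_setMark, lab_setMark, shift_setMark]

theorem path_setMark (m : I) (ω : Sample) (u : List ℕ) :
    path t (setMark m ω) u = path t ω u := by
  cases u with
  | nil => rfl
  | cons j u => simp only [path, lab_setMark, shift_setMark]

theorem treeHat_setMark (y : ℝ) (m : I) (ω : Sample) :
    treeHat k t y (setMark m ω) = treeHat k t y ω := by
  simp only [treeHat, kNode_setMark, funext (path_setMark m ω)]

theorem Reg.setMark {ω : Sample} (h : Reg t ω) (m : I) : Reg t (setMark m ω) := by
  rw [reg_iff] at h ⊢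
  simp only [shift_setMark]
  exact ⟨fun y s hs => (h.1 y s hs).imp fun n hn => (sure_setMark n y m ω s).2 hn, h.2⟩

/-! ### Replacing the subtree of a node -/

/-- The sample `ω` where all that is above the node `u` is replaced by `ω'`. -/
def put : List ℕ → Sample → Sample → Sample
  | [], ω', ω => setMark (ω []).2 ω'
  | j :: u, ω', ω => glue (ω [], Function.update (shift ω) j (put u ω' (shift ω j)))

theorem put_nil_snd (u : List ℕ) (ω' ω : Sample) : (put u ω' ω []).2 = (ω []).2 := by
  cases u with
  | nil => simp [put, setMark]
  | cons j u => rfl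

theorem numKids_put_cons (j : ℕ) (u : List ℕ) (ω' ω : Sample) :
    numKids (put (j :: u) ω' ω) = numKids ω := rfl

theorem shift_put_cons (j : ℕ) (u : List ℕ) (ω' ω : Sample) :
    shift (put (j :: u) ω' ω) = Function.update (shift ω) j (put u ω' (shift ω j)) := rfl

theorem lab_put_cons (j : ℕ) (u : List ℕ) (ω' ω : Sample) :
    lab t (put (j :: u) ω' ω) = lab t ω := by
  funext i
  have h : put (j :: u) ω' ω [i] = shift (put (j :: u) ω' ω) i [] := rfl
  rw [lab, h, shift_put_cons]
  by_cases hij : i = j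
  · subst hij
    rw [Function.update_self, put_nil_snd]
    rfl
  · rw [Function.update_of_ne hij]
    rfl

/-- The replacement keeps the mark of `u`, which labels the edge to its parent. All labels up to the
generation of `u` are therefore unchanged. -/
theorem path_put {u v : List ℕ} (h : v.length ≤ u.length) (ω' ω : Sample) :
    path t (put u ω' ω) v = path t ω v := by
  induction u generalizing v ω with
  | nil =>
    obtain rfl := List.length_eq_zero_iff.1 (Nat.le_zero.1 h)
    rfl
  | cons j u ih =>
    cases v with
    | nil => rfl
    | cons i v =>
      rw [path, path, lab_put_cons, shift_put_cons]
      by_cases hij : i = j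
      · subst hij
        rw [Function.update_self, ih (by simpa using h)]
      · rw [Function.update_of_ne hij]

theorem shiftBy_put_of_ne {u v : List ℕ} (h : v.length = u.length) (huv : v ≠ u)
    (ω' ω : Sample) : shiftBy v (put u ω' ω) = shiftBy v ω := by
  induction u generalizing v ω with
  | nil => exact absurd (List.length_eq_zero_iff.1 h) huv
  | cons j u ih =>
    cases v with
    | nil => simp at h
    | cons i v =>
      change shiftBy v (shift (put (j :: u) ω' ω) i) = shiftBy v (shift ω i)
      rw [shift_put_cons]
      by_cases hij : i = j
      · subst hij
        rw [Function.update_self, ih (by simpa using h) (fun h => huv (by rw [h]))]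
      · rw [Function.update_of_ne hij]

theorem shiftBy_put (u : List ℕ) (ω' ω : Sample) :
    shiftBy u (put u ω' ω) = setMark (ω u).2 ω' := by
  induction u generalizing ω with
  | nil => rfl
  | cons j u ih =>
    change shiftBy u (shift (put (j :: u) ω' ω) j) = _
    rw [shift_put_cons, Function.update_self, ih]
    rfl

theorem put_put (u : List ℕ) (ω'' ω' ω : Sample) : put u ω'' (put u ω' ω) = put u ω'' ω := by
  induction u generalizing ω with
  | nil => simp [put, setMark]
  | cons j u ih =>
    rw [put, shift_put_cons, Function.update_self, ih, Function.update_idem]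
    rfl

/-- Only the ancestors of `u` need an argument, and `allSure_of_kids` carries the property from `u`
down to the root. -/
theorem Reg.put {ω ω' : Sample} (h : Reg t ω) (h' : Reg t ω') (u : List ℕ) :
    Reg t (ForbiddenDegree.put u ω' ω) := by
  induction u generalizing ω with
  | nil => exact h'.setMark _
  | cons j u ih =>
    have hs : ∀ i, Reg t (shift (ForbiddenDegree.put (j :: u) ω' ω) i) := by
      intro i
      rw [shift_put_cons]
      by_cases hij : i = j
      · subst hij
        rw [Function.update_self]
        exact ih ((reg_iff.1 h).2 i)
      · rw [Function.update_of_ne hij]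
        exact (reg_iff.1 h).2 i
    exact reg_iff.2 ⟨allSure_of_kids fun i _ => (hs i).allSure, hs⟩

theorem measurable_put (u : List ℕ) : Measurable fun p : Sample × Sample => put u p.1 p.2 := by
  induction u with
  | nil =>
    exact measurable_setMark.comp (((measurable_pi_apply _).comp measurable_snd).snd.prodMk
      measurable_fst)
  | cons j u ih =>
    have h1 : Measurable fun p : Sample × Sample => shift p.2 :=
      measurable_pi_iff.2 fun i => (measurable_shift i).comp measurable_snd
    have h2 : Measurable fun p : Sample × Sample => put u p.1 (shift p.2 j) :=
      ih.comp (measurable_fst.prodMk ((measurable_shift j).comp measurable_snd))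
    exact measurable_glue.comp (((measurable_pi_apply _).comp measurable_snd).prodMk
      ((measurable_update₂ j).comp (h1.prodMk h2)))

/-- What lies above `u` is independent of the rest, so drawing it anew preserves the law. The
induction resamples the tree of one child of the root at each step. -/
theorem lintegral_put (t : ℝ) (u : List ℕ) {f : Sample → ℝ≥0∞} (hf : Measurable f) :
    ∫⁻ ω, f ω ∂(sampleMeasure t) =
      ∫⁻ ω, ∫⁻ ω', f (put u ω' ω) ∂(sampleMeasure t) ∂(sampleMeasure t) := by
  have hput : ∀ (u : List ℕ) {f : Sample → ℝ≥0∞}, Measurable f →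
      Measurable fun ω => ∫⁻ ω', f (put u ω' ω) ∂(sampleMeasure t) := by
    intro u f hf
    exact Measurable.lintegral_prod_right' (f := fun p : Sample × Sample => f (put u p.2 p.1))
      (hf.comp ((measurable_put u).comp measurable_swap))
  induction u generalizing f with
  | nil =>
    have h := measurePreserving_setMark t
    have h2 : Measurable fun q : I × Sample => f (setMark q.1 q.2) := hf.comp measurable_setMark
    have h3 : Measurable fun m : I => ∫⁻ ω', f (setMark m ω') ∂(sampleMeasure t) :=
      Measurable.lintegral_prod_right' (f := fun q : I × Sample => f (setMark q.1 q.2)) h2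
    rw [← h.lintegral_comp hf, lintegral_prod (fun q : I × Sample => f (setMark q.1 q.2))
      h2.aemeasurable]
    have h4 : MeasurePreserving (fun ω : Sample => (ω []).2) (sampleMeasure t) volume := by
      refine ⟨(measurable_pi_apply _).snd, ?_⟩
      have h5 := (measurePreserving_eval_infinitePi (fun _ : List ℕ => nodeMeasure t) []).map_eq
      have h6 : (sampleMeasure t).map (fun ω : Sample => (ω []).2) =
          ((sampleMeasure t).map (Function.eval [])).map Prod.snd :=
        (Measure.map_map measurable_snd (measurable_pi_apply _)).symm
      rw [h6, sampleMeasure, h5]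
      exact Measure.snd_prod
    exact (h4.lintegral_comp h3).symm
  | cons j u ih =>
    have hg := measurePreserving_glue (nodeMeasure t)
    have key : ∀ {f : Sample → ℝ≥0∞}, Measurable f → ∫⁻ ω, f ω ∂(sampleMeasure t) =
        ∫⁻ x, ∫⁻ c, ∫⁻ ω, f (glue (x, Function.update c j ω)) ∂(sampleMeasure t)
          ∂(Measure.infinitePi fun _ : ℕ => sampleMeasure t) ∂(nodeMeasure t) := by
      intro f hf
      have h1 := hg.lintegral_comp hf
      rw [sampleMeasure, ← h1, lintegral_prod (fun q => f (glue q))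
        (hf.comp measurable_glue).aemeasurable]
      refine lintegral_congr fun x => ?_
      exact lintegral_update (sampleMeasure t) j (f := fun c => f (glue (x, c)))
        (hf.comp (measurable_glue.comp (measurable_const.prodMk measurable_id)))
    rw [key hf, key (hput (j :: u) hf)]
    refine lintegral_congr fun x => lintegral_congr fun c => ?_
    rw [ih (f := fun ω => f (glue (x, Function.update c j ω)))
      (hf.comp (measurable_glue.comp (measurable_const.prodMk
        ((measurable_update₂ j).comp (measurable_const.prodMk measurable_id)))))]
    refine lintegral_congr fun ω => lintegral_congr fun ω' => ?_
    have e1 : shift (glue (x, Function.update c j ω)) = Function.update c j ω := rfl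
    rw [put, e1, Function.update_self, Function.update_idem]
    rfl

end

end ForbiddenDegree
end

/-! ### Effect of the replacement of a subtree on the kept component. -/

noncomputable section

namespace ForbiddenDegree

variable {k : ℕ} {t : ℝ}

theorem vertexType_cons (y a : ℝ) (p : List ℝ) : vertexType y (a :: p) = vertexType a p := by
  simp [vertexType, List.getLast?_cons]

theorem rootEdge_some_alive {y : ℝ} {ω : Sample} {j : ℕ} (h : RootEdge k t y ω (some j)) :
    Alive k t (lab t ω j) (shift ω j) (t + 1) := h.2.1

/-- A kept edge is in particular not removed from the side of its upper endpoint. -/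
theorem alive_of_kNode {y : ℝ} {ω : Sample} {u : List ℕ} (h0 : Alive k t y ω (t + 1))
    (h : KNode k t y ω u) :
    Alive k t (vertexType y (path t ω u)) (shiftBy u ω) (t + 1) := by
  induction u generalizing y ω with
  | nil => exact h0
  | cons j u ih =>
    rw [path, vertexType_cons]
    exact ih (rootEdge_some_alive h.1) h.2

/-- The replacement of the subtree of a kept node by another subtree in which the edge to the
parent is not removed does not change the status of the other edges. -/
theorem put_spec (ht : 0 ≤ t) {ω ω' : Sample} (hω : Reg t ω) (hω' : Reg t ω') {y : ℝ} {u : List ℕ}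
    (h0 : Alive k t y ω (t + 1)) (hu : KNode k t y ω u)
    (h1 : Alive k t (vertexType y (path t ω u)) ω' (t + 1)) :
    Alive k t y (put u ω' ω) (t + 1) ∧
      ∀ v, v.length ≤ u.length → (KNode k t y (put u ω' ω) v ↔ KNode k t y ω v) := by
  induction u generalizing y ω with
  | nil =>
    refine ⟨(alive_setMark y _ ω' (t + 1)).2 h1, fun v hv => ?_⟩
    obtain rfl := List.length_eq_zero_iff.1 (Nat.le_zero.1 hv)
    exact Iff.rfl
  | cons j u ih =>
    rw [path, vertexType_cons] at h1
    have hal := rootEdge_some_alive hu.1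
    obtain ⟨h2, h3⟩ := ih ((reg_iff.1 hω).2 j) hal hu.2 h1
    have hal' : Alive k t (lab t ω j) (shift (put (j :: u) ω' ω) j) (t + 1) := by
      rw [shift_put_cons, Function.update_self]
      exact h2
    -- Only the tree of the child `j` changes. Its edge survives up to `t + 1` before and after the
    -- replacement, hence at every consulted time, so the root sees the same data.
    have hq : ∀ (i : ℕ) (b : ℝ), b ≤ t + 1 → (Alive k t (lab t (put (j :: u) ω' ω) i)
        (shift (put (j :: u) ω' ω) i) b ↔ Alive k t (lab t ω i) (shift ω i) b) := by
      intro i b hb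
      rw [lab_put_cons]
      by_cases hij : i = j
      · subst hij
        exact iff_of_true (hal'.anti hb) (hal.anti hb)
      · rw [shift_put_cons, Function.update_of_ne hij]
    have hroot : ∀ o, RootEdge k t y (put (j :: u) ω' ω) o ↔ RootEdge k t y ω o := by
      intro o
      rw [RootEdge, RootEdge, numKids_put_cons]
      refine kept_congr ?_ ?_ ?_ ?_ ?_
      · intro i _; rw [lab_put_cons]
      · intro i _ _ i' _; rw [lab_put_cons]
      · rintro i _ hi (_ | l) _ _
        · rfl
        · simp only [pres, Option.elim_some]
          rw [lab_put_cons] at hi ⊢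
          have := hq l (labs y (lab t ω) i) hi.le
          rwa [lab_put_cons] at this
      · rw [lab_put_cons]
        cases o with
        | none =>
          rcases lt_or_ge y (t + 1) with h | h
          · exact Or.inl h
          · exact Or.inr fun i _ his => ⟨his.trans_le h, his.trans_le h⟩
        | some l =>
          refine Or.inl ?_
          have := (lab_mem ht ω l).2
          change lab t ω l < t + 1
          linarith
      · cases o with
        | none => rfl
        | some l => exact hq l _ le_rfl
    refine ⟨?_, fun v hv => ?_⟩
    · rw [(hω.put hω' _).allSure.alive_iff, hroot, ← hω.allSure.alive_iff]
      exact h0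
    · cases v with
      | nil => exact Iff.rfl
      | cons i v =>
        rw [kNode_cons, kNode_cons, hroot, lab_put_cons, shift_put_cons]
        by_cases hij : i = j
        · subst hij
          rw [Function.update_self, h3 v (by simpa using hv)]
        · rw [Function.update_of_ne hij]

/-! ### Resampling above a node -/

/-- A symmetry argument. On `A` the sample above `u` satisfies `L`, and neither `A` nor `H` notices
its replacement by another sample satisfying `L`. The sample above `u` and an independent one
restricted to `L` can thus be exchanged. The probability of `L` is kept as a factor, which avoids
conditioning. -/
theorem swap_above {P : Type*} [MeasurableSpace P] (μt : ℝ) (u : List ℕ) {π : Sample → P}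
    (hπ : Measurable π) {R : Sample → Prop} (hR : ∀ᵐ ω ∂(sampleMeasure μt), R ω) {A : Set Sample}
    (hA : MeasurableSet A) {H : Sample → ℝ≥0∞} (hH : Measurable H) {L : P → Sample → Prop}
    (hL : MeasurableSet {q : P × Sample | L q.1 q.2}) {ψ : P → Sample → ℝ≥0∞}
    (hψ : Measurable (Function.uncurry ψ)) (hπput : ∀ ω ω', π (put u ω' ω) = π ω)
    (hLm : ∀ p m ω, L p (setMark m ω) ↔ L p ω) (hψm : ∀ p m ω, ψ p (setMark m ω) = ψ p ω)
    (hRput : ∀ ω ω', R ω → R ω' → R (put u ω' ω))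
    (hAput : ∀ ω ω', R ω → R ω' → ω ∈ A → L (π ω) ω' → put u ω' ω ∈ A ∧ H (put u ω' ω) = H ω)
    (hAL : ∀ ω, R ω → ω ∈ A → L (π ω) (shiftBy u ω)) :
    ∫⁻ ω in A, H ω * ψ (π ω) (shiftBy u ω) * sampleMeasure μt {ω' | L (π ω) ω'} ∂(sampleMeasure μt)
      = ∫⁻ ω in A, H ω * ∫⁻ ω' in {ω' | L (π ω) ω'}, ψ (π ω) ω' ∂(sampleMeasure μt)
        ∂(sampleMeasure μt) := by
  set μ := sampleMeasure μt with hμ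
  set LL : Set (P × Sample) := {q | L q.1 q.2} with hLL
  -- The second variable of `G` is tested for `L`, and `ψ` is evaluated at the third. The two sides
  -- differ only in whether the third is the sample above `u` or the independent one.
  set G : Sample × Sample × Sample → ℝ≥0∞ := fun x => A.indicator 1 x.1 *
    LL.indicator 1 (π x.1, x.2.1) * (H x.1 * ψ (π x.1) x.2.2) with hG
  have hGm : Measurable G := by
    refine Measurable.mul (Measurable.mul ?_ ?_) (Measurable.mul ?_ ?_)
    · exact (measurable_one.indicator hA).comp measurable_fst
    · exact (measurable_one.indicator hL).comp ((hπ.comp measurable_fst).prodMk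
        measurable_snd.fst)
    · exact hH.comp measurable_fst
    · exact hψ.comp ((hπ.comp measurable_fst).prodMk measurable_snd.snd)
  have hsh : Measurable (shiftBy u) := (measurePreserving_shiftBy μt u).measurable
  have hLs : ∀ p, MeasurableSet {ω' | L p ω'} := fun p => hL.preimage measurable_prodMk_left
  have hI1 : ∀ p ω', LL.indicator (1 : P × Sample → ℝ≥0∞) (p, ω') =
      {ω' | L p ω'}.indicator (1 : Sample → ℝ≥0∞) ω' := fun _ _ => rfl
  have hψs : ∀ p, Measurable (ψ p) := fun p => hψ.comp (measurable_const.prodMk measurable_id)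
  have h1 : ∫⁻ ω in A, H ω * ψ (π ω) (shiftBy u ω) * μ {ω' | L (π ω) ω'} ∂μ =
      ∫⁻ ω, ∫⁻ ω'', G (ω, ω'', shiftBy u ω) ∂μ ∂μ := by
    rw [← lintegral_indicator hA]
    refine lintegral_congr fun ω => ?_
    simp only [hG, hI1]
    rw [lintegral_mul_const, lintegral_const_mul, lintegral_indicator_one (hLs _)]
    · by_cases hω : ω ∈ A
      · simp only [indicator_of_mem hω, Pi.one_apply]; ring
      · simp [indicator_of_notMem hω]
    · exact measurable_one.indicator (hLs _)
    · exact (measurable_one.indicator (hLs _)).const_mul _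
  have h2 : ∫⁻ ω in A, H ω * ∫⁻ ω' in {ω' | L (π ω) ω'}, ψ (π ω) ω' ∂μ ∂μ =
      ∫⁻ ω, ∫⁻ ω'', G (ω, ω'', ω'') ∂μ ∂μ := by
    rw [← lintegral_indicator hA]
    refine lintegral_congr fun ω => ?_
    have h3 : ∀ ω'', G (ω, ω'', ω'') = A.indicator 1 ω * H ω *
        {ω' | L (π ω) ω'}.indicator (ψ (π ω)) ω'' := by
      intro ω''
      simp only [hG, hI1]
      by_cases h : L (π ω) ω''
      · rw [indicator_of_mem (show ω'' ∈ {ω' | L (π ω) ω'} from h),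
          indicator_of_mem (show ω'' ∈ {ω' | L (π ω) ω'} from h), Pi.one_apply]
        ring
      · rw [indicator_of_notMem (show ω'' ∉ {ω' | L (π ω) ω'} from h),
          indicator_of_notMem (show ω'' ∉ {ω' | L (π ω) ω'} from h)]
        ring
    simp only [h3]
    rw [lintegral_const_mul _ ((hψs _).indicator (hLs _)), lintegral_indicator (hLs _)]
    by_cases hω : ω ∈ A
    · simp only [indicator_of_mem hω, Pi.one_apply]; ring
    · simp [indicator_of_notMem hω]
  rw [h1, h2]
  have hm1 : Measurable fun x : Sample × Sample => G (x.1, x.2, shiftBy u x.1) :=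
    hGm.comp (measurable_fst.prodMk (measurable_snd.prodMk (hsh.comp measurable_fst)))
  have hm2 : Measurable fun x : Sample × Sample => G (x.1, x.2, x.2) :=
    hGm.comp (measurable_fst.prodMk (measurable_snd.prodMk measurable_snd))
  -- The sample above `u` is replaced by an independent `ω'`. The two sides then become double
  -- integrals over `ω'` and `ω''`, with the parts of these variables exchanged.
  rw [hμ, lintegral_put μt u hm1.lintegral_prod_right', lintegral_put μt u hm2.lintegral_prod_right',
    ← hμ]
  refine lintegral_congr_ae (hR.mono fun ω hω => ?_)
  have hm3 : Measurable fun x : Sample × Sample => G (put u x.1 ω, x.2, x.2) :=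
    hm2.comp (((measurable_put u).comp (measurable_fst.prodMk measurable_const)).prodMk
      measurable_snd)
  change ∫⁻ ω', ∫⁻ ω'', G (put u ω' ω, ω'', shiftBy u (put u ω' ω)) ∂μ ∂μ =
    ∫⁻ ω', ∫⁻ ω'', G (put u ω' ω, ω'', ω'') ∂μ ∂μ
  rw [lintegral_lintegral_swap (f := fun ω' ω'' => G (put u ω' ω, ω'', ω'')) hm3.aemeasurable]
  refine lintegral_congr_ae (hR.mono fun ω' hω' => lintegral_congr_ae (hR.mono fun ω'' hω'' => ?_))
  -- This makes the condition symmetric: if `put u ω₁ ω` is in `A` and `ω₂` satisfies `L`, the same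
  -- holds with `ω₁` and `ω₂` exchanged.
  have key : ∀ ω₁ ω₂, R ω₁ → R ω₂ → put u ω₁ ω ∈ A → L (π ω) ω₂ →
      put u ω₂ ω ∈ A ∧ L (π ω) ω₁ ∧ H (put u ω₁ ω) = H (put u ω₂ ω) := by
    intro ω₁ ω₂ hr1 hr2 hA1 hL2
    have h4 := hAput (put u ω₁ ω) ω₂ (hRput _ _ hω hr1) hr2 hA1 (by rwa [hπput])
    rw [put_put] at h4
    have h5 := hAL _ (hRput _ _ hω hr1) hA1
    rw [hπput, shiftBy_put, hLm] at h5
    exact ⟨h4.1, h5, h4.2.symm⟩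
  simp only [hG, hI1, hπput, shiftBy_put, hψm]
  by_cases hc : put u ω' ω ∈ A ∧ L (π ω) ω''
  · obtain ⟨h4, h5, h6⟩ := key ω' ω'' hω' hω'' hc.1 hc.2
    rw [indicator_of_mem hc.1, indicator_of_mem (show ω'' ∈ {ω' | L (π ω) ω'} from hc.2),
      indicator_of_mem h4, indicator_of_mem (show ω' ∈ {ω' | L (π ω) ω'} from h5), h6]
    rfl
  · have hc' : ¬ (put u ω'' ω ∈ A ∧ L (π ω) ω') := fun h => by
      obtain ⟨h4, h5, -⟩ := key ω'' ω' hω'' hω' h.1 h.2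
      exact hc ⟨h4, h5⟩
    have hz : ∀ ω₁ ω₂, ¬ (put u ω₁ ω ∈ A ∧ L (π ω) ω₂) → A.indicator (1 : Sample → ℝ≥0∞)
        (put u ω₁ ω) * {ω' | L (π ω) ω'}.indicator (1 : Sample → ℝ≥0∞) ω₂ = 0 := by
      intro ω₁ ω₂ h
      rw [not_and_or] at h
      rcases h with h | h
      · rw [indicator_of_notMem h, zero_mul]
      · rw [indicator_of_notMem (show ω₂ ∉ {ω' | L (π ω) ω'} from h), mul_zero]
    rw [hz _ _ hc, hz _ _ hc', zero_mul, zero_mul]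

end ForbiddenDegree
end

/-! ### The conditioned law and the independence of the samples above one generation. -/

noncomputable section

namespace ForbiddenDegree

/-- The event that the extra edge of label `y` is not removed. -/
def aliveSet (k : ℕ) (t y : ℝ) : Set Sample := {ω | Alive k t y ω (t + 1)}

/-- The probability conditioned on `aliveSet`. -/
def aliveMeasure (k : ℕ) (t y : ℝ) : Measure Sample := (sampleMeasure t)[|aliveSet k t y]

variable {k : ℕ} {t : ℝ}

theorem measurableSet_aliveSet_prod (k : ℕ) (t : ℝ) {α : Type*} [MeasurableSpace α] {y : α → ℝ}
    (hy : Measurable y) : MeasurableSet {q : α × Sample | q.2 ∈ aliveSet k t (y q.1)} :=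
  measurableSet_setOfPred.2 (measurable_alive measurable_snd (hy.comp measurable_fst)
    measurable_const)

theorem measurableSet_aliveSet (k : ℕ) (t y : ℝ) : MeasurableSet (aliveSet k t y) :=
  measurableSet_setOfPred.2 (measurable_alive measurable_id measurable_const measurable_const)

theorem measure_numKids_eq_zero (ht : 0 ≤ t) :
    sampleMeasure t {ω | numKids ω = 0} = ENNReal.ofReal (Real.exp (-t)) := by
  have h1 := measurePreserving_eval_infinitePi (fun _ : List ℕ => nodeMeasure t) []
  have h2 : {ω : Sample | numKids ω = 0} = Function.eval [] ⁻¹' (({0} : Set ℕ) ×ˢ (univ : Set I)) := by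
    ext ω; simp [numKids]
  rw [h2, sampleMeasure, h1.measure_preimage
    ((measurableSet_singleton 0).prod MeasurableSet.univ).nullMeasurableSet, Measure.prod_prod,
    measure_univ, mul_one, poissonMeasure_singleton]
  simp [Real.coe_toNNReal t ht]

/-- If the root has no child, the extra edge is its only edge and cannot be removed. -/
theorem le_measure_aliveSet (hk : 2 ≤ k) (ht : 0 ≤ t) (y : ℝ) :
    ENNReal.ofReal (Real.exp (-t)) ≤ sampleMeasure t (aliveSet k t y) := by
  rw [← measure_numKids_eq_zero ht]
  exact measure_mono fun ω hω => alive_of_numKids_eq_zero hk hω _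

theorem measure_aliveSet_ne_zero (hk : 2 ≤ k) (ht : 0 ≤ t) (y : ℝ) :
    sampleMeasure t (aliveSet k t y) ≠ 0 := by
  have h := le_measure_aliveSet hk ht y
  have h2 : 0 < ENNReal.ofReal (Real.exp (-t)) := ENNReal.ofReal_pos.2 (Real.exp_pos _)
  exact (h2.trans_le h).ne'

theorem isProbabilityMeasure_aliveMeasure (hk : 2 ≤ k) (ht : 0 ≤ t) (y : ℝ) :
    IsProbabilityMeasure (aliveMeasure k t y) :=
  cond_isProbabilityMeasure (measure_aliveSet_ne_zero hk ht y)

theorem lintegral_aliveMeasure (k : ℕ) (t y : ℝ) (f : Sample → ℝ≥0∞) :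
    ∫⁻ ω, f ω ∂(aliveMeasure k t y) =
      (sampleMeasure t (aliveSet k t y))⁻¹ * ∫⁻ ω in aliveSet k t y, f ω ∂(sampleMeasure t) := by
  rw [aliveMeasure, ProbabilityTheory.cond, lintegral_smul_measure, smul_eq_mul]

theorem measurable_measure_aliveSet (k : ℕ) (t : ℝ) :
    Measurable fun y => sampleMeasure t (aliveSet k t y) :=
  measurable_measure_prodMk_left (measurableSet_aliveSet_prod k t measurable_id)

theorem measurable_lintegral_aliveMeasure (k : ℕ) (t : ℝ) {α : Type*} [MeasurableSpace α]
    {y : α → ℝ} (hy : Measurable y) {ψ : α → Sample → ℝ≥0∞}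
    (hψ : Measurable (Function.uncurry ψ)) :
    Measurable fun x => ∫⁻ ω, ψ x ω ∂(aliveMeasure k t (y x)) := by
  simp only [lintegral_aliveMeasure]
  refine ((measurable_measure_aliveSet k t).comp hy).inv.mul ?_
  simp only [← lintegral_indicator (measurableSet_aliveSet k t _)]
  exact (hψ.indicator (measurableSet_aliveSet_prod k t hy)).lintegral_prod_right'

/-- The event that the extra edge is not removed and that `S` is the set of the kept nodes of the
`n`-th generation. -/
def genEvent (k : ℕ) (t y : ℝ) (n : ℕ) (S : Finset (List ℕ)) : Set Sample :=
  {ω | Alive k t y ω (t + 1) ∧ {v | v.length = n ∧ KNode k t y ω v} = ↑S}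

theorem measurableSet_genEvent (k : ℕ) (t y : ℝ) (n : ℕ) (S : Finset (List ℕ)) :
    MeasurableSet (genEvent k t y n S) := by
  simp only [genEvent, Set.ext_iff, mem_ofPred_eq]
  exact measurableSet_setOfPred.2 ((measurable_alive measurable_id measurable_const
    measurable_const).and (Measurable.forall fun v => Measurable.iff (measurable_const.and
    (measurable_kNode measurable_id measurable_const v)) measurable_const))

theorem put_mem_genEvent (ht : 0 ≤ t) {ω ω' : Sample} (hω : Reg t ω) (hω' : Reg t ω') {y : ℝ}
    {n : ℕ} {S : Finset (List ℕ)} (h : ω ∈ genEvent k t y n S) {u : List ℕ} (hu : u ∈ S)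
    (h1 : Alive k t (vertexType y (path t ω u)) ω' (t + 1)) :
    put u ω' ω ∈ genEvent k t y n S ∧
      ∀ v, v.length ≤ n → (KNode k t y (put u ω' ω) v ↔ KNode k t y ω v) := by
  have hu' : u ∈ {v | v.length = n ∧ KNode k t y ω v} := by rw [h.2]; exact hu
  obtain ⟨rfl, hk⟩ := hu'
  obtain ⟨h2, h3⟩ := put_spec ht hω hω' h.1 hk h1
  refine ⟨⟨h2, ?_⟩, h3⟩
  rw [← h.2]
  ext v
  exact and_congr_right fun hv => h3 v hv.le

/-- The nodes are integrated one at a time by `swap_above`. `T` is the set of nodes still to be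
treated, and the weight `H`, insensitive to replacements above them, absorbs the factors already
treated. -/
theorem lintegral_genEvent_prod (hk : 2 ≤ k) (ht : 0 ≤ t) (y : ℝ) (n : ℕ) {S : Finset (List ℕ)}
    {ψ : List ℝ → Sample → ℝ≥0∞} (hψ : Measurable (Function.uncurry ψ))
    (hψm : ∀ p m ω, ψ p (setMark m ω) = ψ p ω) (T : Finset (List ℕ)) (hTS : T ⊆ S)
    (hT : ∀ u ∈ T, u.length = n) {H : Sample → ℝ≥0∞} (hH : Measurable H)
    (hHput : ∀ u ∈ T, ∀ ω ω', Reg t ω → Reg t ω' → ω ∈ genEvent k t y n S →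
      Alive k t (vertexType y (path t ω u)) ω' (t + 1) → H (put u ω' ω) = H ω) :
    ∫⁻ ω in genEvent k t y n S, H ω * ∏ u ∈ T, ψ (path t ω u) (shiftBy u ω) ∂(sampleMeasure t) =
      ∫⁻ ω in genEvent k t y n S, H ω * ∏ u ∈ T, ∫⁻ ω', ψ (path t ω u) ω'
        ∂(aliveMeasure k t (vertexType y (path t ω u))) ∂(sampleMeasure t) := by
  classical
  have hsh : ∀ u, Measurable (shiftBy u) := fun u => (measurePreserving_shiftBy t u).measurable
  have hpath : ∀ u, Measurable fun ω => path t ω u := fun u => measurable_path measurable_id u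
  have hvt := measurable_vertexType y
  have hψ' : Measurable fun p => ∫⁻ ω', ψ p ω' ∂(aliveMeasure k t (vertexType y p)) :=
    measurable_lintegral_aliveMeasure k t hvt hψ
  induction T using Finset.induction_on generalizing H with
  | empty => simp
  | insert u T huT ih =>
    have hT' : ∀ v ∈ T, v.length = u.length ∧ v ≠ u := fun v hv =>
      ⟨(hT v (Finset.mem_insert_of_mem hv)).trans (hT u (Finset.mem_insert_self u T)).symm,
        fun h => huT (h ▸ hv)⟩
    have huS : u ∈ S := hTS (Finset.mem_insert_self u T)
    set M : List ℝ → ℝ≥0∞ := fun p => sampleMeasure t (aliveSet k t (vertexType y p)) with hM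
    have hMm : Measurable M := (measurable_measure_aliveSet k t).comp hvt
    have hM0 : ∀ p, M p ≠ 0 := fun p => measure_aliveSet_ne_zero hk ht _
    have hMt : ∀ p, M p ≠ ∞ := fun p => measure_ne_top _ _
    -- The division by the survival probability turns the restricted integral given by `swap_above`
    -- into the conditional expectation. This probability is positive by `measure_aliveSet_ne_zero`.
    set H₁ : Sample → ℝ≥0∞ := fun ω => H ω * (∏ v ∈ T, ψ (path t ω v) (shiftBy v ω)) *
      (M (path t ω u))⁻¹ with hH₁
    have hH₁m : Measurable H₁ := (hH.mul (Finset.measurable_fun_prod T fun v _ =>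
      hψ.comp ((hpath v).prodMk (hsh v)))).mul (hMm.comp (hpath u)).inv
    have key := swap_above t u (hpath u) (ae_reg ht) (measurableSet_genEvent k t y n S) hH₁m
      (L := fun p ω' => ω' ∈ aliveSet k t (vertexType y p))
      (measurableSet_aliveSet_prod k t hvt) hψ (fun ω ω' => path_put le_rfl ω' ω)
      (fun p m ω => alive_setMark _ _ _ _) hψm (fun ω ω' h h' => h.put h' u)
      (fun ω ω' hω hω' hA hL => by
        refine ⟨(put_mem_genEvent ht hω hω' hA huS hL).1, ?_⟩
        simp only [hH₁]
        rw [hHput u (Finset.mem_insert_self u T) ω ω' hω hω' hA hL, path_put le_rfl]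
        congr 2
        refine Finset.prod_congr rfl fun v hv => ?_
        rw [path_put (hT' v hv).1.le, shiftBy_put_of_ne (hT' v hv).1 (hT' v hv).2])
      (fun ω hω hA => by
        refine alive_of_kNode hA.1 ?_
        have hu' : u ∈ {v | v.length = n ∧ KNode k t y ω v} := by rw [hA.2]; exact huS
        exact hu'.2)
    calc ∫⁻ ω in genEvent k t y n S, H ω * ∏ u ∈ insert u T, ψ (path t ω u) (shiftBy u ω)
          ∂(sampleMeasure t)
        = ∫⁻ ω in genEvent k t y n S, H₁ ω * ψ (path t ω u) (shiftBy u ω) *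
          sampleMeasure t {ω' | ω' ∈ aliveSet k t (vertexType y (path t ω u))}
            ∂(sampleMeasure t) := by
          refine lintegral_congr fun ω => ?_
          rw [Finset.prod_insert huT]
          simp only [hH₁]
          change _ = _ * M (path t ω u)
          calc _ = H ω * (ψ (path t ω u) (shiftBy u ω) * ∏ v ∈ T, ψ (path t ω v) (shiftBy v ω)) *
                ((M (path t ω u))⁻¹ * M (path t ω u)) := by
                  rw [ENNReal.inv_mul_cancel (hM0 _) (hMt _), mul_one]
            _ = _ := by ring
      _ = ∫⁻ ω in genEvent k t y n S, (H ω * ∫⁻ ω', ψ (path t ω u) ω'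
          ∂(aliveMeasure k t (vertexType y (path t ω u)))) *
          ∏ v ∈ T, ψ (path t ω v) (shiftBy v ω) ∂(sampleMeasure t) := by
          rw [key]
          refine lintegral_congr fun ω => ?_
          rw [lintegral_aliveMeasure]
          simp only [hH₁, hM]
          change _ * ∫⁻ ω' in aliveSet k t (vertexType y (path t ω u)), _ ∂_ = _
          ring
      _ = _ := by
          rw [ih ((Finset.subset_insert u T).trans hTS)
            (fun v hv => hT v (Finset.mem_insert_of_mem hv)) (H := fun ω => H ω * ∫⁻ ω',
            ψ (path t ω u) ω' ∂(aliveMeasure k t (vertexType y (path t ω u))))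
            (hH.mul (hψ'.comp (hpath u)))]
          · refine lintegral_congr fun ω => ?_
            rw [Finset.prod_insert huT, mul_assoc]
          · intro v hv ω ω' hω hω' hA hL
            rw [hHput v (Finset.mem_insert_of_mem hv) ω ω' hω hω' hA hL,
              path_put (hT' v hv).1.ge]

theorem finite_generation_kNode (k : ℕ) (t y : ℝ) (n : ℕ) (ω : Sample) :
    {v | v.length = n ∧ KNode k t y ω v}.Finite := by
  induction n generalizing y ω with
  | zero =>
    refine (finite_singleton []).subset fun v hv => List.length_eq_zero_iff.1 hv.1
  | succ n ih =>
    refine ((Finset.finite_toSet (Finset.range (numKids ω))).biUnion fun j _ =>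
      (ih (lab t ω j) (shift ω j)).image (List.cons j)).subset ?_
    rintro (_ | ⟨j, v⟩) hv
    · simp at hv
    · have hj : j ∈ (Finset.range (numKids ω)) := by simpa using hv.2.1.1
      exact mem_iUnion₂.2 ⟨j, hj, v, ⟨by simpa using hv.1, hv.2.2⟩, rfl⟩

theorem iUnion_genEvent (k : ℕ) (t y : ℝ) (n : ℕ) :
    ⋃ S, genEvent k t y n S = aliveSet k t y := by
  ext ω
  simp only [mem_iUnion]
  constructor
  · rintro ⟨S, h⟩; exact h.1
  · exact fun h => ⟨(finite_generation_kNode k t y n ω).toFinset, h, by simp⟩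

/-- Given the generations `0, …, n`, the samples above the nodes of the `n`-th generation are
independent, with the law of the sample conditioned on the preservation of the extra edge. -/
theorem lintegral_generation (hk : 2 ≤ k) (ht : 0 ≤ t) (y : ℝ) (n : ℕ)
    {ψ : List ℝ → Sample → ℝ≥0∞} (hψ : Measurable (Function.uncurry ψ))
    (hψm : ∀ p m ω, ψ p (setMark m ω) = ψ p ω) {F : LTree → ℝ≥0∞} (hF : Measurable F) :
    ∫⁻ ω in aliveSet k t y, F (truncate n (treeHat k t y ω)) *
        ∏ᶠ u ∈ {v | v.length = n ∧ KNode k t y ω v}, ψ (path t ω u) (shiftBy u ω)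
        ∂(sampleMeasure t) =
      ∫⁻ ω in aliveSet k t y, F (truncate n (treeHat k t y ω)) *
        ∏ᶠ u ∈ {v | v.length = n ∧ KNode k t y ω v}, (∫⁻ ω', ψ (path t ω u) ω'
        ∂(aliveMeasure k t (vertexType y (path t ω u)))) ∂(sampleMeasure t) := by
  -- The event of survival is cut according to the finite set `S` of kept nodes of generation `n`,
  -- of which there are countably many, so that the product runs over a fixed set.
  have hdisj : Pairwise (Function.onFun Disjoint (genEvent k t y n)) := by
    intro S S' hne
    refine Set.disjoint_left.2 fun ω h h' => hne ?_
    exact_mod_cast h.2.symm.trans h'.2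
  rw [← iUnion_genEvent k t y n, lintegral_iUnion (measurableSet_genEvent k t y n) hdisj,
    lintegral_iUnion (measurableSet_genEvent k t y n) hdisj]
  congr 1
  funext S
  have hcongr : ∀ G : List ℕ → Sample → ℝ≥0∞,
      ∫⁻ ω in genEvent k t y n S, F (truncate n (treeHat k t y ω)) *
        ∏ᶠ u ∈ {v | v.length = n ∧ KNode k t y ω v}, G u ω ∂(sampleMeasure t) =
      ∫⁻ ω in genEvent k t y n S, F (truncate n (treeHat k t y ω)) * ∏ u ∈ S, G u ω
        ∂(sampleMeasure t) := by
    intro G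
    refine setLIntegral_congr_fun (measurableSet_genEvent k t y n S) fun ω hω => ?_
    simp only [hω.2]
    rw [finprod_mem_coe_finset]
  rw [hcongr fun u ω => ψ (path t ω u) (shiftBy u ω), hcongr fun u ω => ∫⁻ ω', ψ (path t ω u) ω'
        ∂(aliveMeasure k t (vertexType y (path t ω u)))]
  by_cases hS : ∀ u ∈ S, u.length = n
  · refine lintegral_genEvent_prod hk ht y n hψ hψm S subset_rfl hS
      (hF.comp ((measurable_truncate n).comp (measurable_treeHat measurable_id measurable_const))) ?_
    intro u hu ω ω' hω hω' hA hL
    congr 1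
    ext p
    have hput := (put_mem_genEvent ht hω hω' hA hu hL).2
    simp only [truncate, treeHat, mem_ofPred_eq, mem_image]
    refine and_congr_left fun hp => exists_congr fun v => ?_
    have hlen : ∀ (ω : Sample) (v : List ℕ), (path t ω v).length = v.length := fun ω v => by
      rw [path_eq_ofFn, List.length_ofFn]
    constructor
    · rintro ⟨h1, rfl⟩
      rw [hlen] at hp
      exact ⟨(hput v hp).1 h1, (path_put (hp.trans_eq (hS u hu).symm) _ _).symm⟩
    · rintro ⟨h1, rfl⟩
      rw [hlen] at hp
      exact ⟨(hput v hp).2 h1, path_put (hp.trans_eq (hS u hu).symm) _ _⟩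
  · have : genEvent k t y n S = ∅ := by
      refine eq_empty_of_forall_notMem fun ω hω => hS fun u hu => ?_
      have hu' : u ∈ {v | v.length = n ∧ KNode k t y ω v} := by rw [hω.2]; exact hu
      exact hu'.1
    simp [this]

end ForbiddenDegree
end

noncomputable section

namespace ForbiddenDegree

variable {k : ℕ} {t : ℝ}

/-! ### Paths and subtrees of the component of the root -/

theorem path_append (ω : Sample) (u w : List ℕ) :
    path t ω (u ++ w) = path t ω u ++ path t (shiftBy u ω) w := by
  induction u generalizing ω with
  | nil => rfl
  | cons j u ih => rw [List.cons_append, path, ih]; rfl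

theorem kNode_append {y : ℝ} {ω : Sample} {u w : List ℕ} : KNode k t y ω (u ++ w) ↔
    KNode k t y ω u ∧ KNode k t (vertexType y (path t ω u)) (shiftBy u ω) w := by
  induction u generalizing y ω with
  | nil => exact ⟨fun h => ⟨trivial, h⟩, fun h => h.2⟩
  | cons j u ih =>
    rw [List.cons_append, kNode_cons, ih, kNode_cons, path, vertexType_cons, and_assoc]
    rfl

theorem RootEdge.lt {y : ℝ} {ω : Sample} {j : ℕ} (h : RootEdge k t y ω (some j)) :
    j < numKids ω := by simpa using h.1

theorem path_inj {ω : Sample} (hω : SibDistinct t ω) {y y' : ℝ} {u v : List ℕ}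
    (hu : KNode k t y ω u) (hv : KNode k t y' ω v) (h : path t ω u = path t ω v) : u = v := by
  induction u generalizing y y' ω v with
  | nil =>
    cases v with
    | nil => rfl
    | cons j v => simp [path] at h
  | cons i u ih =>
    cases v with
    | nil => simp [path] at h
    | cons j v =>
      simp only [path, List.cons.injEq] at h
      obtain rfl := hω.root (by simpa using (kNode_cons.1 hu).1.lt)
        (by simpa using (kNode_cons.1 hv).1.lt) h.1
      rw [ih (hω.shift i) hu.2 hv.2 h.2]

theorem length_path (ω : Sample) (u : List ℕ) : (path t ω u).length = u.length := by
  rw [path_eq_ofFn, List.length_ofFn]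

theorem generation_treeHat (y : ℝ) (ω : Sample) (n : ℕ) : generation (treeHat k t y ω) n =
    path t ω '' {v | v.length = n ∧ KNode k t y ω v} := by
  ext p
  constructor
  · rintro ⟨⟨v, hv, rfl⟩, hn⟩
    exact ⟨v, ⟨(length_path ω v).symm.trans hn, hv⟩, rfl⟩
  · rintro ⟨v, ⟨hn, hv⟩, rfl⟩
    exact ⟨⟨v, hv, rfl⟩, (length_path ω v).trans hn⟩

theorem rootLabels_treeHat (y : ℝ) (ω : Sample) :
    (rootLabels (treeHat k t y ω)).pts = lab t ω '' {j | RootEdge k t y ω (some j)} := by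
  ext a
  constructor
  · rintro ⟨_ | ⟨j, _ | ⟨l, v⟩⟩, hv, h⟩
    · simp [path] at h
    · exact ⟨j, hv.1, (List.cons.inj h).1⟩
    · simp [path] at h
  · rintro ⟨j, hj, rfl⟩
    exact ⟨[j], ⟨hj, trivial⟩, rfl⟩

theorem offspring_treeHat {y : ℝ} {ω : Sample} (hω : SibDistinct t ω) {u : List ℕ}
    (hu : KNode k t y ω u) : offspring (treeHat k t y ω) (path t ω u) =
      rootLabels (treeHat k t (vertexType y (path t ω u)) (shiftBy u ω)) := by
  ext a
  rw [rootLabels_treeHat]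
  constructor
  · rintro ⟨v, hv, h⟩
    have hlen : v.length = u.length + 1 := by
      rw [← length_path (t := t) ω v, h]
      simp [length_path]
    obtain ⟨v', j, rfl⟩ : ∃ v' j, v = v' ++ [j] := by
      refine ⟨v.dropLast, v.getLast ?_, (List.dropLast_append_getLast _).symm⟩
      rintro rfl
      simp at hlen
    rw [path_append] at h
    obtain ⟨h1, h2⟩ := List.append_inj' h rfl
    obtain ⟨h3, h4⟩ := kNode_append.1 hv
    obtain rfl := path_inj hω h3 hu h1
    exact ⟨j, h4.1, (List.cons.inj h2).1⟩
  · rintro ⟨j, hj, rfl⟩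
    exact ⟨u ++ [j], kNode_append.2 ⟨hu, hj, trivial⟩, path_append ω u [j]⟩

theorem subtree_treeHat {y : ℝ} {ω : Sample} (hω : SibDistinct t ω) {j : ℕ}
    (hj : RootEdge k t y ω (some j)) : subtree (treeHat k t y ω) (lab t ω j) =
      treeHat k t (lab t ω j) (shift ω j) := by
  ext p
  constructor
  · rintro ⟨_ | ⟨i, v⟩, hv, h⟩
    · simp [path] at h
    · simp only [path, List.cons.injEq] at h
      obtain rfl := hω.root (by simpa using (kNode_cons.1 hv).1.lt)
        (by simpa using hj.lt) h.1
      exact ⟨v, hv.2, h.2⟩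
  · rintro ⟨v, hv, rfl⟩
    exact ⟨j :: v, ⟨hj, hv⟩, rfl⟩

theorem vertexType_path_mem (ht : 0 ≤ t) {y : ℝ} (ω : Sample) {u : List ℕ}
    (h : u ≠ [] ∨ y ∈ Icc 0 t) : vertexType y (path t ω u) ∈ Icc 0 t := by
  induction u generalizing y ω with
  | nil => exact h.resolve_left fun h => h rfl
  | cons j u ih =>
    rw [path, vertexType_cons]
    exact ih _ (Or.inr (lab_mem ht ω j))

/-! ### The laws of the conditioned trees -/

theorem labelFree_of_lt (ht : 0 ≤ t) {y : ℝ} (hy : t < y) (ω : Sample) :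
    LabelFree y (treeInf t ω) := fun _ h => absurd (label_mem_treeInf ht h).2 (not_le.2 hy)

/-- The bridge between the definition on graphs and the measurable model; it holds only almost
surely, where the sample is nice and no label equals `y`. -/
theorem ae_forbidTreeAt (hk : 2 ≤ k) (ht : 0 ≤ t) {y : ℝ} (hy : y ≤ t) :
    ∀ᵐ ω ∂(sampleMeasure t),
      (ω ∈ aliveSet k t y → forbidTreeAt k y (treeInf t ω) = some (treeHat k t y ω)) ∧
      (ω ∉ aliveSet k t y → forbidTreeAt k y (treeInf t ω) = none) := by
  filter_upwards [ae_nice ht, ae_labelFree ht y] with ω hω hfree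
  have h := (hω.rootNice ht).forbidTreeAt_eq hk ht hy (by rwa [← treeInf_eq_graft])
  rw [← treeInf_eq_graft, keptTree_treeInf hk ht hω hfree] at h
  have h2 : ω ∈ aliveSet k t y ↔ RootModel k t y (Finset.range (numKids ω)) (lab t ω) (shift ω)
    none := hω.reg.allSure.alive_iff y
  rwa [← h2] at h

/-- The absent extra edge is given the label `t + 2`, beyond the horizon `t + 1`. -/
theorem ae_treeK (hk : 2 ≤ k) (ht : 0 ≤ t) :
    ∀ᵐ ω ∂(sampleMeasure t), treeK k t ω = treeHat k t (t + 2) ω := by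
  filter_upwards [ae_nice ht] with ω hω
  rw [treeK, forbidTree_eq hω.good (y := t + 2) (s := t + 1) (by linarith),
    keptTree_treeInf hk ht hω (labelFree_of_lt ht (by linarith) ω)]
  intro p a h
  have := (label_mem_treeInf ht h).2
  linarith

theorem ae_isLocallyFiniteTree (hk : 2 ≤ k) (ht : 0 ≤ t) (y : ℝ) :
    ∀ᵐ ω ∂(sampleMeasure t), IsLocallyFiniteTree (treeHat k t y ω) := by
  filter_upwards [ae_nice ht, ae_labelFree ht y] with ω hω hfree
  rw [← keptTree_treeInf hk ht hω hfree]
  exact isLocallyFiniteTree_keptTree (isLocallyFiniteTree_treeInf t ω)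

theorem survives_ae_eq (hk : 2 ≤ k) (ht : 0 ≤ t) {y : ℝ} (hy : y ≤ t) :
    survives k t y =ᵐ[sampleMeasure t] aliveSet k t y := by
  filter_upwards [ae_forbidTreeAt hk ht hy] with ω hω
  apply propext
  change forbidTreeAt k y (treeInf t ω) ≠ none ↔ ω ∈ aliveSet k t y
  by_cases h : ω ∈ aliveSet k t y
  · simp [hω.1 h, h]
  · simp [hω.2 h, h]

theorem condMeasure_eq (hk : 2 ≤ k) (ht : 0 ≤ t) {y : ℝ} (hy : y ≤ t) :
    condMeasure k t y = aliveMeasure k t y := by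
  have h := survives_ae_eq hk ht hy
  rw [condMeasure, aliveMeasure, ProbabilityTheory.cond, ProbabilityTheory.cond, measure_congr h,
    Measure.restrict_congr_set h]

theorem ae_aliveMeasure {y : ℝ} {p : Sample → Prop}
    (h : ∀ᵐ ω ∂(sampleMeasure t), ω ∈ aliveSet k t y → p ω) : ∀ᵐ ω ∂(aliveMeasure k t y), p ω := by
  rw [aliveMeasure, ProbabilityTheory.cond]
  exact Measure.ae_smul_measure ((ae_restrict_iff' (measurableSet_aliveSet k t y)).2 h) _

theorem treeKAt_ae_eq (hk : 2 ≤ k) (ht : 0 ≤ t) {y : ℝ} (hy : y ≤ t) :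
    treeKAt k t y =ᵐ[aliveMeasure k t y] treeHat k t y := by
  refine ae_aliveMeasure ?_
  filter_upwards [ae_forbidTreeAt hk ht hy] with ω hω h
  rw [treeKAt, hω.1 h, Option.getD_some]

theorem measurable_treeHat_right (k : ℕ) (t y : ℝ) : Measurable (treeHat k t y) :=
  measurable_treeHat measurable_id measurable_const

theorem measurable_rootLabels_treeHat (k : ℕ) (t y : ℝ) :
    Measurable fun ω => rootLabels (treeHat k t y ω) :=
  measurable_rootLabels.comp (measurable_treeHat_right k t y)

theorem lawPlus_eq (hk : 2 ≤ k) (ht : 0 ≤ t) {y : ℝ} (hy : y ≤ t) :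
    lawPlus k t y = (aliveMeasure k t y).map (treeHat k t y) := by
  rw [lawPlus, condMeasure_eq hk ht hy]
  exact Measure.map_congr (treeKAt_ae_eq hk ht hy)

theorem offspringLaw_eq (hk : 2 ≤ k) (ht : 0 ≤ t) {y : ℝ} (hy : y ≤ t) :
    offspringLaw k t y = (aliveMeasure k t y).map fun ω => rootLabels (treeHat k t y ω) := by
  rw [offspringLaw, lawPlus_eq hk ht hy,
    Measure.map_map measurable_rootLabels (measurable_treeHat_right k t y)]
  rfl

theorem rootLaw_eq (hk : 2 ≤ k) (ht : 0 ≤ t) :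
    rootLaw k t = (sampleMeasure t).map fun ω => rootLabels (treeHat k t (t + 2) ω) := by
  rw [rootLaw, Measure.map_congr (ae_treeK hk ht),
    Measure.map_map measurable_rootLabels (measurable_treeHat_right k t _)]
  rfl

theorem lintegral_lawPlus (hk : 2 ≤ k) (ht : 0 ≤ t) {y : ℝ} (hy : y ≤ t) {φ : LTree → ℝ≥0∞}
    (hφ : Measurable φ) : ∫⁻ T, φ T ∂(lawPlus k t y) =
      ∫⁻ ω, φ (treeHat k t y ω) ∂(aliveMeasure k t y) := by
  rw [lawPlus_eq hk ht hy, lintegral_map hφ (measurable_treeHat_right k t y)]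

theorem measurable_lawPlus (hk : 2 ≤ k) (ht : 0 ≤ t) :
    Measurable fun y : Icc 0 t => lawPlus k t y := by
  refine Measure.measurable_of_measurable_coe _ fun D hD => ?_
  have : ∀ y : Icc 0 t, lawPlus k t y D = ∫⁻ ω, D.indicator 1 (treeHat k t y ω)
      ∂(aliveMeasure k t y) := by
    intro y
    rw [← lintegral_lawPlus hk ht y.2.2 (measurable_one.indicator hD), lintegral_indicator_one hD]
  simp only [this]
  refine measurable_lintegral_aliveMeasure k t measurable_subtype_coe
    (ψ := fun (y : Icc 0 t) ω => D.indicator 1 (treeHat k t y ω)) ?_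
  exact (measurable_one.indicator hD).comp
    (measurable_treeHat measurable_snd (measurable_subtype_coe.comp measurable_fst))

theorem isBranchingProcess_treeKAt (hk : 2 ≤ k) (ht : 0 ≤ t) {y : ℝ} (hy : y ∈ Icc 0 t) :
    IsBranchingProcess (condMeasure k t y) (treeKAt k t y) (offspringLaw k t) y := by
  have hae := treeKAt_ae_eq hk ht hy.2
  rw [condMeasure_eq hk ht hy.2]
  refine ⟨isProbabilityMeasure_aliveMeasure hk ht y,
    ⟨_, measurable_treeHat_right k t y, hae⟩, ?_, ?_⟩
  · have h2 := ae_aliveMeasure (k := k) (y := y)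
      ((ae_isLocallyFiniteTree hk ht y).mono fun ω h _ => h)
    filter_upwards [hae, h2] with ω h h'
    rwa [h]
  · intro n F φ hF hφ
    -- The children of a kept node are the root labels of the model tree above it, with the label of
    -- the edge to its parent as the type of the root. Their law under `aliveMeasure` is the
    -- offspring law.
    set ψ : List ℝ → Sample → ℝ≥0∞ := fun p ω => φ p (rootLabels
      (treeHat k t (vertexType y p) ω)) with hψ
    have hψm : Measurable (Function.uncurry ψ) :=
      hφ.comp (measurable_fst.prodMk (measurable_rootLabels.comp
        (measurable_treeHat measurable_snd ((measurable_vertexType y).comp measurable_fst))))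
    have key := lintegral_generation hk ht y n hψm (fun p m ω => by
      simp only [hψ, treeHat_setMark]) hF
    have hsib := ae_aliveMeasure (k := k) (y := y) ((ae_nice ht).mono fun ω h _ => h.sib)
    have hfin : ∀ (G : List ℝ → ℝ≥0∞) (ω : Sample), SibDistinct t ω →
        ∏ᶠ p ∈ generation (treeHat k t y ω) n, G p =
          ∏ᶠ u ∈ {v | v.length = n ∧ KNode k t y ω v}, G (path t ω u) := by
      intro G ω hω
      rw [generation_treeHat]
      exact finprod_mem_image fun u hu v hv h => path_inj hω hu.2 hv.2 h
    calc _ = ∫⁻ ω, F (truncate n (treeHat k t y ω)) *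
          ∏ᶠ u ∈ {v | v.length = n ∧ KNode k t y ω v}, ψ (path t ω u) (shiftBy u ω)
          ∂(aliveMeasure k t y) := by
          refine lintegral_congr_ae ?_
          filter_upwards [hae, hsib] with ω h h'
          rw [h, hfin _ ω h']
          congr 1
          exact finprod_mem_congr rfl fun u hu => by rw [offspring_treeHat h' hu.2]
      _ = ∫⁻ ω, F (truncate n (treeHat k t y ω)) *
          ∏ᶠ u ∈ {v | v.length = n ∧ KNode k t y ω v}, (∫⁻ ω', ψ (path t ω u) ω'
          ∂(aliveMeasure k t (vertexType y (path t ω u)))) ∂(aliveMeasure k t y) := by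
          rw [lintegral_aliveMeasure, lintegral_aliveMeasure k t y, key]
      _ = _ := by
          refine lintegral_congr_ae ?_
          filter_upwards [hae, hsib] with ω h h'
          rw [h, hfin _ ω h']
          congr 1
          refine finprod_mem_congr rfl fun u _ => ?_
          have hφp : Measurable (φ (path t ω u)) := hφ.comp measurable_prodMk_left
          rw [offspringLaw_eq hk ht (vertexType_path_mem ht ω (Or.inr hy)).2, lintegral_map hφp
            (measurable_rootLabels_treeHat k t _)]

theorem aliveSet_eq_univ (k : ℕ) {t y : ℝ} (hy : t + 1 ≤ y) : aliveSet k t y = univ :=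
  eq_univ_of_forall fun ω => alive_of_lt hy ω

theorem hasIndependentSubtrees_treeK (hk : 2 ≤ k) (ht : 0 ≤ t) :
    HasIndependentSubtrees (sampleMeasure t) (treeK k t) (lawPlus k t) := by
  have hae := ae_treeK hk ht
  refine ⟨inferInstance, ⟨_, measurable_treeHat_right k t _, hae⟩, ?_, ?_⟩
  · filter_upwards [hae, ae_isLocallyFiniteTree hk ht (t + 2)] with ω h h'
    rwa [h]
  · intro F φ hF hφ
    set y := t + 2 with hy
    set ψ : List ℝ → Sample → ℝ≥0∞ := fun p ω => φ (vertexType y p)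
      (treeHat k t (vertexType y p) ω) with hψ
    have hv : Measurable fun q : List ℝ × Sample => vertexType y q.1 :=
      (measurable_vertexType y).comp measurable_fst
    have hψm : Measurable (Function.uncurry ψ) :=
      hφ.comp (hv.prodMk (measurable_treeHat measurable_snd hv))
    have key := lintegral_generation hk ht y 1 hψm (fun p m ω => by
      simp only [hψ, treeHat_setMark]) (hF.comp measurable_rootLabels)
    have hsib := (ae_nice ht).mono fun ω h => h.sib
    -- An extra edge of label `t + 2` is never removed before `t + 1`. The conditioning on the root
    -- is void and generation `1` gives the claim.
    rw [aliveSet_eq_univ k (by linarith : t + 1 ≤ y), Measure.restrict_univ] at key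
    have htr : ∀ T : LTree, rootLabels (truncate 1 T) = rootLabels T := by
      intro T
      ext a
      exact ⟨fun h => h.1, fun h => ⟨h, le_rfl⟩⟩
    simp only [Function.comp_apply, htr] at key
    have hset : ∀ ω, {v | v.length = 1 ∧ KNode k t y ω v} =
        (fun j => [j]) '' {j | RootEdge k t y ω (some j)} := by
      intro ω
      ext v
      constructor
      · rintro ⟨hl, hv⟩
        obtain ⟨j, rfl⟩ := List.length_eq_one_iff.1 hl
        exact ⟨j, hv.1, rfl⟩
      · rintro ⟨j, hj, rfl⟩
        exact ⟨rfl, hj, trivial⟩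
    have hfin : ∀ (G : ℝ → ℝ≥0∞) (ω : Sample), SibDistinct t ω →
        ∏ᶠ z ∈ (rootLabels (treeHat k t y ω)).pts, G z =
          ∏ᶠ j ∈ {j | RootEdge k t y ω (some j)}, G (lab t ω j) := by
      intro G ω hω
      rw [rootLabels_treeHat]
      exact finprod_mem_image fun i hi j hj h => hω.root (by simpa using hi.lt)
        (by simpa using hj.lt) h
    have hfin' : ∀ (G : List ℕ → ℝ≥0∞) (ω : Sample),
        ∏ᶠ u ∈ {v | v.length = 1 ∧ KNode k t y ω v}, G u =
          ∏ᶠ j ∈ {j | RootEdge k t y ω (some j)}, G [j] := by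
      intro G ω
      rw [hset]
      exact finprod_mem_image fun i _ j _ h => (List.cons.inj h).1
    simp only [hfin'] at key
    calc _ = ∫⁻ ω, F (rootLabels (treeHat k t y ω)) * ∏ᶠ j ∈ {j | RootEdge k t y ω (some j)},
          ψ (path t ω [j]) (shiftBy [j] ω) ∂(sampleMeasure t) := by
          refine lintegral_congr_ae ?_
          filter_upwards [hae, hsib] with ω h h'
          rw [h, hfin _ ω h']
          congr 1
          exact finprod_mem_congr rfl fun j hj => by rw [subtree_treeHat h' hj]; rfl
      _ = _ := by
          rw [key]
          refine lintegral_congr_ae ?_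
          filter_upwards [hae, hsib] with ω h h'
          rw [h, hfin _ ω h']
          congr 1
          refine finprod_mem_congr rfl fun j _ => ?_
          have hφp : Measurable (φ (lab t ω j)) := hφ.comp measurable_prodMk_left
          rw [lintegral_lawPlus hk ht (lab_mem ht ω j).2 hφp]
          rfl

/-! ### The numbers of children -/

theorem encard_rootEdge_lt (hk : 2 ≤ k) {y : ℝ} {ω : Sample} (hω : SibDistinct t ω)
    (hy : LabelFree y (treeInf t ω)) :
    {o | RootEdge k t y ω o ∧ labs y (lab t ω) o < t + 1}.encard < k := by
  refine encard_kept_lt (by omega) ?_ ?_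
  · rintro (_ | i) hi (_ | j) hj h
    · rfl
    · exact absurd h.symm (labelFree_root hy (by simpa using hj))
    · exact absurd h (labelFree_root hy (by simpa using hi))
    · rw [hω.root (by simpa using hi) (by simpa using hj) h]
  · rintro (_ | i) b c hbc h
    · trivial
    · exact Alive.anti hbc h

/-- Fewer than `k` edges are present at the root at the horizon. If `y ≤ t`, the extra edge is one
of them when it is kept, which leaves one place less for the children. -/
theorem encard_rootLabels_treeHat (hk : 2 ≤ k) (ht : 0 ≤ t) {y : ℝ} {ω : Sample}
    (hω : SibDistinct t ω) (hy : LabelFree y (treeInf t ω)) :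
    (rootLabels (treeHat k t y ω)).pts.encard + 1 ≤ k ∧
    (y ≤ t → RootEdge k t y ω none → (rootLabels (treeHat k t y ω)).pts.encard + 2 ≤ k) := by
  have h := encard_rootEdge_lt hk hω hy
  set S := {o | RootEdge k t y ω o ∧ labs y (lab t ω) o < t + 1} with hS
  set J := {j | RootEdge k t y ω (some j)} with hJ
  have h1 : (rootLabels (treeHat k t y ω)).pts.encard ≤ (some '' J).encard := by
    rw [rootLabels_treeHat, (Option.some_injective ℕ).encard_image]
    exact encard_image_le _ _
  have h2 : some '' J ⊆ S := by
    rintro _ ⟨j, hj, rfl⟩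
    refine ⟨hj, ?_⟩
    have := (lab_mem ht ω j).2
    change lab t ω j < t + 1
    linarith
  have h3 : S.encard + 1 ≤ k := Order.add_one_le_of_lt h
  refine ⟨(add_le_add_left (h1.trans (encard_le_encard h2)) 1).trans h3, fun hyt hn => ?_⟩
  have h4 : insert none (some '' J) ⊆ S := insert_subset ⟨hn, by
    change y < t + 1
    linarith⟩ h2
  have h5 := encard_le_encard h4
  rw [encard_insert_of_notMem (by simp)] at h5
  calc _ = (rootLabels (treeHat k t y ω)).pts.encard + 1 + 1 := by rw [add_assoc]; rfl
    _ ≤ S.encard + 1 := add_le_add_left ((add_le_add_left h1 1).trans h5) 1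
    _ ≤ k := h3

theorem measurableSet_bounded (t : ℝ) (m : ℕ∞) :
    MeasurableSet {X : Config ℝ | X.pts ⊆ Icc 0 t ∧ X.pts.encard + m ≤ (k : ℕ∞)} := by
  have h1 : {X : Config ℝ | X.pts ⊆ Icc 0 t} = {X | (X.pts ∩ (Icc 0 t)ᶜ).encard = 0} := by
    ext X
    rw [mem_ofPred_eq, mem_ofPred_eq, encard_eq_zero, ← sdiff_eq, sdiff_eq_empty]
  have h2 : MeasurableSet {X : Config ℝ | X.pts ⊆ Icc 0 t} := by
    rw [h1]
    exact measurable_encard measurableSet_Icc.compl (measurableSet_singleton 0)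
  have h3 := measurable_encard (β := ℝ) MeasurableSet.univ
    (MeasurableSet.of_discrete (s := {a : ℕ∞ | a + m ≤ k}))
  simp only [inter_univ] at h3
  exact h2.inter h3

theorem rootLabels_treeHat_subset (ht : 0 ≤ t) (y : ℝ) (ω : Sample) :
    (rootLabels (treeHat k t y ω)).pts ⊆ Icc 0 t := by
  rw [rootLabels_treeHat]
  rintro _ ⟨j, -, rfl⟩
  exact lab_mem ht ω j

theorem ae_offspringLaw (hk : 2 ≤ k) (ht : 0 ≤ t) {y : ℝ} (hy : y ≤ t) :
    ∀ᵐ X ∂(offspringLaw k t y), X.pts ⊆ Icc 0 t ∧ X.pts.encard + 2 ≤ (k : ℕ∞) := by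
  rw [offspringLaw_eq hk ht hy, ae_map_iff
    (measurable_rootLabels_treeHat k t y).aemeasurable
    (measurableSet_bounded t 2)]
  refine ae_aliveMeasure ?_
  filter_upwards [ae_nice ht, ae_labelFree ht y] with ω hω hfree h
  exact ⟨rootLabels_treeHat_subset ht y ω, (encard_rootLabels_treeHat hk ht hω.sib hfree).2 hy
    ((hω.reg.allSure.alive_iff y).1 h)⟩

theorem ae_rootLaw (hk : 2 ≤ k) (ht : 0 ≤ t) :
    ∀ᵐ X ∂(rootLaw k t), X.pts ⊆ Icc 0 t ∧ X.pts.encard + 1 ≤ (k : ℕ∞) := by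
  rw [rootLaw_eq hk ht, ae_map_iff
    (measurable_rootLabels_treeHat k t _).aemeasurable (measurableSet_bounded t 1)]
  filter_upwards [ae_nice ht] with ω hω
  exact ⟨rootLabels_treeHat_subset ht _ ω, (encard_rootLabels_treeHat hk ht hω.sib
    (labelFree_of_lt ht (by linarith) ω)).1⟩

theorem exp_le_survivalProb (hk : 2 ≤ k) {y : ℝ} (hy : y ∈ Icc 0 t) :
    Real.exp (-t) ≤ survivalProb k t y := by
  have ht := hy.1.trans hy.2
  rw [survivalProb, measureReal_congr (survives_ae_eq hk ht hy.2)]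
  exact (ENNReal.ofReal_le_iff_le_toReal (measure_ne_top _ _)).1 (le_measure_aliveSet hk ht y)

end ForbiddenDegree
end

noncomputable section

namespace ForbiddenDegree

/-! ### Families indexed by disjoint unions and changes of variables -/

theorem measurable_sumElim {κ κ' α : Type*} [MeasurableSpace α] :
    Measurable fun p : (κ → α) × (κ' → α) => (Sum.elim p.1 p.2 : κ ⊕ κ' → α) := by
  refine measurable_pi_iff.2 ?_
  rintro (j | j)
  exacts [(measurable_pi_apply j).comp measurable_fst, (measurable_pi_apply j).comp measurable_snd]

theorem measurePreserving_sumElim {κ κ' α : Type*} [MeasurableSpace α] (ρ : Measure α)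
    [IsProbabilityMeasure ρ] : MeasurePreserving
      (fun p : (κ → α) × (κ' → α) => (Sum.elim p.1 p.2 : κ ⊕ κ' → α))
      ((Measure.infinitePi fun _ => ρ).prod (Measure.infinitePi fun _ => ρ))
      (Measure.infinitePi fun _ => ρ) := by
  refine ⟨measurable_sumElim, Measure.eq_infinitePi _ fun S T hT => ?_⟩
  rw [Measure.map_apply measurable_sumElim (MeasurableSet.pi S.countable_toSet fun j _ => hT j)]
  have : (fun p : (κ → α) × (κ' → α) => (Sum.elim p.1 p.2 : κ ⊕ κ' → α)) ⁻¹'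
      Set.pi (S : Set (κ ⊕ κ')) T = (Set.pi (S.toLeft : Set κ) fun j => T (Sum.inl j)) ×ˢ
        (Set.pi (S.toRight : Set κ') fun j => T (Sum.inr j)) := by
    ext ⟨x, y⟩
    simp [Set.mem_pi]
  rw [this, Measure.prod_prod, Measure.infinitePi_pi _ fun j _ => hT _,
    Measure.infinitePi_pi _ fun j _ => hT _, Finset.prod_sum_eq_prod_toLeft_mul_prod_toRight]

theorem lintegral_poisson (t : ℝ) (f : ℕ → ℝ≥0∞) : ∫⁻ n, f n ∂(poissonMeasure t.toNNReal) =
    ∑' n : ℕ, ENNReal.ofReal (Real.exp (-t.toNNReal) * (t.toNNReal : ℝ) ^ n / n.factorial) * f n := by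
  rw [poissonMeasure, lintegral_sum_measure]
  simp [lintegral_smul_measure, lintegral_dirac]

/-- The weight of `n` times `n! / (n - i)!` is `t ^ i` times the weight of `n - i`. This is the
Poisson part of the Palm formula: once `i` children are chosen, the number of the others is again
Poisson. -/
theorem lintegral_poisson_descFactorial {t : ℝ} (ht : 0 ≤ t) (i : ℕ) (K : ℕ → ℝ≥0∞) :
    ∫⁻ n, (n.descFactorial i : ℝ≥0∞) * K (n - i) ∂(poissonMeasure t.toNNReal) =
      ENNReal.ofReal t ^ i * ∫⁻ n, K n ∂(poissonMeasure t.toNNReal) := by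
  -- The sum is reindexed by `n = m + i`; the terms with `n < i` vanish with the falling factorial.
  rw [lintegral_poisson, lintegral_poisson, ← ENNReal.tsum_mul_left,
    ← (add_left_injective i).tsum_eq]
  · refine tsum_congr fun m => ?_
    rw [Nat.add_sub_cancel, ← mul_assoc, ← mul_assoc, ← ENNReal.ofReal_pow ht]
    congr 1
    rw [← ENNReal.ofReal_natCast, ← ENNReal.ofReal_mul (by positivity),
      ← ENNReal.ofReal_mul (by positivity)]
    congr 1
    rw [Real.coe_toNNReal t ht, pow_add]
    have h := Nat.factorial_mul_descFactorial (Nat.le_add_left i m)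
    rw [Nat.add_sub_cancel] at h
    have h' : (m.factorial : ℝ) * ((m + i).descFactorial i : ℝ) = (m + i).factorial := by
      exact_mod_cast h
    have h1 : (m.factorial : ℝ) ≠ 0 := by positivity
    rw [← h']
    have h2 : ((m + i).descFactorial i : ℝ) ≠ 0 := by
      have := Nat.pos_of_ne_zero (mt Nat.descFactorial_eq_zero_iff_lt.1 (by omega : ¬ m + i < i))
      positivity
    field_simp
  · intro n hn
    by_contra hcon
    refine hn ?_
    have : n < i := by
      by_contra! h
      exact hcon ⟨n - i, by simp [Nat.sub_add_cancel h]⟩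
    simp [Nat.descFactorial_eq_zero_iff_lt.2 this]

theorem lintegral_scale {t : ℝ} (ht : 0 ≤ t) {i : ℕ} {g : (Fin i → ℝ) → ℝ≥0∞}
    (hg : Measurable g) : ENNReal.ofReal t ^ i * ∫⁻ u : Fin i → I, g (fun j => t * (u j : ℝ)) =
      ∫⁻ x in Set.univ.pi fun _ => Icc 0 t, g x := by
  -- For `t = 0` the dilation is degenerate: both sides vanish if `i > 0`, and for `i = 0` both are
  -- the value at the empty family.
  rcases ht.eq_or_lt with rfl | ht
  · rcases Nat.eq_zero_or_pos i with rfl | hi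
    · have h : (Set.univ.pi fun _ : Fin 0 => Icc (0 : ℝ) 0) = univ := by
        ext x; simp
      rw [h, Measure.restrict_univ, pow_zero, one_mul, volume_pi, volume_pi]
      rw [Measure.pi_of_empty, Measure.pi_of_empty, lintegral_dirac, lintegral_dirac]
      congr 1
      exact Subsingleton.elim _ _
    · have : volume (Set.univ.pi fun _ : Fin i => Icc (0 : ℝ) 0) = 0 := by
        rw [volume_pi, Measure.pi_pi]
        simp [hi.ne']
      rw [Measure.restrict_eq_zero.2 this, lintegral_zero_measure]
      simp [hi.ne']
  · have h1 : MeasurePreserving (fun (u : Fin i → I) j => (u j : ℝ)) volume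
        ((volume : Measure (Fin i → ℝ)).restrict (Set.univ.pi fun _ => I)) := by
      rw [volume_pi, volume_pi, Measure.restrict_pi_pi]
      exact measurePreserving_pi _ _ fun _ => unitInterval.measurePreserving_coe
    have hm : Measurable fun v : Fin i → ℝ => t • v := measurable_const_smul t
    have hS : MeasurableSet (Set.univ.pi fun _ : Fin i => Icc 0 t) :=
      MeasurableSet.univ_pi fun _ => measurableSet_Icc
    have h2 := h1.lintegral_comp (f := fun v => g (t • v)) (hg.comp hm)
    change ENNReal.ofReal t ^ i * ∫⁻ u : Fin i → I, g (t • fun j => (u j : ℝ)) = _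
    rw [h2, ← lintegral_indicator (MeasurableSet.univ_pi fun _ => measurableSet_Icc),
      ← lintegral_indicator hS]
    have h3 : ∀ v : Fin i → ℝ, (Set.univ.pi fun _ : Fin i => (I : Set ℝ)).indicator
        (fun v => g (t • v)) v = (Set.univ.pi fun _ : Fin i => Icc 0 t).indicator g (t • v) := by
      intro v
      have : v ∈ (Set.univ.pi fun _ : Fin i => (I : Set ℝ)) ↔
          t • v ∈ (Set.univ.pi fun _ : Fin i => Icc 0 t) := by
        simp only [Set.mem_pi, mem_univ, true_imp_iff, mem_Icc, Pi.smul_apply, smul_eq_mul]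
        refine forall_congr' fun j => and_congr ?_ ?_
        · rw [mul_nonneg_iff_of_pos_left ht]
        · rw [mul_le_iff_le_one_right ht]
      by_cases h : v ∈ (Set.univ.pi fun _ : Fin i => (I : Set ℝ))
      · rw [indicator_of_mem h, indicator_of_mem (this.1 h)]
      · rw [indicator_of_notMem h, indicator_of_notMem (mt this.2 h)]
    simp only [h3]
    rw [← lintegral_map (hg.indicator hS) hm, Measure.map_addHaar_smul _ ht.ne',
      lintegral_smul_measure, smul_eq_mul, ← mul_assoc, Module.finrank_fin_fun,
      ← ENNReal.ofReal_pow ht.le, ← ENNReal.ofReal_mul (by positivity), abs_of_pos (by positivity),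
      mul_inv_cancel₀ (by positivity), ENNReal.ofReal_one, one_mul]

/-- A finite subfamily of the children together with the family of the others. -/
theorem lintegral_kids_comp (t : ℝ) {i : ℕ} {φ : Fin i ⊕ ℕ → ℕ} (hφ : Function.Injective φ)
    {f : (Fin i ⊕ ℕ → I × Sample) → ℝ≥0∞} (hf : Measurable f) :
    ∫⁻ d, f (fun o => d (φ o)) ∂(kidsMeasure t) =
      ∫⁻ d, ∫⁻ c, ∫⁻ u : Fin i → I, f (Sum.elim (fun j => (u j, c j)) d) ∂volume
        ∂(Measure.pi fun _ => sampleMeasure t) ∂(kidsMeasure t) := by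
  set ρ := (volume : Measure I).prod (sampleMeasure t) with hρ
  have h1 := Measure.map_infinitePi_infinitePi_of_inj (P := fun _ : ℕ => ρ) hφ
  have hm1 : Measurable fun (d : ℕ → I × Sample) (o : Fin i ⊕ ℕ) => d (φ o) :=
    measurable_pi_iff.2 fun o => measurable_pi_apply _
  have h2 := measurePreserving_sumElim (κ := Fin i) (κ' := ℕ) ρ
  have h3 := (measurePreserving_arrowProdEquivProdArrow I Sample (Fin i) (fun _ => volume)
    (fun _ => sampleMeasure t)).symm
  have hf2 : Measurable fun p : (Fin i → I × Sample) × (ℕ → I × Sample) =>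
    f (Sum.elim p.1 p.2) := hf.comp measurable_sumElim
  calc _ = ∫⁻ d, f d ∂(Measure.infinitePi fun _ : Fin i ⊕ ℕ => ρ) := by
        rw [← h1, lintegral_map hf hm1]
    _ = ∫⁻ d, ∫⁻ b, f (Sum.elim b d) ∂(Measure.pi fun _ : Fin i => ρ) ∂(kidsMeasure t) := by
        rw [← h2.lintegral_comp hf, lintegral_prod_symm _ hf2.aemeasurable]
        simp only [Measure.infinitePi_eq_pi]
        rfl
    _ = _ := by
        refine lintegral_congr fun d => ?_
        have hf3 : Measurable fun b : Fin i → I × Sample => f (Sum.elim b d) :=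
          hf2.comp measurable_prodMk_right
        rw [← h3.lintegral_comp hf3]
        exact lintegral_prod_symm _ (hf3.comp h3.measurable).aemeasurable

end ForbiddenDegree
end

noncomputable section

namespace ForbiddenDegree

variable {k : ℕ} {t : ℝ}

/-! ### The density of the labels kept at the root -/

/-- The edges kept at the root of `T^{∞,X}_t` are the extra edge and the edges labelled by `X`. -/
def KeptExactly (k : ℕ) (t y : ℝ) {i : ℕ} (x : Fin i → ℝ) (ω : Sample × (Fin i → Sample)) : Prop :=
  RootModel k t y (Finset.univ.disjSum (Finset.range (numKids ω.1))) (Sum.elim x (lab t ω.1))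
    (Sum.elim ω.2 (shift ω.1)) none ∧
  ∀ j, RootModel k t y (Finset.univ.disjSum (Finset.range (numKids ω.1)))
    (Sum.elim x (lab t ω.1)) (Sum.elim ω.2 (shift ω.1)) (some j) ↔ j.isLeft

theorem measurable_keptExactly {α : Type*} [MeasurableSpace α] {i : ℕ} {x : α → Fin i → ℝ}
    {y : α → ℝ} {f : α → Sample × (Fin i → Sample)} (hx : Measurable x) (hy : Measurable y)
    (hf : Measurable f) : Measurable fun a => KeptExactly k t (y a) (x a) (f a) := by
  have h : ∀ o, Measurable fun a => RootModel k t (y a)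
      (Finset.univ.disjSum (Finset.range (numKids (f a).1))) (Sum.elim (x a) (lab t (f a).1))
      (Sum.elim (f a).2 (shift (f a).1)) o := by
    intro o
    refine measurable_prop_comp (Q := fun m a => RootModel k t (y a)
      (Finset.univ.disjSum (Finset.range m)) (Sum.elim (x a) (lab t (f a).1))
      (Sum.elim (f a).2 (shift (f a).1)) o) (measurable_numKids.comp hf.fst) fun m => ?_
    refine measurable_rootModel _ hy ?_ ?_ o
    · rintro (j | j)
      exacts [(measurable_pi_apply j).comp hx, (measurable_lab t j).comp hf.fst]
    · rintro (j | j)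
      exacts [(measurable_pi_apply j).comp hf.snd, (measurable_shift j).comp hf.fst]
  exact (h none).and (Measurable.forall fun j => (h _).iff measurable_const)

/-- The probability that the edges kept at the root of `T^{∞,X}_t` are the extra edge and the edges
labelled by `X`. -/
def exactProb (k i : ℕ) (t y : ℝ) (x : Fin i → ℝ) : ℝ≥0∞ :=
  sampleMeasureWith i t {ω | KeptExactly k t y x ω}

instance (i : ℕ) (t : ℝ) : IsProbabilityMeasure (sampleMeasureWith i t) := by
  unfold sampleMeasureWith; infer_instance

theorem measurable_exactProb (k i : ℕ) (t y : ℝ) : Measurable (exactProb k i t y) := by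
  have : MeasurableSet {p : (Fin i → ℝ) × (Sample × (Fin i → Sample)) |
      KeptExactly k t y p.1 p.2} :=
    measurableSet_setOfPred.2 (measurable_keptExactly measurable_fst measurable_const
      measurable_snd)
  exact measurable_measure_prodMk_left this

theorem rootModel_reindex {κ κ' : Type*} {E : Finset κ} {E' : Finset κ'} {a : κ → ℝ} {a' : κ' → ℝ}
    {c : κ → Sample} {c' : κ' → Sample} {y : ℝ} (g : κ → κ') (hg : InjOn g E) (hI : g '' E = E')
    (ha : ∀ j ∈ E, a' (g j) = a j)
    (hc : ∀ j ∈ E, ∀ b, Alive k t (a j) (c' (g j)) b ↔ Alive k t (a j) (c j) b) {o : Option κ}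
    (ho : o ∈ Finset.insertNone E) :
    RootModel k t y E' a' c' (o.map g) ↔ RootModel k t y E a c o := by
  refine kept_reindex (Option.map g) ?_ ?_ ?_ ?_ ho
  · rintro (_ | i) hi (_ | j) hj h
    · rfl
    · simp at h
    · simp at h
    · rw [hg (by simpa using hi) (by simpa using hj) (Option.some_injective _ h)]
  · ext o'
    constructor
    · rintro ⟨_ | j, hj, rfl⟩
      · simp
      · have : g j ∈ (E' : Set κ') := hI ▸ ⟨j, by simpa using hj, rfl⟩
        simpa using this
    · rcases o' with _ | j'
      · exact fun _ => ⟨none, by simp, rfl⟩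
      · intro h
        have : j' ∈ (E' : Set κ') := by simpa using h
        rw [← hI] at this
        obtain ⟨j, hj, rfl⟩ := this
        exact ⟨some j, by simpa using hj, rfl⟩
  · rintro (_ | j) hj
    · rfl
    · exact ha j (by simpa using hj)
  · rintro (_ | j) hj b
    · rfl
    · change Alive k t (a' (g j)) (c' (g j)) b ↔ _
      rw [ha j (by simpa using hj)]
      exact hc j (by simpa using hj) b

/-- `φ` lists the chosen children first and the other integers in increasing order. The unchosen
ones among the first `n` are therefore numbered by the integers below `n - i`. -/
theorem exists_enumeration {i n : ℕ} (e : Fin i ↪ ℕ) (he : ∀ j, e j < n) :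
    ∃ φ : Fin i ⊕ ℕ → ℕ, Function.Injective φ ∧ (∀ j, φ (Sum.inl j) = e j) ∧
      φ '' ((Finset.univ.disjSum (Finset.range (n - i)) : Finset (Fin i ⊕ ℕ)) : Set (Fin i ⊕ ℕ)) =
        (Finset.range n : Set ℕ) := by
  classical
  set p : ℕ → Prop := fun m => m ∉ range e with hp
  have hinf : (Set.ofPred p).Infinite := (finite_range e).infinite_compl
  have hinj : Function.Injective (Sum.elim e (Nat.nth p)) := by
    refine e.injective.sumElim (Nat.nth_injective hinf) fun a b h => ?_
    exact Nat.nth_mem_of_infinite hinf b ⟨a, h⟩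
  have hcount : n - i ≤ Nat.count p n := by
    rw [Nat.count_eq_card_filter_range]
    have h1 : ((Finset.range n).filter p).card + ((Finset.range n).filter fun m => ¬ p m).card =
        n := by
      rw [Finset.card_filter_add_card_filter_not, Finset.card_range]
    have h2 : ((Finset.range n).filter fun m => ¬ p m).card ≤ i := by
      refine (Finset.card_le_card (t := Finset.univ.map e) fun m hm => ?_).trans (by simp)
      simpa [hp] using (Finset.mem_filter.1 hm).2
    refine Nat.sub_le_iff_le_add.2 ?_
    refine h1.ge.trans (Nat.add_le_add (le_of_eq ?_) h2)
    congr!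
  refine ⟨_, hinj, fun j => rfl, ?_⟩
  have hni : i ≤ n := by
    have := Finset.card_le_card (s := Finset.univ.map e) (t := Finset.range n) fun m hm => by
      obtain ⟨j, -, rfl⟩ := Finset.mem_map.1 hm
      simpa using he j
    simpa using this
  rw [← Finset.coe_image, Finset.coe_inj]
  refine Finset.eq_of_subset_of_card_le ?_ ?_
  · intro m hm
    obtain ⟨j | j, hj, rfl⟩ := Finset.mem_image.1 hm
    · simpa using he j
    · have hj' : j < n - i := by simpa using hj
      simpa using Nat.nth_lt_of_lt_count (hj'.trans_le hcount)
  · rw [Finset.card_image_of_injective _ hinj, Finset.card_disjSum]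
    simp
    omega

/-- The falling factorial counts the injective choices of `i` children among `n`. -/
theorem tsum_embedding (i n : ℕ) (c : ℝ≥0∞) :
    ∑' e : Fin i ↪ ℕ, {e : Fin i ↪ ℕ | ∀ j, e j < n}.indicator (fun _ => c) e =
      (n.descFactorial i : ℝ≥0∞) * c := by
  have h1 : {e : Fin i ↪ ℕ | ∀ j, e j < n}.encard = (n.descFactorial i : ℕ∞) := by
    have : {e : Fin i ↪ ℕ | ∀ j, e j < n} =
        (fun e : Fin i ↪ Fin n => e.trans Fin.valEmbedding) '' univ := by
      ext e
      constructor
      · intro he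
        exact ⟨⟨fun j => ⟨e j, he j⟩, fun a b h => e.injective (by simpa using h)⟩, trivial, rfl⟩
      · rintro ⟨e, -, rfl⟩ j
        exact (e j).2
    rw [this, Function.Injective.encard_image, encard_univ, ENat.card_eq_coe_fintype_card,
      Fintype.card_embedding_eq]
    · simp
    · intro a b h
      ext j
      exact congrArg (fun f : Fin i ↪ ℕ => f j) h
  rw [← tsum_subtype, ENNReal.tsum_set_const, h1]
  simp

end ForbiddenDegree
end

/-! ### The Palm formula for the labels kept at the root. -/

noncomputable section

namespace ForbiddenDegree

variable {k : ℕ} {t : ℝ}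

/-- The children kept at the root are those chosen by `e`, and their labels are in `A`. -/
def Pick (k : ℕ) (t y : ℝ) {i : ℕ} (A : Set (Fin i → ℝ)) (e : Fin i ↪ ℕ) : Set Sample :=
  {ω | (∀ j, e j < numKids ω) ∧ (fun j => lab t ω (e j)) ∈ A ∧ RootEdge k t y ω none ∧
    ∀ j, RootEdge k t y ω (some j) ↔ j ∈ range e}

theorem measurableSet_pick (k : ℕ) (t y : ℝ) {i : ℕ} {A : Set (Fin i → ℝ)} (hA : MeasurableSet A)
    (e : Fin i ↪ ℕ) : MeasurableSet (Pick k t y A e) := by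
  refine measurableSet_setOfPred.2 (Measurable.and (Measurable.forall fun j => ?_)
    (Measurable.and ?_ (Measurable.and ?_ (Measurable.forall fun j => Measurable.iff ?_
      measurable_const))))
  · exact measurable_prop_comp (Q := fun m _ => e j < m) measurable_numKids
      fun _ => measurable_const
  · exact measurableSet_setOfPred.1 ((measurable_pi_iff.2 fun j => measurable_lab t (e j)) hA)
  · exact measurable_rootEdge measurable_id measurable_const none
  · exact measurable_rootEdge measurable_id measurable_const (some j)

/-- The event `Pick` in terms of the chosen children and of `m` other ones. -/
def PickSum (k : ℕ) (t y : ℝ) {i : ℕ} (A : Set (Fin i → ℝ)) (m : ℕ) :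
    Set (Fin i ⊕ ℕ → I × Sample) :=
  {d | (fun j => t * ((d (Sum.inl j)).1 : ℝ)) ∈ A ∧
    RootModel k t y (Finset.univ.disjSum (Finset.range m)) (fun o => t * ((d o).1 : ℝ))
      (fun o => setMark (d o).1 (d o).2) none ∧
    ∀ o, RootModel k t y (Finset.univ.disjSum (Finset.range m)) (fun o => t * ((d o).1 : ℝ))
      (fun o => setMark (d o).1 (d o).2) (some o) ↔ o.isLeft}

theorem measurableSet_pickSum (k : ℕ) (t y : ℝ) {i : ℕ} {A : Set (Fin i → ℝ)}
    (hA : MeasurableSet A) (m : ℕ) : MeasurableSet (PickSum k t y A m) := by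
  have hlab : ∀ o : Fin i ⊕ ℕ, Measurable fun d : Fin i ⊕ ℕ → I × Sample => t * ((d o).1 : ℝ) :=
    fun o => (measurable_subtype_coe.comp (measurable_pi_apply o).fst).const_mul t
  have hset : ∀ o : Fin i ⊕ ℕ, Measurable fun d : Fin i ⊕ ℕ → I × Sample =>
      setMark (d o).1 (d o).2 := fun o => measurable_setMark.comp (measurable_pi_apply o)
  have h := measurable_rootModel (k := k) (t := t) (Finset.univ.disjSum (Finset.range m))
    (measurable_const (a := y)) hlab hset
  refine measurableSet_setOfPred.2 (Measurable.and ?_ (Measurable.and (h none)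
    (Measurable.forall fun o => Measurable.iff (h _) measurable_const)))
  exact measurableSet_setOfPred.1 ((measurable_pi_iff.2 fun j => hlab _) hA)

theorem build_mem_pick {y : ℝ} {i n : ℕ} {A : Set (Fin i → ℝ)} {e : Fin i ↪ ℕ}
    (he : ∀ j, e j < n) {φ : Fin i ⊕ ℕ → ℕ} (hφ : Function.Injective φ)
    (hφe : ∀ j, φ (Sum.inl j) = e j)
    (hφn : φ '' ((Finset.univ.disjSum (Finset.range (n - i)) : Finset (Fin i ⊕ ℕ)) :
      Set (Fin i ⊕ ℕ)) = (Finset.range n : Set ℕ)) (r : I) (d : ℕ → I × Sample) :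
    build (n, r) d ∈ Pick k t y A e ↔ (fun o => d (φ o)) ∈ PickSum k t y A (n - i) := by
  have hre : ∀ o ∈ Finset.insertNone (Finset.univ.disjSum (Finset.range (n - i))),
      (RootEdge k t y (build (n, r) d) (o.map φ) ↔ RootModel k t y
        (Finset.univ.disjSum (Finset.range (n - i))) (fun o => t * ((d (φ o)).1 : ℝ))
        (fun o => setMark (d (φ o)).1 (d (φ o)).2) o) := fun o ho =>
    rootModel_reindex φ hφ.injOn hφn (fun j _ => lab_build t _ d _) (fun j _ b => Iff.rfl) ho
  have h1 : (∀ j, e j < numKids (build (n, r) d)) := he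
  have h2 : (fun j => lab t (build (n, r) d) (e j)) =
      fun j => t * ((d (φ (Sum.inl j))).1 : ℝ) := by
    funext j
    rw [lab_build, hφe]
  refine (and_iff_right h1).trans (and_congr (by rw [h2]) (and_congr (hre none (by simp)) ?_))
  constructor
  · intro h o
    by_cases ho : o ∈ Finset.univ.disjSum (Finset.range (n - i))
    · have h3 := hre (some o) (by simpa using ho)
      refine h3.symm.trans ((h (φ o)).trans ?_)
      constructor
      · rintro ⟨j, hj⟩
        rw [← hφe] at hj
        rw [← hφ hj]
        rfl
      · rcases o with j | j
        · exact fun _ => ⟨j, (hφe j).symm⟩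
        · simp
    · refine iff_of_false (fun hc => ho (by simpa using hc.1)) ?_
      rcases o with j | j
      · simp at ho
      · simp
  · intro h j
    by_cases hj : j < n
    · have : j ∈ (Finset.range n : Set ℕ) := by simpa using hj
      rw [← hφn] at this
      obtain ⟨o, ho, rfl⟩ := this
      refine (hre (some o) (by simpa using ho)).trans ((h o).trans ?_)
      constructor
      · rcases o with j | j
        · exact fun _ => ⟨j, (hφe j).symm⟩
        · simp
      · rintro ⟨j, hj⟩
        rw [← hφe] at hj
        rw [← hφ hj]
        rfl
    · refine iff_of_false (fun hc => hj (RootEdge.lt hc)) ?_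
      rintro ⟨l, rfl⟩
      exact hj (he l)

/-- The chosen children become the vertices attached by the labels of `X` in `T^{∞,X}_t`, and the
others its ordinary children. The mark `r` at the root has no influence. -/
theorem sumElim_mem_pickSum {y : ℝ} {i : ℕ} {A : Set (Fin i → ℝ)} (m : ℕ) (r : I) (u : Fin i → I)
    (c : Fin i → Sample) (d : ℕ → I × Sample) :
    (Sum.elim (fun j => (u j, c j)) d : Fin i ⊕ ℕ → I × Sample) ∈ PickSum k t y A m ↔
      (fun j => t * (u j : ℝ)) ∈ A ∧ KeptExactly k t y (fun j => t * (u j : ℝ))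
        (build (m, r) d, c) := by
  have h : ∀ o, RootModel k t y (Finset.univ.disjSum (Finset.range m))
      (fun o => t * (((Sum.elim (fun j => (u j, c j)) d : Fin i ⊕ ℕ → I × Sample) o).1 : ℝ))
      (fun o => setMark ((Sum.elim (fun j => (u j, c j)) d : Fin i ⊕ ℕ → I × Sample) o).1
        ((Sum.elim (fun j => (u j, c j)) d : Fin i ⊕ ℕ → I × Sample) o).2) o ↔
      RootModel k t y (Finset.univ.disjSum (Finset.range m))
        (Sum.elim (fun j => t * (u j : ℝ)) (lab t (build (m, r) d)))
        (Sum.elim c (shift (build (m, r) d))) o := by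
    intro o
    by_cases ho : o ∈ Finset.insertNone (Finset.univ.disjSum (Finset.range m))
    · have := rootModel_reindex (k := k) (t := t) (y := y)
        (E := Finset.univ.disjSum (Finset.range m)) (E' := Finset.univ.disjSum (Finset.range m))
        (a := Sum.elim (fun j => t * (u j : ℝ)) (lab t (build (m, r) d)))
        (a' := fun o => t * (((Sum.elim (fun j => (u j, c j)) d :
          Fin i ⊕ ℕ → I × Sample) o).1 : ℝ))
        (c := Sum.elim c (shift (build (m, r) d)))
        (c' := fun o => setMark ((Sum.elim (fun j => (u j, c j)) d :
          Fin i ⊕ ℕ → I × Sample) o).1 ((Sum.elim (fun j => (u j, c j)) d :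
          Fin i ⊕ ℕ → I × Sample) o).2) id (injOn_id _) (image_id _) ?_ ?_ ho
      · rwa [Option.map_id, id] at this
      · rintro (j | j) _
        · rfl
        · exact (lab_build t _ d j).symm
      · rintro (j | j) _ b
        · exact alive_setMark _ _ _ _
        · rfl
    · exact iff_of_false (fun hc => ho hc.1) fun hc => ho hc.1
  exact and_congr Iff.rfl (and_congr (h none) (forall_congr' fun o => iff_congr (h _) Iff.rfl))

/-- The probability of the event `Pick` when there are `m` other children. -/
def pickProb (k : ℕ) (t y : ℝ) {i : ℕ} (A : Set (Fin i → ℝ)) (m : ℕ) : ℝ≥0∞ :=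
  ∫⁻ d, ∫⁻ c, ∫⁻ u : Fin i → I, (PickSum k t y A m).indicator 1
    (Sum.elim (fun j => (u j, c j)) d) ∂volume
    ∂(Measure.pi fun _ => sampleMeasure t) ∂(kidsMeasure t)

theorem lintegral_nodeMeasure (t : ℝ) (f : ℕ → ℝ≥0∞) :
    ∫⁻ x, f x.1 ∂(nodeMeasure t) = ∫⁻ n, f n ∂(poissonMeasure t.toNNReal) :=
  measurePreserving_fst.lintegral_comp (measurable_of_countable f)

/-- Given the number `n` of children, they are exchangeable, so the probability depends on the
choice `e` only through its being below `n`. -/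
theorem measure_pick (y : ℝ) {i : ℕ} {A : Set (Fin i → ℝ)} (hA : MeasurableSet A)
    (e : Fin i ↪ ℕ) : sampleMeasure t (Pick k t y A e) =
      ∫⁻ n, {e : Fin i ↪ ℕ | ∀ j, e j < n}.indicator (fun _ => pickProb k t y A (n - i)) e
        ∂(poissonMeasure t.toNNReal) := by
  have hm := measurableSet_pick k t y hA e
  rw [← lintegral_indicator_one hm, lintegral_build t (measurable_one.indicator hm),
    ← lintegral_nodeMeasure]
  refine lintegral_congr fun x => ?_
  obtain ⟨n, r⟩ := x
  by_cases he : ∀ j, e j < n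
  · rw [indicator_of_mem (show e ∈ {e : Fin i ↪ ℕ | ∀ j, e j < n} from he)]
    obtain ⟨φ, h1, h2, h3⟩ := exists_enumeration e he
    rw [pickProb, ← lintegral_kids_comp t h1
      (measurable_one.indicator (measurableSet_pickSum k t y hA (n - i)))]
    refine lintegral_congr fun d => ?_
    have := build_mem_pick (k := k) (t := t) (y := y) (A := A) he h1 h2 h3 r d
    by_cases h : build (n, r) d ∈ Pick k t y A e
    · rw [indicator_of_mem h, indicator_of_mem (this.1 h)]
      rfl
    · rw [indicator_of_notMem h, indicator_of_notMem (mt this.2 h)]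
  · rw [indicator_of_notMem (show e ∉ {e : Fin i ↪ ℕ | ∀ j, e j < n} from he)]
    have : ∀ d, build (n, r) d ∉ Pick k t y A e := fun d hd => he hd.1
    simp only [indicator_of_notMem (this _), lintegral_zero]

theorem lintegral_pickProb (y : ℝ) {i : ℕ} {A : Set (Fin i → ℝ)} (hA : MeasurableSet A) :
    ∫⁻ n, pickProb k t y A n ∂(poissonMeasure t.toNNReal) =
      ∫⁻ u : Fin i → I, A.indicator (exactProb k i t y) fun j => t * (u j : ℝ) := by
  have hlab : Measurable fun (u : Fin i → I) j => t * (u j : ℝ) :=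
    measurable_pi_iff.2 fun j => (measurable_subtype_coe.comp (measurable_pi_apply j)).const_mul t
  set S : Set ((Sample × (Fin i → Sample)) × (Fin i → I)) :=
    {q | (fun j => t * (q.2 j : ℝ)) ∈ A ∧ KeptExactly k t y (fun j => t * (q.2 j : ℝ)) q.1}
    with hS
  have hSm : MeasurableSet S := measurableSet_setOfPred.2
    ((measurableSet_setOfPred.1 ((hlab.comp measurable_snd) hA)).and
      (measurable_keptExactly (hlab.comp measurable_snd) measurable_const measurable_fst))
  have hSi : Measurable (S.indicator (1 : (Sample × (Fin i → Sample)) × (Fin i → I) → ℝ≥0∞)) :=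
    measurable_one.indicator hSm
  have hSf : Measurable fun p : Sample × (Fin i → Sample) =>
      ∫⁻ u : Fin i → I, S.indicator 1 (p, u) := hSi.lintegral_prod_right'
  calc _ = ∫⁻ x, ∫⁻ d, ∫⁻ c, ∫⁻ u : Fin i → I, S.indicator 1 ((build x d, c), u) ∂volume
        ∂(Measure.pi fun _ => sampleMeasure t) ∂(kidsMeasure t) ∂(nodeMeasure t) := by
        rw [← lintegral_nodeMeasure]
        refine lintegral_congr fun x => lintegral_congr fun d => lintegral_congr fun c =>
          lintegral_congr fun u => ?_
        obtain ⟨n, r⟩ := x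
        have := sumElim_mem_pickSum (k := k) (t := t) (y := y) (A := A) n r u c d
        by_cases h : ((build (n, r) d, c), u) ∈ S
        · rw [indicator_of_mem h, indicator_of_mem (this.2 h)]
          rfl
        · rw [indicator_of_notMem h, indicator_of_notMem (mt this.1 h)]
    _ = ∫⁻ p, ∫⁻ u : Fin i → I, S.indicator 1 (p, u) ∂volume ∂(sampleMeasureWith i t) := by
        rw [sampleMeasureWith, lintegral_prod _ hSf.aemeasurable]
        exact (lintegral_build t hSf.lintegral_prod_right').symm
    _ = ∫⁻ u : Fin i → I, ∫⁻ p, S.indicator 1 (p, u) ∂(sampleMeasureWith i t) :=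
        lintegral_lintegral_swap (f := fun p u => S.indicator 1 (p, u)) hSi.aemeasurable
    _ = _ := by
        refine lintegral_congr fun u => ?_
        by_cases hu : (fun j => t * (u j : ℝ)) ∈ A
        · have hE : MeasurableSet {p | KeptExactly k t y (fun j => t * (u j : ℝ)) p} :=
            measurableSet_setOfPred.2 (measurable_keptExactly measurable_const measurable_const
              measurable_id)
          rw [indicator_of_mem hu, exactProb, ← lintegral_indicator_one hE]
          refine lintegral_congr fun p => ?_
          by_cases h : KeptExactly k t y (fun j => t * (u j : ℝ)) p
          · rw [indicator_of_mem (show (p, u) ∈ S from ⟨hu, h⟩), indicator_of_mem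
              (show p ∈ {p | KeptExactly k t y (fun j => t * (u j : ℝ)) p} from h)]
            rfl
          · rw [indicator_of_notMem (show (p, u) ∉ S from fun hc => h hc.2),
              indicator_of_notMem
              (show p ∉ {p | KeptExactly k t y (fun j => t * (u j : ℝ)) p} from h)]
        · rw [indicator_of_notMem hu]
          have : ∀ p, (p, u) ∉ S := fun p hp => hu hp.1
          simp only [indicator_of_notMem (this _), lintegral_zero]

theorem measurableSet_strictMono (i : ℕ) : MeasurableSet {x : Fin i → ℝ | StrictMono x} := by
  have : {x : Fin i → ℝ | StrictMono x} = {x | ∀ a b, a < b → x a < x b} := rfl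
  rw [this]
  exact measurableSet_setOfPred.2 (Measurable.forall fun a => Measurable.forall fun b =>
    measurable_const.imp (measurable_lt_prop (measurable_pi_apply a) (measurable_pi_apply b)))

/-- The law of the labels of the edges kept at the root. -/
theorem measure_enumeration (ht : 0 ≤ t) (y : ℝ) {i : ℕ} {A : Set (Fin i → ℝ)}
    (hA : MeasurableSet A) :
    sampleMeasure t {ω | RootEdge k t y ω none ∧ ∃ x ∈ A, StrictMono x ∧
      (rootLabels (treeHat k t y ω)).pts = range x} =
      ∫⁻ x in A ∩ {x | StrictMono x ∧ ∀ j, x j ∈ Icc 0 t}, exactProb k i t y x := by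
  -- Requiring increasing labels selects one ordering of each set of children, so the events `Pick`
  -- are disjoint and the event is counted once.
  set A' := A ∩ {x | StrictMono x} with hA'
  have hA'm : MeasurableSet A' := hA.inter (measurableSet_strictMono i)
  have hev : {ω | RootEdge k t y ω none ∧ ∃ x ∈ A, StrictMono x ∧
      (rootLabels (treeHat k t y ω)).pts = range x} =ᵐ[sampleMeasure t]
        ⋃ e, Pick k t y A' e := by
    filter_upwards [ae_nice ht] with ω hω
    apply propext
    change (RootEdge k t y ω none ∧ ∃ x ∈ A, StrictMono x ∧
      (rootLabels (treeHat k t y ω)).pts = range x) ↔ ω ∈ ⋃ e, Pick k t y A' e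
    rw [rootLabels_treeHat, mem_iUnion]
    constructor
    · rintro ⟨h0, x, hx, hmono, hr⟩
      have : ∀ j, ∃ l, RootEdge k t y ω (some l) ∧ lab t ω l = x j := fun j => by
        have : x j ∈ range x := ⟨j, rfl⟩
        rwa [← hr] at this
      choose e he hex using this
      have hinj : Function.Injective e := fun a b h => hmono.injective (by rw [← hex, ← hex, h])
      refine ⟨⟨e, hinj⟩, fun j => (he j).lt, ?_, h0, fun l => ⟨fun hl => ?_, ?_⟩⟩
      · have : (fun j => lab t ω (e j)) = x := funext hex
        change (fun j => lab t ω (e j)) ∈ A'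
        rw [this]
        exact ⟨hx, hmono⟩
      · have : lab t ω l ∈ range x := hr ▸ ⟨l, hl, rfl⟩
        obtain ⟨j, hj⟩ := this
        refine ⟨j, hω.sib.root (by simpa using (he j).lt) (by simpa using hl.lt) ?_⟩
        exact (hex j).trans hj
      · rintro ⟨j, rfl⟩
        exact he j
    · rintro ⟨e, h1, h2, h3, h4⟩
      refine ⟨h3, _, h2.1, h2.2, ?_⟩
      have : {j | RootEdge k t y ω (some j)} = range e := ext h4
      rw [this, ← range_comp]
      rfl
  have hdisj : Pairwise fun e e' => Disjoint (Pick k t y A' e) (Pick k t y A' e') := by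
    intro e e' hne
    refine disjoint_left.2 fun ω h h' => hne ?_
    have hr : range e = range e' := ext fun j => (h.2.2.2 j).symm.trans (h'.2.2.2 j)
    have hmono : StrictMono fun j => lab t ω (e j) := h.2.1.2
    have hmono' : StrictMono fun j => lab t ω (e' j) := h'.2.1.2
    have hlab : (fun j => lab t ω (e j)) = fun j => lab t ω (e' j) := by
      refine (hmono.range_inj hmono').1 ?_
      change range (lab t ω ∘ e) = range (lab t ω ∘ e')
      rw [range_comp, range_comp, hr]
    ext j
    have : e j ∈ range e' := hr ▸ ⟨j, rfl⟩
    obtain ⟨l, hl⟩ := this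
    have h5 := congrFun hlab j
    simp only [← hl] at h5
    rw [← hl, hmono'.injective h5]
  have : Countable (Fin i ↪ ℕ) := DFunLike.coe_injective.countable
  rw [measure_congr hev, measure_iUnion hdisj fun e => measurableSet_pick k t y hA'm e]
  simp only [measure_pick y hA'm]
  rw [← lintegral_tsum fun e => (measurable_of_countable _).aemeasurable]
  simp only [tsum_embedding]
  -- The factor `t ^ i` released by the factorial moment is the one that rescales uniform marks on
  -- the unit cube to Lebesgue measure on `[0,t] ^ i`.
  rw [lintegral_poisson_descFactorial ht, lintegral_pickProb y hA'm,
    lintegral_scale ht ((measurable_exactProb k i t y).indicator hA'm),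
    lintegral_indicator hA'm, Measure.restrict_restrict hA'm]
  congr 2
  ext x
  simp only [hA', mem_inter_iff, mem_ofPred_eq, Set.mem_pi, mem_univ, true_imp_iff, and_assoc]

end ForbiddenDegree
end

noncomputable section

namespace ForbiddenDegree

variable {k : ℕ} {t : ℝ}

/-! ### The densities -/

theorem keptExactly_iff {y : ℝ} {i : ℕ} {x : Fin i → ℝ} {ω : Sample × (Fin i → Sample)}
    (hω : RootNice t (Finset.univ.disjSum (Finset.range (numKids ω.1))) (Sum.elim x (lab t ω.1))
      (Sum.elim ω.2 (shift ω.1))) : KeptExactly k t y x ω ↔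
    RootModel k t y (Finset.univ.disjSum (Finset.range (numKids ω.1))) (Sum.elim x (lab t ω.1))
      (Sum.elim ω.2 (shift ω.1)) none ∧
    Sum.elim x (lab t ω.1) '' {j | RootModel k t y
      (Finset.univ.disjSum (Finset.range (numKids ω.1))) (Sum.elim x (lab t ω.1))
      (Sum.elim ω.2 (shift ω.1)) (some j)} = range x := by
  have h1 : range x = Sum.elim x (lab t ω.1) '' {j | j.isLeft = true} := by
    ext b
    constructor
    · rintro ⟨j, rfl⟩
      exact ⟨Sum.inl j, rfl, rfl⟩
    · rintro ⟨j | j, hj, rfl⟩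
      · exact ⟨j, rfl⟩
      · simp at hj
  refine and_congr_right fun _ => ?_
  rw [h1, hω.inj.image_eq_image_iff]
  · exact Set.ext_iff.symm
  · intro j hj
    simpa using hj.1
  · rintro (j | j) hj
    · simp
    · simp at hj

theorem densityF_eq (hk : 2 ≤ k) {y : ℝ} (hy : y ∈ Icc 0 t) {i : ℕ} {x : Fin i → ℝ}
    (hx : Function.Injective x) (hxt : ∀ j, x j ∈ Icc 0 t) (hxy : ∀ j, x j ≠ y) :
    densityF k i t y x = (exactProb k i t y x).toReal := by
  have ht := hy.1.trans hy.2
  refine measureReal_congr ?_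
  filter_upwards [ae_rootNice_with ht hx hxt, ae_labelFree_with ht hxy] with ω hω hfree
  apply propext
  change (∃ T, forbidTreeAt k y (treeInfWith t x ω) = some T ∧ (rootLabels T).pts = range x) ↔
    KeptExactly k t y x ω
  rw [treeInfWith_eq_graft] at hfree ⊢
  rw [keptExactly_iff hω, ← hω.rootLabels_keptTree hk hfree]
  have h := hω.forbidTreeAt_eq hk ht hy.2 hfree
  constructor
  · rintro ⟨T, hT, hr⟩
    by_cases h0 : RootModel k t y (Finset.univ.disjSum (Finset.range (numKids ω.1)))
      (Sum.elim x (lab t ω.1)) (Sum.elim ω.2 (shift ω.1)) none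
    · rw [h.1 h0] at hT
      obtain rfl := Option.some_injective _ hT
      exact ⟨h0, hr⟩
    · rw [h.2 h0] at hT
      simp at hT
  · exact fun ⟨h0, hr⟩ => ⟨_, h.1 h0, hr⟩

theorem rootModel_none_of_lt {κ : Type*} {E : Finset κ} {a : κ → ℝ} {c : κ → Sample} {y : ℝ}
    (hy : t + 1 ≤ y) : RootModel k t y E a c none := by
  obtain ⟨β, hβ⟩ := exists_sol k (Finset.insertNone E) (labs y a)
    (pres fun j b => Alive k t (a j) (c j) b)
  exact ⟨by simp, trivial, β, hβ, fun o _ h1 h2 => absurd (hy.trans h1) (not_le.2 h2)⟩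

theorem densityH_eq (hk : 2 ≤ k) (ht : 0 ≤ t) {i : ℕ} {x : Fin i → ℝ}
    (hx : Function.Injective x) (hxt : ∀ j, x j ∈ Icc 0 t) :
    densityH k i t x = (exactProb k i t (t + 2) x).toReal := by
  refine measureReal_congr ?_
  have hxy : ∀ j, x j ≠ t + 2 := fun j h => by
    have := (hxt j).2
    linarith
  filter_upwards [ae_rootNice_with ht hx hxt, ae_labelFree_with ht hxy] with ω hω hfree
  apply propext
  change (rootLabels (forbidTree k (treeInfWith t x ω))).pts = range x ↔
    KeptExactly k t (t + 2) x ω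
  rw [treeInfWith_eq_graft] at hfree ⊢
  rw [keptExactly_iff hω, ← hω.rootLabels_keptTree hk hfree,
    forbidTree_eq hω.good (y := t + 2) (s := t + 1) (by linarith) (hω.label_lt ht)]
  exact (and_iff_right (rootModel_none_of_lt (by linarith))).symm

/-- Unlike in `kept_of_card_lt`, only the edges arriving before `s` are counted, so an extra edge
beyond the horizon takes no place. -/
theorem kept_of_encard_lt {κ : Type*} {E : Finset κ} {a : κ → ℝ} {s : ℝ}
    (hE : {j | j ∈ E ∧ a j < s}.encard < k) {p : κ → ℝ → Prop} {j : κ} (hj : j ∈ E)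
    (hp : p j s) : Kept k E a p s j := by
  obtain ⟨β, h⟩ := exists_sol k E a p
  refine (kept_iff_of_sol h).2 ⟨hj, hp, fun i hi _ his hiβ => ?_⟩
  have h1 := (h i hi).1 hiβ
  refine absurd (h1.trans ?_) (not_le.2 hE)
  have hmem : i ∈ {j | j ∈ E ∧ a j < s} := ⟨hi, his⟩
  rw [← encard_sdiff_singleton_add_one hmem, add_comm]
  refine add_le_add_left (encard_le_encard ?_) 1
  rintro l ⟨hl, hli, -⟩
  exact ⟨⟨hl, hli.trans his⟩, fun h => hli.ne (by rw [h])⟩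

theorem keptExactly_of_numKids {y : ℝ} (hk : 2 ≤ k) {i : ℕ} {x : Fin i → ℝ}
    (hi : y < t + 1 → i + 2 ≤ k) (hi' : i + 1 ≤ k)
    {ω : Sample × (Fin i → Sample)} (h0 : numKids ω.1 = 0) (h1 : ∀ j, numKids (ω.2 j) = 0) :
    KeptExactly k t y x ω := by
  have hE : {o | o ∈ Finset.insertNone (Finset.univ.disjSum (Finset.range (numKids ω.1))) ∧
      labs y (Sum.elim x (lab t ω.1)) o < t + 1}.encard < k := by
    have hcard : ((Finset.univ.disjSum (Finset.range (numKids ω.1)) :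
        Finset (Fin i ⊕ ℕ)) : Set (Fin i ⊕ ℕ)).encard = i := by
      rw [encard_coe_eq_coe_finsetCard, Finset.card_disjSum, h0]
      simp
    by_cases hy : y < t + 1
    · refine lt_of_le_of_lt (encard_le_encard (t := ((Finset.insertNone
        (Finset.univ.disjSum (Finset.range (numKids ω.1))) : Finset (Option (Fin i ⊕ ℕ))) :
        Set (Option (Fin i ⊕ ℕ))))
        fun o ho => ho.1) ?_
      rw [encard_coe_eq_coe_finsetCard] at hcard ⊢
      rw [Finset.card_insertNone]
      have := hi hy
      have hc : (Finset.univ.disjSum (Finset.range (numKids ω.1)) :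
        Finset (Fin i ⊕ ℕ)).card = i := by exact_mod_cast hcard
      rw [hc]
      exact_mod_cast this
    · have hsub : {o | o ∈ Finset.insertNone (Finset.univ.disjSum (Finset.range (numKids ω.1))) ∧
          labs y (Sum.elim x (lab t ω.1)) o < t + 1} ⊆ some ''
          ((Finset.univ.disjSum (Finset.range (numKids ω.1)) :
        Finset (Fin i ⊕ ℕ)) : Set (Fin i ⊕ ℕ)) := by
        rintro (_ | o) ⟨ho, hlt⟩
        · exact absurd hlt hy
        · exact ⟨o, by simpa using ho, rfl⟩
      refine lt_of_le_of_lt (encard_le_encard hsub) ?_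
      rw [(Option.some_injective _).encard_image, hcard]
      exact_mod_cast hi'
  refine ⟨kept_of_encard_lt hE (by simp) trivial, ?_⟩
  rintro (j | j)
  · refine iff_of_true (kept_of_encard_lt hE (by simp) ?_) rfl
    exact alive_of_numKids_eq_zero hk (h1 j) _
  · refine iff_of_false (fun hc => ?_) (by simp)
    have := hc.1
    rw [h0] at this
    simp at this

/-- If the root has no ordinary child and the `i` attached trees are single vertices, the degrees
stay below `k` and nothing is removed. These are `i + 1` independent events of probability `exp
(-t)`. -/
theorem le_exactProb (hk : 2 ≤ k) (ht : 0 ≤ t) {y : ℝ} {i : ℕ} (hi : y < t + 1 → i + 2 ≤ k)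
    (hi' : i + 1 ≤ k) (x : Fin i → ℝ) :
    Real.exp (-((i + 1) * t)) ≤ (exactProb k i t y x).toReal := by
  have hsub : {ω : Sample | numKids ω = 0} ×ˢ (Set.univ.pi fun _ : Fin i =>
      {ω : Sample | numKids ω = 0}) ⊆ {ω | KeptExactly k t y x ω} := fun ω hω =>
    keptExactly_of_numKids hk hi hi' hω.1 fun j => hω.2 j trivial
  have h := measure_mono (μ := sampleMeasureWith i t) hsub
  rw [sampleMeasureWith, Measure.prod_prod, Measure.pi_pi] at h
  simp only [measure_numKids_eq_zero ht, Finset.prod_const, Finset.card_univ, Fintype.card_fin] at h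
  rw [← pow_succ', ← ENNReal.ofReal_pow (Real.exp_pos _).le, ← Real.exp_nat_mul] at h
  refine (ENNReal.ofReal_le_iff_le_toReal (measure_ne_top _ _)).1 (le_trans (le_of_eq ?_) h)
  congr 2
  push_cast
  ring

theorem exactProb_ne_top (k i : ℕ) (t y : ℝ) (x : Fin i → ℝ) : exactProb k i t y x ≠ ∞ :=
  measure_ne_top _ _

theorem survivalProb_eq (hk : 2 ≤ k) {y : ℝ} (hy : y ∈ Icc 0 t) :
    survivalProb k t y = (sampleMeasure t (aliveSet k t y)).toReal :=
  measureReal_congr (survives_ae_eq hk (hy.1.trans hy.2) hy.2)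

theorem le_densityF (hk : 2 ≤ k) {y : ℝ} (hy : y ∈ Icc 0 t) {i : ℕ} (hi : i + 2 ≤ k)
    {x : Fin i → ℝ} (hx : Function.Injective x) (hxt : ∀ j, x j ∈ Icc 0 t ∧ x j ≠ y) :
    Real.exp (-((i + 1) * t)) ≤ densityF k i t y x := by
  rw [densityF_eq hk hy hx (fun j => (hxt j).1) fun j => (hxt j).2]
  exact le_exactProb hk (hy.1.trans hy.2) (fun _ => hi) (by omega) x

theorem le_densityG (hk : 2 ≤ k) {y : ℝ} (hy : y ∈ Icc 0 t) {i : ℕ} (hi : i + 2 ≤ k)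
    {x : Fin i → ℝ} (hx : Function.Injective x) (hxt : ∀ j, x j ∈ Icc 0 t ∧ x j ≠ y) :
    Real.exp (-((i + 1) * t)) ≤ densityG k i t y x := by
  have h0 : 0 < survivalProb k t y := (Real.exp_pos _).trans_le (exp_le_survivalProb hk hy)
  refine (le_densityF hk hy hi hx hxt).trans ((le_div_iff₀ h0).2 ?_)
  exact mul_le_of_le_one_right measureReal_nonneg measureReal_le_one

theorem le_densityH (hk : 2 ≤ k) (ht : 0 ≤ t) {i : ℕ} (hi : i + 1 ≤ k)
    {x : Fin i → ℝ} (hx : Function.Injective x) (hxt : ∀ j, x j ∈ Icc 0 t) :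
    Real.exp (-((i + 1) * t)) ≤ densityH k i t x := by
  rw [densityH_eq hk ht hx hxt]
  exact le_exactProb hk ht (fun h => absurd h (by linarith)) hi x

theorem measurableSet_ordered (i : ℕ) (t : ℝ) :
    MeasurableSet {x : Fin i → ℝ | StrictMono x ∧ ∀ j, x j ∈ Icc 0 t} := by
  refine (measurableSet_strictMono i).inter ?_
  have : {x : Fin i → ℝ | ∀ j, x j ∈ Icc 0 t} = ⋂ j, (fun x => x j) ⁻¹' Icc 0 t := by
    ext x; simp
  change MeasurableSet {x : Fin i → ℝ | ∀ j, x j ∈ Icc 0 t}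
  rw [this]
  exact MeasurableSet.iInter fun j => (measurable_pi_apply j) measurableSet_Icc

theorem hasDensity_offspringLaw (hk : 2 ≤ k) {y : ℝ} (hy : y ∈ Icc 0 t) (i : ℕ) :
    HasDensity i t (offspringLaw k t y) (densityG k i t y) := by
  intro A hA
  have ht := hy.1.trans hy.2
  have hm := measurable_rootLabels_treeHat k t y
  rw [offspringLaw_eq hk ht hy.2, Measure.map_apply hm (measurableSet_enumeration hA),
    aliveMeasure, ProbabilityTheory.cond_apply (measurableSet_aliveSet k t y)]
  have h1 : (aliveSet k t y ∩ (fun ω => rootLabels (treeHat k t y ω)) ⁻¹'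
      {X | ∃ x ∈ A, StrictMono x ∧ X.pts = range x} : Set Sample) =ᵐ[sampleMeasure t]
      {ω | RootEdge k t y ω none ∧ ∃ x ∈ A, StrictMono x ∧
        (rootLabels (treeHat k t y ω)).pts = range x} := by
    filter_upwards [ae_reg ht] with ω hω
    exact propext (and_congr (hω.allSure.alive_iff y) Iff.rfl)
  rw [measure_congr h1, measure_enumeration ht y hA,
    ← lintegral_const_mul _ (measurable_exactProb k i t y)]
  -- `densityF_eq` needs labels different from `y`; the exceptional points form a null set.
  have h2 : ∀ᵐ x : Fin i → ℝ, ∀ j, x j ≠ y := by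
    rw [volume_pi]
    exact ae_all_iff.2 fun j => Measure.ae_eval_ne (fun _ : Fin i => (volume : Measure ℝ)) j y
  refine setLIntegral_congr_fun_ae (hA.inter (measurableSet_ordered i t)) ?_
  filter_upwards [h2] with x hxy hx
  rw [densityG, densityF_eq hk hy hx.2.1.injective hx.2.2 hxy, survivalProb_eq hk hy,
    ← ENNReal.toReal_div, ENNReal.ofReal_toReal, ENNReal.div_eq_inv_mul]
  exact ENNReal.div_ne_top (exactProb_ne_top _ _ _ _ _) (measure_aliveSet_ne_zero hk ht y)

theorem hasDensity_rootLaw (hk : 2 ≤ k) (ht : 0 ≤ t) (i : ℕ) :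
    HasDensity i t (rootLaw k t) (densityH k i t) := by
  intro A hA
  have hm := measurable_rootLabels_treeHat k t (t + 2)
  rw [rootLaw_eq hk ht, Measure.map_apply hm (measurableSet_enumeration hA)]
  have h1 : ((fun ω => rootLabels (treeHat k t (t + 2) ω)) ⁻¹'
      {X | ∃ x ∈ A, StrictMono x ∧ X.pts = range x} : Set Sample) =
      {ω | RootEdge k t (t + 2) ω none ∧ ∃ x ∈ A, StrictMono x ∧
        (rootLabels (treeHat k t (t + 2) ω)).pts = range x} := by
    ext ω
    exact (and_iff_right (rootModel_none_of_lt (by linarith))).symm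
  rw [h1, measure_enumeration ht _ hA]
  refine setLIntegral_congr_fun (hA.inter (measurableSet_ordered i t)) fun x hx => ?_
  rw [densityH_eq hk ht hx.2.1.injective hx.2.2, ENNReal.ofReal_toReal (exactProb_ne_top _ _ _ _ _)]

end ForbiddenDegree
end

noncomputable section

namespace ForbiddenDegree

open Filter Topology

variable {k : ℕ} {Q : Type*} {l : Filter Q}

/-! ### Stability of the statuses under small changes of the parameters -/

/-- The status depends on the labels only through their mutual order and their order with `s`. At
the limit there are no ties, so all these comparisons persist nearby. -/
theorem eventually_rootKept_iff {κ : Type*} {E : Finset κ} {y : Q → ℝ} {y₀ : ℝ} {a : Q → κ → ℝ}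
    {a₀ : κ → ℝ} {p : Q → κ → ℝ → Prop} {p₀ : κ → ℝ → Prop} {s : Q → ℝ} {s₀ : ℝ}
    (hy : Tendsto y l (𝓝 y₀)) (ha : ∀ j ∈ E, Tendsto (fun q => a q j) l (𝓝 (a₀ j)))
    (hs : Tendsto s l (𝓝 s₀)) (hinj : InjOn (labs y₀ a₀) (Finset.insertNone E))
    (hne : ∀ o ∈ Finset.insertNone E, labs y₀ a₀ o ≠ s₀)
    (hp : ∀ o ∈ Finset.insertNone E, ∀ j ∈ E, labs y₀ a₀ o < s₀ → a₀ j < labs y₀ a₀ o →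
      ∀ᶠ q in l, (p q j (labs (y q) (a q) o) ↔ p₀ j (labs y₀ a₀ o)))
    {o : Option κ} (ho : o ∈ Finset.insertNone E)
    (hpo : ∀ᶠ q in l, (pres (p q) o (s q) ↔ pres p₀ o s₀)) :
    ∀ᶠ q in l, (RootKept k (y q) E (a q) (p q) (s q) o ↔ RootKept k y₀ E a₀ p₀ s₀ o) := by
  have hlabs : ∀ o ∈ Finset.insertNone E,
      Tendsto (fun q => labs (y q) (a q) o) l (𝓝 (labs y₀ a₀ o)) := by
    rintro (_ | j) hj
    exacts [hy, ha j (by simpa using hj)]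
  have hcomp : ∀ {f g : Q → ℝ} {f₀ g₀ : ℝ}, Tendsto f l (𝓝 f₀) → Tendsto g l (𝓝 g₀) → f₀ ≠ g₀ →
      ∀ᶠ q in l, (f₀ < g₀ ↔ f q < g q) := by
    intro f g f₀ g₀ hf hg h
    rcases h.lt_or_gt with h | h
    · filter_upwards [hf.eventually_lt hg h] with q hq using iff_of_true h hq
    · filter_upwards [hg.eventually_lt hf h] with q hq using iff_of_false h.not_gt hq.not_gt
  have h1 : ∀ᶠ q in l, ∀ i ∈ Finset.insertNone E,
      (labs y₀ a₀ i < s₀ ↔ labs (y q) (a q) i < s q) :=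
    (Finset.eventually_all _).2 fun i hi => hcomp (hlabs i hi) hs (hne i hi)
  have h2 : ∀ᶠ q in l, ∀ i ∈ Finset.insertNone E, ∀ j ∈ Finset.insertNone E,
      (labs y₀ a₀ j < labs y₀ a₀ i ↔ labs (y q) (a q) j < labs (y q) (a q) i) :=
    (Finset.eventually_all _).2 fun i hi => (Finset.eventually_all _).2 fun j hj => by
      by_cases hij : j = i
      · subst hij
        exact Eventually.of_forall fun q => iff_of_false (lt_irrefl _) (lt_irrefl _)
      · exact hcomp (hlabs j hj) (hlabs i hi) fun h => hij (hinj hj hi h)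
  have h3 : ∀ᶠ q in l, ∀ i ∈ Finset.insertNone E, ∀ j ∈ E, labs y₀ a₀ i < s₀ →
      a₀ j < labs y₀ a₀ i → (p q j (labs (y q) (a q) i) ↔ p₀ j (labs y₀ a₀ i)) :=
    (Finset.eventually_all _).2 fun i hi => (Finset.eventually_all _).2 fun j hj => by
      simp only [eventually_imp_distrib_left]
      exact hp i hi j hj
  filter_upwards [h1, h2, h3, hpo] with q h1 h2 h3 hpo
  symm
  refine kept_congr h1 (fun i hi _ j hj => h2 i hi j hj) ?_ ?_ hpo.symm
  · rintro i hi his (_ | j) hj hji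
    · rfl
    · exact (h3 i hi j (by simpa using hj) his hji).symm
  · rcases (hne o ho).lt_or_gt with h | h
    · exact Or.inl h
    · exact Or.inr fun i hi his => ⟨his.trans h, (h2 o ho i hi).1 (his.trans h)⟩

/-- The samples `f q` agree eventually with `ω` at every node. -/
def EventuallyAgree (l : Filter Q) (f : Q → Sample) (ω : Sample) : Prop :=
  ∀ w, ∀ᶠ q in l, f q w = ω w

theorem EventuallyAgree.shift {f : Q → Sample} {ω : Sample} (h : EventuallyAgree l f ω) (j : ℕ) :
    EventuallyAgree l (fun q => shift (f q) j) (shift ω j) := fun w => h (j :: w)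

theorem EventuallyAgree.numKids {f : Q → Sample} {ω : Sample} (h : EventuallyAgree l f ω) :
    ∀ᶠ q in l, numKids (f q) = numKids ω :=
  (h []).mono fun q hq => by rw [ForbiddenDegree.numKids, hq]; rfl

theorem EventuallyAgree.tendsto_lab {f : Q → Sample} {ω : Sample} (h : EventuallyAgree l f ω)
    {t : Q → ℝ} {t₀ : ℝ} (ht : Tendsto t l (𝓝 t₀)) (j : ℕ) :
    Tendsto (fun q => lab (t q) (f q) j) l (𝓝 (lab t₀ ω j)) := by
  refine (ht.mul_const ((ω [j]).2 : ℝ)).congr' ?_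
  filter_upwards [h [j]] with q hq
  rw [lab, hq]

theorem LabelFree.shift {t y : ℝ} {ω : Sample} (h : LabelFree y (treeInf t ω)) {j : ℕ}
    (hj : j < numKids ω) : LabelFree y (treeInf t (shift ω j)) := by
  intro p hp
  refine h (lab t ω j :: p) ?_
  rw [treeInf_eq_graft]
  exact cons_mem_graft.2 ⟨j, by simpa using hj, rfl, hp⟩

theorem labelFree_labs {t y : ℝ} {ω : Sample} (hω : Nice t ω) (h : LabelFree y (treeInf t ω))
    {o : Option ℕ} (ho : o ∈ Finset.insertNone (Finset.range (numKids ω))) {j : ℕ}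
    (hj : j < numKids ω) : LabelFree (labs y (lab t ω) o) (treeInf t (shift ω j)) := by
  rcases o with _ | i
  · exact h.shift hj
  · exact hω.labelFree (by simpa using ho) hj

theorem injOn_labs {t y : ℝ} {ω : Sample} (hω : Nice t ω) (h : LabelFree y (treeInf t ω)) :
    InjOn (labs y (lab t ω)) (Finset.insertNone (Finset.range (numKids ω))) := by
  rintro (_ | i) hi (_ | j) hj hij
  · rfl
  · exact absurd hij.symm (labelFree_root h (by simpa using hj))
  · exact absurd hij (labelFree_root h (by simpa using hi))
  · rw [hω.sib.root (by simpa using hi) (by simpa using hj) hij]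

theorem labs_ne {t y s : ℝ} {ω : Sample} (hs : LabelFree s (treeInf t ω)) (hys : y ≠ s)
    {o : Option ℕ} (ho : o ∈ Finset.insertNone (Finset.range (numKids ω))) :
    labs y (lab t ω) o ≠ s := by
  rcases o with _ | j
  exacts [hys, labelFree_root hs (by simpa using ho)]

theorem EventuallyAgree.tendsto_labs {f : Q → Sample} {ω : Sample} (h : EventuallyAgree l f ω)
    {t y : Q → ℝ} {t₀ y₀ : ℝ} (ht : Tendsto t l (𝓝 t₀)) (hy : Tendsto y l (𝓝 y₀)) (o : Option ℕ) :
    Tendsto (fun q => labs (y q) (lab (t q) (f q)) o) l (𝓝 (labs y₀ (lab t₀ ω) o)) := by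
  rcases o with _ | j
  exacts [hy, h.tendsto_lab ht j]

section

variable {t y s : Q → ℝ} {t₀ y₀ s₀ : ℝ} {f : Q → Sample} {ω : Sample}

theorem eventually_ahat_iff {n : ℕ} (ht : Tendsto t l (𝓝 t₀)) (hy : Tendsto y l (𝓝 y₀))
    (hs : Tendsto s l (𝓝 s₀)) (hf : EventuallyAgree l f ω) (hω : Nice t₀ ω)
    (hyω : LabelFree y₀ (treeInf t₀ ω)) (hsω : LabelFree s₀ (treeInf t₀ ω)) (hys : y₀ ≠ s₀) :
    ∀ᶠ q in l, (Ahat k (t q) n (y q) (f q) (s q) ↔ Ahat k t₀ n y₀ ω s₀) := by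
  induction n generalizing y s y₀ s₀ f ω with
  | zero => exact Eventually.of_forall fun _ => Iff.rfl
  | succ n ih =>
    have key := eventually_rootKept_iff (k := k) (l := l) (E := Finset.range (numKids ω))
      (a := fun q => lab (t q) (f q))
      (p := fun q j b => Ahat k (t q) n (lab (t q) (f q) j) (shift (f q) j) b)
      (p₀ := fun j b => Ahat k t₀ n (lab t₀ ω j) (shift ω j) b) (o := none)
      hy (fun j _ => hf.tendsto_lab ht j) hs (injOn_labs hω hyω) (fun o ho => labs_ne hsω hys ho)
      (fun o ho j hj _ hlt => ?_) (by simp) (Eventually.of_forall fun _ => Iff.rfl)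
    · filter_upwards [key, hf.numKids] with q hq hn
      rw [Ahat, hn]
      exact hq
    · have hj' : j < numKids ω := by simpa using hj
      exact ih (hf.tendsto_lab ht j) (hf.tendsto_labs ht hy o) (hf.shift j) (hω.shift hj')
        (hω.labelFree hj' hj') (labelFree_labs hω hyω ho hj') hlt.ne

/-- A condition in `Sure` is required only under two strict inequalities. If both hold at the limit,
induction applies; if one fails there, the opposite strict inequality persists, except for the
trivial case of a label compared with itself. -/
theorem eventually_sure {n : ℕ} (ht : Tendsto t l (𝓝 t₀)) (hy : Tendsto y l (𝓝 y₀))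
    (hs : Tendsto s l (𝓝 s₀)) (hf : EventuallyAgree l f ω) (hω : Nice t₀ ω)
    (hyω : LabelFree y₀ (treeInf t₀ ω)) (hsω : LabelFree s₀ (treeInf t₀ ω)) (hys : y₀ ≠ s₀)
    (h : Sure t₀ n y₀ ω s₀) : ∀ᶠ q in l, Sure (t q) n (y q) (f q) (s q) := by
  induction n generalizing y s y₀ s₀ f ω with
  | zero => exact h.elim
  | succ n ih =>
    have key : ∀ᶠ q in l, ∀ o ∈ Finset.insertNone (Finset.range (numKids ω)),
        ∀ j ∈ Finset.range (numKids ω), labs (y q) (lab (t q) (f q)) o < s q →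
        lab (t q) (f q) j < labs (y q) (lab (t q) (f q)) o →
        Sure (t q) n (lab (t q) (f q) j) (shift (f q) j) (labs (y q) (lab (t q) (f q)) o) := by
      refine (Finset.eventually_all _).2 fun o ho => (Finset.eventually_all _).2 fun j hj => ?_
      have hj' : j < numKids ω := by simpa using hj
      have h1 := hf.tendsto_labs ht hy o
      have h2 := hf.tendsto_lab ht j
      rcases (labs_ne hsω hys ho).lt_or_gt with h3 | h3
      · by_cases hoj : o = some j
        · subst hoj
          exact Eventually.of_forall fun q _ h => absurd h (lt_irrefl _)
        · have h4 : labs y₀ (lab t₀ ω) (some j) ≠ labs y₀ (lab t₀ ω) o := fun h =>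
            hoj (injOn_labs hω hyω (by simpa using hj') ho h).symm
          rcases h4.lt_or_gt with h5 | h5
          · filter_upwards [ih h2 h1 (hf.shift j) (hω.shift hj') (hω.labelFree hj' hj')
              (labelFree_labs hω hyω ho hj') h5.ne (h o ho j hj' h3 h5)] with q hq _ _ using hq
          · filter_upwards [h1.eventually_lt h2 h5] with q hq _ h using absurd h hq.not_gt
      · filter_upwards [hs.eventually_lt h1 h3] with q hq h using absurd h hq.not_gt
    filter_upwards [key, hf.numKids] with q hq hn
    rw [Sure, hn]
    exact fun o ho j hj => hq o ho j (by simpa using hj)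

/-- A depth that suffices at the limit point suffices nearby, so the infinite tree can be replaced
by finitely many generations of it. -/
theorem eventually_alive_iff (ht : Tendsto t l (𝓝 t₀)) (hy : Tendsto y l (𝓝 y₀))
    (hs : Tendsto s l (𝓝 s₀)) (hf : EventuallyAgree l f ω) (hω : Nice t₀ ω)
    (hyω : LabelFree y₀ (treeInf t₀ ω)) (hsω : LabelFree s₀ (treeInf t₀ ω)) (hys : y₀ ≠ s₀)
    (hst : s₀ ≤ t₀ + 1) :
    ∀ᶠ q in l, (Alive k (t q) (y q) (f q) (s q) ↔ Alive k t₀ y₀ ω s₀) := by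
  obtain ⟨n, hn⟩ := hω.exists_sure y₀ hst
  filter_upwards [eventually_sure ht hy hs hf hω hyω hsω hys hn,
    eventually_ahat_iff (k := k) (n := n) ht hy hs hf hω hyω hsω hys] with q h1 h2
  rw [alive_iff_of_sure h1, h2, alive_iff_of_sure hn]

theorem eventually_rootModel_iff {κ : Type*} {E : Finset κ} {a : Q → κ → ℝ} {a₀ : κ → ℝ}
    {c : Q → κ → Sample} {c₀ : κ → Sample} (ht₀ : 0 ≤ t₀)
    (ht : Tendsto t l (𝓝 t₀)) (hy : Tendsto y l (𝓝 y₀))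
    (ha : ∀ j ∈ E, Tendsto (fun q => a q j) l (𝓝 (a₀ j)))
    (hc : ∀ j ∈ E, EventuallyAgree l (fun q => c q j) (c₀ j)) (h : RootNice t₀ E a₀ c₀)
    (hyT : LabelFree y₀ (graft E a₀ fun j => treeInf t₀ (c₀ j))) (hyt : y₀ ≠ t₀ + 1)
    {o : Option κ} (ho : o ∈ Finset.insertNone E) :
    ∀ᶠ q in l, (RootModel k (t q) (y q) E (a q) (c q) o ↔ RootModel k t₀ y₀ E a₀ c₀ o) := by
  have hya : ∀ j ∈ E, a₀ j ≠ y₀ := by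
    rintro j hj rfl
    exact hyT [] (cons_mem_graft.2 ⟨j, hj, rfl, nil_mem_treeInf _ _⟩)
  have hyc : ∀ j ∈ E, LabelFree y₀ (treeInf t₀ (c₀ j)) := fun j hj p hp =>
    hyT (a₀ j :: p) (cons_mem_graft.2 ⟨j, hj, rfl, hp⟩)
  have hat : ∀ j ∈ E, a₀ j < t₀ + 1 := fun j hj => by
    have := (h.mem j hj).2
    linarith
  have hs := ht.add_const 1
  refine eventually_rootKept_iff hy ha hs ?_ ?_ ?_ ho ?_
  · rintro (_ | i) hi (_ | j) hj hij
    · rfl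
    · exact absurd hij.symm (hya j (by simpa using hj))
    · exact absurd hij (hya i (by simpa using hi))
    · rw [h.inj (by simpa using hi) (by simpa using hj) hij]
  · rintro (_ | j) hj
    · exact hyt
    · exact (hat j (by simpa using hj)).ne
  · rintro (_ | i) hi j hj h1 h2
    · exact eventually_alive_iff ht (ha j hj) hy (hc j hj) (h.nice j hj) (h.free j hj j hj)
        (hyc j hj) h2.ne h1.le
    · exact eventually_alive_iff ht (ha j hj) (ha i (by simpa using hi)) (hc j hj) (h.nice j hj)
        (h.free j hj j hj) (h.free i (by simpa using hi) j hj) h2.ne h1.le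
  · rcases o with _ | j
    · exact Eventually.of_forall fun _ => Iff.rfl
    · have hj : j ∈ E := by simpa using ho
      exact eventually_alive_iff ht (ha j hj) hs (hc j hj) (h.nice j hj) (h.free j hj j hj)
        (labelFree_of_lt ht₀ (by linarith) _) (hat j hj).ne le_rfl

theorem eventually_keptExactly_iff {i : ℕ} {x : Q → Fin i → ℝ} {x₀ : Fin i → ℝ}
    {g : Q → Sample × (Fin i → Sample)} {p : Sample × (Fin i → Sample)} (ht₀ : 0 ≤ t₀)
    (ht : Tendsto t l (𝓝 t₀)) (hy : Tendsto y l (𝓝 y₀)) (hx : Tendsto x l (𝓝 x₀))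
    (hg : EventuallyAgree l (fun q => (g q).1) p.1)
    (hg' : ∀ j, EventuallyAgree l (fun q => (g q).2 j) (p.2 j))
    (h : RootNice t₀ (Finset.univ.disjSum (Finset.range (numKids p.1)))
      (Sum.elim x₀ (lab t₀ p.1)) (Sum.elim p.2 (shift p.1)))
    (hyT : LabelFree y₀ (treeInfWith t₀ x₀ p)) (hyt : y₀ ≠ t₀ + 1) :
    ∀ᶠ q in l, (KeptExactly k (t q) (y q) (x q) (g q) ↔ KeptExactly k t₀ y₀ x₀ p) := by
  rw [treeInfWith_eq_graft] at hyT
  have key : ∀ᶠ q in l, ∀ o ∈ Finset.insertNone (Finset.univ.disjSum (Finset.range (numKids p.1))),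
      (RootModel k (t q) (y q) (Finset.univ.disjSum (Finset.range (numKids p.1)))
        (Sum.elim (x q) (lab (t q) (g q).1)) (Sum.elim (g q).2 (shift (g q).1)) o ↔
      RootModel k t₀ y₀ (Finset.univ.disjSum (Finset.range (numKids p.1)))
        (Sum.elim x₀ (lab t₀ p.1)) (Sum.elim p.2 (shift p.1)) o) := by
    refine (Finset.eventually_all _).2 fun o ho => eventually_rootModel_iff ht₀ ht hy ?_ ?_ h hyT
      hyt ho
    · rintro (j | j) _
      exacts [(tendsto_pi_nhds.1 hx) j, hg.tendsto_lab ht j]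
    · rintro (j | j) _
      exacts [hg' j, hg.shift j]
  filter_upwards [key, hg.numKids] with q hq hn
  simp only [KeptExactly]
  rw [hn]
  refine and_congr (hq none (by simp)) (forall_congr' fun j => iff_congr ?_ Iff.rfl)
  by_cases hj : j ∈ Finset.univ.disjSum (Finset.range (numKids p.1))
  · exact hq (some j) (by simpa using hj)
  · exact iff_of_false (fun hc => hj (by simpa using hc.1)) fun hc => hj (by simpa using hc.1)

end

end ForbiddenDegree
end

noncomputable section

namespace ForbiddenDegree

open Filter Topology

/-! ### A coupling of the Galton–Watson trees -/

/-- The Poisson weights. -/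
def poissonWeight (t : ℝ) (n : ℕ) : ℝ := Real.exp (-t) * t ^ n / n.factorial

/-- The distribution function of the Poisson law. -/
def poissonSum (t : ℝ) (n : ℕ) : ℝ := ∑ m ∈ Finset.range n, poissonWeight t m

/-- The quantile function of the Poisson law. -/
def poissonQuantile (t : ℝ) (u : I) : ℕ := sInf {n | (u : ℝ) < poissonSum t (n + 1)}

theorem poissonWeight_nonneg {t : ℝ} (ht : 0 ≤ t) (n : ℕ) : 0 ≤ poissonWeight t n := by
  unfold poissonWeight; positivity

theorem poissonSum_mono {t : ℝ} (ht : 0 ≤ t) : Monotone (poissonSum t) :=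
  monotone_nat_of_le_succ fun n => by
    rw [poissonSum, poissonSum, Finset.sum_range_succ]
    linarith [poissonWeight_nonneg ht n]

theorem tendsto_poissonSum {t : ℝ} (ht : 0 ≤ t) : Tendsto (poissonSum t) atTop (𝓝 1) := by
  have h := (hasSum_one_poissonMeasure t.toNNReal).tendsto_sum_nat
  rwa [Real.coe_toNNReal t ht] at h

theorem continuous_poissonSum (n : ℕ) : Continuous fun t => poissonSum t n := by
  unfold poissonSum poissonWeight
  fun_prop

theorem poissonSum_nonneg {t : ℝ} (ht : 0 ≤ t) (n : ℕ) : 0 ≤ poissonSum t n :=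
  Finset.sum_nonneg fun m _ => poissonWeight_nonneg ht m

theorem poissonSum_le_one {t : ℝ} (ht : 0 ≤ t) (n : ℕ) : poissonSum t n ≤ 1 :=
  (poissonSum_mono ht).ge_of_tendsto (tendsto_poissonSum ht) n

/-- `poissonSum t n` is the probability of a value less than `n`, hence the half-open interval. The
value `u = 1` is excluded, as no partial sum need exceed it and the infimum would then take its
default value. -/
theorem poissonQuantile_eq_iff {t : ℝ} (ht : 0 ≤ t) {u : I} (hu : (u : ℝ) < 1) {n : ℕ} :
    poissonQuantile t u = n ↔ poissonSum t n ≤ u ∧ (u : ℝ) < poissonSum t (n + 1) := by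
  have hne : {n | (u : ℝ) < poissonSum t (n + 1)}.Nonempty := by
    obtain ⟨n, hn⟩ := ((tendsto_poissonSum ht).eventually_const_lt hu).exists
    exact ⟨n, hn.trans_le (poissonSum_mono ht (Nat.le_succ n))⟩
  constructor
  · rintro rfl
    refine ⟨?_, Nat.sInf_mem hne⟩
    by_contra! h
    rcases Nat.eq_zero_or_pos (poissonQuantile t u) with h0 | h0
    · rw [h0] at h
      have := u.2.1
      simp only [poissonSum, Finset.range_zero, Finset.sum_empty] at h
      linarith
    · have := Nat.sInf_le (s := {n | (u : ℝ) < poissonSum t (n + 1)})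
        (m := poissonQuantile t u - 1) (by
          rw [mem_ofPred_eq, Nat.sub_add_cancel h0]
          exact h)
      change poissonQuantile t u ≤ _ at this
      omega
  · rintro ⟨h1, h2⟩
    refine le_antisymm (Nat.sInf_le h2) ?_
    by_contra! h
    have h3 : (u : ℝ) < poissonSum t (poissonQuantile t u + 1) := Nat.sInf_mem hne
    exact absurd (h3.trans_le (poissonSum_mono ht h)) (not_lt.2 h1)

theorem measurable_poissonQuantile (t : ℝ) : Measurable (poissonQuantile t) := by
  refine measurable_to_countable' fun n => ?_
  have hset : ∀ n, MeasurableSet {u : I | (u : ℝ) < poissonSum t (n + 1)} := fun n =>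
    measurableSet_lt measurable_subtype_coe measurable_const
  have h : ∀ n, poissonQuantile t ⁻¹' Iic n = {u : I | (∃ m ≤ n, (u : ℝ) < poissonSum t (m + 1)) ∨
      ∀ m : ℕ, ¬ (u : ℝ) < poissonSum t (m + 1)} := by
    intro n
    ext u
    constructor
    · intro h
      by_cases hne : {n | (u : ℝ) < poissonSum t (n + 1)}.Nonempty
      · exact Or.inl ⟨_, h, Nat.sInf_mem hne⟩
      · exact Or.inr fun m hm => hne ⟨m, hm⟩
    · rintro (⟨m, hm, h⟩ | h)
      · exact (Nat.sInf_le h).trans hm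
      · have : {n | (u : ℝ) < poissonSum t (n + 1)} = ∅ := eq_empty_of_forall_notMem h
        change poissonQuantile t u ≤ n
        rw [poissonQuantile, this, Nat.sInf_empty]
        exact Nat.zero_le n
  have hm : ∀ n, MeasurableSet (poissonQuantile t ⁻¹' Iic n) := by
    intro n
    rw [h]
    exact measurableSet_setOfPred.2 ((Measurable.exists fun m => measurable_const.and
      (measurableSet_setOfPred.1 (hset m))).or (Measurable.forall fun m =>
      (measurableSet_setOfPred.1 (hset m)).not))
  rcases n with _ | n
  · have : ({0} : Set ℕ) = Iic 0 := by ext; simp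
    exact this ▸ hm 0
  · have : ({n + 1} : Set ℕ) = Iic (n + 1) \ Iic n := by ext; simp; omega
    rw [this]
    exact (hm (n + 1)).diff (hm n)

theorem ae_lt_one : ∀ᵐ u : I, (u : ℝ) < 1 := by
  have h : ∀ᵐ u : I, u ≠ 1 := by
    rw [ae_iff]
    simp
  filter_upwards [h] with u hu
  exact lt_of_le_of_ne u.2.2 fun h => hu (Subtype.ext h)

theorem map_poissonQuantile {t : ℝ} (ht : 0 ≤ t) :
    (volume : Measure I).map (poissonQuantile t) = poissonMeasure t.toNNReal := by
  refine Measure.ext_of_singleton fun n => ?_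
  rw [Measure.map_apply (measurable_poissonQuantile t) (measurableSet_singleton n)]
  have h1 : (poissonQuantile t ⁻¹' {n} : Set I) =ᵐ[volume]
      Subtype.val ⁻¹' (Ico (poissonSum t n) (poissonSum t (n + 1))) := by
    filter_upwards [ae_lt_one] with u hu
    exact propext (poissonQuantile_eq_iff ht hu)
  have h2 := unitInterval.measurePreserving_coe.measure_preimage
    (measurableSet_Ico (a := poissonSum t n) (b := poissonSum t (n + 1))).nullMeasurableSet
  have h3 : Ico (poissonSum t n) (poissonSum t (n + 1)) ⊆ I := fun u hu =>
    ⟨(poissonSum_nonneg ht n).trans hu.1, hu.2.le.trans (poissonSum_le_one ht _)⟩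
  rw [measure_congr h1, h2, Measure.restrict_apply measurableSet_Ico,
    inter_eq_self_of_subset_left h3, Real.volume_Ico, poissonMeasure_singleton,
    Real.coe_toNNReal t ht, poissonSum, poissonSum, Finset.sum_range_succ, add_sub_cancel_left]
  rfl

/-- Outside the countable set of the partial sums at `t₀`, both inequalities that characterize the
quantile are strict and persist by continuity. -/
theorem ae_eventually_poissonQuantile {t₀ : ℝ} (ht₀ : 0 < t₀) :
    ∀ᵐ u : I, ∀ᶠ t in 𝓝 t₀, poissonQuantile t u = poissonQuantile t₀ u := by
  have h : ∀ᵐ u : I, ∀ n, (u : ℝ) ≠ poissonSum t₀ n := by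
    refine ae_all_iff.2 fun n => ?_
    have h1 : ∀ᵐ u : I, u ≠ ⟨poissonSum t₀ n, poissonSum_nonneg ht₀.le n,
        poissonSum_le_one ht₀.le n⟩ := by
      rw [ae_iff]
      simp
    filter_upwards [h1] with u hu h using hu (Subtype.ext h)
  filter_upwards [h, ae_lt_one] with u hu hu1
  obtain ⟨h1, h2⟩ := (poissonQuantile_eq_iff ht₀.le hu1).1 rfl
  have h3 := lt_of_le_of_ne h1 (hu _).symm
  filter_upwards [lt_mem_nhds ht₀, (continuous_poissonSum _).tendsto t₀ |>.eventually_lt_const h3,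
    (continuous_poissonSum _).tendsto t₀ |>.eventually_const_lt h2] with t ht h4 h5
  exact (poissonQuantile_eq_iff ht.le hu1).2 ⟨h4.le, h5⟩

/-- The sample of parameter `t` built from uniform variables. -/
def couple (t : ℝ) (v : List ℕ → I × I) : Sample := fun w => (poissonQuantile t (v w).1, (v w).2)

/-- The law of independent families of uniform variables. -/
abbrev uniformMeasure : Measure (List ℕ → I × I) :=
  Measure.infinitePi fun _ => (volume : Measure I).prod volume

theorem measurePreserving_couple {t : ℝ} (ht : 0 ≤ t) :
    MeasurePreserving (couple t) uniformMeasure (sampleMeasure t) := by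
  have h : MeasurePreserving (fun p : I × I => (poissonQuantile t p.1, p.2))
      ((volume : Measure I).prod volume) (nodeMeasure t) :=
    (⟨measurable_poissonQuantile t, map_poissonQuantile ht⟩ : MeasurePreserving (poissonQuantile t)
      volume (poissonMeasure t.toNNReal)).prod (MeasurePreserving.id volume)
  refine ⟨measurable_pi_iff.2 fun w => h.measurable.comp (measurable_pi_apply w), ?_⟩
  set ρ : Measure (I × I) := (volume : Measure I).prod volume with hρ
  have := Measure.infinitePi_map_pi
    (f := fun (_ : List ℕ) (p : I × I) => (poissonQuantile t p.1, p.2)) (fun _ : List ℕ => ρ)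
    fun _ => h.measurable
  simp only [h.map_eq] at this
  exact this

/-- The agreement holds at each node separately, without uniformity over the tree. This is enough
because a status depends on finitely many nodes. -/
theorem ae_eventuallyAgree_couple {t₀ : ℝ} (ht₀ : 0 < t₀) : ∀ᵐ v ∂uniformMeasure,
    EventuallyAgree (𝓝 t₀) (fun t => couple t v) (couple t₀ v) := by
  refine ae_all_iff.2 fun w => ?_
  have h1 := (measurePreserving_eval_infinitePi
    (fun _ : List ℕ => (volume : Measure I).prod (volume : Measure I)) w).quasiMeasurePreserving.ae
    (Measure.quasiMeasurePreserving_fst.ae (ae_eventually_poissonQuantile ht₀))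
  filter_upwards [h1] with v hv
  filter_upwards [hv] with t ht
  rw [couple, couple]
  exact Prod.ext ht rfl

/-- The law of the uniform variables used to build `T^{∞,X}_t`. -/
abbrev uniformMeasureWith (i : ℕ) : Measure ((List ℕ → I × I) × (Fin i → List ℕ → I × I)) :=
  uniformMeasure.prod (Measure.pi fun _ => uniformMeasure)

/-- The samples of parameter `t` built from uniform variables. -/
def coupleWith (t : ℝ) {i : ℕ} (v : (List ℕ → I × I) × (Fin i → List ℕ → I × I)) :
    Sample × (Fin i → Sample) := (couple t v.1, fun j => couple t (v.2 j))

theorem measurePreserving_coupleWith {t : ℝ} (ht : 0 ≤ t) (i : ℕ) :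
    MeasurePreserving (coupleWith t) (uniformMeasureWith i) (sampleMeasureWith i t) :=
  (measurePreserving_couple ht).prod (measurePreserving_pi _ _ fun _ => measurePreserving_couple ht)

theorem ae_eventuallyAgree_coupleWith {t₀ : ℝ} (ht₀ : 0 < t₀) (i : ℕ) :
    ∀ᵐ v ∂(uniformMeasureWith i),
      EventuallyAgree (𝓝 t₀) (fun t => (coupleWith t v).1) (coupleWith t₀ v).1 ∧
      ∀ j, EventuallyAgree (𝓝 t₀) (fun t => (coupleWith t v).2 j) ((coupleWith t₀ v).2 j) := by
  have h := ae_eventuallyAgree_couple ht₀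
  have h2 : ∀ᵐ v ∂(uniformMeasureWith i), ∀ j : Fin i,
      EventuallyAgree (𝓝 t₀) (fun t => couple t (v.2 j)) (couple t₀ (v.2 j)) :=
    ae_all_iff.2 fun j => Measure.quasiMeasurePreserving_snd.ae ((measurePreserving_eval
      (fun _ : Fin i => uniformMeasure) j).quasiMeasurePreserving.ae h)
  filter_upwards [Measure.quasiMeasurePreserving_fst.ae h, h2] with v h1 h2 using ⟨h1, h2⟩

end ForbiddenDegree
end

noncomputable section

namespace ForbiddenDegree

open Filter Topology

variable {k : ℕ}

/-! ### Continuity of the survival probability and of the densities -/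

theorem EventuallyAgree.comp {Q R : Type*} {l : Filter Q} {l' : Filter R} {f : Q → Sample}
    {ω : Sample} (h : EventuallyAgree l f ω) {g : R → Q} (hg : Tendsto g l' l) :
    EventuallyAgree l' (fun r => f (g r)) ω := fun w => hg.eventually (h w)

/-- On the common probability space of the coupling, the indicator of survival is almost surely
constant near the limit point, so the probabilities converge. The hypothesis `hyt` excludes a tie
between `y₀` and the horizon. -/
theorem tendsto_measure_aliveSet {Q : Type*} {l : Filter Q} [l.IsCountablyGenerated]
    {t y : Q → ℝ} {t₀ y₀ : ℝ} (ht₀ : 0 < t₀) (ht : Tendsto t l (𝓝 t₀)) (hy : Tendsto y l (𝓝 y₀))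
    (hyt : y₀ ≠ t₀ + 1) (hpos : ∀ᶠ q in l, 0 ≤ t q) :
    Tendsto (fun q => sampleMeasure (t q) (aliveSet k (t q) (y q))) l
      (𝓝 (sampleMeasure t₀ (aliveSet k t₀ y₀))) := by
  have hm : ∀ {t y : ℝ}, 0 ≤ t → sampleMeasure t (aliveSet k t y) =
      uniformMeasure (couple t ⁻¹' aliveSet k t y) := fun ht =>
    ((measurePreserving_couple ht).measure_preimage
      (measurableSet_aliveSet _ _ _).nullMeasurableSet).symm
  rw [hm ht₀.le]
  have hcm : ∀ t, Measurable (couple t) := fun t => measurable_pi_iff.2 fun w =>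
    ((measurable_poissonQuantile t).comp (measurable_pi_apply w).fst).prodMk
      (measurable_pi_apply w).snd
  refine Tendsto.congr' (hpos.mono fun q hq => (hm hq).symm) ?_
  refine tendsto_measure_of_ae_tendsto_indicator_of_isFiniteMeasure l
    (hcm _ (measurableSet_aliveSet _ _ _)) (fun q => hcm _ (measurableSet_aliveSet _ _ _)) ?_
  have hmp := (measurePreserving_couple ht₀.le).quasiMeasurePreserving
  filter_upwards [hmp.ae (ae_nice ht₀.le), hmp.ae (ae_labelFree ht₀.le y₀),
    ae_eventuallyAgree_couple ht₀] with v h1 h2 h3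
  exact eventually_alive_iff ht hy (ht.add_const 1) (h3.comp ht) h1 h2
    (labelFree_of_lt ht₀.le (by linarith) _) hyt le_rfl

theorem tendsto_exactProb {Q : Type*} {l : Filter Q} [l.IsCountablyGenerated] {i : ℕ}
    {t y : Q → ℝ} {x : Q → Fin i → ℝ} {t₀ y₀ : ℝ} {x₀ : Fin i → ℝ} (ht₀ : 0 < t₀)
    (ht : Tendsto t l (𝓝 t₀)) (hy : Tendsto y l (𝓝 y₀)) (hx : Tendsto x l (𝓝 x₀))
    (hyt : y₀ ≠ t₀ + 1) (hx₀ : Function.Injective x₀) (hxt : ∀ j, x₀ j ∈ Icc 0 t₀)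
    (hxy : ∀ j, x₀ j ≠ y₀) (hpos : ∀ᶠ q in l, 0 ≤ t q) :
    Tendsto (fun q => exactProb k i (t q) (y q) (x q)) l (𝓝 (exactProb k i t₀ y₀ x₀)) := by
  have hset : ∀ t y (x : Fin i → ℝ), MeasurableSet {p | KeptExactly k t y x p} := fun t y x =>
    measurableSet_setOfPred.2 (measurable_keptExactly measurable_const measurable_const
      measurable_id)
  have hm : ∀ {t y : ℝ} {x : Fin i → ℝ}, 0 ≤ t → exactProb k i t y x =
      uniformMeasureWith i (coupleWith t ⁻¹' {p | KeptExactly k t y x p}) := fun ht =>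
    ((measurePreserving_coupleWith ht i).measure_preimage (hset _ _ _).nullMeasurableSet).symm
  rw [hm ht₀.le]
  have hc : ∀ t, Measurable (couple t) := fun t => measurable_pi_iff.2 fun w =>
    ((measurable_poissonQuantile t).comp (measurable_pi_apply w).fst).prodMk
      (measurable_pi_apply w).snd
  have hcm : ∀ t, Measurable (coupleWith t (i := i)) := fun t =>
    ((hc t).comp measurable_fst).prodMk (measurable_pi_iff.2 fun j =>
      (hc t).comp ((measurable_pi_apply j).comp measurable_snd))
  refine Tendsto.congr' (hpos.mono fun q hq => (hm hq).symm) ?_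
  refine tendsto_measure_of_ae_tendsto_indicator_of_isFiniteMeasure l
    (hcm _ (hset _ _ _)) (fun q => hcm _ (hset _ _ _)) ?_
  have hmp := (measurePreserving_coupleWith ht₀.le i).quasiMeasurePreserving
  filter_upwards [hmp.ae (ae_rootNice_with ht₀.le hx₀ hxt), hmp.ae (ae_labelFree_with ht₀.le hxy),
    ae_eventuallyAgree_coupleWith ht₀ i] with v h1 h2 h3
  exact eventually_keptExactly_iff (g := fun q => coupleWith (t q) v) ht₀.le ht hy hx
    (h3.1.comp ht) (fun j => (h3.2 j).comp ht) h1 h2 hyt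

theorem continuousOn_survivalProb (hk : 2 ≤ k) :
    ContinuousOn (fun q : ℝ × ℝ => survivalProb k q.1 q.2) {q | 0 ≤ q.2 ∧ q.2 < q.1} := by
  rintro ⟨t₀, y₀⟩ ⟨h0, h1⟩
  change 0 ≤ y₀ at h0
  change y₀ < t₀ at h1
  have hev : ∀ᶠ q : ℝ × ℝ in 𝓝[{q | 0 ≤ q.2 ∧ q.2 < q.1}] (t₀, y₀), 0 ≤ q.2 ∧ q.2 < q.1 :=
    self_mem_nhdsWithin
  have ht : Tendsto (fun q : ℝ × ℝ => q.1) (𝓝[{q | 0 ≤ q.2 ∧ q.2 < q.1}] (t₀, y₀)) (𝓝 t₀) :=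
    (continuous_fst.tendsto _).mono_left nhdsWithin_le_nhds
  have hy : Tendsto (fun q : ℝ × ℝ => q.2) (𝓝[{q | 0 ≤ q.2 ∧ q.2 < q.1}] (t₀, y₀)) (𝓝 y₀) :=
    (continuous_snd.tendsto _).mono_left nhdsWithin_le_nhds
  have key := (ENNReal.tendsto_toReal (measure_ne_top _ _)).comp
    (tendsto_measure_aliveSet (k := k) (h0.trans_lt h1) ht hy (by linarith)
    (hev.mono fun q hq => hq.1.trans hq.2.le))
  change Tendsto _ _ (𝓝 (survivalProb k t₀ y₀))
  rw [survivalProb_eq hk ⟨h0, h1.le⟩]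
  exact Tendsto.congr' (hev.mono fun q hq => (survivalProb_eq hk ⟨hq.1, hq.2.le⟩).symm) key

theorem continuousOn_densityF (hk : 2 ≤ k) (i : ℕ) : ContinuousOn
    (fun q : ℝ × ℝ × (Fin i → ℝ) => densityF k i q.1 q.2.1 q.2.2) (domainY i) := by
  rintro ⟨t₀, y₀, x₀⟩ h
  have heq : ∀ q ∈ domainY i, densityF k i q.1 q.2.1 q.2.2 =
      (exactProb k i q.1 q.2.1 q.2.2).toReal := fun q hq =>
    densityF_eq hk (Ioo_subset_Icc_self hq.1) hq.2.1 (fun j => Ioo_subset_Icc_self (hq.2.2 j).1)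
      fun j => (hq.2.2 j).2
  have hev : ∀ᶠ q in 𝓝[domainY i] (t₀, y₀, x₀), q ∈ domainY i := self_mem_nhdsWithin
  have hle : 𝓝[domainY i] (t₀, y₀, x₀) ≤ 𝓝 (t₀, y₀, x₀) := nhdsWithin_le_nhds
  obtain ⟨h1, h2, h3⟩ := id h
  change y₀ ∈ Ioo 0 t₀ at h1
  have key := (ENNReal.tendsto_toReal (exactProb_ne_top _ _ _ _ _)).comp
    (tendsto_exactProb (k := k) (l := 𝓝[domainY i] (t₀, y₀, x₀)) (h1.1.trans h1.2)
    ((continuous_fst.tendsto _).mono_left hle)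
    ((continuous_snd.fst.tendsto _).mono_left hle) ((continuous_snd.snd.tendsto _).mono_left hle)
    (by linarith [h1.2]) h2 (fun j => Ioo_subset_Icc_self (h3 j).1) (fun j => (h3 j).2)
    (hev.mono fun q hq => (hq.1.1.trans hq.1.2).le))
  change Tendsto _ _ (𝓝 (densityF k i t₀ y₀ x₀))
  rw [heq _ h]
  exact Tendsto.congr' (hev.mono fun q hq => (heq q hq).symm) key

theorem continuousOn_densityG (hk : 2 ≤ k) (i : ℕ) : ContinuousOn
    (fun q : ℝ × ℝ × (Fin i → ℝ) => densityG k i q.1 q.2.1 q.2.2) (domainY i) := by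
  refine (continuousOn_densityF hk i).div ((continuousOn_survivalProb hk).comp
    (f := fun q : ℝ × ℝ × (Fin i → ℝ) => (q.1, q.2.1)) (by fun_prop)
    fun q hq => ⟨hq.1.1.le, hq.1.2⟩) fun q hq => ?_
  exact ((Real.exp_pos _).trans_le (exp_le_survivalProb hk (Ioo_subset_Icc_self hq.1))).ne'

/-- The fictitious label moves with `t` as `t + 2` and always stays away from the horizon `t + 1`,
so `tendsto_exactProb` applies. -/
theorem continuousOn_densityH (hk : 2 ≤ k) (i : ℕ) : ContinuousOn
    (fun q : ℝ × (Fin i → ℝ) => densityH k i q.1 q.2) (domain i) := by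
  rintro ⟨t₀, x₀⟩ h
  have heq : ∀ q ∈ domain i, densityH k i q.1 q.2 =
      (exactProb k i q.1 (q.1 + 2) q.2).toReal := fun q hq =>
    densityH_eq hk hq.1.le hq.2.1 fun j => Ioo_subset_Icc_self (hq.2.2 j)
  have hev : ∀ᶠ q in 𝓝[domain i] (t₀, x₀), q ∈ domain i := self_mem_nhdsWithin
  have hle : 𝓝[domain i] (t₀, x₀) ≤ 𝓝 (t₀, x₀) := nhdsWithin_le_nhds
  obtain ⟨h1, h2, h3⟩ := id h
  change 0 < t₀ at h1
  have ht : Tendsto (fun q : ℝ × (Fin i → ℝ) => q.1) (𝓝[domain i] (t₀, x₀)) (𝓝 t₀) :=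
    (continuous_fst.tendsto _).mono_left hle
  have key := (ENNReal.tendsto_toReal (exactProb_ne_top _ _ _ _ _)).comp
    (tendsto_exactProb (k := k) h1 ht (ht.add_const 2) ((continuous_snd.tendsto _).mono_left hle)
    (by linarith) h2 (fun j => Ioo_subset_Icc_self (h3 j)) (fun j hj => by
      have : x₀ j < t₀ := (h3 j).2
      linarith)
    (hev.mono fun q hq => hq.1.le))
  change Tendsto _ _ (𝓝 (densityH k i t₀ x₀))
  rw [heq _ h]
  exact Tendsto.congr' (hev.mono fun q hq => (heq q hq).symm) key

/-! ### The class of the random graphs -/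

theorem ae_isOmegaPlus_treeGraph (k : ℕ) {t : ℝ} (ht : 0 ≤ t) :
    ∀ᵐ ω ∂(sampleMeasure t), IsOmegaPlus k (treeGraph (treeInf t ω)) := by
  filter_upwards [ae_nice ht] with ω hω
  exact isOmegaPlus_of_wellFounded k (isOmega_treeGraph hω.good.tree.2.2 hω.good.inj) hω.good.wf

theorem ae_isOmegaPlus_theta (k : ℕ) {t : ℝ} (ht : 0 ≤ t) (y : ℝ) :
    ∀ᵐ ω ∂(sampleMeasure t), IsOmegaPlus k (theta y (treeInf t ω)) := by
  filter_upwards [ae_nice ht, ae_labelFree ht y] with ω hω hfree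
  exact isOmegaPlus_of_wellFounded k (isOmega_theta hω.good hfree) (wellFounded_theta hω.good y)

theorem nullMeasurableSet_survives (hk : 2 ≤ k) {t y : ℝ} (hy : y ∈ Icc 0 t) :
    NullMeasurableSet (survives k t y) (sampleMeasure t) :=
  (measurableSet_aliveSet k t y).nullMeasurableSet.congr
    (survives_ae_eq hk (hy.1.trans hy.2) hy.2).symm

end ForbiddenDegree
end

theorem mainTheorem5 (k : ℕ) (hk : 2 ≤ k) :
    -- the objects are well defined
    (∀ t : ℝ, 0 ≤ t →
      (∀ᵐ ω ∂(ForbiddenDegree.sampleMeasure t),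
        ForbiddenDegree.IsOmegaPlus k
          (ForbiddenDegree.treeGraph (ForbiddenDegree.treeInf t ω))) ∧
      (∀ y ∈ Set.Icc 0 t,
        (∀ᵐ ω ∂(ForbiddenDegree.sampleMeasure t),
          ForbiddenDegree.IsOmegaPlus k
            (ForbiddenDegree.theta y (ForbiddenDegree.treeInf t ω))) ∧
        MeasureTheory.NullMeasurableSet (ForbiddenDegree.survives k t y)
          (ForbiddenDegree.sampleMeasure t)) ∧
      Measurable (fun y : Set.Icc 0 t => ForbiddenDegree.lawPlus k t y)) ∧
    -- the conditioned tree is a multitype branching process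
    (∀ t : ℝ, 0 ≤ t → ∀ y ∈ Set.Icc 0 t,
      ForbiddenDegree.IsBranchingProcess (ForbiddenDegree.condMeasure k t y)
        (ForbiddenDegree.treeKAt k t y) (ForbiddenDegree.offspringLaw k t) y) ∧
    -- the local limit is a two-stage branching process
    (∀ t : ℝ, 0 ≤ t →
      ForbiddenDegree.HasIndependentSubtrees (ForbiddenDegree.sampleMeasure t)
        (ForbiddenDegree.treeK k t) (ForbiddenDegree.lawPlus k t)) ∧
    -- types and numbers of children
    (∀ t : ℝ, 0 ≤ t →
      (∀ y ∈ Set.Icc 0 t, ∀ᵐ X ∂(ForbiddenDegree.offspringLaw k t y),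
        X.pts ⊆ Set.Icc 0 t ∧ X.pts.encard + 2 ≤ (k : ℕ∞)) ∧
      (∀ᵐ X ∂(ForbiddenDegree.rootLaw k t),
        X.pts ⊆ Set.Icc 0 t ∧ X.pts.encard + 1 ≤ (k : ℕ∞))) ∧
    -- the conditioning event
    (∀ t : ℝ, ∀ y ∈ Set.Icc 0 t, Real.exp (-t) ≤ ForbiddenDegree.survivalProb k t y) ∧
    ContinuousOn (fun q : ℝ × ℝ => ForbiddenDegree.survivalProb k q.1 q.2)
      {q | 0 ≤ q.2 ∧ q.2 < q.1} ∧
    -- densities of the offspring laws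
    (∀ i : ℕ, i + 2 ≤ k →
      (∀ t : ℝ, ∀ y ∈ Set.Icc 0 t,
        ForbiddenDegree.HasDensity i t (ForbiddenDegree.offspringLaw k t y)
          (ForbiddenDegree.densityG k i t y)) ∧
      ContinuousOn
        (fun q : ℝ × ℝ × (Fin i → ℝ) => ForbiddenDegree.densityF k i q.1 q.2.1 q.2.2)
        (ForbiddenDegree.domainY i) ∧
      ContinuousOn
        (fun q : ℝ × ℝ × (Fin i → ℝ) => ForbiddenDegree.densityG k i q.1 q.2.1 q.2.2)
        (ForbiddenDegree.domainY i) ∧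
      (∀ t : ℝ, ∀ y ∈ Set.Icc 0 t, ∀ x : Fin i → ℝ, Function.Injective x →
        (∀ j, x j ∈ Set.Icc 0 t ∧ x j ≠ y) →
          Real.exp (-((i + 1) * t)) ≤ ForbiddenDegree.densityF k i t y x ∧
          Real.exp (-((i + 1) * t)) ≤ ForbiddenDegree.densityG k i t y x)) ∧
    -- densities of the law at the root of the local limit
    (∀ i : ℕ, i + 1 ≤ k →
      (∀ t : ℝ, 0 ≤ t →
        ForbiddenDegree.HasDensity i t (ForbiddenDegree.rootLaw k t)
          (ForbiddenDegree.densityH k i t)) ∧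
      ContinuousOn (fun q : ℝ × (Fin i → ℝ) => ForbiddenDegree.densityH k i q.1 q.2)
        (ForbiddenDegree.domain i) ∧
      (∀ t : ℝ, 0 ≤ t → ∀ x : Fin i → ℝ, Function.Injective x →
        (∀ j, x j ∈ Set.Icc 0 t) →
          Real.exp (-((i + 1) * t)) ≤ ForbiddenDegree.densityH k i t x)) := by
  open ForbiddenDegree in
  exact ⟨fun t ht => ⟨ae_isOmegaPlus_treeGraph k ht, fun y hy =>
      ⟨ae_isOmegaPlus_theta k ht y, nullMeasurableSet_survives hk hy⟩, measurable_lawPlus hk ht⟩,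
    fun t ht y hy => isBranchingProcess_treeKAt hk ht hy,
    fun t ht => hasIndependentSubtrees_treeK hk ht,
    fun t ht => ⟨fun y hy => ae_offspringLaw hk ht hy.2, ae_rootLaw hk ht⟩,
    fun t y hy => exp_le_survivalProb hk hy,
    continuousOn_survivalProb hk,
    fun i hi => ⟨fun t y hy => hasDensity_offspringLaw hk hy i, continuousOn_densityF hk i,
      continuousOn_densityG hk i, fun t y hy x hx hxt =>
        ⟨le_densityF hk hy hi hx hxt, le_densityG hk hy hi hx hxt⟩⟩,
    fun i hi => ⟨fun t ht => hasDensity_rootLaw hk ht i, continuousOn_densityH hk i,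
      fun t ht x hx hxt => le_densityH hk ht hi hx hxt⟩⟩
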